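/- **Setting.** Let $(x_0,X,Y)\in\mathbb R\times\mathbb R^p\times\mathbb R$ satisfy $Y=F_0(z_0)+\varepsilon$, $z_0=x_0+X'\theta_0$, $\mathbb E(\varepsilon\mid x_0,X)=0$, with $F_0:\mathbb R\to\mathbb R$ nondecreasing, twice differentiable with bounded first and second derivatives. Assume $\mathbb E\|X\|^4<\infty$, $\mathbb E(\varepsilon^2\mid z_0)$ is bounded, and $\mathbb E|\varepsilon|^\kappa<\infty$ for some $\kappa>2+2/\alpha_\eta$. In rounds $k=1,2,\dots$ one observes i.i.d. batches $W_k=\{(x_{0,i,k},X_{i,k},Y_{i,k})\}_{i=1}^B$, $B\ge 1$, of i.i.d. copies of $(x_0,X,Y)$; write $z_{0,i,k}=x_{0,i,k}+X_{i,k}'\theta_0$ and $\varepsilon_{i,k}=Y_{i,k}-F_0(z_{0,i,k})$. Let $\check\theta_k$ ($k\ge0$) be $\sigma(W_1,\dots,W_k)$-measurable, $\Delta\check\theta_k=\check\theta_k-\theta_0$, with $\|\Delta\check\theta_k\|=O(k^{-\alpha_\theta}\log^q k)$ a.s. for some $\alpha_\theta>0$, $q\ge 0$. **Sieve.** Let $\psi_1,\psi_2,\dots:\mathbb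 R\to\mathbb R$ be differentiable, $\Psi_J=(\psi_1,\dots,\psi_J)'$, $\mathcal S_J$ the span of $\psi_1,\dots,\psi_J$, $\Gamma_J=\mathbb E[\Psi_J(z_0)\Psi_J(z_0)']$, $\mathbb P_J(h)(z)=\Psi_J(z)'\Gamma_J^{-1}\mathbb E[\Psi_J(z_0)h(z_0)]$, $\mathcal B_{J,0}=\Gamma_J^{-1}\mathbb E[\Psi_J(z_0)F_0(z_0)]$, and let $\|\cdot\|_\infty$ be the supremum norm on $\mathbb R$. Assume that, for some constants $C>0$, $\alpha_\psi>0$, $s>1$, $0<s_1\le s$ and all $j,J\ge 1$: (a) $\limsup_{J\to\infty}\sup\{\|\mathbb P_J(F_0-g)\|_\infty/\|F_0-g\|_\infty: g\in\mathcal S_J,\ 0<\|F_0-g\|_\infty<\infty\}<\infty$, some $g_J^*\in\mathcal S_J$ has $\|F_0-g_J^*\|_\infty\le CJ^{-s}$, and $\|\partial F_0-\partial\mathbb P_J(F_0)\|_\infty\le CJ^{-s_1}$; (b) $\|\psi_j\|_\infty\le C$, $\|\partial\psi_j\|_\infty\le Cj^{\alpha_\psi}$, and the eigenvalues of all $\Gamma_J$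 lie in a fixed compact subset of $(0,\infty)$. **Algorithm.** Let $\eta_k=\eta_0k^{-\alpha_\eta}$ and $J_k=\lfloor J_0k^{\alpha_J}\rfloor$ for $k\ge1$, with $\eta_0,\alpha_\eta,\alpha_J>0$ and a positive integer $J_0$, which is also the dimension at $k=0$. For a vector $a$, $[a]_k\in\mathbb R^{J_k}$ is $a$ extended by zeros. Given $\hat{\mathcal B}_0\in\mathbb R^{J_0}$ and $\check z_{i,k}=x_{0,i,k}+X_{i,k}'\check\theta_{k-1}$, put $$\hat{\mathcal B}_k=[\hat{\mathcal B}_{k-1}]_k+\frac{\eta_k}{B}\sum_{i=1}^B\bigl(Y_{i,k}-\Psi_{J_k}(\check z_{i,k})'[\hat{\mathcal B}_{k-1}]_k\bigr)\Psi_{J_k}(\check z_{i,k}),$$ $\bar{\mathcal B}_N=\frac1N\sum_{k=1}^N[\hat{\mathcal B}_k]_N$, $\Delta\bar{\mathcal B}_N=\bar{\mathcal B}_N-\mathcal B_{J_N,0}$, and $\bar F_N(z)=\Psi_{J_N}(z)'\bar{\mathcal B}_N$. **Exponents.** Assume $2\alpha_J<\alpha_\eta<1$, $\alpha_\theta>\alpha_J(1+\alpha_\psi)$,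 $\alpha_\eta+(2s-1)\alpha_J>1$, $\alpha_\eta+2\alpha_\theta-\alpha_J(1+2\alpha_\psi)>1$, $2\alpha_\eta>1+\alpha_J$; $\max\{\frac12+\alpha_J,\,1+2\alpha_J(1+\alpha_\psi)-2\alpha_\theta\}<\alpha_\eta<\min\{2\alpha_\theta-2\alpha_J\alpha_\psi,\,\alpha_J(2s+1)\}$; $4\alpha_J<\alpha_\eta<1-4\alpha_J$; and $\alpha_\theta>\max\{(1-s_1)\alpha_J+\frac12,\ (1-s+\alpha_\psi)\alpha_J+\frac12,\ (\frac34+\frac{\alpha_\psi}2)\alpha_J+\frac14\}$. Finally, for a version $\mu_0(z)$ of $\mathbb E(X\mid z_0=z)$, assume $\sup_z\|\partial F_0(z)\mu_0(z)\|<\infty$ and $\limsup_{k}\sup_z\|\mathbb P_{J_k}(\partial F_0\,\mu_0')(z)-\partial F_0(z)\mu_0(z)'\|_\infty=0$ (with $\mathbb P_{J_k}$ applied coordinatewise). **Theorem.** Almost surely, in Euclidean norm as $N\to\infty$, $$\Delta\bar{\mathcal B}_N=\frac1N\sum_{k=1}^N\frac1B\sum_{i=1}^B\varepsilon_{i,k}\bigl[\Gamma_{J_k}^{-1}\Psi_{J_k}(z_{0,i,k})\bigr]_N-\frac1N\sum_{k=1}^N\mathbb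 E\Bigl(\partial F_0(z_0)\bigl[\Gamma_{J_k}^{-1}\Psi_{J_k}(z_0)\bigr]_NX'\Bigr)\Delta\check\theta_{k-1}+\frac1N\sum_{k=1}^N\bigl([\mathcal B_{J_k,0}]_N-\mathcal B_{J_N,0}\bigr)+o\bigl(N^{-\frac{1+\alpha_J}2}\bigr).$$ Moreover, let $D\subseteq\mathbb R$ be such that the sets $\{\Psi_J(z):z\in D\}$ have polynomial covering numbers: for some $C',a$ and all $J\ge1$, $\delta\in(0,1]$ there is a set $T\subset\mathbb R$ of at most $C'(J/\delta)^a$ points such that every $z\in D$ has a $t\in T$ with $\max_{j\le J}|\psi_j(z)-\psi_j(t)|\le\delta$. (Every bounded $D$ has this property; so has $D=\mathbb R$ if $\psi_j=\varphi_j\circ\tau$ with $\tau$ a map from $\mathbb R$ to a bounded interval and $\|\partial\varphi_j\|_\infty$ of polynomial growth in $j$.) Then $$\sup_{z\in D}|\bar F_N(z)-F_0(z)|=O\Bigl(N^{-\frac{1-\alpha_J}2}\log^{\frac12}N+N^{-\alpha_Js}+N^{-\alpha_\theta}\log^qN\Bigr)\quad\text{a.s.}$$ -/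

import Mathlib

open MeasureTheory ProbabilityTheory Filter Topology Asymptotics
open scoped ENNReal Matrix

noncomputable section

namespace OnlineSieve

/-- One observation `(x₀, X, Y)`. -/
abbrev Obs (p : ℕ) : Type := ℝ × EuclideanSpace ℝ (Fin p) × ℝ

/-- The index `x₀ + X'θ`. -/
def index {p : ℕ} (θ : EuclideanSpace ℝ (Fin p)) (w : Obs p) : ℝ :=
  w.1 + inner ℝ w.2.1 θ

/-- The error `ε = Y - F₀(x₀ + X'θ₀)`. -/
def noise {p : ℕ} (θ₀ : EuclideanSpace ℝ (Fin p)) (F₀ : ℝ → ℝ) (w : Obs p) : ℝ :=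
  w.2.2 - F₀ (index θ₀ w)

/-- Supremum norm on a set `D`, with values in `[0, ∞]`. -/
def supNormOn (D : Set ℝ) (f : ℝ → ℝ) : ℝ≥0∞ := ⨆ z ∈ D, ‖f z‖ₑ

/-- Supremum norm on `ℝ`, with values in `[0, ∞]`. -/
def supNorm (f : ℝ → ℝ) : ℝ≥0∞ := supNormOn Set.univ f

/-! ### Sieve spaces and projections -/

/-- `Ψ_J(z) = (ψ_1(z), …, ψ_J(z))'`; only `ψ j` with `j ≥ 1` is used. -/
def sieveVec (ψ : ℕ → ℝ → ℝ) (J : ℕ) (z : ℝ) : Fin J → ℝ := fun i => ψ (i + 1) z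

/-- The sieve space `S_J`. -/
def sieveSpace (ψ : ℕ → ℝ → ℝ) (J : ℕ) : Set (ℝ → ℝ) :=
  {g | ∃ b : Fin J → ℝ, g = fun z => sieveVec ψ J z ⬝ᵥ b}

/-- `[a]`: the vector `a` followed by zeros, in dimension `n`. -/
def pad {m : ℕ} (n : ℕ) (a : Fin m → ℝ) : Fin n → ℝ :=
  fun i => if h : (i : ℕ) < m then a ⟨i, h⟩ else 0

/-- `Γ_J = E[Ψ_J(z₀) Ψ_J(z₀)']`, where `ν` is the law of an observation. -/
def gram {p : ℕ} (ν : Measure (Obs p)) (θ₀ : EuclideanSpace ℝ (Fin p)) (ψ : ℕ → ℝ → ℝ)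
    (J : ℕ) : Matrix (Fin J) (Fin J) ℝ :=
  Matrix.of fun i j => ∫ w, sieveVec ψ J (index θ₀ w) i * sieveVec ψ J (index θ₀ w) j ∂ν

/-- `Γ_J⁻¹ E[Ψ_J(z₀) h(z₀)]`; for `h = F₀` this is the pseudo-true coefficient `B_{J,0}`. -/
def projCoef {p : ℕ} (ν : Measure (Obs p)) (θ₀ : EuclideanSpace ℝ (Fin p)) (ψ : ℕ → ℝ → ℝ)
    (J : ℕ) (h : ℝ → ℝ) : Fin J → ℝ :=
  (gram ν θ₀ ψ J)⁻¹ *ᵥ fun i => ∫ w, sieveVec ψ J (index θ₀ w) i * h (index θ₀ w) ∂ν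

/-- The `L²`-projection `P_J(h)(z) = Ψ_J(z)' Γ_J⁻¹ E[Ψ_J(z₀) h(z₀)]`. -/
def proj {p : ℕ} (ν : Measure (Obs p)) (θ₀ : EuclideanSpace ℝ (Fin p)) (ψ : ℕ → ℝ → ℝ)
    (J : ℕ) (h : ℝ → ℝ) (z : ℝ) : ℝ :=
  sieveVec ψ J z ⬝ᵥ projCoef ν θ₀ ψ J h

/-! ### The online estimator -/

/-- `J_k = ⌊J₀ k^{α_J}⌋` for `k ≥ 1`; the initial coefficient vector has dimension `J₀`. -/
def sieveDim (J₀ : ℕ) (αJ : ℝ) (k : ℕ) : ℕ :=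
  if k = 0 then J₀ else ⌊(J₀ : ℝ) * (k : ℝ) ^ αJ⌋₊

/-- `η_k = η₀ k^{-α_η}`. -/
def learningRate (η₀ αη : ℝ) (k : ℕ) : ℝ := η₀ * (k : ℝ) ^ (-αη)

/-- The online sieve coefficient along one realisation: `W k i` is the `i`-th observation of
round `k ≥ 1` and `θc k` the plug-in estimate available after round `k`. In round `k` the previous
coefficient is extended by zeros to dimension `J_k` and then updated. -/
def coefHat {p B : ℕ} (ψ : ℕ → ℝ → ℝ) (J₀ : ℕ) (αJ η₀ αη : ℝ) (b₀ : Fin J₀ → ℝ)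
    (W : ℕ → Fin B → Obs p) (θc : ℕ → EuclideanSpace ℝ (Fin p)) :
    (k : ℕ) → Fin (sieveDim J₀ αJ k) → ℝ
  | 0 => pad _ b₀
  | k + 1 =>
    let b := pad (sieveDim J₀ αJ (k + 1)) (coefHat ψ J₀ αJ η₀ αη b₀ W θc k)
    b + (learningRate η₀ αη (k + 1) / B) •
      ∑ i : Fin B,
        ((W (k + 1) i).2.2
            - sieveVec ψ (sieveDim J₀ αJ (k + 1)) (index (θc k) (W (k + 1) i)) ⬝ᵥ b) •
          sieveVec ψ (sieveDim J₀ αJ (k + 1)) (index (θc k) (W (k + 1) i))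

/-- Polyak-Ruppert average `N⁻¹ ∑_{k=1}^N [B̂_k]_N`. -/
def coefBar {p B : ℕ} (ψ : ℕ → ℝ → ℝ) (J₀ : ℕ) (αJ η₀ αη : ℝ) (b₀ : Fin J₀ → ℝ)
    (W : ℕ → Fin B → Obs p) (θc : ℕ → EuclideanSpace ℝ (Fin p)) (N : ℕ) :
    Fin (sieveDim J₀ αJ N) → ℝ :=
  (N : ℝ)⁻¹ • ∑ k ∈ Finset.Icc 1 N,
    pad (sieveDim J₀ αJ N) (coefHat ψ J₀ αJ η₀ αη b₀ W θc k)

/-- `F̄_N(z) = Ψ_{J_N}(z)' B̄_N`. -/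
def linkBar {p B : ℕ} (ψ : ℕ → ℝ → ℝ) (J₀ : ℕ) (αJ η₀ αη : ℝ) (b₀ : Fin J₀ → ℝ)
    (W : ℕ → Fin B → Obs p) (θc : ℕ → EuclideanSpace ℝ (Fin p)) (N : ℕ) (z : ℝ) : ℝ :=
  sieveVec ψ (sieveDim J₀ αJ N) z ⬝ᵥ coefBar ψ J₀ αJ η₀ αη b₀ W θc N

/-- `ΔB̄_N = B̄_N - B_{J_N,0}`. -/
def coefBarError {p B : ℕ} (ν : Measure (Obs p)) (θ₀ : EuclideanSpace ℝ (Fin p)) (F₀ : ℝ → ℝ)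
    (ψ : ℕ → ℝ → ℝ) (J₀ : ℕ) (αJ η₀ αη : ℝ) (b₀ : Fin J₀ → ℝ)
    (W : ℕ → Fin B → Obs p) (θc : ℕ → EuclideanSpace ℝ (Fin p)) (N : ℕ) :
    Fin (sieveDim J₀ αJ N) → ℝ :=
  coefBar ψ J₀ αJ η₀ αη b₀ W θc N - projCoef ν θ₀ ψ (sieveDim J₀ αJ N) F₀

/-! ### The terms of the expansion -/

/-- `[Γ_{J_k}⁻¹ Ψ_{J_k}(z)]_N`. -/
def scaledSieveVec {p : ℕ} (ν : Measure (Obs p)) (θ₀ : EuclideanSpace ℝ (Fin p))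
    (ψ : ℕ → ℝ → ℝ) (J₀ : ℕ) (αJ : ℝ) (N k : ℕ) (z : ℝ) : Fin (sieveDim J₀ αJ N) → ℝ :=
  pad (sieveDim J₀ αJ N)
    ((gram ν θ₀ ψ (sieveDim J₀ αJ k))⁻¹ *ᵥ sieveVec ψ (sieveDim J₀ αJ k) z)

/-- `N⁻¹ ∑_{k=1}^N B⁻¹ ∑_{i=1}^B ε_{i,k} [Γ_{J_k}⁻¹ Ψ_{J_k}(z_{0,i,k})]_N`. -/
def varianceTerm {p B : ℕ} (ν : Measure (Obs p)) (θ₀ : EuclideanSpace ℝ (Fin p)) (F₀ : ℝ → ℝ)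
    (ψ : ℕ → ℝ → ℝ) (J₀ : ℕ) (αJ : ℝ) (W : ℕ → Fin B → Obs p) (N : ℕ) :
    Fin (sieveDim J₀ αJ N) → ℝ :=
  (N : ℝ)⁻¹ • ∑ k ∈ Finset.Icc 1 N, (B : ℝ)⁻¹ • ∑ i : Fin B,
    noise θ₀ F₀ (W k i) • scaledSieveVec ν θ₀ ψ J₀ αJ N k (index θ₀ (W k i))

/-- `N⁻¹ ∑_{k=1}^N E(∂F₀(z₀) [Γ_{J_k}⁻¹ Ψ_{J_k}(z₀)]_N X') (θ̌_{k-1} - θ₀)`. -/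
def regressorTerm {p : ℕ} (ν : Measure (Obs p)) (θ₀ : EuclideanSpace ℝ (Fin p)) (F₀ : ℝ → ℝ)
    (ψ : ℕ → ℝ → ℝ) (J₀ : ℕ) (αJ : ℝ) (θc : ℕ → EuclideanSpace ℝ (Fin p)) (N : ℕ) :
    Fin (sieveDim J₀ αJ N) → ℝ :=
  (N : ℝ)⁻¹ • ∑ k ∈ Finset.Icc 1 N,
    (Matrix.of fun (j : Fin (sieveDim J₀ αJ N)) (a : Fin p) =>
      ∫ w, deriv F₀ (index θ₀ w) * scaledSieveVec ν θ₀ ψ J₀ αJ N k (index θ₀ w) j * w.2.1 a ∂ν)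
      *ᵥ (fun a => (θc (k - 1) - θ₀) a)

/-- `N⁻¹ ∑_{k=1}^N ([B_{J_k,0}]_N - B_{J_N,0})`. -/
def pseudoTrueTerm {p : ℕ} (ν : Measure (Obs p)) (θ₀ : EuclideanSpace ℝ (Fin p)) (F₀ : ℝ → ℝ)
    (ψ : ℕ → ℝ → ℝ) (J₀ : ℕ) (αJ : ℝ) (N : ℕ) : Fin (sieveDim J₀ αJ N) → ℝ :=
  (N : ℝ)⁻¹ • ∑ k ∈ Finset.Icc 1 N,
    (pad (sieveDim J₀ αJ N) (projCoef ν θ₀ ψ (sieveDim J₀ αJ k) F₀)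
      - projCoef ν θ₀ ψ (sieveDim J₀ αJ N) F₀)

/-! ### Conditions -/

/-- The monotone index model `Y = F₀(x₀ + X'θ₀) + ε`, `E(ε | x₀, X) = 0`, with the moment
conditions. -/
structure IndexModel {p : ℕ} (ν : Measure (Obs p)) (θ₀ : EuclideanSpace ℝ (Fin p))
    (F₀ : ℝ → ℝ) (κ : ℝ) : Prop where
  monotone_link : Monotone F₀
  integrable_noise : Integrable (noise θ₀ F₀) ν
  condExp_noise :
    ν[noise θ₀ F₀ | MeasurableSpace.comap (fun w : Obs p => (w.1, w.2.1)) inferInstance]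
      =ᵐ[ν] 0
  /-- `E|ε|^κ < ∞` -/
  noise_moment : Integrable (fun w => |noise θ₀ F₀ w| ^ κ) ν
  /-- `E(ε² | z₀)` is bounded -/
  condVar_bounded : ∃ C : ℝ,
    ν[fun w => noise θ₀ F₀ w ^ 2 | MeasurableSpace.comap (index θ₀) inferInstance]
      ≤ᵐ[ν] fun _ => C
  /-- `E‖X‖⁴ < ∞` -/
  regressor_moment : Integrable (fun w => ‖w.2.1‖ ^ 4) ν

/-- `F₀` has bounded first and second derivatives. -/
structure SmoothLink (F₀ : ℝ → ℝ) : Prop where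
  differentiable : Differentiable ℝ F₀
  differentiable_deriv : Differentiable ℝ (deriv F₀)
  deriv_bounded : supNorm (deriv F₀) < ⊤
  deriv2_bounded : supNorm (deriv (deriv F₀)) < ⊤

/-- Stability of the projection at `F₀`, and the approximation orders `s` and `s₁`. -/
structure SieveApproximation {p : ℕ} (ν : Measure (Obs p)) (θ₀ : EuclideanSpace ℝ (Fin p))
    (F₀ : ℝ → ℝ) (ψ : ℕ → ℝ → ℝ) (s s₁ : ℝ) : Prop where
  stable : limsup (fun J : ℕ => ⨆ g ∈ sieveSpace ψ J,
      ⨆ (_ : 0 < supNorm (fun z => F₀ z - g z) ∧ supNorm (fun z => F₀ z - g z) < ⊤),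
        supNorm (proj ν θ₀ ψ J (fun z => F₀ z - g z)) / supNorm (fun z => F₀ z - g z)) atTop < ⊤
  approx : ∃ C : ℝ, 0 < C ∧ ∀ J : ℕ, 1 ≤ J → ∃ g ∈ sieveSpace ψ J,
    supNorm (fun z => F₀ z - g z) ≤ ENNReal.ofReal (C * (J : ℝ) ^ (-s))
  approx_deriv : ∃ C : ℝ, 0 < C ∧ ∀ J : ℕ, 1 ≤ J →
    supNorm (fun z => deriv F₀ z - deriv (proj ν θ₀ ψ J F₀) z)
      ≤ ENNReal.ofReal (C * (J : ℝ) ^ (-s₁))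

/-- Bounded basis functions with polynomially bounded derivatives, and Gram matrices with
eigenvalues bounded away from zero and infinity. -/
structure SieveBasis {p : ℕ} (ν : Measure (Obs p)) (θ₀ : EuclideanSpace ℝ (Fin p))
    (ψ : ℕ → ℝ → ℝ) (αψ : ℝ) : Prop where
  differentiable : ∀ j : ℕ, 1 ≤ j → Differentiable ℝ (ψ j)
  bounded : ∃ C : ℝ, ∀ j : ℕ, 1 ≤ j →
    supNorm (ψ j) ≤ ENNReal.ofReal C ∧
      supNorm (deriv (ψ j)) ≤ ENNReal.ofReal (C * (j : ℝ) ^ αψ)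
  eigenvalues : ∃ c C : ℝ, 0 < c ∧ ∀ J : ℕ, 1 ≤ J →
    ∀ l ∈ spectrum ℝ (gram ν θ₀ ψ J), c ≤ l ∧ l ≤ C

/-- `W` consists of i.i.d. batches (rounds `k ≥ 1`) of `B` i.i.d. observations with law `ν`. -/
structure IIDBatches {p B : ℕ} {Ω : Type*} [MeasurableSpace Ω] (P : Measure Ω)
    (ν : Measure (Obs p)) (W : ℕ → Fin B → Ω → Obs p) : Prop where
  measurable : ∀ k i, 1 ≤ k → Measurable (W k i)
  law : ∀ k i, 1 ≤ k → P.map (W k i) = ν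
  indep : iIndepFun (fun (a : ℕ+ × Fin B) => W a.1 a.2) P

/-- `σ(W_1, …, W_k)`. -/
@[reducible] def dataSigma {p B : ℕ} {Ω : Type*} (W : ℕ → Fin B → Ω → Obs p) (k : ℕ) : MeasurableSpace Ω :=
  ⨆ l ∈ Finset.Icc 1 k, ⨆ i : Fin B, MeasurableSpace.comap (W l i) inferInstance

/-- The plug-in estimates are adapted to the data, and a.s. `‖θ̌_k - θ₀‖ = O(k^{-α_θ} log^q k)`. -/
structure PlugIn {p B : ℕ} {Ω : Type*} [MeasurableSpace Ω] (P : Measure Ω)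
    (θ₀ : EuclideanSpace ℝ (Fin p)) (W : ℕ → Fin B → Ω → Obs p)
    (θc : ℕ → Ω → EuclideanSpace ℝ (Fin p)) (αθ q : ℝ) : Prop where
  adapted : ∀ k, Measurable[dataSigma W k] (θc k)
  rate : ∀ᵐ ω ∂P, (fun k : ℕ => ‖θc k ω - θ₀‖) =O[atTop]
    fun k : ℕ => (k : ℝ) ^ (-αθ) * Real.log k ^ q

/-- `μ₀` is a version of `z ↦ E(X | z₀ = z)`, `∂F₀ μ₀` is bounded, and the projections of its
coordinates on the sieve spaces `S_{J_k}` converge uniformly. -/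
structure RegressorMean {p : ℕ} (ν : Measure (Obs p)) (θ₀ : EuclideanSpace ℝ (Fin p))
    (F₀ : ℝ → ℝ) (ψ : ℕ → ℝ → ℝ) (J₀ : ℕ) (αJ : ℝ) (μ₀ : ℝ → EuclideanSpace ℝ (Fin p)) :
    Prop where
  measurable : Measurable μ₀
  version : ν[fun w : Obs p => w.2.1 | MeasurableSpace.comap (index θ₀) inferInstance]
    =ᵐ[ν] fun w => μ₀ (index θ₀ w)
  bounded : ⨆ z : ℝ, ‖deriv F₀ z • μ₀ z‖ₑ < ⊤
  proj_converges : limsup (fun k : ℕ => ⨆ a : Fin p,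
    supNorm (fun z => proj ν θ₀ ψ (sieveDim J₀ αJ k) (fun t => deriv F₀ t * μ₀ t a) z
      - deriv F₀ z * μ₀ z a)) atTop = 0

/-- The restrictions on the exponents. -/
structure Exponents (αη αJ αψ αθ s s₁ : ℝ) : Prop where
  αη_pos : 0 < αη
  αJ_pos : 0 < αJ
  αψ_pos : 0 < αψ
  αθ_pos : 0 < αθ
  s₁_pos : 0 < s₁
  s₁_le : s₁ ≤ s
  one_lt_s : 1 < s
  αη_lt_one : αη < 1
  two_αJ_lt : 2 * αJ < αη
  αθ_gt : αJ * (1 + αψ) < αθ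
  bias_cond : 1 < αη + (2 * s - 1) * αJ
  plug_in_cond : 1 < αη + 2 * αθ - αJ * (1 + 2 * αψ)
  variance_cond : 1 + αJ < 2 * αη
  αη_lower : max (1 / 2 + αJ) (1 + 2 * αJ * (1 + αψ) - 2 * αθ) < αη
  αη_upper : αη < min (2 * αθ - 2 * αJ * αψ) (αJ * (2 * s + 1))
  four_αJ_lt : 4 * αJ < αη
  αη_lt : αη < 1 - 4 * αJ
  αθ_lower : max ((1 - s₁) * αJ + 1 / 2)
    (max ((1 - s + αψ) * αJ + 1 / 2) ((3 / 4 + αψ / 2) * αJ + 1 / 4)) < αθ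

/-- The curves `z ↦ Ψ_J(z)`, `z ∈ D`, have covering numbers that are polynomial in `J` and in the
inverse radius. -/
def PolyCovered (ψ : ℕ → ℝ → ℝ) (D : Set ℝ) : Prop :=
  ∃ C a : ℝ, ∀ J : ℕ, 1 ≤ J → ∀ δ : ℝ, 0 < δ → δ ≤ 1 →
    ∃ T : Finset ℝ, (T.card : ℝ) ≤ C * ((J : ℝ) / δ) ^ a ∧
      ∀ z ∈ D, ∃ t ∈ T, ∀ j : ℕ, 1 ≤ j → j ≤ J → |ψ j z - ψ j t| ≤ δ

end OnlineSieve

end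

open OnlineSieve

set_option linter.unusedSectionVars false

noncomputable section

namespace OnlineSieve

section

/-! ### Deterministic sequences -/

theorem tendsto_natCast_add_one_rpow_neg {a : ℝ} (ha : 0 < a) :
    Tendsto (fun k : ℕ => ((k : ℝ) + 1) ^ (-a)) atTop (𝓝 0) :=
  (tendsto_rpow_neg_atTop ha).comp
    (tendsto_atTop_add_const_right _ _ tendsto_natCast_atTop_atTop)

theorem eventually_mul_rpow_le (C : ℝ) {a b ε : ℝ} (hab : a < b) (hε : 0 < ε) :
    ∀ᶠ k : ℕ in atTop, C * ((k : ℝ) + 1) ^ a ≤ ε * ((k : ℝ) + 1) ^ b := by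
  have h := (tendsto_natCast_add_one_rpow_neg (sub_pos.2 hab)).const_mul C
  rw [mul_zero] at h
  filter_upwards [h.eventually (gt_mem_nhds hε)] with k hk
  have hpos : (0 : ℝ) < (k : ℝ) + 1 := by positivity
  have : ((k : ℝ) + 1) ^ a = ((k : ℝ) + 1) ^ (-(b - a)) * ((k : ℝ) + 1) ^ b := by
    rw [← Real.rpow_add hpos]; congr 1; ring
  rw [this, ← mul_assoc]
  exact mul_le_mul_of_nonneg_right hk.le (by positivity)

theorem ratio_le (r : ℝ) {c a : ℝ} (hc : 0 < c) (ha0 : 0 < a) (ha : a < 1) :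
    ∀ᶠ k : ℕ in atTop, 0 ≤ 1 - c * ((k : ℝ) + 1) ^ (-a) ∧
      (1 - c * ((k : ℝ) + 1) ^ (-a)) * (((k : ℝ) + 1) ^ r * (k : ℝ) ^ (-r))
        ≤ 1 - c / 2 * ((k : ℝ) + 1) ^ (-a) := by
  have h1 : ∀ᶠ k : ℕ in atTop, c * ((k : ℝ) + 1) ^ (-a) ≤ 1 * ((k : ℝ) + 1) ^ (0 : ℝ) :=
    eventually_mul_rpow_le c (by linarith) one_pos
  have h2 : ∀ᶠ k : ℕ in atTop,
      (4 * |r|) * ((k : ℝ) + 1) ^ (-1 : ℝ) ≤ (c / 2) * ((k : ℝ) + 1) ^ (-a) :=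
    eventually_mul_rpow_le _ (by linarith) (by positivity)
  have h3 : ∀ᶠ k : ℕ in atTop, |r| ≤ (k : ℝ) :=
    tendsto_natCast_atTop_atTop.eventually_ge_atTop _
  filter_upwards [h1, h2, h3, eventually_ge_atTop 1] with k h1 h2 h3 hk
  rw [Real.rpow_zero, mul_one] at h1
  have hk' : (1 : ℝ) ≤ k := by exact_mod_cast hk
  have hk0 : (0 : ℝ) < k := by linarith
  refine ⟨by linarith, ?_⟩
  have hrat : ((k : ℝ) + 1) ^ r * (k : ℝ) ^ (-r) ≤ 1 + 2 * (|r| / k) := by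
    have e1 : ((k : ℝ) + 1) ^ r * (k : ℝ) ^ (-r) = (1 + 1 / (k : ℝ)) ^ r := by
      rw [Real.rpow_neg hk0.le, ← div_eq_mul_inv, ← Real.div_rpow (by positivity) hk0.le]
      congr 1; field_simp
    have e2 : (1 + 1 / (k : ℝ)) ^ r ≤ (1 + 1 / (k : ℝ)) ^ |r| :=
      Real.rpow_le_rpow_of_exponent_le (by simp [hk0.le]) (le_abs_self r)
    have e3 : (1 + 1 / (k : ℝ)) ^ |r| ≤ Real.exp (|r| / k) := by
      have : 1 + 1 / (k : ℝ) ≤ Real.exp (1 / k) := by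
        have := Real.add_one_le_exp (1 / (k : ℝ)); linarith
      calc (1 + 1 / (k : ℝ)) ^ |r| ≤ (Real.exp (1 / k)) ^ |r| :=
            Real.rpow_le_rpow (by positivity) this (abs_nonneg r)
        _ = Real.exp (|r| / k) := by rw [← Real.exp_mul]; congr 1; ring
    have e4 : Real.exp (|r| / k) ≤ 1 + 2 * (|r| / k) := by
      have hx0 : 0 ≤ |r| / k := by positivity
      have hx1 : |r| / k ≤ 1 := by rw [div_le_one hk0]; exact h3
      have := Real.abs_exp_sub_one_le (x := |r| / k) (by rw [abs_of_nonneg hx0]; exact hx1)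
      rw [abs_of_nonneg hx0] at this
      linarith [le_abs_self (Real.exp (|r| / k) - 1)]
    rw [e1]; linarith
  have hu : 2 * (|r| / k) ≤ (c / 2) * ((k : ℝ) + 1) ^ (-a) := by
    refine le_trans ?_ h2
    rw [Real.rpow_neg_one, ← div_eq_mul_inv, ← mul_div_assoc, div_le_div_iff₀ hk0 (by positivity)]
    nlinarith [abs_nonneg r]
  have hu0 : 0 ≤ 2 * (|r| / (k : ℝ)) := by positivity
  have ht : 0 ≤ c * ((k : ℝ) + 1) ^ (-a) := by positivity
  calc _ ≤ (1 - c * ((k : ℝ) + 1) ^ (-a)) * (1 + 2 * (|r| / k)) :=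
        mul_le_mul_of_nonneg_left hrat (by linarith)
    _ ≤ _ := by nlinarith [mul_nonneg ht hu0]

theorem forall_le_of_eventually_le {x y : ℕ → ℝ} (hy : ∀ k, 1 ≤ k → 0 < y k) {C : ℝ}
    (h : ∀ᶠ k in atTop, x k ≤ C * y k) : ∃ C', 0 ≤ C' ∧ ∀ k, 1 ≤ k → x k ≤ C' * y k := by
  obtain ⟨n, hn⟩ := eventually_atTop.1 h
  refine ⟨|C| + ∑ k ∈ Finset.range n, |x k| / |y k|, by positivity, fun k hk => ?_⟩
  have hyk := hy k hk
  rcases le_or_gt n k with hnk | hnk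
  · refine (hn k hnk).trans (mul_le_mul_of_nonneg_right ?_ hyk.le)
    have : 0 ≤ ∑ k ∈ Finset.range n, |x k| / |y k| :=
      Finset.sum_nonneg fun i _ => by positivity
    linarith [le_abs_self C]
  · have h1 : |x k| / |y k| ≤ ∑ k ∈ Finset.range n, |x k| / |y k| :=
      Finset.single_le_sum (f := fun k => |x k| / |y k|) (fun i _ => by positivity)
        (Finset.mem_range.2 hnk)
    calc x k ≤ |x k| := le_abs_self _
      _ = |x k| / |y k| * y k := by rw [abs_of_pos hyk]; field_simp
      _ ≤ _ := mul_le_mul_of_nonneg_right (by linarith [abs_nonneg C]) hyk.le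

/-- A contraction with rate `c k^{-a}` driven by summable inputs, in the scale `k^r`. -/
theorem weighted_recursion {a c r : ℝ} (hc : 0 < c) (ha0 : 0 < a) (ha : a < 1) {x y : ℕ → ℝ}
    (hx : ∀ k, 0 ≤ x k) (hy : ∀ k, 0 ≤ y k)
    (hsum : Summable fun k : ℕ => x k * (k : ℝ) ^ r)
    (h : ∀ᶠ k : ℕ in atTop, y (k + 1) ≤ (1 - c * ((k : ℝ) + 1) ^ (-a)) * y k + x (k + 1)) :
    ∃ C, 0 ≤ C ∧ ∀ k : ℕ, 1 ≤ k → y k ≤ C * (k : ℝ) ^ (-r) := by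
  obtain ⟨n, hn⟩ := eventually_atTop.1 ((h.and (ratio_le r hc ha0 ha)).and (eventually_ge_atTop 1))
  have hn1 : 1 ≤ n := (hn n le_rfl).2
  have key : ∀ k, n ≤ k → y k * (k : ℝ) ^ r ≤ y n * (n : ℝ) ^ r
      + ∑ l ∈ Finset.range (k + 1), x l * (l : ℝ) ^ r := by
    intro k hk
    induction k, hk using Nat.le_induction with
    | base =>
      have : 0 ≤ ∑ l ∈ Finset.range (n + 1), x l * (l : ℝ) ^ r :=
        Finset.sum_nonneg fun l _ => mul_nonneg (hx l) (by positivity)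
      linarith
    | succ k hk ih =>
      obtain ⟨⟨h1, h2, h3⟩, hk1⟩ := hn k hk
      have hk0 : (0 : ℝ) < k := by exact_mod_cast hk1
      have hkk : ((k : ℝ)) ^ (-r) * (k : ℝ) ^ r = 1 := by
        rw [← Real.rpow_add hk0]; simp
      rw [Finset.sum_range_succ]
      have hyk : 0 ≤ y k * (k : ℝ) ^ r := mul_nonneg (hy k) (by positivity)
      have e1 : (1 - c * ((k : ℝ) + 1) ^ (-a)) * y k * ((k : ℝ) + 1) ^ r
          ≤ y k * (k : ℝ) ^ r := by
        calc _ = ((1 - c * ((k : ℝ) + 1) ^ (-a)) * (((k : ℝ) + 1) ^ r * (k : ℝ) ^ (-r)))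
              * (y k * (k : ℝ) ^ r) := by
              linear_combination (-(1 - c * ((k : ℝ) + 1) ^ (-a)) * y k * ((k : ℝ) + 1) ^ r) * hkk
          _ ≤ 1 * (y k * (k : ℝ) ^ r) := by
              refine mul_le_mul_of_nonneg_right (h3.trans ?_) hyk
              have : 0 ≤ c / 2 * ((k : ℝ) + 1) ^ (-a) := by positivity
              linarith
          _ = _ := one_mul _
      have e2 := mul_le_mul_of_nonneg_right h1 (by positivity : (0 : ℝ) ≤ ((k : ℝ) + 1) ^ r)
      push_cast
      nlinarith
  have hb : ∀ k, n ≤ k → y k ≤ (y n * (n : ℝ) ^ r + ∑' l : ℕ, x l * (l : ℝ) ^ r) * (k : ℝ) ^ (-r) := by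
    intro k hk
    have hk0 : (0 : ℝ) < k := by exact_mod_cast hn1.trans hk
    have h1 := key k hk
    have h2 := hsum.sum_le_tsum (Finset.range (k + 1))
      fun l _ => mul_nonneg (hx l) (Real.rpow_nonneg (Nat.cast_nonneg l) r)
    rw [Real.rpow_neg hk0.le, ← div_eq_mul_inv, le_div_iff₀ (by positivity)]
    linarith
  exact forall_le_of_eventually_le (fun k hk => Real.rpow_pos_of_pos (by exact_mod_cast hk) _)
    (eventually_atTop.2 ⟨n, hb⟩)

/-- A contraction with rate `c k^{-a}` driven by inputs of order `k^{-a-r}`. -/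
theorem power_recursion {a c r C : ℝ} (hc : 0 < c) (ha0 : 0 < a) (ha : a < 1) {y : ℕ → ℝ}
    (hy : ∀ k, 0 ≤ y k)
    (h : ∀ᶠ k : ℕ in atTop, y (k + 1) ≤ (1 - c * ((k : ℝ) + 1) ^ (-a)) * y k
      + C * ((k : ℝ) + 1) ^ (-a) * ((k : ℝ) + 1) ^ (-r)) :
    ∃ C', 0 ≤ C' ∧ ∀ k : ℕ, 1 ≤ k → y k ≤ C' * (k : ℝ) ^ (-r) := by
  obtain ⟨n, hn⟩ := eventually_atTop.1 ((h.and (ratio_le r hc ha0 ha)).and (eventually_ge_atTop 1))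
  have hn1 : 1 ≤ n := (hn n le_rfl).2
  have key : ∀ k, n ≤ k → y k * (k : ℝ) ^ r ≤ y n * (n : ℝ) ^ r + 2 * |C| / c := by
    intro k hk
    induction k, hk using Nat.le_induction with
    | base => have : 0 ≤ 2 * |C| / c := by positivity
              linarith
    | succ k hk ih =>
      obtain ⟨⟨h1, h2, h3⟩, hk1⟩ := hn k hk
      have hk0 : (0 : ℝ) < k := by exact_mod_cast hk1
      have hkk : ((k : ℝ)) ^ (-r) * (k : ℝ) ^ r = 1 := by
        rw [← Real.rpow_add hk0]; simp
      have hkk' : ((k : ℝ) + 1) ^ (-r) * ((k : ℝ) + 1) ^ r = 1 := by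
        rw [← Real.rpow_add (by positivity)]; simp
      set t := ((k : ℝ) + 1) ^ (-a) with ht
      have ht0 : 0 ≤ t := by positivity
      have hct1 : c / 2 * t ≤ 1 := by nlinarith
      have hyk : 0 ≤ y k * (k : ℝ) ^ r := mul_nonneg (hy k) (by positivity)
      set A := y n * (n : ℝ) ^ r + 2 * |C| / c with hA
      have hA2 : C ≤ c / 2 * A := by
        have h0 : 0 ≤ y n * (n : ℝ) ^ r := mul_nonneg (hy n) (by positivity)
        have h1 : c / 2 * (2 * |C| / c) = |C| := by field_simp
        have : c / 2 * A = c / 2 * (y n * (n : ℝ) ^ r) + |C| := by rw [hA, mul_add, h1]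
        rw [this]
        have : 0 ≤ c / 2 * (y n * (n : ℝ) ^ r) := by positivity
        linarith [le_abs_self C]
      have e1 : (1 - c * t) * y k * ((k : ℝ) + 1) ^ r ≤ (1 - c / 2 * t) * A := by
        calc _ = ((1 - c * t) * (((k : ℝ) + 1) ^ r * (k : ℝ) ^ (-r)))
              * (y k * (k : ℝ) ^ r) := by
              linear_combination (-(1 - c * t) * y k * ((k : ℝ) + 1) ^ r) * hkk
          _ ≤ (1 - c / 2 * t) * (y k * (k : ℝ) ^ r) := mul_le_mul_of_nonneg_right h3 hyk
          _ ≤ _ := mul_le_mul_of_nonneg_left ih (by linarith)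
      have e2 := mul_le_mul_of_nonneg_right h1 (by positivity : (0 : ℝ) ≤ ((k : ℝ) + 1) ^ r)
      have e3 : C * t * ((k : ℝ) + 1) ^ (-r) * ((k : ℝ) + 1) ^ r = C * t := by
        rw [mul_assoc, hkk', mul_one]
      have e4 : C * t ≤ c / 2 * A * t := mul_le_mul_of_nonneg_right hA2 ht0
      push_cast
      nlinarith
  have hb : ∀ k, n ≤ k → y k ≤ (y n * (n : ℝ) ^ r + 2 * |C| / c) * (k : ℝ) ^ (-r) := by
    intro k hk
    have hk0 : (0 : ℝ) < k := by exact_mod_cast hn1.trans hk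
    rw [Real.rpow_neg hk0.le, ← div_eq_mul_inv, le_div_iff₀ (by positivity)]
    exact key k hk
  exact forall_le_of_eventually_le (fun k hk => Real.rpow_pos_of_pos (by exact_mod_cast hk) _)
    (eventually_atTop.2 ⟨n, hb⟩)

theorem sum_Icc_le_of_summable {x : ℕ → ℝ} (hx : ∀ k, 0 ≤ x k) {b : ℝ} (hb : 0 ≤ b)
    (hsum : Summable fun k : ℕ => x k * (k : ℝ) ^ (-b)) (N : ℕ) :
    ∑ k ∈ Finset.Icc 1 N, x k ≤ (∑' k : ℕ, x k * (k : ℝ) ^ (-b)) * (N : ℝ) ^ b := by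
  calc ∑ k ∈ Finset.Icc 1 N, x k ≤ ∑ k ∈ Finset.Icc 1 N, x k * (k : ℝ) ^ (-b) * (N : ℝ) ^ b := by
        refine Finset.sum_le_sum fun k hk => ?_
        obtain ⟨h1, h2⟩ := Finset.mem_Icc.1 hk
        have hk0 : (0 : ℝ) < k := by exact_mod_cast h1
        have : (1 : ℝ) ≤ (k : ℝ) ^ (-b) * (N : ℝ) ^ b := by
          rw [Real.rpow_neg hk0.le, ← div_eq_inv_mul, one_le_div (by positivity)]
          exact Real.rpow_le_rpow hk0.le (by exact_mod_cast h2) hb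
        rw [mul_assoc]
        exact le_mul_of_one_le_right (hx k) this
    _ = (∑ k ∈ Finset.Icc 1 N, x k * (k : ℝ) ^ (-b)) * (N : ℝ) ^ b := by rw [Finset.sum_mul]
    _ ≤ _ := mul_le_mul_of_nonneg_right (hsum.sum_le_tsum _ fun l _ =>
        mul_nonneg (hx l) (Real.rpow_nonneg (Nat.cast_nonneg l) _)) (by positivity)

theorem sum_Icc_rpow_neg_le {r : ℝ} (hr0 : 0 ≤ r) (hr : r < 1) (N : ℕ) :
    ∑ k ∈ Finset.Icc 1 N, (k : ℝ) ^ (-r) ≤ (1 - r)⁻¹ * (N : ℝ) ^ (1 - r) := by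
  induction N with
  | zero => simp [Real.zero_rpow (by linarith : (1 - r) ≠ 0)]
  | succ n ih =>
    rw [Finset.sum_Icc_succ_top (by omega)]
    have hr1 : 0 < 1 - r := by linarith
    have hn : (0 : ℝ) < (n : ℝ) + 1 := by positivity
    have hB := rpow_one_add_le_one_add_mul_self (s := -1 / ((n : ℝ) + 1)) (p := 1 - r)
      (by rw [le_div_iff₀ hn]; linarith [(Nat.cast_nonneg n : (0 : ℝ) ≤ n)]) hr1.le (by linarith)
    have e1 : 1 + -1 / ((n : ℝ) + 1) = n / ((n : ℝ) + 1) := by field_simp; ring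
    rw [e1, Real.div_rpow (Nat.cast_nonneg n) hn.le, div_le_iff₀ (by positivity)] at hB
    have e2 : ((n : ℝ) + 1) ^ (1 - r) = ((n : ℝ) + 1) * ((n : ℝ) + 1) ^ (-r) := by
      rw [sub_eq_add_neg, Real.rpow_add hn, Real.rpow_one]
    have e3 : (n : ℝ) ^ (1 - r) ≤ ((n : ℝ) + 1) ^ (1 - r) - (1 - r) * ((n : ℝ) + 1) ^ (-r) := by
      refine hB.trans_eq ?_
      rw [e2]; field_simp; ring
    push_cast
    have e4 : (1 - r)⁻¹ * (n : ℝ) ^ (1 - r) ≤ (1 - r)⁻¹ * ((n : ℝ) + 1) ^ (1 - r)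
        - ((n : ℝ) + 1) ^ (-r) := by
      have := mul_le_mul_of_nonneg_left e3 (inv_pos.2 hr1).le
      rw [mul_sub, inv_mul_cancel_left₀ hr1.ne'] at this
      exact this
    linarith

theorem summable_natCast_rpow_of_lt {r : ℝ} (hr : r < -1) : Summable fun k : ℕ => (k : ℝ) ^ r :=
  Real.summable_nat_rpow.2 hr

/-- The times at which a monotone integer sequence of order `k^j` jumps are sparse. -/
theorem summable_jumps {J : ℕ → ℕ} (hmono : ∀ k, 1 ≤ k → J k ≤ J (k + 1)) {C j r : ℝ}
    (hj : 0 < j) (hJ : ∀ k, 1 ≤ k → (J k : ℝ) ≤ C * (k : ℝ) ^ j) (hJ1 : ∀ k, 1 ≤ k → 1 ≤ J k)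
    (hr : j < r) :
    Summable fun k : ℕ => if J k = J (k + 1) then 0 else (k : ℝ) ^ (-r) := by
  have hC : 0 < C := by
    have := hJ 1 le_rfl
    have h1 : (1 : ℝ) ≤ J 1 := by exact_mod_cast hJ1 1 le_rfl
    simp at this; linarith
  have hr0 : 0 < r := hj.trans hr
  have hmono' : ∀ k l, 1 ≤ k → k ≤ l → J k ≤ J l := fun k l hk hkl => by
    induction l, hkl using Nat.le_induction with
    | base => exact le_rfl
    | succ l hl ih => exact ih.trans (hmono l (hk.trans hl))
  set q := r / j with hq
  have hq1 : 1 < q := by rw [hq, one_lt_div hj]; exact hr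
  have hS : Summable fun m : ℕ => (m : ℝ) ^ (-q) := Real.summable_nat_rpow.2 (by linarith)
  set K : ℝ := (C * 2 ^ j) ^ q with hK
  have hb : ∀ k : ℕ, 1 ≤ k → (k : ℝ) ^ (-r) ≤ K * (J (k + 1) : ℝ) ^ (-q) := by
    intro k hk
    have hk0 : (0 : ℝ) < k := by exact_mod_cast hk
    have hk1 : (1 : ℝ) ≤ k := by exact_mod_cast hk
    have hJp : (0 : ℝ) < J (k + 1) := by exact_mod_cast hJ1 (k + 1) (by omega)
    have h1 : (J (k + 1) : ℝ) ≤ C * 2 ^ j * (k : ℝ) ^ j := by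
      refine (hJ (k + 1) (by omega)).trans ?_
      rw [mul_assoc, ← Real.mul_rpow (by norm_num) hk0.le]
      refine mul_le_mul_of_nonneg_left (Real.rpow_le_rpow (by positivity) ?_ hj.le) hC.le
      push_cast; linarith
    have h2 : (J (k + 1) : ℝ) ^ q ≤ K * (k : ℝ) ^ r := by
      calc _ ≤ (C * 2 ^ j * (k : ℝ) ^ j) ^ q := Real.rpow_le_rpow hJp.le h1 (by linarith)
        _ = _ := by
          rw [Real.mul_rpow (by positivity) (by positivity), ← Real.rpow_mul hk0.le]
          congr 2; rw [hq]; field_simp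
    rw [Real.rpow_neg hk0.le, Real.rpow_neg hJp.le, ← div_eq_mul_inv, inv_eq_one_div,
      div_le_div_iff₀ (by positivity) (by positivity)]
    linarith
  refine summable_of_sum_range_le (c := 1 + K * ∑' m : ℕ, (m : ℝ) ^ (-q)) (fun k => ?_) fun N => ?_
  · split_ifs <;> positivity
  have hstep : ∀ k ∈ Finset.range N, (if J k = J (k + 1) then 0 else (k : ℝ) ^ (-r))
      ≤ (if k = 0 then 1 else 0) +
        (if 1 ≤ k ∧ J k ≠ J (k + 1) then K * (J (k + 1) : ℝ) ^ (-q) else 0) := by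
    intro k _
    rcases Nat.eq_zero_or_pos k with rfl | hk
    · simp only [Nat.cast_zero, Real.zero_rpow (by linarith : -r ≠ 0)]
      split_ifs <;> simp_all
    · by_cases hkJ : J k = J (k + 1)
      · simp [hkJ, Nat.pos_iff_ne_zero.1 hk]
      · have h1k : 1 ≤ k := hk
        simp only [hkJ, if_false, Nat.pos_iff_ne_zero.1 hk, h1k, ne_eq, not_false_eq_true, and_self,
          if_true, zero_add]
        exact hb k hk
  refine (Finset.sum_le_sum hstep).trans ?_
  rw [Finset.sum_add_distrib]
  refine add_le_add ?_ ?_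
  · rw [Finset.sum_ite_eq']; split_ifs <;> norm_num
  · rw [← Finset.sum_filter, ← Finset.mul_sum]
    refine mul_le_mul_of_nonneg_left ?_ (by positivity)
    rw [← Finset.sum_image (f := fun m : ℕ => (m : ℝ) ^ (-q)) (g := fun k => J (k + 1))]
    · exact hS.sum_le_tsum _ fun m _ => by positivity
    · intro k hk l hl hkl
      simp only [Finset.coe_filter, Finset.mem_range, Set.mem_ofPred_eq] at hk hl
      simp only at hkl
      by_contra hne
      rcases lt_or_gt_of_ne hne with h | h
      · have h1 := hmono' (k + 1) l (by omega) h
        have h2 := hmono l hl.2.1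
        exact hl.2.2 (by omega)
      · have h1 := hmono' (l + 1) k (by omega) h
        have h2 := hmono k hk.2.1
        exact hk.2.2 (by omega)

end

section

/-! ### Probabilistic tools -/

theorem ae_summable_of_summable_integral {Ω : Type*} [MeasurableSpace Ω] {P : Measure Ω}
    {X : ℕ → Ω → ℝ} (h0 : ∀ k ω, 0 ≤ X k ω) (hint : ∀ k, Integrable (X k) P)
    (hsum : Summable fun k => ∫ ω, X k ω ∂P) : ∀ᵐ ω ∂P, Summable fun k => X k ω := by
  have h1 : ∫⁻ ω, ∑' k, ENNReal.ofReal (X k ω) ∂P ≠ ⊤ := by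
    rw [lintegral_tsum fun k => (hint k).1.aemeasurable.ennreal_ofReal]
    have : ∀ k, ∫⁻ ω, ENNReal.ofReal (X k ω) ∂P = ENNReal.ofReal (∫ ω, X k ω ∂P) := fun k =>
      (ofReal_integral_eq_lintegral_ofReal (hint k) (Eventually.of_forall (h0 k))).symm
    simp_rw [this]
    exact hsum.tsum_ofReal_ne_top
  have h2 := ae_lt_top' (AEMeasurable.tsum
    fun k => (hint k).1.aemeasurable.ennreal_ofReal) h1
  filter_upwards [h2] with ω hω
  have := ENNReal.summable_toReal hω.ne
  simpa [ENNReal.toReal_ofReal, h0] using this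

section Pair

variable {Ω O S : Type*} [MeasurableSpace Ω] [MeasurableSpace O] [MeasurableSpace S]
  {P : Measure Ω} [IsProbabilityMeasure P] {ν : Measure O} [IsProbabilityMeasure ν]
  {V : Ω → O} {ξ : Ω → S}

omit [IsProbabilityMeasure ν] in
theorem map_prodMk_eq_of_indepFun (hξ : Measurable ξ) (hV : Measurable V)
    (hind : IndepFun ξ V P) (hlaw : P.map V = ν) :
    P.map (fun ω => (ξ ω, V ω)) = (P.map ξ).prod ν := by
  rw [(indepFun_iff_map_prod_eq_prod_map_map hξ.aemeasurable hV.aemeasurable).1 hind, hlaw]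

theorem lintegral_eq_of_indepFun (hξ : Measurable ξ) (hV : Measurable V)
    (hind : IndepFun ξ V P) (hlaw : P.map V = ν) {f : S × O → ℝ≥0∞} (hf : Measurable f) :
    ∫⁻ ω, f (ξ ω, V ω) ∂P = ∫⁻ ω, ∫⁻ w, f (ξ ω, w) ∂ν ∂P := by
  rw [← lintegral_map hf (hξ.prodMk hV), map_prodMk_eq_of_indepFun hξ hV hind hlaw,
    lintegral_prod f hf.aemeasurable, lintegral_map hf.lintegral_prod_right' hξ]

theorem integral_eq_of_indepFun {E : Type*} [NormedAddCommGroup E] [NormedSpace ℝ E]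
    (hξ : Measurable ξ) (hV : Measurable V)
    (hind : IndepFun ξ V P) (hlaw : P.map V = ν) {f : S × O → E} (hf : StronglyMeasurable f)
    (hint : Integrable (fun ω => f (ξ ω, V ω)) P) :
    ∫ ω, f (ξ ω, V ω) ∂P = ∫ ω, ∫ w, f (ξ ω, w) ∂ν ∂P := by
  have hφ := (hξ.prodMk hV).aemeasurable (μ := P)
  have hint' := (integrable_map_measure hf.aestronglyMeasurable hφ).2 hint
  rw [map_prodMk_eq_of_indepFun hξ hV hind hlaw] at hint'
  have : IsProbabilityMeasure (P.map ξ) := Measure.isProbabilityMeasure_map hξ.aemeasurable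
  rw [← integral_map hφ hf.aestronglyMeasurable, map_prodMk_eq_of_indepFun hξ hV hind hlaw,
    integral_prod f hint', integral_map hξ.aemeasurable
      (hf.integral_prod_right').aestronglyMeasurable]

section
omit [MeasurableSpace Ω]
variable {E : Type*} [NormedAddCommGroup E]

theorem stronglyMeasurable_pair [MeasurableSpace Ω]
    (hξ : Measurable ξ) (hV : Measurable V) {f : S × O → E}
    (hf : StronglyMeasurable f) : StronglyMeasurable fun ω => f (ξ ω, V ω) :=
  hf.comp_measurable (hξ.prodMk hV)

theorem stronglyMeasurable_integral_snd [NormedSpace ℝ E] {f : S × O → E}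
    (hf : StronglyMeasurable f) : StronglyMeasurable fun s => ∫ w, f (s, w) ∂ν :=
  hf.integral_prod_right'

theorem measurable_ofReal_norm_sq {f : S × O → E} (hf : StronglyMeasurable f) :
    Measurable fun x => ENNReal.ofReal (‖f x‖ ^ 2) :=
  (hf.norm.pow 2).measurable.ennreal_ofReal

theorem stronglyMeasurable_inner_fst {E : Type*} [NormedAddCommGroup E] [InnerProductSpace ℝ E]
    {f : S × O → E} (hf : StronglyMeasurable f) {y : S → E} (hy : StronglyMeasurable y) :
    StronglyMeasurable fun x : S × O => inner ℝ (y x.1) (f x) :=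
  (hy.comp_measurable measurable_fst).inner hf

end

end Pair

section Step

variable {Ω O : Type*} {m m0 : MeasurableSpace Ω} [mO : MeasurableSpace O] {P : Measure Ω}
  [IsProbabilityMeasure P] {ν : Measure O} [IsProbabilityMeasure ν] {V : Ω → O}

omit [IsProbabilityMeasure P] in
theorem indepFun_id_of_indep (hind : Indep m (MeasurableSpace.comap V mO) P) :
    @IndepFun Ω Ω O m0 m mO (id : Ω → Ω) V P := by
  rw [@IndepFun_iff_Indep Ω Ω O m0 m mO id V P]
  simpa [MeasurableSpace.comap_id] using hind

theorem lintegral_eq_of_indep (hm : m ≤ m0) (hV : Measurable V)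
    (hind : Indep m (MeasurableSpace.comap V mO) P) (hlaw : P.map V = ν)
    {f : Ω × O → ℝ≥0∞} (hf : Measurable[m.prod mO] f) :
    ∫⁻ ω, f (ω, V ω) ∂P = ∫⁻ ω, ∫⁻ w, f (ω, w) ∂ν ∂P :=
  @lintegral_eq_of_indepFun Ω O Ω m0 mO m P _ ν _ V id (measurable_id'' hm) hV
    (indepFun_id_of_indep hind) hlaw f hf

variable {E : Type*} [NormedAddCommGroup E] [NormedSpace ℝ E]

theorem integral_eq_of_indep (hm : m ≤ m0) (hV : Measurable V)
    (hind : Indep m (MeasurableSpace.comap V mO) P) (hlaw : P.map V = ν)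
    {f : Ω × O → E} (hf : StronglyMeasurable[m.prod mO] f)
    (hint : Integrable (fun ω => f (ω, V ω)) P) :
    ∫ ω, f (ω, V ω) ∂P = ∫ ω, ∫ w, f (ω, w) ∂ν ∂P :=
  @integral_eq_of_indepFun Ω O Ω m0 mO m P _ ν _ V id E _ _ (measurable_id'' hm) hV
    (indepFun_id_of_indep hind) hlaw f hf hint

omit [NormedSpace ℝ E] in
theorem stronglyMeasurable_prodMk_of_le (hm : m ≤ m0) (hV : Measurable V) {f : Ω × O → E}
    (hf : StronglyMeasurable[m.prod mO] f) : StronglyMeasurable[m0] fun ω => f (ω, V ω) :=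
  @stronglyMeasurable_pair Ω O Ω mO m V id E _ m0 (measurable_id'' hm) hV f hf

end Step

/-- `D` is square integrable and conditionally centred given `m`. -/
structure CondCentered {Ω H : Type*} [NormedAddCommGroup H] [InnerProductSpace ℝ H]
    {m0 : MeasurableSpace Ω} (P : Measure Ω) (m : MeasurableSpace Ω) (D : Ω → H) : Prop where
  memLp : MemLp D 2 P
  integral_inner : ∀ y : Ω → H, StronglyMeasurable[m] y → MemLp y 2 P →
    ∫ ω, inner ℝ (y ω) (D ω) ∂P = 0

section Centered

variable {Ω H : Type*} [NormedAddCommGroup H] [InnerProductSpace ℝ H]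
  {m m0 : MeasurableSpace Ω} {P : Measure Ω}

theorem integrable_inner_of_memLp {f g : Ω → H} (hf : MemLp f 2 P) (hg : MemLp g 2 P) :
    Integrable (fun ω => inner ℝ (f ω) (g ω)) P := by
  refine (hf.norm.integrable_mul hg.norm).mono (hf.1.inner hg.1) (Eventually.of_forall fun ω => ?_)
  simp only [Pi.mul_apply, norm_mul, norm_norm]
  exact norm_inner_le_norm _ _

omit [InnerProductSpace ℝ H] in
theorem integrable_norm_sq {f : Ω → H} (hf : MemLp f 2 P) :
    Integrable (fun ω => ‖f ω‖ ^ 2) P :=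
  hf.integrable_norm_pow two_ne_zero

theorem CondCentered.add {D D' : Ω → H} (h : CondCentered P m D) (h' : CondCentered P m D') :
    CondCentered P m fun ω => D ω + D' ω where
  memLp := h.memLp.add h'.memLp
  integral_inner y hy hy2 := by
    simp only [inner_add_right]
    rw [integral_add (integrable_inner_of_memLp hy2 h.memLp)
      (integrable_inner_of_memLp hy2 h'.memLp), h.integral_inner y hy hy2,
      h'.integral_inner y hy hy2, add_zero]

theorem CondCentered.const_smul {D : Ω → H} (h : CondCentered P m D) (c : ℝ) :
    CondCentered P m fun ω => c • D ω where
  memLp := h.memLp.const_smul c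
  integral_inner y hy hy2 := by
    simp only [inner_smul_right]
    rw [integral_const_mul, h.integral_inner y hy hy2, mul_zero]

theorem condCentered_zero : CondCentered P m fun _ => (0 : H) :=
  ⟨MemLp.zero, fun y _ _ => by simp⟩

theorem CondCentered.sum {ι : Type*} (s : Finset ι) {D : ι → Ω → H}
    (h : ∀ i ∈ s, CondCentered P m (D i)) : CondCentered P m fun ω => ∑ i ∈ s, D i ω := by
  classical
  induction s using Finset.induction_on with
  | empty => simpa using condCentered_zero
  | insert a s ha ih =>
    simp only [Finset.sum_insert ha]
    exact (h a (by simp)).add (ih fun i hi => h i (Finset.mem_insert_of_mem hi))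

theorem CondCentered.clm [CompleteSpace H] {D : Ω → H} (h : CondCentered P m D) (L : H →L[ℝ] H) :
    CondCentered P m fun ω => L (D ω) where
  memLp := L.comp_memLp' h.memLp
  integral_inner y hy hy2 := by
    simp only [← ContinuousLinearMap.adjoint_inner_left L]
    exact h.integral_inner _ ((L.adjoint).continuous.comp_stronglyMeasurable hy)
      ((L.adjoint).comp_memLp' hy2)

theorem CondCentered.condExp_inner [IsProbabilityMeasure P] (hm : m ≤ m0) {D y : Ω → H}
    (h : CondCentered P m D) (hy : StronglyMeasurable[m] y) (hy2 : MemLp y 2 P) :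
    P[fun ω => inner ℝ (y ω) (D ω) | m] =ᵐ[P] 0 := by
  symm
  refine ae_eq_condExp_of_forall_setIntegral_eq hm (integrable_inner_of_memLp hy2 h.memLp)
    (fun s _ _ => (integrable_zero _ _ _).integrableOn) (fun s hs _ => ?_)
    stronglyMeasurable_zero.aestronglyMeasurable
  simp only [Pi.zero_apply, integral_zero]
  rw [← integral_indicator (hm s hs)]
  have := h.integral_inner (s.indicator y) (hy.indicator hs) (hy2.indicator (hm s hs))
  rw [← this]
  congr 1; ext ω
  by_cases hω : ω ∈ s <;> simp [hω]

/-- Second moment of a conditionally centred sample average: reduction to one observation. -/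
theorem condCentered_sample {O : Type*} [mO : MeasurableSpace O] [IsProbabilityMeasure P]
    [CompleteSpace H]
    {ν : Measure O} [IsProbabilityMeasure ν] {V : Ω → O} (hm : m ≤ m0) (hV : Measurable V)
    (hind : Indep m (MeasurableSpace.comap V mO) P) (hlaw : P.map V = ν)
    {f : Ω × O → H} (hf : StronglyMeasurable[m.prod mO] f) {R : Ω → ℝ} (hR : Integrable R P)
    (hfint : ∀ ω, MemLp (fun w => f (ω, w)) 2 ν) (hfR : ∀ ω, ∫ w, ‖f (ω, w)‖ ^ 2 ∂ν ≤ R ω) :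
    CondCentered P m (fun ω => f (ω, V ω) - ∫ w, f (ω, w) ∂ν) ∧
      ∫ ω, ‖f (ω, V ω) - ∫ w, f (ω, w) ∂ν‖ ^ 2 ∂P ≤ 4 * ∫ ω, R ω ∂P := by
  have hfV : StronglyMeasurable[m0] fun ω => f (ω, V ω) :=
    stronglyMeasurable_prodMk_of_le hm hV hf
  have hmean : StronglyMeasurable[m] fun ω => ∫ w, f (ω, w) ∂ν :=
    @stronglyMeasurable_integral_snd O Ω mO m ν _ H _ _ f hf
  have hsq : ∀ ω, ∫⁻ w, ENNReal.ofReal (‖f (ω, w)‖ ^ 2) ∂ν ≤ ENNReal.ofReal (R ω) := fun ω => by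
    rw [← ofReal_integral_eq_lintegral_ofReal (integrable_norm_sq (hfint ω))
      (Eventually.of_forall fun w => by positivity)]
    exact ENNReal.ofReal_le_ofReal (hfR ω)
  have hfm : Measurable[m.prod mO] fun x => ENNReal.ofReal (‖f x‖ ^ 2) :=
    @measurable_ofReal_norm_sq O Ω mO m H _ f hf
  have hle := lintegral_eq_of_indep hm hV hind hlaw hfm
  have hR0 : ∀ ω, 0 ≤ R ω := fun ω =>
    (integral_nonneg fun w => by positivity).trans (hfR ω)
  have hRl : ∫⁻ ω, ENNReal.ofReal (R ω) ∂P = ENNReal.ofReal (∫ ω, R ω ∂P) :=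
    (ofReal_integral_eq_lintegral_ofReal hR (Eventually.of_forall hR0)).symm
  have hlt : ∫⁻ ω, ENNReal.ofReal (‖f (ω, V ω)‖ ^ 2) ∂P ≤ ENNReal.ofReal (∫ ω, R ω ∂P) := by
    rw [hle, ← hRl]; exact lintegral_mono hsq
  have hint2 : Integrable (fun ω => ‖f (ω, V ω)‖ ^ 2) P := by
    refine ⟨(hfV.norm.pow 2).aestronglyMeasurable, ?_⟩
    rw [hasFiniteIntegral_iff_ofReal (Eventually.of_forall fun ω => by positivity)]
    exact hlt.trans_lt ENNReal.ofReal_lt_top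
  have hL2 : MemLp (fun ω => f (ω, V ω)) 2 P :=
    (memLp_two_iff_integrable_sq_norm hfV.aestronglyMeasurable).2 hint2
  have hfV2 : ∫ ω, ‖f (ω, V ω)‖ ^ 2 ∂P ≤ ∫ ω, R ω ∂P := by
    rw [← ENNReal.ofReal_le_ofReal_iff (integral_nonneg hR0),
      ofReal_integral_eq_lintegral_ofReal hint2 (Eventually.of_forall fun ω => by positivity)]
    exact hlt
  have hmR : ∀ ω, ‖∫ w, f (ω, w) ∂ν‖ ^ 2 ≤ R ω := fun ω => by
    refine le_trans ?_ (hfR ω)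
    have h1 : ‖∫ w, f (ω, w) ∂ν‖ ≤ ∫ w, ‖f (ω, w)‖ ∂ν := norm_integral_le_integral_norm _
    have h2 : (∫ w, ‖f (ω, w)‖ ∂ν) ^ 2 ≤ ∫ w, ‖f (ω, w)‖ ^ 2 ∂ν := by
      have hv := ProbabilityTheory.variance_nonneg (fun w => ‖f (ω, w)‖) ν
      rw [ProbabilityTheory.variance_eq_sub (hfint ω).norm] at hv
      simpa using hv
    exact (pow_le_pow_left₀ (norm_nonneg _) h1 2).trans h2
  have hmean2 : MemLp (fun ω => ∫ w, f (ω, w) ∂ν) 2 P :=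
    (memLp_two_iff_integrable_sq_norm (hmean.mono hm).aestronglyMeasurable).2
      (hR.mono ((hmean.mono hm).norm.pow 2).aestronglyMeasurable
        (Eventually.of_forall fun ω => by
          simp only [norm_pow, norm_norm]
          exact (hmR ω).trans (le_abs_self _)))
  refine ⟨⟨hL2.sub hmean2, fun y hy hy2 => ?_⟩, ?_⟩
  · simp only [inner_sub_right]
    have hi1 := integrable_inner_of_memLp hy2 hL2
    rw [integral_sub hi1 (integrable_inner_of_memLp hy2 hmean2)]
    have hyf : StronglyMeasurable[m.prod mO] fun x : Ω × O => inner ℝ (y x.1) (f x) :=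
      @stronglyMeasurable_inner_fst O Ω mO m H _ _ f hf y hy
    rw [integral_eq_of_indep hm hV hind hlaw (f := fun x => inner ℝ (y x.1) (f x)) hyf hi1,
      sub_eq_zero]
    congr 1; ext ω
    exact integral_inner ((hfint ω).integrable one_le_two) (y ω)
  · calc ∫ ω, ‖f (ω, V ω) - ∫ w, f (ω, w) ∂ν‖ ^ 2 ∂P
        ≤ ∫ ω, (2 * ‖f (ω, V ω)‖ ^ 2 + 2 * R ω) ∂P := by
          refine integral_mono (integrable_norm_sq (hL2.sub hmean2))
            ((hint2.const_mul 2).add (hR.const_mul 2)) fun ω => ?_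
          have h1 := norm_sub_le (f (ω, V ω)) (∫ w, f (ω, w) ∂ν)
          have h2 := hmR ω
          nlinarith [norm_nonneg (f (ω, V ω) - ∫ w, f (ω, w) ∂ν), norm_nonneg (f (ω, V ω)),
            norm_nonneg (∫ w, f (ω, w) ∂ν), sq_nonneg (‖f (ω, V ω)‖ - ‖∫ w, f (ω, w) ∂ν‖)]
      _ ≤ _ := by
          rw [integral_add (hint2.const_mul 2) (hR.const_mul 2), integral_const_mul,
            integral_const_mul]
          linarith

/-- Perturbed contractions with conditionally centred, square summable perturbations stay
bounded. -/
theorem ae_bounded_of_condCentered [IsProbabilityMeasure P] (ℱ : Filtration ℕ m0)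
    {S D : ℕ → Ω → H} {L : ℕ → H →L[ℝ] H} {n : ℕ} (hL : ∀ k, n ≤ k → ∀ x, ‖L k x‖ ≤ ‖x‖)
    (hS : ∀ k, StronglyMeasurable[ℱ k] (S k)) (hS2 : ∀ k, MemLp (S k) 2 P)
    (hrec : ∀ k, n ≤ k → ∀ ω, S (k + 1) ω = L k (S k ω) + D (k + 1) ω)
    (hD : ∀ k, CondCentered P (ℱ k) (D (k + 1)))
    (hsum : Summable fun k => ∫ ω, ‖D k ω‖ ^ 2 ∂P) (hD0 : MemLp (D 0) 2 P) :
    ∀ᵐ ω ∂P, ∃ C, ∀ k, n ≤ k → ‖S k ω‖ ≤ C := by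
  have hDm : ∀ k, MemLp (D k) 2 P := fun k => by cases k with
    | zero => exact hD0
    | succ k => exact (hD k).memLp
  have hLS2 : ∀ k, MemLp (fun ω => L k (S k ω)) 2 P := fun k => (L k).comp_memLp' (hS2 k)
  have hLS : ∀ k, StronglyMeasurable[ℱ k] fun ω => L k (S k ω) := fun k =>
    (L k).continuous.comp_stronglyMeasurable (hS k)
  set X : ℕ → Ω → ℝ := fun l ω => if n ≤ l then 2 * inner ℝ (L l (S l ω)) (D (l + 1) ω) else 0
    with hX
  set M : ℕ → Ω → ℝ := fun k ω => ∑ l ∈ Finset.range k, X l ω with hM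
  have hXint : ∀ l, Integrable (X l) P := fun l => by
    by_cases h : n ≤ l
    · simp only [hX, h, if_true]
      exact (integrable_inner_of_memLp (hLS2 l) (hDm (l + 1))).const_mul 2
    · simp [hX, h]
  have hDmeas : ∀ k, n ≤ k → StronglyMeasurable[ℱ (k + 1)] (D (k + 1)) := fun k hk => by
    have : D (k + 1) = fun ω => S (k + 1) ω - L k (S k ω) := by
      ext ω; rw [hrec k hk ω]; simp
    rw [this]
    exact (hS (k + 1)).sub ((hLS k).mono (ℱ.mono (Nat.le_succ k)))
  have hXmeas : ∀ l, StronglyMeasurable[ℱ (l + 1)] (X l) := fun l => by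
    by_cases h : n ≤ l
    · simp only [hX, h, if_true]
      exact (((hLS l).mono (ℱ.mono (Nat.le_succ l))).inner (hDmeas l h)).const_mul 2
    · simp only [hX, h, if_false]; exact stronglyMeasurable_const
  have hMart : Martingale M ℱ P := by
    refine martingale_of_condExp_sub_eq_zero_nat (fun k => ?_) (fun k => ?_) (fun k => ?_)
    · refine Finset.stronglyMeasurable_fun_sum _ fun l hl => (hXmeas l).mono (ℱ.mono ?_)
      exact Finset.mem_range.1 hl
    · exact integrable_finsetSum _ fun l _ => hXint l
    · have : M (k + 1) - M k = X k := by
        ext ω; simp [hM, Finset.sum_range_succ]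
      rw [this]
      by_cases h : n ≤ k
      · have h1 := (hD k).condExp_inner (ℱ.le k) (hLS k) (hLS2 k)
        have h2 : X k = (2 : ℝ) • fun ω => inner ℝ (L k (S k ω)) (D (k + 1) ω) := by
          ext ω; simp [hX, h]
        rw [h2]
        filter_upwards [condExp_smul (μ := P) (2 : ℝ)
          (fun ω => inner ℝ (L k (S k ω)) (D (k + 1) ω)) (ℱ k), h1] with ω h3 h4
        rw [h3]; simp [h4]
      · have h2 : X k = 0 := by ext ω; simp [hX, h]
        rw [h2, condExp_zero]
  set Q : ℕ → Ω → ℝ := fun k ω => ‖S n ω‖ ^ 2 + ∑ l ∈ Finset.range k, ‖D l ω‖ ^ 2 with hQ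
  have hV : ∀ k, n ≤ k → ∀ ω, ‖S k ω‖ ^ 2 ≤ M k ω + Q (k + 1) ω := by
    intro k hk ω
    induction k, hk using Nat.le_induction with
    | base =>
      have : M n ω = 0 := by
        simp only [hM, hX]
        refine Finset.sum_eq_zero fun l hl => ?_
        simp [not_le.2 (Finset.mem_range.1 hl)]
      have h2 : 0 ≤ ∑ l ∈ Finset.range (n + 1), ‖D l ω‖ ^ 2 :=
        Finset.sum_nonneg fun l _ => by positivity
      simp only [this, hQ]; linarith
    | succ k hk ih =>
      have h1 : M (k + 1) ω = M k ω + 2 * inner ℝ (L k (S k ω)) (D (k + 1) ω) := by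
        simp [hM, Finset.sum_range_succ, hX, hk]
      have h2 : Q (k + 1 + 1) ω = Q (k + 1) ω + ‖D (k + 1) ω‖ ^ 2 := by
        simp only [hQ]; rw [Finset.sum_range_succ _ (k + 1)]; ring
      rw [hrec k hk ω, norm_add_sq_real, h1, h2]
      have h3 := pow_le_pow_left₀ (norm_nonneg _) (hL k hk (S k ω)) 2
      linarith
  have hQint : ∀ k, Integrable (Q k) P := fun k =>
    (integrable_norm_sq (hS2 n)).add (integrable_finsetSum _ fun l _ => integrable_norm_sq (hDm l))
  have hQb : ∀ k, ∫ ω, Q k ω ∂P ≤ ∫ ω, ‖S n ω‖ ^ 2 ∂P + ∑' k, ∫ ω, ‖D k ω‖ ^ 2 ∂P := fun k => by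
    simp only [hQ]
    rw [integral_add (integrable_norm_sq (hS2 n))
      (integrable_finsetSum _ fun l _ => integrable_norm_sq (hDm l)),
      integral_finsetSum _ fun l _ => integrable_norm_sq (hDm l)]
    gcongr
    exact hsum.sum_le_tsum _ fun l _ => integral_nonneg fun ω => by positivity
  have hM0 : ∀ k, ∫ ω, M k ω ∂P = 0 := fun k => by
    have h1 := hMart.setIntegral_eq (Nat.zero_le k) (s := Set.univ) MeasurableSet.univ
    simp only [setIntegral_univ] at h1
    rw [← h1]; simp [hM]
  have hML : ∀ k, n ≤ k → ∫ ω, ‖M k ω‖ ∂P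
      ≤ 2 * (∫ ω, ‖S n ω‖ ^ 2 ∂P + ∑' k, ∫ ω, ‖D k ω‖ ^ 2 ∂P) := fun k hk => by
    calc ∫ ω, ‖M k ω‖ ∂P ≤ ∫ ω, (M k ω + 2 * Q (k + 1) ω) ∂P := by
          refine integral_mono (hMart.integrable k).norm
            ((hMart.integrable k).add ((hQint (k + 1)).const_mul 2)) fun ω => ?_
          have h1 := hV k hk ω
          have h2 : 0 ≤ Q (k + 1) ω := add_nonneg (by positivity)
            (Finset.sum_nonneg fun l _ => by positivity)
          have h3 : 0 ≤ ‖S k ω‖ ^ 2 := by positivity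
          rw [Real.norm_eq_abs]
          rcases abs_cases (M k ω) with ⟨h, _⟩ | ⟨h, _⟩ <;> rw [h] <;> linarith
      _ = 2 * ∫ ω, Q (k + 1) ω ∂P := by
          rw [integral_add (hMart.integrable k) ((hQint (k + 1)).const_mul 2), hM0 k,
            integral_const_mul, zero_add]
      _ ≤ _ := by gcongr; exact hQb _
  have hMb : ∃ R : NNReal, ∀ k, eLpNorm (M k) 1 P ≤ R := by
    set R1 := 2 * (∫ ω, ‖S n ω‖ ^ 2 ∂P + ∑' k, ∫ ω, ‖D k ω‖ ^ 2 ∂P)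
    set R2 := R1 + ∑ k ∈ Finset.range n, ∫ ω, ‖M k ω‖ ∂P
    have hR1 : 0 ≤ R1 := le_trans (integral_nonneg fun ω => norm_nonneg _) (hML n le_rfl)
    have hs : ∀ k ∈ Finset.range n, 0 ≤ ∫ ω, ‖M k ω‖ ∂P := fun k _ =>
      integral_nonneg fun ω => norm_nonneg _
    refine ⟨R2.toNNReal, fun k => ?_⟩
    rw [eLpNorm_one_eq_lintegral_enorm, ← ofReal_integral_norm_eq_lintegral_enorm
      (hMart.integrable k)]
    refine ENNReal.ofReal_le_ofReal ?_
    rcases le_or_gt n k with h | h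
    · exact (hML k h).trans (le_add_of_nonneg_right (Finset.sum_nonneg hs))
    · exact (Finset.single_le_sum hs (Finset.mem_range.2 h)).trans (le_add_of_nonneg_left hR1)
  obtain ⟨R, hR⟩ := hMb
  have hconv := hMart.submartingale.exists_ae_tendsto_of_bdd hR
  have hsumm := ae_summable_of_summable_integral (X := fun k ω => ‖D k ω‖ ^ 2)
    (fun k ω => by positivity) (fun k => integrable_norm_sq (hDm k)) hsum
  filter_upwards [hconv, hsumm] with ω ⟨c, hc⟩ hs
  obtain ⟨b, hb⟩ := hc.bddAbove_range
  set C := b + (‖S n ω‖ ^ 2 + ∑' k, ‖D k ω‖ ^ 2)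
  refine ⟨√C, fun k hk => Real.le_sqrt_of_sq_le ?_⟩
  refine (hV k hk ω).trans (add_le_add (hb ⟨k, rfl⟩) ?_)
  simp only [hQ]
  gcongr
  exact hs.sum_le_tsum _ fun l _ => by positivity

end Centered

/-- One step of the exponential moment induction. -/
theorem lintegral_exp_step {Ω O : Type*} {m m0 : MeasurableSpace Ω} [mO : MeasurableSpace O]
    {P : Measure Ω} [IsProbabilityMeasure P] {ν : Measure O} [IsProbabilityMeasure ν]
    {B : ℕ} (hB : 1 ≤ B) {V : Fin B → Ω → O} (hm : m ≤ m0) (hV : ∀ i, Measurable (V i))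
    (hind : ∀ i, Indep m (MeasurableSpace.comap (V i) mO) P) (hlaw : ∀ i, P.map (V i) = ν)
    {X : Ω → ℝ} (hX : Measurable[m] X) {f : O → ℝ} (hf : Measurable f) (hf1 : ∀ w, |f w| ≤ 1)
    (hf0 : ∫ w, f w ∂ν = 0) {v : ℝ} (hfv : ∫ w, f w ^ 2 ∂ν ≤ v) :
    ∫⁻ ω, ENNReal.ofReal (Real.exp (X ω + (B : ℝ)⁻¹ * ∑ i, f (V i ω))) ∂P
      ≤ ENNReal.ofReal (Real.exp v) * ∫⁻ ω, ENNReal.ofReal (Real.exp (X ω)) ∂P := by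
  have hB0 : (0 : ℝ) < B := by exact_mod_cast hB
  have hfint : Integrable f ν := Integrable.of_bound hf.aestronglyMeasurable 1
    (Eventually.of_forall hf1)
  have hf2int : Integrable (fun w => f w ^ 2) ν :=
    Integrable.of_bound (hf.pow_const 2).aestronglyMeasurable 1
      (Eventually.of_forall fun w => by
        rw [Real.norm_eq_abs, abs_pow]; exact pow_le_one₀ (abs_nonneg _) (hf1 w))
  have h3int : Integrable (fun w => 1 + f w + f w ^ 2) ν :=
    ((integrable_const 1).add hfint).add hf2int
  have hexp : ∫⁻ w, ENNReal.ofReal (Real.exp (f w)) ∂ν ≤ ENNReal.ofReal (Real.exp v) := by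
    calc ∫⁻ w, ENNReal.ofReal (Real.exp (f w)) ∂ν
        ≤ ∫⁻ w, ENNReal.ofReal (1 + f w + f w ^ 2) ∂ν := by
          refine lintegral_mono fun w => ENNReal.ofReal_le_ofReal ?_
          have := Real.abs_exp_sub_one_sub_id_le (hf1 w)
          linarith [le_abs_self (Real.exp (f w) - 1 - f w)]
      _ = ENNReal.ofReal (∫ w, (1 + f w + f w ^ 2) ∂ν) := by
          rw [ofReal_integral_eq_lintegral_ofReal h3int (Eventually.of_forall fun w => ?_)]
          have := hf1 w
          simp only [Pi.zero_apply]
          nlinarith [abs_le.1 this, sq_nonneg (f w)]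
      _ ≤ _ := by
          refine ENNReal.ofReal_le_ofReal ?_
          rw [integral_add (f := fun w => 1 + f w) ((integrable_const 1).add hfint) hf2int,
            integral_add (integrable_const 1) hfint, hf0]
          simp only [integral_const, probReal_univ, smul_eq_mul, mul_one, add_zero]
          linarith [Real.add_one_le_exp v]
  have hexp1 : ∀ i, ∫⁻ ω, ENNReal.ofReal (Real.exp (X ω)) * ENNReal.ofReal (Real.exp (f (V i ω))) ∂P
      ≤ ENNReal.ofReal (Real.exp v) * ∫⁻ ω, ENNReal.ofReal (Real.exp (X ω)) ∂P := fun i => by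
    have hV' : Measurable[MeasurableSpace.comap (V i) mO]
        fun ω => ENNReal.ofReal (Real.exp (f (V i ω))) :=
      (ENNReal.measurable_ofReal.comp (Real.measurable_exp.comp hf)).comp
        (comap_measurable (V i))
    have hX' : Measurable[m] fun ω => ENNReal.ofReal (Real.exp (X ω)) :=
      ENNReal.measurable_ofReal.comp (Real.measurable_exp.comp hX)
    rw [lintegral_mul_eq_lintegral_mul_lintegral_of_independent_measurableSpace hm
      ((hV i).comap_le) (hind i) hX' hV', mul_comm]
    gcongr
    have : ∫⁻ ω, ENNReal.ofReal (Real.exp (f (V i ω))) ∂P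
        = ∫⁻ w, ENNReal.ofReal (Real.exp (f w)) ∂ν := by
      rw [← hlaw i, lintegral_map hf.exp.ennreal_ofReal (hV i)]
    rw [this]; exact hexp
  have hJ : ∀ ω, Real.exp (X ω + (B : ℝ)⁻¹ * ∑ i, f (V i ω))
      ≤ (B : ℝ)⁻¹ * ∑ i, Real.exp (X ω) * Real.exp (f (V i ω)) := fun ω => by
    rw [Real.exp_add, ← Finset.mul_sum, mul_left_comm]
    refine mul_le_mul_of_nonneg_left ?_ (Real.exp_pos _).le
    have := convexOn_exp.map_sum_le (t := Finset.univ) (w := fun _ : Fin B => (B : ℝ)⁻¹)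
      (p := fun i => f (V i ω)) (fun i _ => by positivity) (by simp [hB0.ne'])
      (fun i _ => Set.mem_univ _)
    simpa [← Finset.mul_sum] using this
  calc _ ≤ ∫⁻ ω, ENNReal.ofReal ((B : ℝ)⁻¹ * ∑ i, Real.exp (X ω) * Real.exp (f (V i ω))) ∂P :=
        lintegral_mono fun ω => ENNReal.ofReal_le_ofReal (hJ ω)
    _ = ENNReal.ofReal ((B : ℝ)⁻¹) * ∑ i, ∫⁻ ω, ENNReal.ofReal (Real.exp (X ω)) *
          ENNReal.ofReal (Real.exp (f (V i ω))) ∂P := by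
        have hmeas : ∀ i, Measurable fun ω => ENNReal.ofReal (Real.exp (X ω)) *
            ENNReal.ofReal (Real.exp (f (V i ω))) := fun i =>
          ((ENNReal.measurable_ofReal.comp (Real.measurable_exp.comp (hX.mono hm le_rfl)))).mul
            (ENNReal.measurable_ofReal.comp (Real.measurable_exp.comp (hf.comp (hV i))))
        rw [← lintegral_finsetSum _ fun i _ => hmeas i, ← lintegral_const_mul _
          (Finset.measurable_fun_sum _ fun i _ => hmeas i)]
        congr 1; ext ω
        rw [ENNReal.ofReal_mul (by positivity), ENNReal.ofReal_sum_of_nonneg fun i _ => by positivity]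
        congr 1
        refine Finset.sum_congr rfl fun i _ => ?_
        rw [ENNReal.ofReal_mul (Real.exp_pos _).le]
    _ ≤ ENNReal.ofReal ((B : ℝ)⁻¹) * ∑ _i : Fin B, ENNReal.ofReal (Real.exp v) *
          ∫⁻ ω, ENNReal.ofReal (Real.exp (X ω)) ∂P := by
        gcongr with i _; exact hexp1 i
    _ = _ := by
        rw [Finset.sum_const, Finset.card_univ, Fintype.card_fin, nsmul_eq_mul, ← mul_assoc,
          ENNReal.ofReal_inv_of_pos hB0, ENNReal.ofReal_natCast,
          ENNReal.inv_mul_cancel (by exact_mod_cast (by omega : B ≠ 0)) (ENNReal.natCast_ne_top B),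
          one_mul]

end

section

/-! ### Embedding of the coefficient vectors in one Hilbert space -/

section Embedding

variable {H : Type*} [NormedAddCommGroup H] [InnerProductSpace ℝ H] {e : ℕ → H}

/-- The coefficient vector `a` as an element of `H`, along the orthonormal sequence `e`. -/
def emb (e : ℕ → H) (J : ℕ) : (Fin J → ℝ) →ₗ[ℝ] H :=
  Fintype.linearCombination ℝ fun i : Fin J => e i

/-- The first `J` coordinates. -/
def coord (e : ℕ → H) (J : ℕ) : H →ₗ[ℝ] (Fin J → ℝ) :=
  LinearMap.pi fun i => (innerₛₗ ℝ (e i))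

theorem emb_apply (J : ℕ) (a : Fin J → ℝ) : emb e J a = ∑ i, a i • e i := rfl

@[simp] theorem coord_apply (J : ℕ) (x : H) (i : Fin J) : coord e J x i = inner ℝ (e i) x := rfl

theorem inner_e_emb (he : Orthonormal ℝ e) {J : ℕ} (a : Fin J → ℝ) (l : ℕ) :
    inner ℝ (e l) (emb e J a) = if h : l < J then a ⟨l, h⟩ else 0 := by
  rw [emb_apply, inner_sum]
  simp only [inner_smul_right, orthonormal_iff_ite.1 he]
  split_ifs with h
  · rw [Finset.sum_eq_single ⟨l, h⟩]
    · simp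
    · intro i _ hi
      have : l ≠ i := fun h' => hi (by ext; exact h'.symm)
      simp [this]
    · simp
  · refine Finset.sum_eq_zero fun i _ => ?_
    have : l ≠ i := fun h' => h (h' ▸ i.2)
    simp [this]

@[simp] theorem coord_emb (he : Orthonormal ℝ e) {J : ℕ} (a : Fin J → ℝ) :
    coord e J (emb e J a) = a := by
  ext i; simp [inner_e_emb he]

theorem inner_emb_left {J : ℕ} (a : Fin J → ℝ) (x : H) :
    inner ℝ (emb e J a) x = a ⬝ᵥ coord e J x := by
  rw [emb_apply, sum_inner]
  simp [inner_smul_left, dotProduct]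

theorem inner_emb_emb (he : Orthonormal ℝ e) {J : ℕ} (a b : Fin J → ℝ) :
    inner ℝ (emb e J a) (emb e J b) = a ⬝ᵥ b := by
  rw [inner_emb_left, coord_emb he]

theorem norm_emb_sq (he : Orthonormal ℝ e) {J : ℕ} (a : Fin J → ℝ) :
    ‖emb e J a‖ ^ 2 = ∑ i, a i ^ 2 := by
  rw [← real_inner_self_eq_norm_sq, inner_emb_emb he]
  simp [dotProduct, sq]

theorem norm_emb (he : Orthonormal ℝ e) {J : ℕ} (a : Fin J → ℝ) :
    ‖emb e J a‖ = ‖WithLp.toLp 2 a‖ := by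
  refine (sq_eq_sq₀ (norm_nonneg _) (norm_nonneg _)).1 ?_
  rw [norm_emb_sq he, EuclideanSpace.norm_sq_eq]
  exact Finset.sum_congr rfl fun i _ => (sq_abs (a i)).symm

theorem emb_pad {m n : ℕ} (hmn : m ≤ n) (a : Fin m → ℝ) : emb e n (pad n a) = emb e m a := by
  rw [emb_apply, emb_apply]
  set g : ℕ → H := fun l => if h : l < m then a ⟨l, h⟩ • e l else 0 with hg
  have h : ∀ i : Fin n, pad n a i • e i = g i := fun i => by
    simp only [pad, hg]; split_ifs <;> simp only [zero_smul]
  have h' : ∀ i : Fin m, a i • e i = g i := fun i => by simp [hg]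
  rw [Finset.sum_congr rfl fun i _ => h i, Finset.sum_congr rfl fun i _ => h' i,
    Fin.sum_univ_eq_sum_range g, Fin.sum_univ_eq_sum_range g]
  refine (Finset.sum_subset (Finset.range_mono hmn) fun l _ hl => ?_).symm
  rw [Finset.mem_range] at hl
  simp [hg, hl]

theorem sum_coord_sq_le (he : Orthonormal ℝ e) (J : ℕ) (x : H) :
    ∑ i, coord e J x i ^ 2 ≤ ‖x‖ ^ 2 := by
  have := he.sum_inner_products_le x (s := Finset.range J)
  rw [← Fin.sum_univ_eq_sum_range (fun i => ‖(inner ℝ (e i) x : ℝ)‖ ^ 2)] at this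
  simpa using this

theorem norm_emb_coord_le (he : Orthonormal ℝ e) (J : ℕ) (x : H) :
    ‖emb e J (coord e J x)‖ ≤ ‖x‖ := by
  refine le_of_sq_le_sq ?_ (norm_nonneg x)
  rw [norm_emb_sq he]; exact sum_coord_sq_le he J x

/-- The space spanned by the first `J` basis vectors. -/
def sieveSub (e : ℕ → H) (J : ℕ) : Submodule ℝ H := LinearMap.range (emb e J)

theorem emb_mem (J : ℕ) (a : Fin J → ℝ) : emb e J a ∈ sieveSub e J := ⟨a, rfl⟩

theorem sieveSub_mono {m n : ℕ} (hmn : m ≤ n) : sieveSub e m ≤ sieveSub e n := by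
  rintro _ ⟨a, rfl⟩
  exact ⟨pad n a, emb_pad hmn a⟩

theorem emb_coord_of_mem (he : Orthonormal ℝ e) {J : ℕ} {x : H} (hx : x ∈ sieveSub e J) :
    emb e J (coord e J x) = x := by
  obtain ⟨a, rfl⟩ := hx
  rw [coord_emb he]

theorem norm_sq_eq_sum_of_mem (he : Orthonormal ℝ e) {J : ℕ} {x : H} (hx : x ∈ sieveSub e J) :
    ‖x‖ ^ 2 = ∑ i : Fin J, (inner ℝ (e i) x : ℝ) ^ 2 := by
  conv_lhs => rw [← emb_coord_of_mem he hx, norm_emb_sq he]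
  rfl

/-- The operator acting as the matrix `M` on the first `J` coordinates and as the identity on the
orthogonal complement. -/
def extOp (e : ℕ → H) {J : ℕ} (M : Matrix (Fin J) (Fin J) ℝ) : H →L[ℝ] H :=
  ContinuousLinearMap.id ℝ H
    + ∑ i : Fin J, (∑ l : Fin J, (M i l - if i = l then 1 else 0) • innerSL ℝ (e l)).smulRight (e i)

theorem extOp_apply {J : ℕ} (M : Matrix (Fin J) (Fin J) ℝ) (x : H) :
    extOp e M x = x - emb e J (coord e J x) + emb e J (M *ᵥ coord e J x) := by
  have h : ∀ i : Fin J, (∑ l : Fin J, (M i l - if i = l then 1 else 0) • innerSL ℝ (e l)) x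
      = (M *ᵥ coord e J x) i - coord e J x i := fun i => by
    simp [Matrix.mulVec, dotProduct, sub_mul, Finset.sum_sub_distrib, ite_mul, sum_apply]
  have h' : extOp e M x = x + ∑ i : Fin J, ((M *ᵥ coord e J x) i - coord e J x i) • e i := by
    rw [extOp, add_apply, ContinuousLinearMap.id_apply, sum_apply]
    exact congrArg (x + ·) (Finset.sum_congr rfl fun i _ => congrArg (· • e i) (h i))
  rw [h', emb_apply, emb_apply]
  simp only [sub_smul, Finset.sum_sub_distrib]
  abel

theorem coord_extOp (he : Orthonormal ℝ e) {J : ℕ} (M : Matrix (Fin J) (Fin J) ℝ) (x : H) :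
    coord e J (extOp e M x) = M *ᵥ coord e J x := by
  rw [extOp_apply, map_add, map_sub, coord_emb he, coord_emb he, sub_self, zero_add]

theorem extOp_extOp (he : Orthonormal ℝ e) {J : ℕ} (M M' : Matrix (Fin J) (Fin J) ℝ) (x : H) :
    extOp e M (extOp e M' x) = extOp e (M * M') x := by
  rw [extOp_apply M, coord_extOp he, extOp_apply M', extOp_apply (M * M'), Matrix.mulVec_mulVec]
  abel

theorem extOp_one {J : ℕ} (x : H) : extOp e (1 : Matrix (Fin J) (Fin J) ℝ) x = x := by
  rw [extOp_apply]; simp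

theorem extOp_emb (he : Orthonormal ℝ e) {J : ℕ} (M : Matrix (Fin J) (Fin J) ℝ) (a : Fin J → ℝ) :
    extOp e M (emb e J a) = emb e J (M *ᵥ a) := by
  rw [extOp_apply, coord_emb he]; simp

theorem extOp_mem (he : Orthonormal ℝ e) {J : ℕ} (M : Matrix (Fin J) (Fin J) ℝ) {x : H}
    (hx : x ∈ sieveSub e J) : extOp e M x ∈ sieveSub e J := by
  obtain ⟨a, rfl⟩ := hx
  rw [extOp_emb he]; exact emb_mem _ _

theorem inner_extOp_self (he : Orthonormal ℝ e) {J : ℕ} (M : Matrix (Fin J) (Fin J) ℝ) (x : H) :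
    inner ℝ (extOp e M x) x = ‖x‖ ^ 2 - ‖emb e J (coord e J x)‖ ^ 2
      + (M *ᵥ coord e J x) ⬝ᵥ coord e J x := by
  rw [extOp_apply, inner_add_left, inner_sub_left, inner_emb_left, inner_emb_left,
    real_inner_self_eq_norm_sq, norm_emb_sq he]
  simp [dotProduct, sq]

theorem inner_extOp_comm {J : ℕ} {M : Matrix (Fin J) (Fin J) ℝ} (hM : Mᵀ = M) (x y : H) :
    inner ℝ (extOp e M x) y = inner ℝ x (extOp e M y) := by
  rw [extOp_apply, extOp_apply, inner_add_left, inner_sub_left, inner_add_right, inner_sub_right,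
    inner_emb_left, inner_emb_left, real_inner_comm (emb e J (coord e J y)) x,
    real_inner_comm (emb e J (M *ᵥ coord e J y)) x, inner_emb_left,
    inner_emb_left, dotProduct_comm (coord e J y), dotProduct_comm (M *ᵥ coord e J y),
    Matrix.dotProduct_mulVec, ← Matrix.mulVec_transpose, hM]

end Embedding

/-! ### Elementary facts about the supremum norm and square integrable functions -/

theorem enorm_le_supNorm (f : ℝ → ℝ) (z : ℝ) : ‖f z‖ₑ ≤ supNorm f := by
  unfold supNorm supNormOn
  exact le_iSup₂_of_le z (Set.mem_univ z) le_rfl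

theorem abs_le_of_supNorm_le {f : ℝ → ℝ} {C : ℝ} (hC : 0 ≤ C)
    (h : supNorm f ≤ ENNReal.ofReal C) (z : ℝ) : |f z| ≤ C := by
  have := (enorm_le_supNorm f z).trans h
  rw [← ofReal_norm, ENNReal.ofReal_le_ofReal_iff hC] at this
  exact this

theorem supNorm_le_iff {f : ℝ → ℝ} {C : ℝ} (hC : 0 ≤ C) :
    supNorm f ≤ ENNReal.ofReal C ↔ ∀ z, |f z| ≤ C := by
  refine ⟨fun h => abs_le_of_supNorm_le hC h, fun h => ?_⟩
  unfold supNorm supNormOn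
  refine iSup₂_le fun z _ => ?_
  rw [← ofReal_norm]
  exact ENNReal.ofReal_le_ofReal (h z)

theorem exists_bound_of_supNorm_lt_top {f : ℝ → ℝ} (h : supNorm f < ⊤) :
    ∃ C, 0 ≤ C ∧ ∀ z, |f z| ≤ C :=
  ⟨(supNorm f).toReal, ENNReal.toReal_nonneg,
    (supNorm_le_iff ENNReal.toReal_nonneg).1 (ENNReal.ofReal_toReal h.ne).ge⟩

theorem abs_sub_le_of_deriv_le {f : ℝ → ℝ} (hf : Differentiable ℝ f) {C : ℝ}
    (h : ∀ z, |deriv f z| ≤ C) (x y : ℝ) : |f x - f y| ≤ C * |x - y| :=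
  Convex.norm_image_sub_le_of_norm_deriv_le (s := Set.univ) (fun z _ => hf z) (fun z _ => h z)
    convex_univ (Set.mem_univ y) (Set.mem_univ x)

section L2

variable {O : Type*} [MeasurableSpace O] {ν : Measure O}

theorem integrable_mul_of_memLp {f g : O → ℝ} (hf : MemLp f 2 ν) (hg : MemLp g 2 ν) :
    Integrable (fun w => f w * g w) ν := hf.integrable_mul hg

theorem sq_integral_mul_le {f g : O → ℝ} (hf : MemLp f 2 ν) (hg : MemLp g 2 ν) :
    (∫ w, f w * g w ∂ν) ^ 2 ≤ (∫ w, f w ^ 2 ∂ν) * ∫ w, g w ^ 2 ∂ν := by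
  have h : ∀ t : ℝ, 0 ≤ (∫ w, g w ^ 2 ∂ν) * (t * t) + (-2 * ∫ w, f w * g w ∂ν) * t
      + ∫ w, f w ^ 2 ∂ν := fun t => by
    have h1 : 0 ≤ ∫ w, (f w - t * g w) ^ 2 ∂ν := integral_nonneg fun w => sq_nonneg _
    have h2 : ∀ w, (f w - t * g w) ^ 2 = f w ^ 2 + (-2 * t) * (f w * g w) + t ^ 2 * g w ^ 2 :=
      fun w => by ring
    simp_rw [h2] at h1
    rw [integral_add (f := fun w => f w ^ 2 + (-2 * t) * (f w * g w))
      (hf.integrable_sq.add ((integrable_mul_of_memLp hf hg).const_mul _))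
      (hg.integrable_sq.const_mul _), integral_add hf.integrable_sq
      ((integrable_mul_of_memLp hf hg).const_mul _), integral_const_mul, integral_const_mul] at h1
    nlinarith
  have := discrim_le_zero h
  rw [discrim] at this
  nlinarith

theorem abs_integral_mul_le {f g : O → ℝ} (hf : MemLp f 2 ν) (hg : MemLp g 2 ν) {A B : ℝ}
    (hA : 0 ≤ A) (hB : 0 ≤ B) (hfA : ∫ w, f w ^ 2 ∂ν ≤ A ^ 2) (hgB : ∫ w, g w ^ 2 ∂ν ≤ B ^ 2) :
    |∫ w, f w * g w ∂ν| ≤ A * B := by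
  refine abs_le_of_sq_le_sq ?_ (by positivity)
  rw [mul_pow]
  exact (sq_integral_mul_le hf hg).trans (mul_le_mul hfA hgB
    (integral_nonneg fun w => sq_nonneg _) (by positivity))

variable {H : Type*} [NormedAddCommGroup H] [InnerProductSpace ℝ H] [CompleteSpace H]

omit [CompleteSpace H] in
theorem integrable_smul_of_memLp {f : O → ℝ} {Φ : O → H} (hf : MemLp f 2 ν) (hΦ : MemLp Φ 2 ν) :
    Integrable (fun w => f w • Φ w) ν := by
  refine (hf.norm.integrable_mul hΦ.norm).mono (hf.1.smul hΦ.1) (Eventually.of_forall fun w => ?_)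
  simp [norm_smul]

/-- Bessel's inequality. -/
theorem norm_integral_smul_le {f : O → ℝ} {Φ : O → H} (hf : MemLp f 2 ν) (hΦ : MemLp Φ 2 ν)
    {A K : ℝ} (hA : 0 ≤ A) (hK : 0 ≤ K) (hfA : ∫ w, f w ^ 2 ∂ν ≤ A ^ 2)
    (hΦK : ∀ v : H, ∫ w, (inner ℝ (Φ w) v : ℝ) ^ 2 ∂ν ≤ (K * ‖v‖) ^ 2) :
    ‖∫ w, f w • Φ w ∂ν‖ ≤ A * K := by
  set u := ∫ w, f w • Φ w ∂ν with hu
  have h1 : ‖u‖ ^ 2 = ∫ w, f w * inner ℝ (Φ w) u ∂ν := by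
    rw [← real_inner_self_eq_norm_sq]
    nth_rewrite 2 [hu]
    rw [← integral_inner (integrable_smul_of_memLp hf hΦ)]
    simp only [inner_smul_right, real_inner_comm u]
  have h2 := abs_integral_mul_le hf (hΦ.inner_const (𝕜 := ℝ) u) hA
    (by positivity : 0 ≤ K * ‖u‖) hfA (hΦK u)
  rw [← h1, abs_of_nonneg (by positivity)] at h2
  by_contra hlt
  push Not at hlt
  have hu0 : 0 < ‖u‖ := lt_of_le_of_lt (by positivity) hlt
  nlinarith

end L2

end

section

/-! ### Quantitative consequences of the model assumptions -/

theorem measurable_index {p : ℕ} (θ : EuclideanSpace ℝ (Fin p)) :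
    Measurable (index θ : Obs p → ℝ) := by
  unfold index
  exact measurable_fst.add ((measurable_fst.comp measurable_snd).inner_const)

theorem measurable_index_prod {p : ℕ} :
    Measurable (fun x : EuclideanSpace ℝ (Fin p) × Obs p => index x.1 x.2) := by
  unfold index
  have h1 : Measurable fun x : EuclideanSpace ℝ (Fin p) × Obs p => x.2.2.1 :=
    measurable_fst.comp (measurable_snd.comp measurable_snd)
  exact (measurable_fst.comp measurable_snd).add (h1.inner measurable_fst)

theorem measurable_noise {p : ℕ} (θ₀ : EuclideanSpace ℝ (Fin p)) {F₀ : ℝ → ℝ}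
    (hF₀ : Measurable F₀) : Measurable (noise θ₀ F₀) := by
  unfold noise
  exact (measurable_snd.comp measurable_snd).sub (hF₀.comp (measurable_index θ₀))

theorem index_sub_index {p : ℕ} (θ θ' : EuclideanSpace ℝ (Fin p)) (w : Obs p) :
    index θ w - index θ' w = inner ℝ w.2.1 (θ - θ') := by
  simp [index, inner_sub_right]

theorem abs_index_sub_le {p : ℕ} (θ θ' : EuclideanSpace ℝ (Fin p)) (w : Obs p) :
    |index θ w - index θ' w| ≤ ‖w.2.1‖ * ‖θ - θ'‖ := by
  rw [index_sub_index]; exact abs_real_inner_le_norm _ _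

/-- Quantitative regularity of the model and of the sieve, with one constant `K`. -/
structure Regular {p : ℕ} (ν : Measure (Obs p)) (θ₀ : EuclideanSpace ℝ (Fin p)) (F₀ : ℝ → ℝ)
    (ψ : ℕ → ℝ → ℝ) (αψ s s₁ κ K : ℝ) : Prop where
  one_le : 1 ≤ K
  basis_continuous : ∀ j, 1 ≤ j → Continuous (ψ j)
  basis_bound : ∀ j, 1 ≤ j → ∀ z, |ψ j z| ≤ K
  basis_lip : ∀ j : ℕ, 1 ≤ j → ∀ z z', |ψ j z - ψ j z'| ≤ K * (j : ℝ) ^ αψ * |z - z'|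
  gram_lower : ∀ J, 1 ≤ J → ∀ a : Fin J → ℝ, a ⬝ᵥ a ≤ K * ((gram ν θ₀ ψ J *ᵥ a) ⬝ᵥ a)
  gram_upper : ∀ J, 1 ≤ J → ∀ a : Fin J → ℝ, (gram ν θ₀ ψ J *ᵥ a) ⬝ᵥ a ≤ K * (a ⬝ᵥ a)
  link_bound : ∀ z, |F₀ z| ≤ K
  link_differentiable : Differentiable ℝ F₀
  link_deriv_continuous : Continuous (deriv F₀)
  link_deriv_bound : ∀ z, |deriv F₀ z| ≤ K
  link_taylor : ∀ z z', |F₀ z' - F₀ z - deriv F₀ z * (z' - z)| ≤ K * |z' - z| ^ 2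
  approx : ∀ J : ℕ, 1 ≤ J → ∃ b : Fin J → ℝ, ∀ z,
    |F₀ z - sieveVec ψ J z ⬝ᵥ b| ≤ K * (J : ℝ) ^ (-s)
  approx_lip : ∀ J : ℕ, 1 ≤ J → ∀ z z', |(F₀ z - proj ν θ₀ ψ J F₀ z)
    - (F₀ z' - proj ν θ₀ ψ J F₀ z')| ≤ K * (J : ℝ) ^ (-s₁) * |z - z'|
  noise_memLp : MemLp (noise θ₀ F₀) 4 ν
  regressor_memLp : MemLp (fun w : Obs p => w.2.1) 4 ν
  regressor_sq : ∫ w, ‖w.2.1‖ ^ 2 ∂ν ≤ K ^ 2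
  regressor_four : ∫ w, (‖w.2.1‖ ^ 2) ^ 2 ∂ν ≤ K ^ 2
  noise_regressor_sq : ∫ w, (noise θ₀ F₀ w * ‖w.2.1‖) ^ 2 ∂ν ≤ K ^ 2
  noise_orth : ∀ f : Obs p → ℝ,
    StronglyMeasurable[MeasurableSpace.comap (fun w : Obs p => (w.1, w.2.1)) inferInstance] f →
    MemLp f 2 ν → ∫ w, f w * noise θ₀ F₀ w ∂ν = 0
  noise_condVar : ∀ g : ℝ → ℝ, Measurable g → (∃ C, ∀ z, |g z| ≤ C) →
    ∫ w, (noise θ₀ F₀ w * g (index θ₀ w)) ^ 2 ∂ν ≤ K ^ 2 * ∫ w, g (index θ₀ w) ^ 2 ∂ν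
  noise_tail : ∀ T : ℝ, 0 < T →
    ∫ w, (if |noise θ₀ F₀ w| ≤ T then 0 else noise θ₀ F₀ w) ^ 2 ∂ν ≤ K * T ^ (2 - κ)

theorem Regular.pos {p : ℕ} {ν : Measure (Obs p)} {θ₀ : EuclideanSpace ℝ (Fin p)} {F₀ : ℝ → ℝ}
    {ψ : ℕ → ℝ → ℝ} {αψ s s₁ κ K : ℝ} (h : Regular ν θ₀ F₀ ψ αψ s s₁ κ K) : 0 < K :=
  one_pos.trans_le h.one_le

section Gram

variable {p : ℕ} {ν : Measure (Obs p)} {θ₀ : EuclideanSpace ℝ (Fin p)}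
  {ψ : ℕ → ℝ → ℝ}

theorem gram_transpose (J : ℕ) : (gram ν θ₀ ψ J)ᵀ = gram ν θ₀ ψ J := by
  ext i j
  simp only [gram, Matrix.transpose_apply, Matrix.of_apply, mul_comm]

theorem gram_quadratic_bounds {J : ℕ} {c C : ℝ} (h : ∀ l ∈ spectrum ℝ (gram ν θ₀ ψ J), c ≤ l ∧ l ≤ C)
    (a : Fin J → ℝ) : c * (a ⬝ᵥ a) ≤ (gram ν θ₀ ψ J *ᵥ a) ⬝ᵥ a ∧
      (gram ν θ₀ ψ J *ᵥ a) ⬝ᵥ a ≤ C * (a ⬝ᵥ a) := by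
  set Γ := gram ν θ₀ ψ J
  have hΓ : Γ.IsHermitian := by
    rw [Matrix.IsHermitian, Matrix.conjTranspose_eq_transpose_of_trivial]; exact gram_transpose J
  have hsc : ∀ t : ℝ, (algebraMap ℝ (Matrix (Fin J) (Fin J) ℝ) t).IsHermitian := fun t => by
    rw [Matrix.IsHermitian, Matrix.algebraMap_eq_diagonal, Matrix.diagonal_conjTranspose]
    simp
  have hmul : ∀ t : ℝ, algebraMap ℝ (Matrix (Fin J) (Fin J) ℝ) t *ᵥ a = t • a := fun t => by
    rw [Algebra.algebraMap_eq_smul_one, Matrix.smul_mulVec, Matrix.one_mulVec]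
  constructor
  · have : (Γ - algebraMap ℝ _ c).PosSemidef := by
      rw [Matrix.posSemidef_iff_isHermitian_and_spectrum_nonneg]
      refine ⟨hΓ.sub (hsc c), fun l hl => ?_⟩
      have h1 : l + c ∈ spectrum ℝ Γ := by
        rw [spectrum.add_mem_iff, ← sub_eq_neg_add] ; exact hl
      have := (h _ h1).1
      simp only [Set.mem_ofPred_eq]; linarith
    have h2 := this.dotProduct_mulVec_nonneg a
    rw [Matrix.sub_mulVec, hmul, dotProduct_sub, dotProduct_smul] at h2
    simp only [star_trivial, smul_eq_mul] at h2
    rw [dotProduct_comm (Γ *ᵥ a)]; linarith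
  · have : (algebraMap ℝ _ C - Γ).PosSemidef := by
      rw [Matrix.posSemidef_iff_isHermitian_and_spectrum_nonneg]
      refine ⟨(hsc C).sub hΓ, fun l hl => ?_⟩
      have h1 : C - l ∈ spectrum ℝ Γ := by
        rw [← neg_sub, ← spectrum.neg_eq, Set.mem_neg] at hl
        have h2 : -l + C ∈ spectrum ℝ Γ := by
          rw [spectrum.add_mem_iff, ← sub_eq_neg_add]; simpa using hl
        simpa [sub_eq_neg_add] using h2
      have := (h _ h1).2
      simp only [Set.mem_ofPred_eq]; linarith
    have h2 := this.dotProduct_mulVec_nonneg a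
    rw [Matrix.sub_mulVec, hmul, dotProduct_sub, dotProduct_smul] at h2
    simp only [star_trivial, smul_eq_mul] at h2
    rw [dotProduct_comm (Γ *ᵥ a)]; linarith

end Gram

theorem exists_common_bound {ι : Type*} (s : Finset ι) (c : ι → ℝ) : ∃ K, 1 ≤ K ∧ ∀ i ∈ s, c i ≤ K :=
  ⟨1 + ∑ i ∈ s, |c i|, le_add_of_nonneg_right (Finset.sum_nonneg fun _ _ => abs_nonneg _),
    fun _ hi => (le_abs_self _).trans ((Finset.single_le_sum (f := fun i => |c i|)
      (fun _ _ => abs_nonneg _) hi).trans (le_add_of_nonneg_left zero_le_one))⟩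

section Noise

variable {p : ℕ} {ν : Measure (Obs p)} [IsProbabilityMeasure ν] {θ₀ : EuclideanSpace ℝ (Fin p)}
  {F₀ : ℝ → ℝ} {κ : ℝ}

theorem noise_memLp_four (hF : Measurable F₀) (hκ : 4 ≤ κ) (h : IndexModel ν θ₀ F₀ κ) :
    MemLp (noise θ₀ F₀) 4 ν := by
  have hm := measurable_noise θ₀ hF
  rw [← integrable_norm_rpow_iff hm.aestronglyMeasurable (by norm_num) (by norm_num)]
  refine ((integrable_const (1 : ℝ)).add h.noise_moment).mono
    ((hm.norm.pow_const _).aestronglyMeasurable) (Eventually.of_forall fun w => ?_)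
  have h0 := abs_nonneg (noise θ₀ F₀ w)
  simp only [Pi.add_apply, Real.norm_eq_abs, ENNReal.toReal_ofNat]
  rw [abs_of_nonneg (by positivity), abs_of_nonneg (a := 1 + _) (by positivity)]
  rcases le_total (|noise θ₀ F₀ w|) 1 with h1 | h1
  · have := Real.rpow_le_one h0 h1 (by norm_num : (0 : ℝ) ≤ 4)
    have : 0 ≤ |noise θ₀ F₀ w| ^ κ := by positivity
    linarith
  · have := Real.rpow_le_rpow_of_exponent_le h1 hκ
    linarith

omit [IsProbabilityMeasure ν] in
theorem noise_tail_le (hκ : 4 ≤ κ) (h : IndexModel ν θ₀ F₀ κ)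
    {T : ℝ} (hT : 0 < T) :
    ∫ w, (if |noise θ₀ F₀ w| ≤ T then 0 else noise θ₀ F₀ w) ^ 2 ∂ν
      ≤ (∫ w, |noise θ₀ F₀ w| ^ κ ∂ν) * T ^ (2 - κ) := by
  rw [← integral_mul_const]
  refine integral_mono_of_nonneg (Eventually.of_forall fun w => by positivity)
    (h.noise_moment.mul_const _) (Eventually.of_forall fun w => ?_)
  have h0 := abs_nonneg (noise θ₀ F₀ w)
  simp only
  split_ifs with h1
  · simp; positivity
  · push Not at h1
    have hp : 0 < |noise θ₀ F₀ w| := hT.trans h1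
    calc noise θ₀ F₀ w ^ 2 = |noise θ₀ F₀ w| ^ κ * |noise θ₀ F₀ w| ^ (2 - κ) := by
          rw [← Real.rpow_add hp, ← sq_abs]; norm_num
      _ ≤ _ := mul_le_mul_of_nonneg_left
          (Real.rpow_le_rpow_of_nonpos hT h1.le (by linarith)) (by positivity)

theorem noise_orthogonal (h : IndexModel ν θ₀ F₀ κ) (h2 : MemLp (noise θ₀ F₀) 2 ν)
    {f : Obs p → ℝ}
    (hf : StronglyMeasurable[MeasurableSpace.comap (fun w : Obs p => (w.1, w.2.1)) inferInstance] f)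
    (hf2 : MemLp f 2 ν) : ∫ w, f w * noise θ₀ F₀ w ∂ν = 0 := by
  have hm : MeasurableSpace.comap (fun w : Obs p => (w.1, w.2.1)) inferInstance
      ≤ (inferInstance : MeasurableSpace (Obs p)) :=
    (measurable_fst.prodMk (measurable_fst.comp measurable_snd)).comap_le
  have h1 := condExp_mul_of_stronglyMeasurable_left hf (hf2.integrable_mul h2) h.integrable_noise
  have h3 : ∫ w, f w * noise θ₀ F₀ w ∂ν = ∫ w, (f * noise θ₀ F₀) w ∂ν := rfl
  rw [h3, ← integral_condExp hm, integral_congr_ae h1]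
  refine integral_eq_zero_of_ae ?_
  filter_upwards [h.condExp_noise] with w hw
  simp [hw]

theorem noise_condVar_le (h : IndexModel ν θ₀ F₀ κ) (h2 : MemLp (noise θ₀ F₀) 2 ν) :
    ∃ C, 0 ≤ C ∧ ∀ g : ℝ → ℝ, Measurable g → (∃ C, ∀ z, |g z| ≤ C) →
      ∫ w, (noise θ₀ F₀ w * g (index θ₀ w)) ^ 2 ∂ν ≤ C * ∫ w, g (index θ₀ w) ^ 2 ∂ν := by
  obtain ⟨C, hC⟩ := h.condVar_bounded
  refine ⟨|C|, abs_nonneg C, fun g hg ⟨A, hA⟩ => ?_⟩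
  have hm : MeasurableSpace.comap (index θ₀) inferInstance
      ≤ (inferInstance : MeasurableSpace (Obs p)) := (measurable_index θ₀).comap_le
  have hA0 : 0 ≤ A := (abs_nonneg _).trans (hA 0)
  have hgm : StronglyMeasurable[MeasurableSpace.comap (index θ₀) inferInstance]
      fun w : Obs p => g (index θ₀ w) ^ 2 :=
    ((hg.pow_const 2).comp (comap_measurable _)).stronglyMeasurable
  have hgb : ∀ w : Obs p, ‖g (index θ₀ w) ^ 2‖ ≤ A ^ 2 := fun w => by
    rw [Real.norm_eq_abs, abs_pow]; exact pow_le_pow_left₀ (abs_nonneg _) (hA _) 2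
  have hgi : Integrable (fun w : Obs p => g (index θ₀ w) ^ 2) ν :=
    Integrable.of_bound (hgm.mono hm).aestronglyMeasurable _ (Eventually.of_forall hgb)
  have hint : Integrable ((fun w => g (index θ₀ w) ^ 2) * fun w => noise θ₀ F₀ w ^ 2) ν :=
    h2.integrable_sq.bdd_mul (hgm.mono hm).aestronglyMeasurable (Eventually.of_forall hgb)
  have h1 := condExp_mul_of_stronglyMeasurable_left hgm hint h2.integrable_sq
  have h3 : ∫ w, (noise θ₀ F₀ w * g (index θ₀ w)) ^ 2 ∂ν
      = ∫ w, ((fun w => g (index θ₀ w) ^ 2) * fun w => noise θ₀ F₀ w ^ 2) w ∂ν := by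
    congr 1; ext w; simp only [Pi.mul_apply]; ring
  rw [h3, ← integral_condExp hm, ← integral_const_mul]
  refine integral_mono_ae integrable_condExp (hgi.const_mul _) ?_
  filter_upwards [h1, hC] with w hw1 hw2
  rw [hw1, Pi.mul_apply, mul_comm]
  exact mul_le_mul_of_nonneg_right (hw2.trans (le_abs_self C)) (sq_nonneg _)

end Noise

theorem exists_regular {p : ℕ} {ν : Measure (Obs p)} [IsProbabilityMeasure ν]
    {θ₀ : EuclideanSpace ℝ (Fin p)} {F₀ : ℝ → ℝ} {ψ : ℕ → ℝ → ℝ} {αψ s s₁ κ : ℝ} (hκ : 4 ≤ κ)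
    (hmodel : IndexModel ν θ₀ F₀ κ) (hF₀ : SmoothLink F₀)
    (hbasis : SieveBasis ν θ₀ ψ αψ) (happrox : SieveApproximation ν θ₀ F₀ ψ s s₁) :
    ∃ K, Regular ν θ₀ F₀ ψ αψ s s₁ κ K := by
  obtain ⟨Cψ, hCψ⟩ := hbasis.bounded
  obtain ⟨c, C, hc, hcC⟩ := hbasis.eigenvalues
  obtain ⟨D1, hD10, hD1⟩ := exists_bound_of_supNorm_lt_top hF₀.deriv_bounded
  obtain ⟨D2, hD20, hD2⟩ := exists_bound_of_supNorm_lt_top hF₀.deriv2_bounded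
  obtain ⟨A, hA0, hA⟩ := happrox.approx
  obtain ⟨A1, hA10, hA1⟩ := happrox.approx_deriv
  have hFm : Measurable F₀ := hF₀.differentiable.continuous.measurable
  have hn4 := noise_memLp_four hFm hκ hmodel
  have hn2 : MemLp (noise θ₀ F₀) 2 ν := hn4.mono_exponent (by norm_num)
  obtain ⟨Cv, hCv0, hCv⟩ := noise_condVar_le hmodel hn2
  have hX4 : MemLp (fun w : Obs p => w.2.1) 4 ν := by
    rw [← integrable_norm_rpow_iff (by fun_prop) (by norm_num) (by norm_num)]
    simpa using hmodel.regressor_moment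
  obtain ⟨g1, ⟨b1, rfl⟩, hg1⟩ := hA 1 le_rfl
  have hψb : ∀ j, 1 ≤ j → ∀ z, |ψ j z| ≤ |Cψ| := fun j hj z =>
    abs_le_of_supNorm_le (abs_nonneg _)
      ((hCψ j hj).1.trans (ENNReal.ofReal_le_ofReal (le_abs_self _))) z
  have hψd : ∀ j : ℕ, 1 ≤ j → ∀ z, |deriv (ψ j) z| ≤ |Cψ| * (j : ℝ) ^ αψ := fun j hj z =>
    abs_le_of_supNorm_le (by positivity)
      ((hCψ j hj).2.trans (ENNReal.ofReal_le_ofReal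
        (mul_le_mul_of_nonneg_right (le_abs_self _) (by positivity)))) z
  set I1 := ∫ w, ‖w.2.1‖ ^ 2 ∂ν
  set I2 := ∫ w, (‖w.2.1‖ ^ 2) ^ 2 ∂ν
  set I3 := ∫ w, (noise θ₀ F₀ w * ‖w.2.1‖) ^ 2 ∂ν
  set I4 := ∫ w, |noise θ₀ F₀ w| ^ κ ∂ν
  obtain ⟨K, hK1, hK⟩ := exists_common_bound (Finset.univ : Finset (Fin 13))
    ![|Cψ|, c⁻¹, C, A + |Cψ| * |b1 0|, D1, D2, A, A1, I1, I2, I3, I4, Cv]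
  have hKall : |Cψ| ≤ K ∧ c⁻¹ ≤ K ∧ C ≤ K ∧ A + |Cψ| * |b1 0| ≤ K ∧ D1 ≤ K ∧ D2 ≤ K ∧ A ≤ K ∧
      A1 ≤ K ∧ I1 ≤ K ∧ I2 ≤ K ∧ I3 ≤ K ∧ I4 ≤ K ∧ Cv ≤ K :=
    ⟨hK 0 (Finset.mem_univ _), hK 1 (Finset.mem_univ _), hK 2 (Finset.mem_univ _),
      hK 3 (Finset.mem_univ _), hK 4 (Finset.mem_univ _), hK 5 (Finset.mem_univ _),
      hK 6 (Finset.mem_univ _), hK 7 (Finset.mem_univ _), hK 8 (Finset.mem_univ _),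
      hK 9 (Finset.mem_univ _), hK 10 (Finset.mem_univ _), hK 11 (Finset.mem_univ _),
      hK 12 (Finset.mem_univ _)⟩
  obtain ⟨k0, k1, k2, k3, k4, k5, k6, k7, k8, k9, k10, k11, k12⟩ := hKall
  have hK0 : 0 < K := by linarith
  have hKK : K ≤ K ^ 2 := by nlinarith
  refine ⟨K, hK1, fun j hj => (hbasis.differentiable j hj).continuous,
    fun j hj z => (hψb j hj z).trans k0, fun j hj z z' => ?_, fun J hJ a => ?_, fun J hJ a => ?_,
    fun z => ?_, hF₀.differentiable, hF₀.differentiable_deriv.continuous,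
    fun z => (hD1 z).trans k4, fun z z' => ?_, fun J hJ => ?_, fun J hJ z z' => ?_, hn4, hX4,
    k8.trans hKK, k9.trans hKK, k10.trans hKK, fun f hf hf2 => noise_orthogonal hmodel hn2 hf hf2,
    fun g hg hgb => ?_, fun T hT => ?_⟩
  · refine (abs_sub_le_of_deriv_le (hbasis.differentiable j hj) (hψd j hj) z z').trans ?_
    gcongr
  · have h1 := (gram_quadratic_bounds (hcC J hJ) a).1
    have h0 : 0 ≤ a ⬝ᵥ a := by simpa using dotProduct_star_self_nonneg a
    have h2 : c * (a ⬝ᵥ a) * c⁻¹ ≤ (gram ν θ₀ ψ J *ᵥ a) ⬝ᵥ a * c⁻¹ :=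
      mul_le_mul_of_nonneg_right h1 (by positivity)
    have h3 : 0 ≤ (gram ν θ₀ ψ J *ᵥ a) ⬝ᵥ a := le_trans (by positivity) h1
    have h4 : c * (a ⬝ᵥ a) * c⁻¹ = a ⬝ᵥ a := by field_simp
    nlinarith
  · have h1 := (gram_quadratic_bounds (hcC J hJ) a).2
    have h0 : 0 ≤ a ⬝ᵥ a := by simpa using dotProduct_star_self_nonneg a
    nlinarith
  · refine le_trans ?_ k3
    have h1 := (supNorm_le_iff (by positivity)).1 hg1 z
    have h2 : sieveVec ψ 1 z ⬝ᵥ b1 = ψ 1 z * b1 0 := by simp [sieveVec, dotProduct]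
    simp only [Nat.cast_one, Real.one_rpow, mul_one, h2] at h1
    have h3 : |ψ 1 z * b1 0| ≤ |Cψ| * |b1 0| := by
      rw [abs_mul]; exact mul_le_mul_of_nonneg_right (hψb 1 le_rfl z) (abs_nonneg _)
    have h4 := abs_add_le (F₀ z - ψ 1 z * b1 0) (ψ 1 z * b1 0)
    rw [sub_add_cancel] at h4
    linarith
  · have hlip : ∀ y, |deriv F₀ y - deriv F₀ z| ≤ D2 * |y - z| := fun y =>
      abs_sub_le_of_deriv_le hF₀.differentiable_deriv hD2 y z
    have hd : ∀ y, HasDerivAt (fun y => F₀ y - deriv F₀ z * y) (deriv F₀ y - deriv F₀ z) y :=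
      fun y => by
        have := ((hasDerivAt_id y).const_mul (deriv F₀ z))
        rw [mul_one] at this
        exact (hF₀.differentiable y).hasDerivAt.sub this
    have := Convex.norm_image_sub_le_of_norm_hasDerivWithin_le (s := Set.uIcc z z')
      (C := D2 * |z' - z|) (fun y _ => (hd y).hasDerivWithinAt) (fun y hy => by
        refine (hlip y).trans (mul_le_mul_of_nonneg_left ?_ hD20)
        exact Set.abs_sub_left_of_mem_uIcc hy) (convex_uIcc z z') Set.left_mem_uIcc
        Set.right_mem_uIcc
    rw [Real.norm_eq_abs, Real.norm_eq_abs] at this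
    calc |F₀ z' - F₀ z - deriv F₀ z * (z' - z)|
        = |F₀ z' - deriv F₀ z * z' - (F₀ z - deriv F₀ z * z)| := by congr 1; ring
      _ ≤ D2 * |z' - z| * |z' - z| := this
      _ ≤ K * |z' - z| ^ 2 := by rw [sq, ← mul_assoc]; gcongr
  · obtain ⟨g, ⟨b, rfl⟩, hg⟩ := hA J hJ
    refine ⟨b, fun z => ((supNorm_le_iff (by positivity)).1 hg z).trans ?_⟩
    gcongr
  · have hpd : Differentiable ℝ (proj ν θ₀ ψ J F₀) := by
      unfold proj sieveVec dotProduct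
      refine Differentiable.fun_sum fun i _ => ?_
      exact (hbasis.differentiable _ (by omega)).mul_const _
    refine (abs_sub_le_of_deriv_le (f := fun z => F₀ z - proj ν θ₀ ψ J F₀ z)
      (hF₀.differentiable.sub hpd) (C := A1 * (J : ℝ) ^ (-s₁)) (fun y => ?_) z z').trans ?_
    · have h1 := (supNorm_le_iff (by positivity)).1 (hA1 J hJ) y
      rw [deriv_fun_sub (hF₀.differentiable y) (hpd y)]
      exact h1
    · gcongr
  · refine (hCv g hg hgb).trans (mul_le_mul_of_nonneg_right (k12.trans hKK)
      (integral_nonneg fun w => sq_nonneg _))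
  · exact (noise_tail_le hκ hmodel hT).trans
      (mul_le_mul_of_nonneg_right k11 (by positivity))

end

section

/-! ### Features, Gram operators and pseudo-true coefficients in the Hilbert space -/

section Defs

variable {p : ℕ} {H : Type*} [NormedAddCommGroup H] [InnerProductSpace ℝ H]

/-- The feature vector `Ψ_J(z)` in `H`. -/
def feat (e : ℕ → H) (ψ : ℕ → ℝ → ℝ) (J : ℕ) (z : ℝ) : H := emb e J (sieveVec ψ J z)

/-- The Gram operator. -/
def gramOp (e : ℕ → H) (ν : Measure (Obs p)) (θ₀ : EuclideanSpace ℝ (Fin p)) (ψ : ℕ → ℝ → ℝ)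
    (J : ℕ) : H →L[ℝ] H := extOp e (gram ν θ₀ ψ J)

/-- The inverse Gram operator. -/
def gramInv (e : ℕ → H) (ν : Measure (Obs p)) (θ₀ : EuclideanSpace ℝ (Fin p)) (ψ : ℕ → ℝ → ℝ)
    (J : ℕ) : H →L[ℝ] H := extOp e (gram ν θ₀ ψ J)⁻¹

/-- The pseudo-true coefficient in `H`. -/
def coefStar (e : ℕ → H) (ν : Measure (Obs p)) (θ₀ : EuclideanSpace ℝ (Fin p)) (F₀ : ℝ → ℝ)
    (ψ : ℕ → ℝ → ℝ) (J : ℕ) : H := emb e J (projCoef ν θ₀ ψ J F₀)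

end Defs

section Estimates

variable {p : ℕ} {ν : Measure (Obs p)} [IsProbabilityMeasure ν] {θ₀ : EuclideanSpace ℝ (Fin p)}
  {F₀ : ℝ → ℝ} {ψ : ℕ → ℝ → ℝ} {αψ s s₁ κ K : ℝ}
  {H : Type*} [NormedAddCommGroup H] [InnerProductSpace ℝ H] [CompleteSpace H] {e : ℕ → H}

omit [CompleteSpace H] in
theorem feat_mem (J : ℕ) (z : ℝ) : feat e ψ J z ∈ sieveSub e J := emb_mem _ _

omit [CompleteSpace H] in
theorem inner_feat_emb (he : Orthonormal ℝ e) {J : ℕ} (a : Fin J → ℝ) (z : ℝ) :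
    inner ℝ (feat e ψ J z) (emb e J a) = sieveVec ψ J z ⬝ᵥ a := inner_emb_emb he _ _

omit [CompleteSpace H] in
theorem inner_feat (J : ℕ) (z : ℝ) (v : H) :
    inner ℝ (feat e ψ J z) v = sieveVec ψ J z ⬝ᵥ coord e J v := inner_emb_left _ _

omit [CompleteSpace H] in
theorem inner_feat_of_le (he : Orthonormal ℝ e) {J J' : ℕ} (hJ : J ≤ J') {v : H}
    (hv : v ∈ sieveSub e J) (z : ℝ) :
    inner ℝ (feat e ψ J' z) v = inner ℝ (feat e ψ J z) v := by
  obtain ⟨a, rfl⟩ := hv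
  rw [← emb_pad hJ a, inner_feat_emb he, emb_pad hJ, inner_feat_emb he]
  have h1 : ∀ i : Fin J', sieveVec ψ J' z i * pad J' a i
      = (fun l : ℕ => if h : l < J then ψ (l + 1) z * a ⟨l, h⟩ else 0) i := fun i => by
    simp only [sieveVec, pad]; split_ifs <;> simp
  have h2 : ∀ i : Fin J, sieveVec ψ J z i * a i
      = (fun l : ℕ => if h : l < J then ψ (l + 1) z * a ⟨l, h⟩ else 0) i := fun i => by
    simp [sieveVec]
  rw [dotProduct, dotProduct, Finset.sum_congr rfl fun i _ => h1 i,
    Finset.sum_congr rfl fun i _ => h2 i,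
    Fin.sum_univ_eq_sum_range (fun l : ℕ => if h : l < J then ψ (l + 1) z * a ⟨l, h⟩ else 0),
    Fin.sum_univ_eq_sum_range (fun l : ℕ => if h : l < J then ψ (l + 1) z * a ⟨l, h⟩ else 0)]
  refine (Finset.sum_subset (Finset.range_mono hJ) fun l _ hl => ?_).symm
  rw [Finset.mem_range] at hl
  simp [hl]

omit [IsProbabilityMeasure ν] [CompleteSpace H] in
theorem proj_eq_inner (he : Orthonormal ℝ e) (J : ℕ) (z : ℝ) :
    proj ν θ₀ ψ J F₀ z = inner ℝ (feat e ψ J z) (coefStar e ν θ₀ F₀ ψ J) :=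
  (inner_feat_emb he _ _).symm

variable (h : Regular ν θ₀ F₀ ψ αψ s s₁ κ K) (he : Orthonormal ℝ e)
include h

omit [IsProbabilityMeasure ν] [CompleteSpace H] in
theorem feat_continuous (J : ℕ) : Continuous (feat e ψ J) := by
  unfold feat
  simp only [emb_apply, sieveVec]
  exact continuous_finsetSum _ fun i _ => (h.basis_continuous _ (by omega)).smul continuous_const

omit [IsProbabilityMeasure ν] [CompleteSpace H] in
theorem feat_stronglyMeasurable (J : ℕ) (θ : EuclideanSpace ℝ (Fin p)) :
    StronglyMeasurable fun w : Obs p => feat e ψ J (index θ w) :=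
  ((feat_continuous h J).stronglyMeasurable).comp_measurable (measurable_index θ)

include he

omit [IsProbabilityMeasure ν] [CompleteSpace H] in
theorem norm_feat_le (J : ℕ) (z : ℝ) : ‖feat e ψ J z‖ ≤ K * √J := by
  refine le_of_sq_le_sq ?_ (mul_nonneg h.pos.le (Real.sqrt_nonneg _))
  rw [feat, norm_emb_sq he, mul_pow, Real.sq_sqrt (Nat.cast_nonneg J)]
  calc ∑ i : Fin J, sieveVec ψ J z i ^ 2 ≤ ∑ _i : Fin J, K ^ 2 := by
        refine Finset.sum_le_sum fun i _ => ?_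
        rw [← sq_abs]
        exact pow_le_pow_left₀ (abs_nonneg _) (h.basis_bound _ (by omega) z) 2
    _ = K ^ 2 * J := by simp [mul_comm]

omit [IsProbabilityMeasure ν] [CompleteSpace H] in
theorem norm_feat_sub_le (hα : 0 ≤ αψ) (J : ℕ) (z z' : ℝ) :
    ‖feat e ψ J z - feat e ψ J z'‖ ≤ K * (√J * (J : ℝ) ^ αψ) * |z - z'| := by
  have hK := h.pos
  refine le_of_sq_le_sq ?_ (by positivity)
  rw [feat, feat, ← map_sub, norm_emb_sq he]
  have hR : (K * (√J * (J : ℝ) ^ αψ) * |z - z'|) ^ 2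
      = ∑ _i : Fin J, (K * (J : ℝ) ^ αψ * |z - z'|) ^ 2 := by
    simp only [Finset.sum_const, Finset.card_univ, Fintype.card_fin, nsmul_eq_mul]
    rw [mul_pow, mul_pow, mul_pow, Real.sq_sqrt (Nat.cast_nonneg J)]; ring
  rw [hR]
  refine Finset.sum_le_sum fun i _ => ?_
  rw [← sq_abs]
  refine pow_le_pow_left₀ (abs_nonneg _) ((h.basis_lip (i + 1) (by omega) z z').trans ?_) 2
  have : ((i + 1 : ℕ) : ℝ) ≤ J := by exact_mod_cast i.2
  gcongr

omit [CompleteSpace H] in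
theorem feat_memLp (J : ℕ) (θ : EuclideanSpace ℝ (Fin p)) :
    MemLp (fun w : Obs p => feat e ψ J (index θ w)) 2 ν :=
  MemLp.of_bound (feat_stronglyMeasurable h J θ).aestronglyMeasurable (K * √J)
    (Eventually.of_forall fun _ => norm_feat_le h he J _)

omit [CompleteSpace H] he in
theorem integral_inner_feat_sq (J : ℕ) (v : H) :
    ∫ w, (inner ℝ (feat e ψ J (index θ₀ w)) v : ℝ) ^ 2 ∂ν
      = (gram ν θ₀ ψ J *ᵥ coord e J v) ⬝ᵥ coord e J v := by
  have hb : ∀ i : Fin J, MemLp (fun w : Obs p => sieveVec ψ J (index θ₀ w) i) 2 ν := fun i =>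
    MemLp.of_bound (((h.basis_continuous (i + 1) (by omega)).measurable.comp
      (measurable_index θ₀)).aestronglyMeasurable) K
      (Eventually.of_forall fun _ => h.basis_bound _ (by omega) _)
  have hi : ∀ i l : Fin J, Integrable (fun w : Obs p =>
      sieveVec ψ J (index θ₀ w) i * sieveVec ψ J (index θ₀ w) l * (coord e J v i * coord e J v l)) ν :=
    fun i l => (integrable_mul_of_memLp (hb i) (hb l)).mul_const _
  have h1 : ∀ w : Obs p, (inner ℝ (feat e ψ J (index θ₀ w)) v : ℝ) ^ 2
      = ∑ i : Fin J, ∑ l : Fin J, sieveVec ψ J (index θ₀ w) i * sieveVec ψ J (index θ₀ w) l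
        * (coord e J v i * coord e J v l) := fun w => by
    rw [inner_feat, dotProduct, sq, Finset.sum_mul_sum]
    exact Finset.sum_congr rfl fun i _ => Finset.sum_congr rfl fun l _ => by ring
  simp_rw [h1]
  rw [integral_finsetSum _ fun i _ => integrable_finsetSum _ fun l _ => hi i l]
  simp_rw [integral_finsetSum _ fun l _ => hi _ l, integral_mul_const]
  simp only [dotProduct, Matrix.mulVec, gram, Matrix.of_apply, Finset.sum_mul]
  exact Finset.sum_congr rfl fun i _ => Finset.sum_congr rfl fun l _ => by ring

omit [CompleteSpace H] in
theorem integral_inner_feat_sq_le {J : ℕ} (hJ : 1 ≤ J) (v : H) :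
    ∫ w, (inner ℝ (feat e ψ J (index θ₀ w)) v : ℝ) ^ 2 ∂ν ≤ (K * ‖v‖) ^ 2 := by
  rw [integral_inner_feat_sq h]
  have h1 : coord e J v ⬝ᵥ coord e J v ≤ ‖v‖ ^ 2 := by
    have := sum_coord_sq_le he J v
    simpa [dotProduct, sq] using this
  calc _ ≤ K * (coord e J v ⬝ᵥ coord e J v) := h.gram_upper J hJ _
    _ ≤ K * ‖v‖ ^ 2 := mul_le_mul_of_nonneg_left h1 h.pos.le
    _ ≤ (K * ‖v‖) ^ 2 := by
      rw [mul_pow]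
      exact mul_le_mul_of_nonneg_right (by nlinarith [h.one_le]) (sq_nonneg _)

omit he in
theorem integral_smul_feat {f : ℝ → ℝ} (hf : Measurable f) {C : ℝ} (hC : ∀ z, |f z| ≤ C) (J : ℕ) :
    ∫ w, f (index θ₀ w) • feat e ψ J (index θ₀ w) ∂ν
      = emb e J fun i => ∫ w, sieveVec ψ J (index θ₀ w) i * f (index θ₀ w) ∂ν := by
  have hfm : MemLp (fun w : Obs p => f (index θ₀ w)) 2 ν :=
    MemLp.of_bound (hf.comp (measurable_index θ₀)).aestronglyMeasurable C
      (Eventually.of_forall fun _ => hC _)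
  have hb : ∀ i : Fin J, MemLp (fun w : Obs p => sieveVec ψ J (index θ₀ w) i) 2 ν := fun i =>
    MemLp.of_bound (((h.basis_continuous (i + 1) (by omega)).measurable.comp
      (measurable_index θ₀)).aestronglyMeasurable) K
      (Eventually.of_forall fun _ => h.basis_bound _ (by omega) _)
  have h1 : ∀ w : Obs p, f (index θ₀ w) • feat e ψ J (index θ₀ w)
      = ∑ i : Fin J, (sieveVec ψ J (index θ₀ w) i * f (index θ₀ w)) • e i := fun w => by
    rw [feat, emb_apply, Finset.smul_sum]
    exact Finset.sum_congr rfl fun i _ => by rw [smul_smul, mul_comm]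
  simp_rw [h1]
  rw [integral_finsetSum _ fun i _ => (integrable_mul_of_memLp (hb i) hfm).smul_const _, emb_apply]
  exact Finset.sum_congr rfl fun i _ => integral_smul_const _ _

theorem integral_inner_smul_feat {J : ℕ} {v : H} (hv : v ∈ sieveSub e J) :
    ∫ w, (inner ℝ (feat e ψ J (index θ₀ w)) v : ℝ) • feat e ψ J (index θ₀ w) ∂ν
      = gramOp e ν θ₀ ψ J v := by
  obtain ⟨a, rfl⟩ := hv
  have hc : Continuous fun z => (inner ℝ (feat e ψ J z) (emb e J a) : ℝ) :=
    (feat_continuous h J).inner continuous_const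
  rw [integral_smul_feat h (f := fun z => (inner ℝ (feat e ψ J z) (emb e J a) : ℝ))
    hc.measurable (C := K * √J * ‖emb e J a‖)
    (fun z => (abs_real_inner_le_norm _ _).trans
      (mul_le_mul_of_nonneg_right (norm_feat_le h he J z) (norm_nonneg _))), gramOp, extOp_emb he]
  congr 1
  ext i
  have hb : ∀ i : Fin J, MemLp (fun w : Obs p => sieveVec ψ J (index θ₀ w) i) 2 ν := fun i =>
    MemLp.of_bound (((h.basis_continuous (i + 1) (by omega)).measurable.comp
      (measurable_index θ₀)).aestronglyMeasurable) K
      (Eventually.of_forall fun _ => h.basis_bound _ (by omega) _)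
  simp only [inner_feat_emb he, Matrix.mulVec, dotProduct, gram, Matrix.of_apply, Finset.mul_sum,
    ← mul_assoc]
  rw [integral_finsetSum _ fun l _ => (integrable_mul_of_memLp (hb i) (hb l)).mul_const _]
  exact Finset.sum_congr rfl fun l _ => integral_mul_const _ _

omit [IsProbabilityMeasure ν] [CompleteSpace H] in
theorem gramOp_coercive {J : ℕ} (hJ : 1 ≤ J) (x : H) :
    ‖x‖ ^ 2 ≤ K * inner ℝ (gramOp e ν θ₀ ψ J x) x := by
  rw [gramOp, inner_extOp_self he, mul_add]
  have h1 := h.gram_lower J hJ (coord e J x)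
  have h2 : ‖emb e J (coord e J x)‖ ^ 2 = coord e J x ⬝ᵥ coord e J x := by
    rw [norm_emb_sq he]; simp [dotProduct, sq]
  have h3 : ‖emb e J (coord e J x)‖ ^ 2 ≤ ‖x‖ ^ 2 :=
    pow_le_pow_left₀ (norm_nonneg _) (norm_emb_coord_le he J x) 2
  nlinarith [h.one_le]

theorem norm_gramOp_le {J : ℕ} (hJ : 1 ≤ J) (x : H) :
    ‖gramOp e ν θ₀ ψ J x‖ ≤ 3 * K ^ 2 * ‖x‖ := by
  have hP := norm_emb_coord_le he J x
  have h1 : gramOp e ν θ₀ ψ J x = x - emb e J (coord e J x)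
      + gramOp e ν θ₀ ψ J (emb e J (coord e J x)) := by
    simp only [gramOp]; rw [extOp_apply, extOp_emb he]
  have h2 : ‖gramOp e ν θ₀ ψ J (emb e J (coord e J x))‖ ≤ K * ‖emb e J (coord e J x)‖ * K := by
    rw [← integral_inner_smul_feat h he (emb_mem J _)]
    exact norm_integral_smul_le ((feat_memLp h he J θ₀).inner_const (𝕜 := ℝ) _)
      (feat_memLp h he J θ₀) (mul_nonneg h.pos.le (norm_nonneg _)) h.pos.le
      (integral_inner_feat_sq_le h he hJ _) (integral_inner_feat_sq_le h he hJ)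
  rw [h1]
  have hK := h.one_le
  have h4 := norm_sub_le x (emb e J (coord e J x))
  calc _ ≤ ‖x - emb e J (coord e J x)‖ + ‖gramOp e ν θ₀ ψ J (emb e J (coord e J x))‖ :=
        norm_add_le _ _
    _ ≤ 2 * ‖x‖ + K * ‖x‖ * K := by
        have : K * ‖emb e J (coord e J x)‖ * K ≤ K * ‖x‖ * K := by gcongr
        linarith
    _ ≤ _ := by nlinarith [norm_nonneg x, mul_nonneg (norm_nonneg x) (sub_nonneg.2 hK)]

omit [IsProbabilityMeasure ν] he in
theorem gram_isUnit {J : ℕ} (hJ : 1 ≤ J) : IsUnit (gram ν θ₀ ψ J).det := by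
  rw [← Matrix.isUnit_iff_isUnit_det, ← Matrix.mulVec_injective_iff_isUnit]
  intro a b hab
  have h1 := h.gram_lower J hJ (a - b)
  change gram ν θ₀ ψ J *ᵥ a = gram ν θ₀ ψ J *ᵥ b at hab
  rw [Matrix.mulVec_sub, hab, sub_self, zero_dotProduct, mul_zero] at h1
  have h0 : 0 ≤ (a - b) ⬝ᵥ (a - b) := by simpa using dotProduct_star_self_nonneg (a - b)
  exact sub_eq_zero.1 (dotProduct_self_eq_zero.1 (le_antisymm h1 h0))

omit [IsProbabilityMeasure ν] [CompleteSpace H] in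
theorem gramInv_gramOp {J : ℕ} (hJ : 1 ≤ J) (x : H) :
    gramInv e ν θ₀ ψ J (gramOp e ν θ₀ ψ J x) = x := by
  rw [gramInv, gramOp, extOp_extOp he, Matrix.nonsing_inv_mul _ (gram_isUnit h hJ), extOp_one]

omit [IsProbabilityMeasure ν] [CompleteSpace H] in
theorem gramOp_gramInv {J : ℕ} (hJ : 1 ≤ J) (x : H) :
    gramOp e ν θ₀ ψ J (gramInv e ν θ₀ ψ J x) = x := by
  rw [gramInv, gramOp, extOp_extOp he, Matrix.mul_nonsing_inv _ (gram_isUnit h hJ), extOp_one]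

omit [IsProbabilityMeasure ν] [CompleteSpace H] in
theorem norm_gramInv_le {J : ℕ} (hJ : 1 ≤ J) (x : H) : ‖gramInv e ν θ₀ ψ J x‖ ≤ K * ‖x‖ := by
  have h1 := gramOp_coercive h he hJ (gramInv e ν θ₀ ψ J x)
  rw [gramOp_gramInv h he hJ] at h1
  have h2 := real_inner_le_norm x (gramInv e ν θ₀ ψ J x)
  have hK := h.pos
  by_contra hlt
  push Not at hlt
  have h0 : 0 < ‖gramInv e ν θ₀ ψ J x‖ := lt_of_le_of_lt (by positivity) hlt
  nlinarith [mul_le_mul_of_nonneg_left h2 hK.le]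

theorem contraction_gramOp {J : ℕ} (hJ : 1 ≤ J) {η : ℝ} (hη : 0 ≤ η) (hη1 : 9 * K ^ 5 * η ≤ 1)
    (x : H) : ‖x - η • gramOp e ν θ₀ ψ J x‖ ≤ (1 - η / (2 * K)) * ‖x‖ := by
  have hK := h.one_le
  have hK0 := h.pos
  have hη2 : η ≤ 1 := by
    have : 1 ≤ K ^ 5 := one_le_pow₀ hK
    nlinarith
  have hd : η / (2 * K) ≤ 1 := by rw [div_le_one (by positivity)]; linarith
  refine le_of_sq_le_sq ?_ (mul_nonneg (by linarith) (norm_nonneg _))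
  rw [norm_sub_sq_real, inner_smul_right, norm_smul, Real.norm_of_nonneg hη, real_inner_comm]
  have h1 := gramOp_coercive h he hJ x
  have h2 := norm_gramOp_le h he hJ x
  set g := ‖gramOp e ν θ₀ ψ J x‖
  set q : ℝ := inner ℝ (gramOp e ν θ₀ ψ J x) x
  have hg : g ^ 2 ≤ 9 * K ^ 4 * ‖x‖ ^ 2 := by
    calc g ^ 2 ≤ (3 * K ^ 2 * ‖x‖) ^ 2 := pow_le_pow_left₀ (norm_nonneg _) h2 2
      _ = _ := by ring
  have hq : ‖x‖ ^ 2 / K ≤ q := by rw [div_le_iff₀ hK0]; linarith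
  have e1 : (η * g) ^ 2 ≤ η * (‖x‖ ^ 2 / K) := by
    have : (η * g) ^ 2 ≤ η * (η * (9 * K ^ 4 * ‖x‖ ^ 2)) := by
      rw [mul_pow, sq η, mul_assoc]; gcongr
    refine this.trans (mul_le_mul_of_nonneg_left ?_ hη)
    rw [le_div_iff₀ hK0]
    calc η * (9 * K ^ 4 * ‖x‖ ^ 2) * K = (9 * K ^ 5 * η) * ‖x‖ ^ 2 := by ring
      _ ≤ 1 * ‖x‖ ^ 2 := by gcongr
      _ = _ := one_mul _
  have e2 : ((1 - η / (2 * K)) * ‖x‖) ^ 2 = ‖x‖ ^ 2 - η * (‖x‖ ^ 2 / K)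
      + (η / (2 * K) * ‖x‖) ^ 2 := by field_simp; ring
  rw [e2]
  have e3 : η * (‖x‖ ^ 2 / K) ≤ η * q := mul_le_mul_of_nonneg_left hq hη
  nlinarith [sq_nonneg (η / (2 * K) * ‖x‖)]

/-! ### Pseudo-true coefficients -/

theorem integral_residual_smul_feat {J : ℕ} (hJ : 1 ≤ J) :
    ∫ w, (F₀ (index θ₀ w) - proj ν θ₀ ψ J F₀ (index θ₀ w)) • feat e ψ J (index θ₀ w) ∂ν = 0 := by
  have hF : MemLp (fun w : Obs p => F₀ (index θ₀ w)) 2 ν :=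
    MemLp.of_bound (h.link_differentiable.continuous.measurable.comp
      (measurable_index θ₀)).aestronglyMeasurable K (Eventually.of_forall fun _ => h.link_bound _)
  have hΦ := feat_memLp h he (e := e) J θ₀
  simp only [sub_smul, proj_eq_inner he]
  rw [integral_sub (integrable_smul_of_memLp hF hΦ)
    (integrable_smul_of_memLp (hΦ.inner_const (𝕜 := ℝ) _) hΦ),
    integral_inner_smul_feat h he (v := coefStar e ν θ₀ F₀ ψ J) (emb_mem J _),
    integral_smul_feat h h.link_differentiable.continuous.measurable h.link_bound, gramOp,
    coefStar, extOp_emb he, projCoef, Matrix.mulVec_mulVec,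
    Matrix.mul_nonsing_inv _ (gram_isUnit h hJ), Matrix.one_mulVec, sub_self]

omit [CompleteSpace H] in
theorem residual_memLp (J : ℕ) :
    MemLp (fun w : Obs p => F₀ (index θ₀ w) - proj ν θ₀ ψ J F₀ (index θ₀ w)) 2 ν := by
  have hF : MemLp (fun w : Obs p => F₀ (index θ₀ w)) 2 ν :=
    MemLp.of_bound (h.link_differentiable.continuous.measurable.comp
      (measurable_index θ₀)).aestronglyMeasurable K (Eventually.of_forall fun _ => h.link_bound _)
  simp only [proj_eq_inner he]
  exact hF.sub ((feat_memLp h he J θ₀).inner_const (𝕜 := ℝ) _)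

theorem integral_residual_sq_le {J : ℕ} (hJ : 1 ≤ J) :
    ∫ w, (F₀ (index θ₀ w) - proj ν θ₀ ψ J F₀ (index θ₀ w)) ^ 2 ∂ν ≤ (K * (J : ℝ) ^ (-s)) ^ 2 := by
  obtain ⟨b, hb⟩ := h.approx J hJ
  have hr := residual_memLp h he J
  set v := coefStar e ν θ₀ F₀ ψ J - emb e J b with hv
  have hu : MemLp (fun w : Obs p => (inner ℝ (feat e ψ J (index θ₀ w)) v : ℝ)) 2 ν :=
    (feat_memLp h he J θ₀).inner_const (𝕜 := ℝ) _
  have h0 : ∫ w, (F₀ (index θ₀ w) - proj ν θ₀ ψ J F₀ (index θ₀ w))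
      * inner ℝ (feat e ψ J (index θ₀ w)) v ∂ν = 0 := by
    have := integral_inner (𝕜 := ℝ) (integrable_smul_of_memLp hr (feat_memLp h he J θ₀)) v
    rw [integral_residual_smul_feat h he hJ, inner_zero_right] at this
    rw [← this]
    congr 1; ext w; rw [inner_smul_right, real_inner_comm v]
  have h1 : ∀ w : Obs p, (F₀ (index θ₀ w) - sieveVec ψ J (index θ₀ w) ⬝ᵥ b) ^ 2
      = (F₀ (index θ₀ w) - proj ν θ₀ ψ J F₀ (index θ₀ w)) ^ 2
        + 2 * ((F₀ (index θ₀ w) - proj ν θ₀ ψ J F₀ (index θ₀ w))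
          * inner ℝ (feat e ψ J (index θ₀ w)) v)
        + (inner ℝ (feat e ψ J (index θ₀ w)) v) ^ 2 := fun w => by
    rw [hv, inner_sub_right, inner_feat_emb he, ← proj_eq_inner he]; ring
  have h2 : ∫ w, (F₀ (index θ₀ w) - sieveVec ψ J (index θ₀ w) ⬝ᵥ b) ^ 2 ∂ν
      ≤ (K * (J : ℝ) ^ (-s)) ^ 2 := by
    calc _ ≤ ∫ _w : Obs p, (K * (J : ℝ) ^ (-s)) ^ 2 ∂ν :=
          integral_mono_of_nonneg (Eventually.of_forall fun _ => sq_nonneg _) (integrable_const _)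
            (Eventually.of_forall fun w => by
              simp only
              rw [← sq_abs]; exact pow_le_pow_left₀ (abs_nonneg _) (hb _) 2)
      _ = _ := by simp
  simp_rw [h1] at h2
  have hi := (integrable_mul_of_memLp hr hu).const_mul 2
  have hi2 : Integrable (fun w : Obs p =>
      (F₀ (index θ₀ w) - proj ν θ₀ ψ J F₀ (index θ₀ w)) ^ 2
        + 2 * ((F₀ (index θ₀ w) - proj ν θ₀ ψ J F₀ (index θ₀ w))
          * inner ℝ (feat e ψ J (index θ₀ w)) v)) ν := hr.integrable_sq.add hi
  rw [integral_add hi2 hu.integrable_sq, integral_add hr.integrable_sq hi, integral_const_mul,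
    h0] at h2
  have h3 : 0 ≤ ∫ w, (inner ℝ (feat e ψ J (index θ₀ w)) v : ℝ) ^ 2 ∂ν :=
    integral_nonneg fun _ => sq_nonneg _
  linarith

theorem norm_coefStar_sub_le (hs : 0 ≤ s) {J J' : ℕ} (hJ : 1 ≤ J) (hJJ : J ≤ J') :
    ‖coefStar e ν θ₀ F₀ ψ J - coefStar e ν θ₀ F₀ ψ J'‖ ≤ 2 * K ^ 2 * (J : ℝ) ^ (-s) := by
  have hK := h.one_le
  have hK0 := h.pos
  have hJ0 : (0 : ℝ) < J := by exact_mod_cast hJ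
  set v := coefStar e ν θ₀ F₀ ψ J - coefStar e ν θ₀ F₀ ψ J' with hv
  have hm : coefStar e ν θ₀ F₀ ψ J ∈ sieveSub e J := emb_mem _ _
  have hvm : v ∈ sieveSub e J' := sub_mem (sieveSub_mono hJJ hm) (emb_mem _ _)
  have h1 := gramOp_coercive h he (hJ.trans hJJ) v
  have h2 : inner ℝ (gramOp e ν θ₀ ψ J' v) v
      = ∫ w, (inner ℝ (feat e ψ J' (index θ₀ w)) v : ℝ) ^ 2 ∂ν := by
    rw [integral_inner_feat_sq h, gramOp]
    conv_lhs => rw [← emb_coord_of_mem he hvm, extOp_emb he, inner_emb_emb he]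
  have hr := residual_memLp h he (e := e) J
  have hr' := residual_memLp h he (e := e) J'
  have h3 : ∫ w, (inner ℝ (feat e ψ J' (index θ₀ w)) v : ℝ) ^ 2 ∂ν
      ≤ 2 * (K * (J : ℝ) ^ (-s)) ^ 2 + 2 * (K * (J : ℝ) ^ (-s)) ^ 2 := by
    have hJ' : (K * (J' : ℝ) ^ (-s)) ^ 2 ≤ (K * (J : ℝ) ^ (-s)) ^ 2 := by
      have : (J' : ℝ) ^ (-s) ≤ (J : ℝ) ^ (-s) :=
        Real.rpow_le_rpow_of_nonpos hJ0 (by exact_mod_cast hJJ) (by linarith)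
      gcongr
    calc _ ≤ ∫ w, (2 * (F₀ (index θ₀ w) - proj ν θ₀ ψ J' F₀ (index θ₀ w)) ^ 2
          + 2 * (F₀ (index θ₀ w) - proj ν θ₀ ψ J F₀ (index θ₀ w)) ^ 2) ∂ν := by
          refine integral_mono_of_nonneg (Eventually.of_forall fun _ => sq_nonneg _)
            ((hr'.integrable_sq.const_mul 2).add (hr.integrable_sq.const_mul 2))
            (Eventually.of_forall fun w => ?_)
          simp only
          rw [hv, inner_sub_right, inner_feat_of_le he hJJ hm, ← proj_eq_inner he,
            ← proj_eq_inner he]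
          nlinarith [sq_nonneg (F₀ (index θ₀ w) - proj ν θ₀ ψ J' F₀ (index θ₀ w)
            + (F₀ (index θ₀ w) - proj ν θ₀ ψ J F₀ (index θ₀ w)))]
      _ ≤ _ := by
          rw [integral_add (hr'.integrable_sq.const_mul 2) (hr.integrable_sq.const_mul 2),
            integral_const_mul, integral_const_mul]
          have := (integral_residual_sq_le h he (e := e) (hJ.trans hJJ)).trans hJ'
          have := integral_residual_sq_le h he (e := e) hJ
          linarith
  refine le_of_sq_le_sq ?_ (by positivity)
  rw [h2] at h1
  calc ‖v‖ ^ 2 ≤ K * (2 * (K * (J : ℝ) ^ (-s)) ^ 2 + 2 * (K * (J : ℝ) ^ (-s)) ^ 2) :=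
        h1.trans (mul_le_mul_of_nonneg_left h3 hK0.le)
    _ = 4 * K ^ 3 * ((J : ℝ) ^ (-s)) ^ 2 := by ring
    _ ≤ 4 * K ^ 4 * ((J : ℝ) ^ (-s)) ^ 2 := by
        have : K ^ 3 ≤ K ^ 4 := pow_le_pow_right₀ hK (by norm_num)
        gcongr
    _ = _ := by ring

theorem exists_coefLimit (hs : 0 < s) :
    ∃ b : H, ∀ J : ℕ, 1 ≤ J → ‖coefStar e ν θ₀ F₀ ψ J - b‖ ≤ 2 * K ^ 2 * (J : ℝ) ^ (-s) := by
  have hlim : Tendsto (fun J : ℕ => 2 * K ^ 2 * ((J : ℝ) ^ (-s))) atTop (𝓝 0) := by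
    have := ((tendsto_rpow_neg_atTop hs).comp tendsto_natCast_atTop_atTop).const_mul (2 * K ^ 2)
    simpa using this
  have hC : CauchySeq (coefStar e ν θ₀ F₀ ψ) := by
    refine Metric.cauchySeq_iff'.2 fun ε hε => ?_
    obtain ⟨n, hn⟩ := eventually_atTop.1 ((hlim.eventually (gt_mem_nhds hε)).and
      (eventually_ge_atTop 1))
    refine ⟨n, fun m hm => ?_⟩
    rw [dist_comm, dist_eq_norm]
    exact (norm_coefStar_sub_le h he hs.le (hn n le_rfl).2 hm).trans_lt (hn n le_rfl).1
  obtain ⟨b, hb⟩ := cauchySeq_tendsto_of_complete hC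
  refine ⟨b, fun J hJ => ?_⟩
  refine le_of_tendsto ((tendsto_const_nhds.sub hb).norm) ?_
  filter_upwards [eventually_ge_atTop J] with J' hJ'
  exact norm_coefStar_sub_le h he hs.le hJ hJ'

end Estimates

end

section

/-! ### Effect of the plug-in index -/

section Defs

variable {p : ℕ} {H : Type*} [NormedAddCommGroup H] [InnerProductSpace ℝ H]

/-- Mean of the gradient at the pseudo-true coefficient. -/
def biasDrift (e : ℕ → H) (ν : Measure (Obs p)) (θ₀ : EuclideanSpace ℝ (Fin p)) (F₀ : ℝ → ℝ)
    (ψ : ℕ → ℝ → ℝ) (J : ℕ) (θ : EuclideanSpace ℝ (Fin p)) : H :=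
  ∫ w, (F₀ (index θ₀ w) - proj ν θ₀ ψ J F₀ (index θ w)) • feat e ψ J (index θ w) ∂ν

/-- The linear effect of the plug-in error. -/
def plugInEffect (e : ℕ → H) (ν : Measure (Obs p)) (θ₀ : EuclideanSpace ℝ (Fin p)) (F₀ : ℝ → ℝ)
    (ψ : ℕ → ℝ → ℝ) (J : ℕ) (Δ : EuclideanSpace ℝ (Fin p)) : H :=
  ∫ w, (deriv F₀ (index θ₀ w) * inner ℝ w.2.1 Δ) • feat e ψ J (index θ₀ w) ∂ν

/-- The perturbation of the Gram operator by the plug-in index. -/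
def gramDrift (e : ℕ → H) (ν : Measure (Obs p)) (θ₀ : EuclideanSpace ℝ (Fin p))
    (ψ : ℕ → ℝ → ℝ) (J : ℕ) (θ : EuclideanSpace ℝ (Fin p)) (v : H) : H :=
  ∫ w, (inner ℝ (feat e ψ J (index θ w)) v : ℝ) • feat e ψ J (index θ w) ∂ν
    - ∫ w, (inner ℝ (feat e ψ J (index θ₀ w)) v : ℝ) • feat e ψ J (index θ₀ w) ∂ν

end Defs

section Estimates

variable {p : ℕ} {ν : Measure (Obs p)} [IsProbabilityMeasure ν] {θ₀ : EuclideanSpace ℝ (Fin p)}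
  {F₀ : ℝ → ℝ} {ψ : ℕ → ℝ → ℝ} {αψ s s₁ κ K : ℝ}
  {H : Type*} [NormedAddCommGroup H] [InnerProductSpace ℝ H] [CompleteSpace H] {e : ℕ → H}
  (h : Regular ν θ₀ F₀ ψ αψ s s₁ κ K) (he : Orthonormal ℝ e)

theorem abs_integral_le_of_sq_le {O : Type*} [MeasurableSpace O] {μ : Measure O}
    [IsProbabilityMeasure μ] {f : O → ℝ} (hf : MemLp f 2 μ) {A : ℝ} (hA : 0 ≤ A)
    (h : ∫ w, f w ^ 2 ∂μ ≤ A ^ 2) : |∫ w, f w ∂μ| ≤ A := by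
  have := abs_integral_mul_le hf (memLp_const (1 : ℝ)) hA zero_le_one h (by simp)
  simpa using this

include h

theorem regressor_norm_memLp : MemLp (fun w : Obs p => ‖w.2.1‖) 2 ν :=
  (h.regressor_memLp.mono_exponent (by norm_num)).norm

theorem regressor_normSq_memLp : MemLp (fun w : Obs p => ‖w.2.1‖ ^ 2) 2 ν := by
  have hm : AEStronglyMeasurable (fun w : Obs p => ‖w.2.1‖ ^ 2) ν := h.regressor_memLp.1.norm.pow 2
  rw [memLp_two_iff_integrable_sq hm]
  have := h.regressor_memLp.integrable_norm_pow (by norm_num : (4 : ℕ) ≠ 0)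
  simpa [← pow_mul] using this

theorem integral_regressor_norm_le : ∫ w : Obs p, ‖w.2.1‖ ∂ν ≤ K :=
  (le_abs_self _).trans (abs_integral_le_of_sq_le (regressor_norm_memLp h) h.pos.le h.regressor_sq)

theorem integral_regressor_normSq_le : ∫ w : Obs p, ‖w.2.1‖ ^ 2 ∂ν ≤ K :=
  (le_abs_self _).trans
    (abs_integral_le_of_sq_le (regressor_normSq_memLp h) h.pos.le h.regressor_four)

theorem noise_memLp_two : MemLp (noise θ₀ F₀) 2 ν := h.noise_memLp.mono_exponent (by norm_num)

theorem noise_regressor_memLp : MemLp (fun w : Obs p => noise θ₀ F₀ w * ‖w.2.1‖) 2 ν := by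
  have hm : AEStronglyMeasurable (fun w : Obs p => noise θ₀ F₀ w * ‖w.2.1‖) ν :=
    h.noise_memLp.1.mul h.regressor_memLp.1.norm
  rw [memLp_two_iff_integrable_sq hm]
  have h1 := h.regressor_memLp.integrable_norm_pow (by norm_num : (4 : ℕ) ≠ 0)
  have h2 := h.noise_memLp.integrable_norm_pow (by norm_num : (4 : ℕ) ≠ 0)
  refine (h1.add h2).mono (hm.pow 2)
    (Eventually.of_forall fun w => ?_)
  simp only [Pi.add_apply, Real.norm_eq_abs]
  rw [abs_of_nonneg (by positivity), abs_of_nonneg (by positivity), mul_pow, ← sq_abs]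
  nlinarith [sq_nonneg (|noise θ₀ F₀ w| ^ 2 - ‖w.2.1‖ ^ 2), sq_nonneg (|noise θ₀ F₀ w| ^ 2),
    sq_nonneg (‖w.2.1‖ ^ 2)]

include he

theorem norm_feat_index_sub_le (hα : 0 ≤ αψ) (J : ℕ) (θ θ' : EuclideanSpace ℝ (Fin p))
    (w : Obs p) : ‖feat e ψ J (index θ w) - feat e ψ J (index θ' w)‖
      ≤ K * (√J * (J : ℝ) ^ αψ * ‖θ - θ'‖) * ‖w.2.1‖ := by
  have hK := h.pos
  refine (norm_feat_sub_le h he hα J _ _).trans ?_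
  calc _ ≤ K * (√J * (J : ℝ) ^ αψ) * (‖w.2.1‖ * ‖θ - θ'‖) := by
        have := abs_index_sub_le θ θ' w
        gcongr
    _ = _ := by ring

theorem featDiff_memLp (J : ℕ) (θ : EuclideanSpace ℝ (Fin p)) :
    MemLp (fun w : Obs p => feat e ψ J (index θ w) - feat e ψ J (index θ₀ w)) 2 ν :=
  (feat_memLp h he J θ).sub (feat_memLp h he J θ₀)

theorem integral_featDiff_sq_le (hα : 0 ≤ αψ) (J : ℕ) (θ : EuclideanSpace ℝ (Fin p)) :
    ∫ w, ‖feat e ψ J (index θ w) - feat e ψ J (index θ₀ w)‖ ^ 2 ∂ν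
      ≤ (K ^ 2 * (√J * (J : ℝ) ^ αψ * ‖θ - θ₀‖)) ^ 2 := by
  have hK := h.pos
  calc _ ≤ ∫ w : Obs p, (K * (√J * (J : ℝ) ^ αψ * ‖θ - θ₀‖)) ^ 2 * ‖w.2.1‖ ^ 2 ∂ν := by
        refine integral_mono (integrable_norm_sq (featDiff_memLp h he J θ))
          ((regressor_norm_memLp h).integrable_sq.const_mul _) fun w => ?_
        simp only
        rw [← mul_pow]
        exact pow_le_pow_left₀ (norm_nonneg _) (norm_feat_index_sub_le h he hα J θ θ₀ w) 2
    _ ≤ (K * (√J * (J : ℝ) ^ αψ * ‖θ - θ₀‖)) ^ 2 * K ^ 2 := by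
        rw [integral_const_mul]
        exact mul_le_mul_of_nonneg_left h.regressor_sq (by positivity)
    _ = _ := by ring

theorem proj_lip {J : ℕ} (hJ : 1 ≤ J) (hs₁ : 0 ≤ s₁) (z z' : ℝ) :
    |proj ν θ₀ ψ J F₀ z - proj ν θ₀ ψ J F₀ z'| ≤ 2 * K * |z - z'| := by
  have h1 := h.approx_lip J hJ z z'
  have h2 := abs_sub_le_of_deriv_le h.link_differentiable h.link_deriv_bound z z'
  have h3 : (J : ℝ) ^ (-s₁) ≤ 1 :=
    Real.rpow_le_one_of_one_le_of_nonpos (by exact_mod_cast hJ) (by linarith)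
  have h4 : K * (J : ℝ) ^ (-s₁) * |z - z'| ≤ K * 1 * |z - z'| := by
    have := h.pos; gcongr
  calc _ = |(F₀ z - F₀ z') - ((F₀ z - proj ν θ₀ ψ J F₀ z)
        - (F₀ z' - proj ν θ₀ ψ J F₀ z'))| := by congr 1; ring
    _ ≤ |F₀ z - F₀ z'| + |(F₀ z - proj ν θ₀ ψ J F₀ z) - (F₀ z' - proj ν θ₀ ψ J F₀ z')| :=
        abs_sub _ _
    _ ≤ _ := by linarith

theorem proj_index_memLp (J : ℕ) (θ : EuclideanSpace ℝ (Fin p)) :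
    MemLp (fun w : Obs p => proj ν θ₀ ψ J F₀ (index θ w)) 2 ν := by
  simp only [proj_eq_inner he]
  exact (feat_memLp h he J θ).inner_const (𝕜 := ℝ) _

theorem link_index_memLp : MemLp (fun w : Obs p => F₀ (index θ₀ w)) 2 ν :=
  MemLp.of_bound (h.link_differentiable.continuous.measurable.comp
    (measurable_index θ₀)).aestronglyMeasurable K (Eventually.of_forall fun _ => h.link_bound _)

theorem norm_biasDrift_add_plugInEffect_le (hα : 0 ≤ αψ) {J : ℕ} (hJ : 1 ≤ J)
    (θ : EuclideanSpace ℝ (Fin p)) :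
    ‖biasDrift e ν θ₀ F₀ ψ J θ + plugInEffect e ν θ₀ F₀ ψ J (θ - θ₀)‖
      ≤ 4 * K ^ 4 * ((J : ℝ) ^ (-s) * (√J * (J : ℝ) ^ αψ * ‖θ - θ₀‖)
        + (J : ℝ) ^ (-s₁) * (√J * ‖θ - θ₀‖) + √J * ‖θ - θ₀‖ ^ 2
        + ‖θ - θ₀‖ * (√J * (J : ℝ) ^ αψ * ‖θ - θ₀‖)) := by
  have hK1 := h.one_le
  have hK := h.pos
  set t := ‖θ - θ₀‖ with ht
  set d := √J * (J : ℝ) ^ αψ * t with hd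
  have hΦ := feat_memLp h he (e := e) J θ
  have hΦ₀ := feat_memLp h he (e := e) J θ₀
  have hr := residual_memLp h he (e := e) J
  have hX := regressor_norm_memLp h
  have hXX := regressor_normSq_memLp h
  have hF : MemLp (fun w : Obs p => F₀ (index θ₀ w) - proj ν θ₀ ψ J F₀ (index θ w)) 2 ν :=
    (link_index_memLp h he).sub (proj_index_memLp h he J θ)
  have hd' : MemLp (fun w : Obs p => deriv F₀ (index θ₀ w) * inner ℝ w.2.1 (θ - θ₀)) 2 ν := by
    refine (hX.const_mul (K * t)).mono
      (((h.link_deriv_continuous.measurable.comp (measurable_index θ₀)).mul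
        (by fun_prop)).aestronglyMeasurable)
      (Eventually.of_forall fun w => ?_)
    rw [Real.norm_eq_abs, Real.norm_eq_abs, abs_mul]
    have := abs_real_inner_le_norm w.2.1 (θ - θ₀)
    have := h.link_deriv_bound (index θ₀ w)
    rw [abs_of_nonneg (show 0 ≤ K * t * ‖w.2.1‖ by positivity)]
    calc _ ≤ K * (‖w.2.1‖ * t) := by gcongr
      _ = _ := by ring
  have hsum : biasDrift e ν θ₀ F₀ ψ J θ + plugInEffect e ν θ₀ F₀ ψ J (θ - θ₀)
      = ∫ w, ((F₀ (index θ₀ w) - proj ν θ₀ ψ J F₀ (index θ w)) • feat e ψ J (index θ w)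
        + (deriv F₀ (index θ₀ w) * inner ℝ w.2.1 (θ - θ₀)) • feat e ψ J (index θ₀ w)
        - (F₀ (index θ₀ w) - proj ν θ₀ ψ J F₀ (index θ₀ w)) • feat e ψ J (index θ₀ w)) ∂ν := by
    have hi : Integrable (fun w : Obs p =>
        (F₀ (index θ₀ w) - proj ν θ₀ ψ J F₀ (index θ w)) • feat e ψ J (index θ w)
        + (deriv F₀ (index θ₀ w) * inner ℝ w.2.1 (θ - θ₀)) • feat e ψ J (index θ₀ w)) ν :=
      (integrable_smul_of_memLp hF hΦ).add (integrable_smul_of_memLp hd' hΦ₀)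
    rw [integral_sub hi (integrable_smul_of_memLp hr hΦ₀),
      integral_add (integrable_smul_of_memLp hF hΦ) (integrable_smul_of_memLp hd' hΦ₀),
      integral_residual_smul_feat h he hJ, sub_zero]
    rfl
  have hpt : ∀ w : Obs p, ‖(F₀ (index θ₀ w) - proj ν θ₀ ψ J F₀ (index θ w)) • feat e ψ J (index θ w)
        + (deriv F₀ (index θ₀ w) * inner ℝ w.2.1 (θ - θ₀)) • feat e ψ J (index θ₀ w)
        - (F₀ (index θ₀ w) - proj ν θ₀ ψ J F₀ (index θ₀ w)) • feat e ψ J (index θ₀ w)‖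
      ≤ K * d * (|F₀ (index θ₀ w) - proj ν θ₀ ψ J F₀ (index θ₀ w)| * ‖w.2.1‖)
        + K ^ 2 * ((J : ℝ) ^ (-s₁) * (√J * t)) * ‖w.2.1‖
        + K ^ 2 * (√J * t ^ 2) * ‖w.2.1‖ ^ 2 + K ^ 2 * (t * d) * ‖w.2.1‖ ^ 2 := by
    intro w
    set z := index θ₀ w
    set y := index θ w
    have hyz : y - z = inner ℝ w.2.1 (θ - θ₀) := index_sub_index θ θ₀ w
    have hyz' : |y - z| ≤ ‖w.2.1‖ * t := abs_index_sub_le θ θ₀ w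
    have hD := norm_feat_index_sub_le h he (e := e) hα J θ θ₀ w
    have hN := norm_feat_le h he (e := e) J y
    rw [← hyz]
    have hid : (F₀ z - proj ν θ₀ ψ J F₀ y) • feat e ψ J y + (deriv F₀ z * (y - z)) • feat e ψ J z
          - (F₀ z - proj ν θ₀ ψ J F₀ z) • feat e ψ J z
        = (F₀ z - proj ν θ₀ ψ J F₀ z) • (feat e ψ J y - feat e ψ J z)
          + ((F₀ y - proj ν θ₀ ψ J F₀ y) - (F₀ z - proj ν θ₀ ψ J F₀ z)) • feat e ψ J y
          - (F₀ y - F₀ z - deriv F₀ z * (y - z)) • feat e ψ J y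
          - (deriv F₀ z * (y - z)) • (feat e ψ J y - feat e ψ J z) := by module
    rw [hid]
    have e1 : ‖(F₀ z - proj ν θ₀ ψ J F₀ z) • (feat e ψ J y - feat e ψ J z)‖
        ≤ K * d * (|F₀ z - proj ν θ₀ ψ J F₀ z| * ‖w.2.1‖) := by
      rw [norm_smul, Real.norm_eq_abs]
      calc _ ≤ |F₀ z - proj ν θ₀ ψ J F₀ z| * (K * d * ‖w.2.1‖) := by gcongr
        _ = _ := by ring
    have e2 : ‖((F₀ y - proj ν θ₀ ψ J F₀ y) - (F₀ z - proj ν θ₀ ψ J F₀ z)) • feat e ψ J y‖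
        ≤ K ^ 2 * ((J : ℝ) ^ (-s₁) * (√J * t)) * ‖w.2.1‖ := by
      rw [norm_smul, Real.norm_eq_abs]
      calc _ ≤ (K * (J : ℝ) ^ (-s₁) * (‖w.2.1‖ * t)) * (K * √J) := by
            have := h.approx_lip J hJ y z
            have h5 : K * (J : ℝ) ^ (-s₁) * |y - z| ≤ K * (J : ℝ) ^ (-s₁) * (‖w.2.1‖ * t) := by
              gcongr
            exact mul_le_mul (this.trans h5) hN (norm_nonneg _) (by positivity)
        _ = _ := by ring
    have e3 : ‖(F₀ y - F₀ z - deriv F₀ z * (y - z)) • feat e ψ J y‖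
        ≤ K ^ 2 * (√J * t ^ 2) * ‖w.2.1‖ ^ 2 := by
      rw [norm_smul, Real.norm_eq_abs]
      calc _ ≤ (K * (‖w.2.1‖ * t) ^ 2) * (K * √J) := by
            have := h.link_taylor z y
            have h5 : K * |y - z| ^ 2 ≤ K * (‖w.2.1‖ * t) ^ 2 := by gcongr
            exact mul_le_mul (this.trans h5) hN (norm_nonneg _) (by positivity)
        _ = _ := by ring
    have e4 : ‖(deriv F₀ z * (y - z)) • (feat e ψ J y - feat e ψ J z)‖
        ≤ K ^ 2 * (t * d) * ‖w.2.1‖ ^ 2 := by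
      rw [norm_smul, Real.norm_eq_abs, abs_mul]
      calc _ ≤ (K * (‖w.2.1‖ * t)) * (K * d * ‖w.2.1‖) := by
            have := h.link_deriv_bound z
            gcongr
        _ = _ := by ring
    refine (norm_sub_le _ _).trans (add_le_add ((norm_sub_le _ _).trans
      (add_le_add ((norm_add_le _ _).trans (add_le_add e1 e2)) e3)) e4)
  have hrX : MemLp (fun w : Obs p => |F₀ (index θ₀ w) - proj ν θ₀ ψ J F₀ (index θ₀ w)|) 2 ν := hr.abs
  have i1 := (integrable_mul_of_memLp hrX hX).const_mul (K * d)
  have i2 := (hX.integrable one_le_two).const_mul (K ^ 2 * ((J : ℝ) ^ (-s₁) * (√J * t)))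
  have i3 := (hXX.integrable one_le_two).const_mul (K ^ 2 * (√J * t ^ 2))
  have i4 := (hXX.integrable one_le_two).const_mul (K ^ 2 * (t * d))
  have i12 : Integrable (fun w : Obs p =>
      K * d * (|F₀ (index θ₀ w) - proj ν θ₀ ψ J F₀ (index θ₀ w)| * ‖w.2.1‖)
        + K ^ 2 * ((J : ℝ) ^ (-s₁) * (√J * t)) * ‖w.2.1‖) ν := i1.add i2
  have i123 : Integrable (fun w : Obs p =>
      K * d * (|F₀ (index θ₀ w) - proj ν θ₀ ψ J F₀ (index θ₀ w)| * ‖w.2.1‖)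
        + K ^ 2 * ((J : ℝ) ^ (-s₁) * (√J * t)) * ‖w.2.1‖
        + K ^ 2 * (√J * t ^ 2) * ‖w.2.1‖ ^ 2) ν := i12.add i3
  rw [hsum]
  refine (norm_integral_le_integral_norm _).trans ?_
  refine (integral_mono_of_nonneg (Eventually.of_forall fun _ => norm_nonneg _)
    (i123.add i4) (Eventually.of_forall hpt)).trans ?_
  simp only [Pi.add_apply]
  rw [integral_add i123 i4, integral_add i12 i3, integral_add i1 i2, integral_const_mul,
    integral_const_mul, integral_const_mul, integral_const_mul]
  have j1 : ∫ w, |F₀ (index θ₀ w) - proj ν θ₀ ψ J F₀ (index θ₀ w)| * ‖w.2.1‖ ∂ν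
      ≤ K * (J : ℝ) ^ (-s) * K := by
    refine (le_abs_self _).trans (abs_integral_mul_le hrX hX (by positivity) hK.le ?_ h.regressor_sq)
    simp only [sq_abs]
    exact integral_residual_sq_le h he (e := e) hJ
  have j2 := integral_regressor_norm_le h
  have j3 := integral_regressor_normSq_le h
  have hKK : K ^ 3 ≤ 4 * K ^ 4 := by nlinarith [pow_pos hK 3]
  have hd0 : 0 ≤ d := by positivity
  calc _ ≤ K * d * (K * (J : ℝ) ^ (-s) * K) + K ^ 2 * ((J : ℝ) ^ (-s₁) * (√J * t)) * K
        + K ^ 2 * (√J * t ^ 2) * K + K ^ 2 * (t * d) * K := by gcongr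
    _ = K ^ 3 * ((J : ℝ) ^ (-s) * d + (J : ℝ) ^ (-s₁) * (√J * t) + √J * t ^ 2 + t * d) := by ring
    _ ≤ _ := mul_le_mul_of_nonneg_right hKK (by positivity)

theorem norm_plugInEffect_le (J : ℕ) (Δ : EuclideanSpace ℝ (Fin p)) :
    ‖plugInEffect e ν θ₀ F₀ ψ J Δ‖ ≤ K ^ 3 * (√J * ‖Δ‖) := by
  have hK := h.pos
  refine (norm_integral_le_integral_norm _).trans ?_
  refine (integral_mono_of_nonneg (Eventually.of_forall fun _ => norm_nonneg _)
    (((regressor_norm_memLp h).integrable one_le_two).const_mul (K ^ 2 * (√J * ‖Δ‖)))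
    (Eventually.of_forall fun w => ?_)).trans ?_
  · simp only
    rw [norm_smul, Real.norm_eq_abs, abs_mul]
    calc _ ≤ K * (‖w.2.1‖ * ‖Δ‖) * (K * √J) := by
          have := h.link_deriv_bound (index θ₀ w)
          have := abs_real_inner_le_norm w.2.1 Δ
          have := norm_feat_le h he (e := e) J (index θ₀ w)
          gcongr
      _ = _ := by ring
  · rw [integral_const_mul]
    calc _ ≤ K ^ 2 * (√J * ‖Δ‖) * K := by
          have := integral_regressor_norm_le h
          gcongr
      _ = _ := by ring

end Estimates

end

section

/-! ### Samples of the gradient -/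

section Defs

variable {p : ℕ} {H : Type*} [NormedAddCommGroup H] [InnerProductSpace ℝ H]

/-- The error truncated at level `T`. -/
def truncNoise (θ₀ : EuclideanSpace ℝ (Fin p)) (F₀ : ℝ → ℝ) (T : ℝ) (w : Obs p) : ℝ :=
  if |noise θ₀ F₀ w| ≤ T then noise θ₀ F₀ w else 0

/-- The truncated and recentred score at the true index. -/
def truncScore (e : ℕ → H) (ν : Measure (Obs p)) (θ₀ : EuclideanSpace ℝ (Fin p)) (F₀ : ℝ → ℝ)
    (ψ : ℕ → ℝ → ℝ) (J : ℕ) (T : ℝ) (w : Obs p) : H :=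
  truncNoise θ₀ F₀ T w • feat e ψ J (index θ₀ w)
    - ∫ w', truncNoise θ₀ F₀ T w' • feat e ψ J (index θ₀ w') ∂ν

/-- The stochastic gradient at index parameter `θ` and coefficient `v`. -/
def gradSample (e : ℕ → H) (ψ : ℕ → ℝ → ℝ) (J : ℕ) (θ : EuclideanSpace ℝ (Fin p)) (v : H)
    (w : Obs p) : H :=
  (w.2.2 - inner ℝ (feat e ψ J (index θ w)) v) • feat e ψ J (index θ w)

/-- The part of the stochastic gradient which is not the truncated score. -/
def remSample (e : ℕ → H) (θ₀ : EuclideanSpace ℝ (Fin p)) (F₀ : ℝ → ℝ) (ψ : ℕ → ℝ → ℝ) (J : ℕ)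
    (T : ℝ) (θ : EuclideanSpace ℝ (Fin p)) (v : H) (w : Obs p) : H :=
  gradSample e ψ J θ v w - truncNoise θ₀ F₀ T w • feat e ψ J (index θ₀ w)

/-- The part of the score lost by truncation. -/
def tailSample (e : ℕ → H) (θ₀ : EuclideanSpace ℝ (Fin p)) (F₀ : ℝ → ℝ) (ψ : ℕ → ℝ → ℝ) (J : ℕ)
    (T : ℝ) (w : Obs p) : H :=
  noise θ₀ F₀ w • feat e ψ J (index θ₀ w) - truncNoise θ₀ F₀ T w • feat e ψ J (index θ₀ w)

end Defs

theorem memLp_two_of_sq_le {O H : Type*} [MeasurableSpace O] {μ : Measure O}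
    [NormedAddCommGroup H] {f : O → H} (hf : AEStronglyMeasurable f μ) {g : O → ℝ}
    (hg : Integrable g μ) (h : ∀ w, ‖f w‖ ^ 2 ≤ g w) :
    MemLp f 2 μ ∧ ∫ w, ‖f w‖ ^ 2 ∂μ ≤ ∫ w, g w ∂μ := by
  refine ⟨?_, integral_mono_of_nonneg (Eventually.of_forall fun _ => by positivity) hg
    (Eventually.of_forall h)⟩
  rw [← memLp_norm_iff hf]
  have hm : AEStronglyMeasurable (fun w => ‖f w‖) μ := hf.norm
  rw [memLp_two_iff_integrable_sq hm]
  refine hg.mono' (hm.pow 2) (Eventually.of_forall fun w => ?_)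
  rw [Real.norm_of_nonneg (by positivity)]
  exact h w

theorem norm_add_four_sq_le {H : Type*} [SeminormedAddCommGroup H] (a b c d : H) :
    ‖a + b + c - d‖ ^ 2 ≤ 4 * (‖a‖ ^ 2 + ‖b‖ ^ 2 + ‖c‖ ^ 2 + ‖d‖ ^ 2) := by
  have h : ‖a + b + c - d‖ ≤ ‖a‖ + ‖b‖ + ‖c‖ + ‖d‖ :=
    (norm_sub_le _ _).trans (by gcongr; exact norm_add₃_le)
  calc _ ≤ (‖a‖ + ‖b‖ + ‖c‖ + ‖d‖) ^ 2 := by gcongr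
    _ ≤ _ := by
      nlinarith [sq_nonneg (‖a‖ - ‖b‖), sq_nonneg (‖a‖ - ‖c‖), sq_nonneg (‖a‖ - ‖d‖),
        sq_nonneg (‖b‖ - ‖c‖), sq_nonneg (‖b‖ - ‖d‖), sq_nonneg (‖c‖ - ‖d‖)]

section Estimates

variable {p : ℕ} {ν : Measure (Obs p)} [IsProbabilityMeasure ν] {θ₀ : EuclideanSpace ℝ (Fin p)}
  {F₀ : ℝ → ℝ} {ψ : ℕ → ℝ → ℝ} {αψ s s₁ κ K : ℝ}
  {H : Type*} [NormedAddCommGroup H] [InnerProductSpace ℝ H] [CompleteSpace H] {e : ℕ → H}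
  (h : Regular ν θ₀ F₀ ψ αψ s s₁ κ K) (he : Orthonormal ℝ e)

include h

theorem noise_measurable : Measurable (noise θ₀ F₀) :=
  measurable_noise θ₀ h.link_differentiable.continuous.measurable

theorem truncNoise_measurable (T : ℝ) : Measurable (truncNoise θ₀ F₀ T) :=
  Measurable.ite (measurableSet_le (noise_measurable h).abs measurable_const)
    (noise_measurable h) measurable_const

omit h [IsProbabilityMeasure ν] in
theorem abs_truncNoise_le {T : ℝ} (hT : 0 ≤ T) (w : Obs p) : |truncNoise θ₀ F₀ T w| ≤ T := by
  unfold truncNoise; split_ifs with h1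
  · exact h1
  · simpa using hT

omit h [IsProbabilityMeasure ν] in
theorem abs_truncNoise_le_noise (T : ℝ) (w : Obs p) :
    |truncNoise θ₀ F₀ T w| ≤ |noise θ₀ F₀ w| := by
  unfold truncNoise; split_ifs with h1
  · exact le_rfl
  · simp

omit h [IsProbabilityMeasure ν] in
theorem noise_sub_truncNoise (T : ℝ) (w : Obs p) :
    noise θ₀ F₀ w - truncNoise θ₀ F₀ T w
      = if |noise θ₀ F₀ w| ≤ T then 0 else noise θ₀ F₀ w := by
  unfold truncNoise; split_ifs <;> simp

theorem truncNoise_memLp (T : ℝ) : MemLp (truncNoise θ₀ F₀ T) 2 ν :=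
  (noise_memLp_two h).mono (truncNoise_measurable h T).aestronglyMeasurable
    (Eventually.of_forall fun w => by simpa using abs_truncNoise_le_noise T w)

theorem inner_feat_measurable (J : ℕ) (θ : EuclideanSpace ℝ (Fin p)) (v : H) :
    Measurable fun w : Obs p => (inner ℝ (feat e ψ J (index θ w)) v : ℝ) :=
  ((feat_stronglyMeasurable h (e := e) J θ).inner stronglyMeasurable_const (𝕜 := ℝ)).measurable

theorem integral_noise_inner_sq_le (he : Orthonormal ℝ e) {J : ℕ} (hJ : 1 ≤ J) (v : H) :
    ∫ w, (noise θ₀ F₀ w * inner ℝ (feat e ψ J (index θ₀ w)) v) ^ 2 ∂ν ≤ (K ^ 2 * ‖v‖) ^ 2 := by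
  have hc : Measurable fun z : ℝ => (inner ℝ (feat e ψ J z) v : ℝ) :=
    ((feat_continuous h (e := e) J).inner continuous_const).measurable
  have hK := h.pos
  refine (h.noise_condVar _ hc ⟨K * √J * ‖v‖, fun z => (abs_real_inner_le_norm _ _).trans
    (by have := norm_feat_le h he J z; gcongr)⟩).trans ?_
  calc _ ≤ K ^ 2 * (K * ‖v‖) ^ 2 := by
        have := integral_inner_feat_sq_le h he hJ v
        gcongr
    _ = _ := by ring

include he

theorem integral_noise_smul_feat (J : ℕ) (θ : EuclideanSpace ℝ (Fin p)) :
    ∫ w, noise θ₀ F₀ w • feat e ψ J (index θ w) ∂ν = 0 := by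
  have hi := integrable_smul_of_memLp (noise_memLp_two h) (feat_memLp h he J θ)
  refine ext_inner_left ℝ fun v => ?_
  rw [← integral_inner hi, inner_zero_right]
  have hm : Measurable[MeasurableSpace.comap (fun w : Obs p => (w.1, w.2.1)) inferInstance]
      (fun w : Obs p => index θ w) := by
    have h1 : Measurable fun x : ℝ × EuclideanSpace ℝ (Fin p) => x.1 + inner ℝ x.2 θ :=
      measurable_fst.add measurable_snd.inner_const
    exact h1.comp (comap_measurable _)
  have hc : Measurable fun z : ℝ => (inner ℝ (feat e ψ J z) v : ℝ) :=
    ((feat_continuous h (e := e) J).inner continuous_const).measurable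
  rw [← h.noise_orth (fun w => inner ℝ (feat e ψ J (index θ w)) v)
    (hc.comp hm).stronglyMeasurable ((feat_memLp h he J θ).inner_const (𝕜 := ℝ) v)]
  refine integral_congr_ae (Eventually.of_forall fun w => ?_)
  simp only
  rw [inner_smul_right, real_inner_comm, mul_comm]

theorem integrable_truncNoise_smul (J : ℕ) (T : ℝ) :
    Integrable (fun w => truncNoise θ₀ F₀ T w • feat e ψ J (index θ₀ w)) ν :=
  integrable_smul_of_memLp (truncNoise_memLp h T) (feat_memLp h he J θ₀)

theorem norm_truncNoise_smul_le (J : ℕ) {T : ℝ} (hT : 0 ≤ T) (w : Obs p) :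
    ‖truncNoise θ₀ F₀ T w • feat e ψ J (index θ₀ w)‖ ≤ T * (K * √J) := by
  rw [norm_smul, Real.norm_eq_abs]
  have := abs_truncNoise_le (θ₀ := θ₀) (F₀ := F₀) hT w
  have := norm_feat_le h he (e := e) J (index θ₀ w)
  gcongr

theorem norm_truncScore_le (J : ℕ) {T : ℝ} (hT : 0 ≤ T) (w : Obs p) :
    ‖truncScore e ν θ₀ F₀ ψ J T w‖ ≤ 2 * (T * (K * √J)) := by
  have h1 := norm_truncNoise_smul_le h he (e := e) J hT
  have h2 : ‖∫ w', truncNoise θ₀ F₀ T w' • feat e ψ J (index θ₀ w') ∂ν‖ ≤ T * (K * √J) := by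
    refine (norm_integral_le_integral_norm _).trans ?_
    refine (integral_mono_of_nonneg (Eventually.of_forall fun _ => norm_nonneg _)
      (integrable_const (T * (K * √J))) (Eventually.of_forall h1)).trans ?_
    simp
  exact (norm_sub_le _ _).trans (by linarith [h1 w])

theorem truncScore_stronglyMeasurable (J : ℕ) (T : ℝ) :
    StronglyMeasurable (truncScore e ν θ₀ F₀ ψ J T) :=
  ((truncNoise_measurable h T).stronglyMeasurable.smul (feat_stronglyMeasurable h J θ₀)).sub
    stronglyMeasurable_const

omit h he in
theorem integral_mem_sieveSub (he : Orthonormal ℝ e) {O : Type*} [MeasurableSpace O]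
    {μ : Measure O} (J : ℕ) {f : O → H} (hf : ∀ w, f w ∈ sieveSub e J) :
    ∫ w, f w ∂μ ∈ sieveSub e J := by
  by_cases hi : Integrable f μ
  · have hL := (extOp e (0 : Matrix (Fin J) (Fin J) ℝ)).integral_comp_comm hi
    have h0 : ∀ w, extOp e (0 : Matrix (Fin J) (Fin J) ℝ) (f w) = 0 := by
      intro w
      rw [extOp_apply, emb_coord_of_mem he (hf w)]
      simp
    simp only [h0, integral_zero] at hL
    have := hL.symm
    rw [extOp_apply] at this
    simp only [Matrix.zero_mulVec, map_zero, add_zero] at this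
    rw [sub_eq_zero.mp this]
    exact emb_mem _ _
  · rw [integral_undef hi]
    exact Submodule.zero_mem _

omit h in
theorem truncScore_mem (J : ℕ) (T : ℝ) (w : Obs p) :
    truncScore e ν θ₀ F₀ ψ J T w ∈ sieveSub e J :=
  Submodule.sub_mem _ (Submodule.smul_mem _ _ (feat_mem _ _))
    (integral_mem_sieveSub he J fun _ => Submodule.smul_mem _ _ (feat_mem _ _))

omit h in
theorem gramDrift_mem (J : ℕ) (θ : EuclideanSpace ℝ (Fin p)) (v : H) :
    gramDrift e ν θ₀ ψ J θ v ∈ sieveSub e J :=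
  Submodule.sub_mem _ (integral_mem_sieveSub he J fun _ => Submodule.smul_mem _ _ (feat_mem _ _))
    (integral_mem_sieveSub he J fun _ => Submodule.smul_mem _ _ (feat_mem _ _))

theorem integral_inner_truncScore (J : ℕ) (T : ℝ) (v : H) :
    ∫ w, inner ℝ v (truncScore e ν θ₀ F₀ ψ J T w) ∂ν = 0 := by
  have hi := integrable_truncNoise_smul h he (e := e) J T
  have hi' : Integrable (truncScore e ν θ₀ F₀ ψ J T) ν := hi.sub (integrable_const _)
  rw [integral_inner hi']
  have : ∫ w, truncScore e ν θ₀ F₀ ψ J T w ∂ν = 0 := by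
    unfold truncScore
    rw [integral_sub hi (integrable_const _)]
    simp
  rw [this, inner_zero_right]

theorem integral_inner_truncScore_sq_le {J : ℕ} (hJ : 1 ≤ J) {T : ℝ} (hT : 0 ≤ T) (v : H) :
    ∫ w, (inner ℝ v (truncScore e ν θ₀ F₀ ψ J T w)) ^ 2 ∂ν ≤ (K ^ 2 * ‖v‖) ^ 2 := by
  have hi := integrable_truncNoise_smul h he (e := e) J T
  set u : Obs p → ℝ := fun w => inner ℝ v (truncNoise θ₀ F₀ T w • feat e ψ J (index θ₀ w)) with hu
  have hum : Measurable u := ((stronglyMeasurable_const (b := v)).inner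
    ((truncNoise_measurable h T).stronglyMeasurable.smul
      (feat_stronglyMeasurable h (e := e) J θ₀)) (𝕜 := ℝ)).measurable
  have hub : MemLp u 2 ν := MemLp.of_bound hum.aestronglyMeasurable (‖v‖ * (T * (K * √J)))
    (Eventually.of_forall fun w => (norm_inner_le_norm _ _).trans
      (by have := norm_truncNoise_smul_le h he (e := e) J hT w; gcongr))
  have h1 : ∀ w, inner ℝ v (truncScore e ν θ₀ F₀ ψ J T w) = u w - ∫ w', u w' ∂ν := by
    intro w
    rw [truncScore, inner_sub_right, integral_inner hi]
  have h2 : ∫ w, (inner ℝ v (truncScore e ν θ₀ F₀ ψ J T w)) ^ 2 ∂ν ≤ ∫ w, u w ^ 2 ∂ν := by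
    set c := ∫ w', u w' ∂ν with hc
    have i1 : Integrable (fun w => u w ^ 2) ν := hub.integrable_sq
    have i2 : Integrable (fun w => 2 * c * u w) ν := (hub.integrable one_le_two).const_mul _
    have i3 : Integrable (fun w => u w ^ 2 - 2 * c * u w) ν := i1.sub i2
    calc _ = ∫ w, (u w ^ 2 - 2 * c * u w + c ^ 2) ∂ν := by
          refine integral_congr_ae (Eventually.of_forall fun w => ?_)
          simp only [h1]; ring
      _ = ∫ w, u w ^ 2 ∂ν - c ^ 2 := by
          rw [integral_add i3 (integrable_const _), integral_sub i1 i2, integral_const_mul, ← hc]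
          simp; ring
      _ ≤ _ := by linarith [sq_nonneg c]
  refine h2.trans (le_trans ?_ (integral_noise_inner_sq_le h he hJ v))
  have hb : MemLp (fun w => noise θ₀ F₀ w * inner ℝ (feat e ψ J (index θ₀ w)) v) 2 ν := by
    have hm := inner_feat_measurable h (e := e) J θ₀ v
    refine ((noise_memLp_two h).const_mul (K * √J * ‖v‖)).mono
      ((noise_measurable h).mul hm).aestronglyMeasurable (Eventually.of_forall fun w => ?_)
    rw [norm_mul, norm_mul, mul_comm]
    refine mul_le_mul_of_nonneg_right ?_ (norm_nonneg _)
    refine (norm_inner_le_norm _ _).trans ((mul_le_mul_of_nonneg_right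
      (norm_feat_le h he J _) (norm_nonneg _)).trans (le_abs_self _))
  refine integral_mono hub.integrable_sq hb.integrable_sq fun w => ?_
  simp only [hu]
  rw [inner_smul_right, real_inner_comm, mul_pow, mul_pow]
  refine mul_le_mul_of_nonneg_right ?_ (sq_nonneg _)
  rw [← sq_abs, ← sq_abs (noise θ₀ F₀ w)]
  exact pow_le_pow_left₀ (abs_nonneg _) (abs_truncNoise_le_noise T w) 2

theorem tailSample_sq_le (J : ℕ) {T : ℝ} (hT : 0 < T) :
    MemLp (tailSample e θ₀ F₀ ψ J T) 2 ν ∧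
      ∫ w, ‖tailSample e θ₀ F₀ ψ J T w‖ ^ 2 ∂ν ≤ K ^ 3 * (J * T ^ (2 - κ)) := by
  have hK := h.pos
  have hl : MemLp (fun w => noise θ₀ F₀ w - truncNoise θ₀ F₀ T w) 2 ν :=
    (noise_memLp_two h).sub (truncNoise_memLp h T)
  have ht := h.noise_tail T hT
  simp only [← noise_sub_truncNoise] at ht
  have hms : StronglyMeasurable (tailSample e θ₀ F₀ ψ J T) :=
    ((noise_measurable h).stronglyMeasurable.smul (feat_stronglyMeasurable h J θ₀)).sub
      ((truncNoise_measurable h T).stronglyMeasurable.smul (feat_stronglyMeasurable h J θ₀))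
  have hpt : ∀ w, ‖tailSample e θ₀ F₀ ψ J T w‖ ^ 2
      ≤ K ^ 2 * J * (noise θ₀ F₀ w - truncNoise θ₀ F₀ T w) ^ 2 := by
    intro w
    rw [tailSample, ← sub_smul, norm_smul, mul_pow, Real.norm_eq_abs, sq_abs, mul_comm]
    refine mul_le_mul_of_nonneg_right ?_ (sq_nonneg _)
    calc _ ≤ (K * √J) ^ 2 := by
          have := norm_feat_le h he (e := e) J (index θ₀ w); gcongr
      _ = K ^ 2 * J := by rw [mul_pow, Real.sq_sqrt (by positivity)]
  obtain ⟨h1, h2⟩ := memLp_two_of_sq_le hms.aestronglyMeasurable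
    (hl.integrable_sq.const_mul (K ^ 2 * J)) hpt
  refine ⟨h1, h2.trans ?_⟩
  rw [integral_const_mul]
  calc _ ≤ K ^ 2 * J * (K * T ^ (2 - κ)) := by gcongr
    _ = _ := by ring

theorem integral_tailSample (J : ℕ) (T : ℝ) :
    ∫ w, tailSample e θ₀ F₀ ψ J T w ∂ν
      = - ∫ w, truncNoise θ₀ F₀ T w • feat e ψ J (index θ₀ w) ∂ν := by
  unfold tailSample
  rw [integral_sub (integrable_smul_of_memLp (noise_memLp_two h) (feat_memLp h he J θ₀))
    (integrable_truncNoise_smul h he J T), integral_noise_smul_feat h he, zero_sub]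

theorem gradSample_eq (J : ℕ) (θ : EuclideanSpace ℝ (Fin p)) (v : H) (w : Obs p) :
    gradSample e ψ J θ v w = noise θ₀ F₀ w • feat e ψ J (index θ w)
      + (F₀ (index θ₀ w) - proj ν θ₀ ψ J F₀ (index θ w)) • feat e ψ J (index θ w)
      - (inner ℝ (feat e ψ J (index θ w)) (v - coefStar e ν θ₀ F₀ ψ J) : ℝ)
        • feat e ψ J (index θ w) := by
  rw [gradSample, ← add_smul, ← sub_smul, proj_eq_inner he, inner_sub_right, noise]
  congr 1; ring

set_option maxHeartbeats 800000 in
theorem remSample_sq_le (hα : 0 ≤ αψ) {J : ℕ} (hJ : 1 ≤ J) {T : ℝ} (hT : 0 < T)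
    (θ : EuclideanSpace ℝ (Fin p)) (v : H) (hs₁ : 0 ≤ s₁) :
    MemLp (remSample e θ₀ F₀ ψ J T θ v) 2 ν ∧
      ∫ w, ‖remSample e θ₀ F₀ ψ J T θ v w‖ ^ 2 ∂ν ≤ 40 * K ^ 6 *
        ((√J * (J : ℝ) ^ αψ * ‖θ - θ₀‖) ^ 2 + J * ((J : ℝ) ^ (-s)) ^ 2 + J * T ^ (2 - κ)
          + J * (1 + (√J * (J : ℝ) ^ αψ * ‖θ - θ₀‖) ^ 2) * ‖v - coefStar e ν θ₀ F₀ ψ J‖ ^ 2) := by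
  have hK1 := h.one_le
  have hK := h.pos
  set t := ‖θ - θ₀‖ with ht
  set d := √J * (J : ℝ) ^ αψ * t with hd
  set δ := v - coefStar e ν θ₀ F₀ ψ J with hδ
  have hJ1 : (1 : ℝ) ≤ J := by exact_mod_cast hJ
  have htd : J * t ^ 2 ≤ d ^ 2 := by
    rw [hd, mul_pow, mul_pow, Real.sq_sqrt (by positivity)]
    have : 1 ≤ ((J : ℝ) ^ αψ) ^ 2 := one_le_pow₀ (Real.one_le_rpow hJ1 hα)
    nlinarith [mul_nonneg (by positivity : (0 : ℝ) ≤ J) (sq_nonneg t)]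
  obtain ⟨htl, htl2⟩ := tailSample_sq_le h he (e := e) J hT
  have hX := regressor_norm_memLp h
  have hr := residual_memLp h he (e := e) J
  have hI : MemLp (fun w : Obs p => (inner ℝ (feat e ψ J (index θ₀ w)) δ : ℝ)) 2 ν :=
    (feat_memLp h he J θ₀).inner_const (𝕜 := ℝ) δ
  have hdec : ∀ w, remSample e θ₀ F₀ ψ J T θ v w = tailSample e θ₀ F₀ ψ J T w
      + noise θ₀ F₀ w • (feat e ψ J (index θ w) - feat e ψ J (index θ₀ w))
      + (F₀ (index θ₀ w) - proj ν θ₀ ψ J F₀ (index θ w)) • feat e ψ J (index θ w)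
      - (inner ℝ (feat e ψ J (index θ w)) δ : ℝ) • feat e ψ J (index θ w) := by
    intro w
    rw [remSample, gradSample_eq h he (ν := ν), tailSample]
    module
  have hsm : StronglyMeasurable (remSample e θ₀ F₀ ψ J T θ v) := by
    have hF := feat_stronglyMeasurable h (e := e) J θ
    have hY : Measurable fun w : Obs p => w.2.2 := measurable_snd.comp measurable_snd
    exact ((hY.sub (inner_feat_measurable h J θ v)).stronglyMeasurable.smul hF).sub
      ((truncNoise_measurable h T).stronglyMeasurable.smul (feat_stronglyMeasurable h J θ₀))
  set g1 : Obs p → ℝ := fun w => 4 * ‖tailSample e θ₀ F₀ ψ J T w‖ ^ 2 with hg1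
  set g2 : Obs p → ℝ := fun w => 4 * (K * d) ^ 2 * (noise θ₀ F₀ w * ‖w.2.1‖) ^ 2 with hg2
  set g3 : Obs p → ℝ := fun w => 8 * K ^ 2 * J *
    (F₀ (index θ₀ w) - proj ν θ₀ ψ J F₀ (index θ₀ w)) ^ 2 with hg3
  set g4 : Obs p → ℝ := fun w =>
    (32 * K ^ 4 * (J * t ^ 2) + 8 * K ^ 4 * (J * d ^ 2 * ‖δ‖ ^ 2)) * ‖w.2.1‖ ^ 2 with hg4
  set g5 : Obs p → ℝ := fun w => 8 * K ^ 2 * J * (inner ℝ (feat e ψ J (index θ₀ w)) δ : ℝ) ^ 2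
    with hg5
  have i1 : Integrable g1 ν := (integrable_norm_sq htl).const_mul 4
  have i2 : Integrable g2 ν := (noise_regressor_memLp h).integrable_sq.const_mul _
  have i3 : Integrable g3 ν := hr.integrable_sq.const_mul _
  have i4 : Integrable g4 ν := hX.integrable_sq.const_mul _
  have i5 : Integrable g5 ν := hI.integrable_sq.const_mul _
  have i12 : Integrable (fun w => g1 w + g2 w) ν := i1.add i2
  have i13 : Integrable (fun w => g1 w + g2 w + g3 w) ν := i12.add i3
  have i14 : Integrable (fun w => g1 w + g2 w + g3 w + g4 w) ν := i13.add i4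
  have i15 : Integrable (fun w => g1 w + g2 w + g3 w + g4 w + g5 w) ν := i14.add i5
  have hpt : ∀ w, ‖remSample e θ₀ F₀ ψ J T θ v w‖ ^ 2
      ≤ g1 w + g2 w + g3 w + g4 w + g5 w := by
    intro w
    rw [hdec]
    refine (norm_add_four_sq_le _ _ _ _).trans ?_
    set z := index θ₀ w
    set y := index θ w
    have hyz : |y - z| ≤ ‖w.2.1‖ * t := abs_index_sub_le θ θ₀ w
    have hD := norm_feat_index_sub_le h he (e := e) hα J θ θ₀ w
    have hN := norm_feat_le h he (e := e) J y
    have hN2 : ‖feat e ψ J y‖ ^ 2 ≤ K ^ 2 * J := by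
      calc _ ≤ (K * √J) ^ 2 := by gcongr
        _ = K ^ 2 * J := by rw [mul_pow, Real.sq_sqrt (by positivity)]
    have c2 : ‖noise θ₀ F₀ w • (feat e ψ J y - feat e ψ J z)‖ ^ 2
        ≤ (K * d) ^ 2 * (noise θ₀ F₀ w * ‖w.2.1‖) ^ 2 := by
      rw [norm_smul, mul_pow, Real.norm_eq_abs, sq_abs]
      calc _ ≤ noise θ₀ F₀ w ^ 2 * (K * d * ‖w.2.1‖) ^ 2 := by gcongr
        _ = _ := by ring
    have c3 : ‖(F₀ z - proj ν θ₀ ψ J F₀ y) • feat e ψ J y‖ ^ 2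
        ≤ (2 * (F₀ z - proj ν θ₀ ψ J F₀ z) ^ 2 + 8 * K ^ 2 * (t ^ 2 * ‖w.2.1‖ ^ 2))
          * (K ^ 2 * J) := by
      rw [norm_smul, mul_pow, Real.norm_eq_abs, sq_abs]
      have e1 := proj_lip h he hJ hs₁ z y
      have e2 : (proj ν θ₀ ψ J F₀ z - proj ν θ₀ ψ J F₀ y) ^ 2
          ≤ (2 * K * (‖w.2.1‖ * t)) ^ 2 := by
        rw [← sq_abs]
        refine pow_le_pow_left₀ (abs_nonneg _) (e1.trans ?_) 2
        rw [abs_sub_comm]; gcongr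
      have e3 : (F₀ z - proj ν θ₀ ψ J F₀ y) ^ 2
          ≤ 2 * (F₀ z - proj ν θ₀ ψ J F₀ z) ^ 2 + 8 * K ^ 2 * (t ^ 2 * ‖w.2.1‖ ^ 2) := by
        nlinarith [sq_nonneg ((F₀ z - proj ν θ₀ ψ J F₀ z)
          - (proj ν θ₀ ψ J F₀ z - proj ν θ₀ ψ J F₀ y))]
      exact mul_le_mul e3 hN2 (by positivity) (by positivity)
    have c4 : ‖(inner ℝ (feat e ψ J y) δ : ℝ) • feat e ψ J y‖ ^ 2
        ≤ (2 * (inner ℝ (feat e ψ J z) δ : ℝ) ^ 2 + 2 * (K ^ 2 * (d ^ 2 * ‖δ‖ ^ 2) * ‖w.2.1‖ ^ 2))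
          * (K ^ 2 * J) := by
      rw [norm_smul, mul_pow, Real.norm_eq_abs, sq_abs]
      have e1 : (inner ℝ (feat e ψ J y - feat e ψ J z) δ : ℝ) ^ 2
          ≤ (K * d * ‖w.2.1‖ * ‖δ‖) ^ 2 := by
        rw [← sq_abs]
        refine pow_le_pow_left₀ (abs_nonneg _) ((abs_real_inner_le_norm _ _).trans ?_) 2
        gcongr
      rw [inner_sub_left] at e1
      have e3 : (inner ℝ (feat e ψ J y) δ : ℝ) ^ 2 ≤ 2 * (inner ℝ (feat e ψ J z) δ : ℝ) ^ 2
          + 2 * (K ^ 2 * (d ^ 2 * ‖δ‖ ^ 2) * ‖w.2.1‖ ^ 2) := by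
        nlinarith [sq_nonneg ((inner ℝ (feat e ψ J y) δ : ℝ) - 2 * inner ℝ (feat e ψ J z) δ)]
      exact mul_le_mul e3 hN2 (by positivity) (by positivity)
    simp only [hg1, hg2, hg3, hg4, hg5]
    nlinarith [c2, c3, c4]
  obtain ⟨h1, h2⟩ := memLp_two_of_sq_le hsm.aestronglyMeasurable i15 hpt
  refine ⟨h1, h2.trans ?_⟩
  rw [integral_add i14 i5, integral_add i13 i4, integral_add i12 i3, integral_add i1 i2, hg1, hg2,
    hg3, hg4, hg5]
  simp only [integral_const_mul]
  have b2 := h.noise_regressor_sq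
  have b3 := integral_residual_sq_le h he (e := e) hJ
  have b4 := h.regressor_sq
  have b5 := integral_inner_feat_sq_le h he hJ δ
  generalize (J : ℝ) ^ (-s) = r at b3 ⊢
  calc _ ≤ 4 * (K ^ 3 * (J * T ^ (2 - κ))) + 4 * (K * d) ^ 2 * K ^ 2
        + 8 * K ^ 2 * J * (K * r) ^ 2
        + (32 * K ^ 4 * (J * t ^ 2) + 8 * K ^ 4 * (J * d ^ 2 * ‖δ‖ ^ 2)) * K ^ 2
        + 8 * K ^ 2 * J * (K * ‖δ‖) ^ 2 := by gcongr
    _ = 4 * K ^ 3 * (J * T ^ (2 - κ)) + 4 * K ^ 4 * d ^ 2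
        + 8 * K ^ 4 * (J * r ^ 2) + 32 * K ^ 6 * (J * t ^ 2)
        + 8 * K ^ 6 * (J * d ^ 2 * ‖δ‖ ^ 2) + 8 * K ^ 4 * (J * ‖δ‖ ^ 2) := by ring
    _ ≤ 4 * K ^ 6 * (J * T ^ (2 - κ)) + 4 * K ^ 6 * d ^ 2
        + 8 * K ^ 6 * (J * r ^ 2) + 32 * K ^ 6 * d ^ 2
        + 8 * K ^ 6 * (J * d ^ 2 * ‖δ‖ ^ 2) + 8 * K ^ 6 * (J * ‖δ‖ ^ 2) := by
      have e1 : K ^ 3 ≤ K ^ 6 := pow_le_pow_right₀ hK1 (by norm_num)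
      have e2 : K ^ 4 ≤ K ^ 6 := pow_le_pow_right₀ hK1 (by norm_num)
      gcongr
    _ ≤ _ := by
      have p1 : 0 ≤ K ^ 6 * (J * T ^ (2 - κ)) := by positivity
      have p2 : 0 ≤ K ^ 6 * d ^ 2 := by positivity
      have p3 : 0 ≤ K ^ 6 * (J * r ^ 2) := by positivity
      have p4 : 0 ≤ K ^ 6 * (J * d ^ 2 * ‖δ‖ ^ 2) := by positivity
      have p5 : 0 ≤ K ^ 6 * (J * ‖δ‖ ^ 2) := by positivity
      nlinarith

theorem proj_residual_smul_integrable (J : ℕ) (θ : EuclideanSpace ℝ (Fin p)) :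
    Integrable (fun w => (F₀ (index θ₀ w) - proj ν θ₀ ψ J F₀ (index θ w))
      • feat e ψ J (index θ w)) ν :=
  integrable_smul_of_memLp ((link_index_memLp h he).sub (proj_index_memLp h he J θ))
    (feat_memLp h he J θ)

theorem inner_feat_smul_integrable (J : ℕ) (θ : EuclideanSpace ℝ (Fin p)) (v : H) :
    Integrable (fun w => (inner ℝ (feat e ψ J (index θ w)) v : ℝ) • feat e ψ J (index θ w)) ν :=
  integrable_smul_of_memLp ((feat_memLp h he J θ).inner_const (𝕜 := ℝ) v) (feat_memLp h he J θ)

/-- The mean of the stochastic gradient. -/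
theorem integral_gradSample {J : ℕ} (θ : EuclideanSpace ℝ (Fin p)) {v : H}
    (hv : v ∈ sieveSub e J) :
    ∫ w, gradSample e ψ J θ v w ∂ν = biasDrift e ν θ₀ F₀ ψ J θ
      - gramOp e ν θ₀ ψ J (v - coefStar e ν θ₀ F₀ ψ J)
      - gramDrift e ν θ₀ ψ J θ (v - coefStar e ν θ₀ F₀ ψ J) := by
  set δ := v - coefStar e ν θ₀ F₀ ψ J with hδ
  have hδm : δ ∈ sieveSub e J := Submodule.sub_mem _ hv (emb_mem _ _)
  have i1 := integrable_smul_of_memLp (noise_memLp_two h) (feat_memLp h he (e := e) J θ)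
  have i2 := proj_residual_smul_integrable h he (e := e) J θ
  have i3 := inner_feat_smul_integrable h he (e := e) J θ δ
  have i12 : Integrable (fun w => noise θ₀ F₀ w • feat e ψ J (index θ w)
      + (F₀ (index θ₀ w) - proj ν θ₀ ψ J F₀ (index θ w)) • feat e ψ J (index θ w)) ν := i1.add i2
  simp only [gradSample_eq h he (ν := ν)]
  rw [integral_sub i12 i3, integral_add i1 i2, integral_noise_smul_feat h he, gramDrift,
    integral_inner_smul_feat h he hδm, biasDrift]
  abel

theorem integrable_gradSample (J : ℕ) (θ : EuclideanSpace ℝ (Fin p)) (v : H) :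
    Integrable (gradSample e ψ J θ v) ν := by
  have i1 := integrable_smul_of_memLp (noise_memLp_two h) (feat_memLp h he (e := e) J θ)
  have i2 := proj_residual_smul_integrable h he (e := e) J θ
  have i3 := inner_feat_smul_integrable h he (e := e) J θ (v - coefStar e ν θ₀ F₀ ψ J)
  refine ((i1.add i2).sub i3).congr (Eventually.of_forall fun w => ?_)
  rw [gradSample_eq h he (ν := ν)]
  rfl

theorem integral_remSample {J : ℕ} (T : ℝ) (θ : EuclideanSpace ℝ (Fin p)) {v : H}
    (hv : v ∈ sieveSub e J) :
    ∫ w, remSample e θ₀ F₀ ψ J T θ v w ∂ν = biasDrift e ν θ₀ F₀ ψ J θ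
      - gramOp e ν θ₀ ψ J (v - coefStar e ν θ₀ F₀ ψ J)
      - gramDrift e ν θ₀ ψ J θ (v - coefStar e ν θ₀ F₀ ψ J)
      - ∫ w, truncNoise θ₀ F₀ T w • feat e ψ J (index θ₀ w) ∂ν := by
  unfold remSample
  rw [integral_sub (integrable_gradSample h he J θ v) (integrable_truncNoise_smul h he J T),
    integral_gradSample h he θ hv]

/-! ### The perturbation of the Gram operator -/

theorem inner_gramDrift (J : ℕ) (θ : EuclideanSpace ℝ (Fin p)) (v x : H) :
    inner ℝ x (gramDrift e ν θ₀ ψ J θ v)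
      = ∫ w, inner ℝ (feat e ψ J (index θ w)) v * inner ℝ (feat e ψ J (index θ w)) x ∂ν
        - ∫ w, inner ℝ (feat e ψ J (index θ₀ w)) v * inner ℝ (feat e ψ J (index θ₀ w)) x ∂ν := by
  have key : ∀ θ' : EuclideanSpace ℝ (Fin p),
      inner ℝ x (∫ w, (inner ℝ (feat e ψ J (index θ' w)) v : ℝ) • feat e ψ J (index θ' w) ∂ν)
        = ∫ w, inner ℝ (feat e ψ J (index θ' w)) v * inner ℝ (feat e ψ J (index θ' w)) x ∂ν := by
    intro θ'
    rw [← integral_inner (inner_feat_smul_integrable h he J θ' v)]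
    refine integral_congr_ae (Eventually.of_forall fun w => ?_)
    simp only
    rw [inner_smul_right, real_inner_comm x]
  rw [gramDrift, inner_sub_right, key, key]

theorem inner_gramDrift_comm (J : ℕ) (θ : EuclideanSpace ℝ (Fin p)) (v x : H) :
    inner ℝ x (gramDrift e ν θ₀ ψ J θ v) = inner ℝ v (gramDrift e ν θ₀ ψ J θ x) := by
  rw [inner_gramDrift h he, inner_gramDrift h he]
  simp only [mul_comm]

theorem norm_sq_gramDrift (J : ℕ) (θ : EuclideanSpace ℝ (Fin p)) (v : H) :
    ‖gramDrift e ν θ₀ ψ J θ v‖ ^ 2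
      = ∑ i : Fin J, (inner ℝ (gramDrift e ν θ₀ ψ J θ (e i)) v : ℝ) ^ 2 := by
  rw [norm_sq_eq_sum_of_mem he (gramDrift_mem he J θ v)]
  exact Finset.sum_congr rfl fun i _ => by rw [inner_gramDrift_comm h he, real_inner_comm]

theorem norm_sub_gramDrift_le (hα : 0 ≤ αψ) (J : ℕ) (θ θ' : EuclideanSpace ℝ (Fin p)) (v : H) :
    ‖gramDrift e ν θ₀ ψ J θ v - gramDrift e ν θ₀ ψ J θ' v‖
      ≤ 2 * K ^ 3 * (J * (J : ℝ) ^ αψ * ‖θ - θ'‖) * ‖v‖ := by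
  have hK := h.pos
  have i1 := inner_feat_smul_integrable h he (e := e) J θ v
  have i2 := inner_feat_smul_integrable h he (e := e) J θ' v
  rw [gramDrift, gramDrift, sub_sub_sub_cancel_right, ← integral_sub i1 i2]
  refine (norm_integral_le_integral_norm _).trans ?_
  refine (integral_mono_of_nonneg (Eventually.of_forall fun _ => norm_nonneg _)
    (((regressor_norm_memLp h).integrable one_le_two).const_mul
      (2 * K ^ 2 * (J * (J : ℝ) ^ αψ * ‖θ - θ'‖) * ‖v‖))
    (Eventually.of_forall fun w => ?_)).trans ?_
  · simp only
    have hD := norm_feat_index_sub_le h he (e := e) hα J θ θ' w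
    have hN := norm_feat_le h he (e := e) J (index θ w)
    have hN' := norm_feat_le h he (e := e) J (index θ' w)
    have hid : (inner ℝ (feat e ψ J (index θ w)) v : ℝ) • feat e ψ J (index θ w)
        - (inner ℝ (feat e ψ J (index θ' w)) v : ℝ) • feat e ψ J (index θ' w)
        = (inner ℝ (feat e ψ J (index θ w) - feat e ψ J (index θ' w)) v : ℝ)
            • feat e ψ J (index θ w)
          + (inner ℝ (feat e ψ J (index θ' w)) v : ℝ)
            • (feat e ψ J (index θ w) - feat e ψ J (index θ' w)) := by
      rw [inner_sub_left]; module
    rw [hid]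
    refine (norm_add_le _ _).trans ?_
    rw [norm_smul, norm_smul]
    have n1 := norm_inner_le_norm (𝕜 := ℝ) (feat e ψ J (index θ w) - feat e ψ J (index θ' w)) v
    have n2 := norm_inner_le_norm (𝕜 := ℝ) (feat e ψ J (index θ' w)) v
    calc _ ≤ (K * (√J * (J : ℝ) ^ αψ * ‖θ - θ'‖) * ‖w.2.1‖ * ‖v‖) * (K * √J)
          + (K * √J * ‖v‖) * (K * (√J * (J : ℝ) ^ αψ * ‖θ - θ'‖) * ‖w.2.1‖) := by
          gcongr
          · exact n1.trans (by gcongr)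
          · exact n2.trans (by gcongr)
      _ = 2 * K ^ 2 * ((√J * √J) * (J : ℝ) ^ αψ * ‖θ - θ'‖) * ‖v‖ * ‖w.2.1‖ := by ring
      _ = _ := by rw [Real.mul_self_sqrt (by positivity)]
  · rw [integral_const_mul]
    calc _ ≤ 2 * K ^ 2 * (J * (J : ℝ) ^ αψ * ‖θ - θ'‖) * ‖v‖ * K := by
          have := integral_regressor_norm_le h
          gcongr
      _ = _ := by ring

theorem sum_norm_sq_gramDrift_le (hα : 0 ≤ αψ) {J : ℕ} (hJ : 1 ≤ J)
    (θ : EuclideanSpace ℝ (Fin p)) :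
    ∑ i : Fin J, ‖gramDrift e ν θ₀ ψ J θ (e i)‖ ^ 2
      ≤ 9 * K ^ 8 * ((√J * (J : ℝ) ^ αψ * ‖θ - θ₀‖) ^ 2
        * (1 + (√J * (J : ℝ) ^ αψ * ‖θ - θ₀‖) ^ 2)) := by
  have hK := h.pos
  have hK1 := h.one_le
  set d := √J * (J : ℝ) ^ αψ * ‖θ - θ₀‖ with hd
  set D : Obs p → H := fun w => feat e ψ J (index θ w) - feat e ψ J (index θ₀ w) with hDdef
  have hDm : MemLp D 2 ν := featDiff_memLp h he J θ
  have hΦ := feat_memLp h he (e := e) J θ₀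
  set E := ∫ w, ‖D w‖ ^ 2 ∂ν with hE
  have hE0 : 0 ≤ E := integral_nonneg fun _ => by positivity
  have hEd : E ≤ K ^ 4 * d ^ 2 := (integral_featDiff_sq_le h he hα J θ).trans (by
    rw [mul_pow]; exact le_of_eq (by ring))
  have hDi : ∀ i : Fin J, MemLp (fun w => (inner ℝ (D w) (e i) : ℝ)) 2 ν := fun i =>
    hDm.inner_const (𝕜 := ℝ) _
  have hΦi : ∀ i : Fin J, MemLp (fun w => (inner ℝ (feat e ψ J (index θ₀ w)) (e i) : ℝ)) 2 ν :=
    fun i => hΦ.inner_const (𝕜 := ℝ) _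
  set V : Fin J → ℝ := fun i => ∫ w, (inner ℝ (D w) (e i) : ℝ) ^ 2 ∂ν with hV
  have hV0 : ∀ i, 0 ≤ V i := fun i => integral_nonneg fun _ => sq_nonneg _
  have hVE : ∑ i, V i = E := by
    rw [hV, ← integral_finsetSum _ fun i _ => (hDi i).integrable_sq, hE]
    refine integral_congr_ae (Eventually.of_forall fun w => ?_)
    simp only
    rw [norm_sq_eq_sum_of_mem he (Submodule.sub_mem _ (feat_mem J _) (feat_mem J _) : D w ∈ _)]
    exact Finset.sum_congr rfl fun i _ => by rw [real_inner_comm]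
  have t1 : ∀ i : Fin J, ‖∫ w, (inner ℝ (D w) (e i) : ℝ) • feat e ψ J (index θ₀ w) ∂ν‖ ^ 2
      ≤ V i * K ^ 2 := by
    intro i
    have := norm_integral_smul_le (hDi i) hΦ (Real.sqrt_nonneg (V i)) hK.le
      (by rw [Real.sq_sqrt (hV0 i)]) fun v => integral_inner_feat_sq_le h he hJ v
    calc _ ≤ (√(V i) * K) ^ 2 := by gcongr
      _ = _ := by rw [mul_pow, Real.sq_sqrt (hV0 i)]
  have t3 : ∀ i : Fin J, ‖∫ w, (inner ℝ (D w) (e i) : ℝ) • D w ∂ν‖ ^ 2 ≤ V i * E := by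
    intro i
    have := norm_integral_smul_le (hDi i) hDm (Real.sqrt_nonneg (V i)) (Real.sqrt_nonneg E)
      (by rw [Real.sq_sqrt (hV0 i)]) fun v => by
        rw [mul_pow, Real.sq_sqrt hE0, hE, ← integral_mul_const]
        refine integral_mono ((hDm.inner_const (𝕜 := ℝ) v).integrable_sq)
          ((integrable_norm_sq hDm).mul_const _) fun w => ?_
        simp only
        rw [← mul_pow, ← sq_abs]
        exact pow_le_pow_left₀ (abs_nonneg _) (abs_real_inner_le_norm _ _) 2
    calc _ ≤ (√(V i) * √E) ^ 2 := by gcongr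
      _ = _ := by rw [mul_pow, Real.sq_sqrt (hV0 i), Real.sq_sqrt hE0]
  have hent : ∀ i l : Fin J,
      inner ℝ (e l) (∫ w, (inner ℝ (feat e ψ J (index θ₀ w)) (e i) : ℝ) • D w ∂ν)
        = inner ℝ (e i) (∫ w, (inner ℝ (D w) (e l) : ℝ) • feat e ψ J (index θ₀ w) ∂ν) := by
    intro i l
    rw [← integral_inner (integrable_smul_of_memLp (hΦi i) hDm),
      ← integral_inner (integrable_smul_of_memLp (hDi l) hΦ)]
    refine integral_congr_ae (Eventually.of_forall fun w => ?_)
    simp only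
    rw [inner_smul_right, inner_smul_right, real_inner_comm (D w), real_inner_comm _ (e i),
      mul_comm]
  have t2 : ∑ i : Fin J, ‖∫ w, (inner ℝ (feat e ψ J (index θ₀ w)) (e i) : ℝ) • D w ∂ν‖ ^ 2
      ≤ E * K ^ 2 := by
    have hDmem : ∀ i : Fin J,
        ∫ w, (inner ℝ (feat e ψ J (index θ₀ w)) (e i) : ℝ) • D w ∂ν ∈ sieveSub e J := fun i =>
      integral_mem_sieveSub he J fun w => Submodule.smul_mem _ _
        (Submodule.sub_mem _ (feat_mem J _) (feat_mem J _))
    have hΦmem : ∀ l : Fin J,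
        ∫ w, (inner ℝ (D w) (e l) : ℝ) • feat e ψ J (index θ₀ w) ∂ν ∈ sieveSub e J := fun i =>
      integral_mem_sieveSub he J fun w => Submodule.smul_mem _ _ (feat_mem J _)
    calc _ = ∑ i : Fin J, ∑ l : Fin J, (inner ℝ (e i)
          (∫ w, (inner ℝ (D w) (e l) : ℝ) • feat e ψ J (index θ₀ w) ∂ν) : ℝ) ^ 2 :=
          Finset.sum_congr rfl fun i _ => by
            rw [norm_sq_eq_sum_of_mem he (hDmem i)]
            exact Finset.sum_congr rfl fun l _ => by rw [hent]
      _ = ∑ l : Fin J, ‖∫ w, (inner ℝ (D w) (e l) : ℝ) • feat e ψ J (index θ₀ w) ∂ν‖ ^ 2 := by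
          rw [Finset.sum_comm]
          exact Finset.sum_congr rfl fun l _ => (norm_sq_eq_sum_of_mem he (hΦmem l)).symm
      _ ≤ ∑ l, V l * K ^ 2 := Finset.sum_le_sum fun l _ => t1 l
      _ = _ := by rw [← Finset.sum_mul, hVE]
  have hdec : ∀ i : Fin J, gramDrift e ν θ₀ ψ J θ (e i)
      = ∫ w, (inner ℝ (D w) (e i) : ℝ) • feat e ψ J (index θ₀ w) ∂ν
        + ∫ w, (inner ℝ (feat e ψ J (index θ₀ w)) (e i) : ℝ) • D w ∂ν
        + ∫ w, (inner ℝ (D w) (e i) : ℝ) • D w ∂ν := by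
    intro i
    have j1 := integrable_smul_of_memLp (hDi i) hΦ
    have j2 := integrable_smul_of_memLp (hΦi i) hDm
    have j3 := integrable_smul_of_memLp (hDi i) hDm
    have j12 : Integrable (fun w => (inner ℝ (D w) (e i) : ℝ) • feat e ψ J (index θ₀ w)
        + (inner ℝ (feat e ψ J (index θ₀ w)) (e i) : ℝ) • D w) ν := j1.add j2
    rw [← integral_add j1 j2, ← integral_add j12 j3, gramDrift,
      ← integral_sub (inner_feat_smul_integrable h he J θ (e i))
        (inner_feat_smul_integrable h he J θ₀ (e i))]
    refine integral_congr_ae (Eventually.of_forall fun w => ?_)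
    simp only [hDdef]
    rw [inner_sub_left]
    module
  calc _ ≤ ∑ i : Fin J, 3 * (V i * K ^ 2
        + ‖∫ w, (inner ℝ (feat e ψ J (index θ₀ w)) (e i) : ℝ) • D w ∂ν‖ ^ 2 + V i * E) := by
        refine Finset.sum_le_sum fun i _ => ?_
        rw [hdec]
        have h3 := norm_add₃_le (a := ∫ w, (inner ℝ (D w) (e i) : ℝ) • feat e ψ J (index θ₀ w) ∂ν)
          (b := ∫ w, (inner ℝ (feat e ψ J (index θ₀ w)) (e i) : ℝ) • D w ∂ν)
          (c := ∫ w, (inner ℝ (D w) (e i) : ℝ) • D w ∂ν)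
        have h4 := pow_le_pow_left₀ (norm_nonneg _) h3 2
        have s1 := t1 i
        have s3 := t3 i
        refine h4.trans ?_
        generalize ‖∫ w, (inner ℝ (D w) (e i) : ℝ) • feat e ψ J (index θ₀ w) ∂ν‖ = a1 at *
        generalize ‖∫ w, (inner ℝ (feat e ψ J (index θ₀ w)) (e i) : ℝ) • D w ∂ν‖ = a2 at *
        generalize ‖∫ w, (inner ℝ (D w) (e i) : ℝ) • D w ∂ν‖ = a3 at *
        nlinarith [sq_nonneg (a1 - a2), sq_nonneg (a1 - a3), sq_nonneg (a2 - a3)]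
    _ ≤ 3 * (E * K ^ 2 + E * K ^ 2 + E * E) := by
        rw [← Finset.mul_sum, Finset.sum_add_distrib, Finset.sum_add_distrib, ← Finset.sum_mul,
          ← Finset.sum_mul, hVE]
        linarith
    _ ≤ 3 * (K ^ 4 * d ^ 2 * K ^ 2 + K ^ 4 * d ^ 2 * K ^ 2
          + (K ^ 4 * d ^ 2) * (K ^ 4 * d ^ 2)) := by gcongr
    _ = 6 * K ^ 6 * d ^ 2 + 3 * K ^ 8 * d ^ 4 := by ring
    _ ≤ 6 * K ^ 8 * d ^ 2 + 3 * K ^ 8 * d ^ 4 := by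
        have e2 : K ^ 6 ≤ K ^ 8 := pow_le_pow_right₀ hK1 (by norm_num)
        gcongr
    _ ≤ _ := by
        have q1 : 0 ≤ K ^ 8 * d ^ 2 := by positivity
        have q2 : 0 ≤ K ^ 8 * d ^ 4 := by positivity
        nlinarith

theorem norm_gramDrift_le (hα : 0 ≤ αψ) {J : ℕ} (hJ : 1 ≤ J) (θ : EuclideanSpace ℝ (Fin p))
    (v : H) : ‖gramDrift e ν θ₀ ψ J θ v‖ ≤ 3 * K ^ 4 * (√J * (J : ℝ) ^ αψ * ‖θ - θ₀‖
        * (1 + √J * (J : ℝ) ^ αψ * ‖θ - θ₀‖)) * ‖v‖ := by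
  have hs := sum_norm_sq_gramDrift_le h he hα hJ θ
  set d := √J * (J : ℝ) ^ αψ * ‖θ - θ₀‖ with hd
  have hd0 : 0 ≤ d := by positivity
  have hK := h.pos
  refine le_of_sq_le_sq ?_ (by positivity)
  rw [norm_sq_gramDrift h he]
  calc _ ≤ ∑ i : Fin J, ‖gramDrift e ν θ₀ ψ J θ (e i)‖ ^ 2 * ‖v‖ ^ 2 := by
        refine Finset.sum_le_sum fun i _ => ?_
        rw [← mul_pow, ← sq_abs]
        exact pow_le_pow_left₀ (abs_nonneg _) (abs_real_inner_le_norm _ _) 2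
    _ ≤ 9 * K ^ 8 * (d ^ 2 * (1 + d ^ 2)) * ‖v‖ ^ 2 := by
        rw [← Finset.sum_mul]; gcongr
    _ ≤ 9 * K ^ 8 * (d ^ 2 * (1 + d) ^ 2) * ‖v‖ ^ 2 := by
        gcongr; nlinarith
    _ = _ := by ring

end Estimates

end

section

/-! ### Powers of `k + 1` -/

theorem one_le_natCast_add_one (k : ℕ) : (1 : ℝ) ≤ (k : ℝ) + 1 := by
  linarith [(Nat.cast_nonneg k : (0 : ℝ) ≤ k)]

theorem natCast_add_one_pos (k : ℕ) : (0 : ℝ) < (k : ℝ) + 1 := by positivity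

theorem rpow_succ_mul (k : ℕ) (x y : ℝ) :
    ((k : ℝ) + 1) ^ x * ((k : ℝ) + 1) ^ y = ((k : ℝ) + 1) ^ (x + y) :=
  (Real.rpow_add (natCast_add_one_pos k) x y).symm

theorem rpow_succ_le (k : ℕ) {x y : ℝ} (h : x ≤ y) : ((k : ℝ) + 1) ^ x ≤ ((k : ℝ) + 1) ^ y :=
  Real.rpow_le_rpow_of_exponent_le (one_le_natCast_add_one k) h

theorem rpow_succ_le_one (k : ℕ) {x : ℝ} (h : x ≤ 0) : ((k : ℝ) + 1) ^ x ≤ 1 :=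
  Real.rpow_le_one_of_one_le_of_nonpos (one_le_natCast_add_one k) h

theorem rpow_succ_pos (k : ℕ) (x : ℝ) : 0 < ((k : ℝ) + 1) ^ x :=
  Real.rpow_pos_of_pos (natCast_add_one_pos k) x

theorem rpow_succ_pow_two (k : ℕ) (x : ℝ) : (((k : ℝ) + 1) ^ x) ^ 2 = ((k : ℝ) + 1) ^ (2 * x) := by
  rw [sq, rpow_succ_mul, two_mul]

/-- Shift of the base of a power bound. -/
theorem exists_le_rpow_succ {y : ℕ → ℝ} {C r : ℝ} (hC : 0 ≤ C)
    (h : ∀ k : ℕ, 1 ≤ k → y k ≤ C * (k : ℝ) ^ (-r)) :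
    ∃ C', 0 ≤ C' ∧ ∀ k : ℕ, y k ≤ C' * ((k : ℝ) + 1) ^ (-r) := by
  refine ⟨max |y 0| (C * 2 ^ |r|), le_max_of_le_left (abs_nonneg _), fun k => ?_⟩
  rcases Nat.eq_zero_or_pos k with rfl | hk
  · simpa using Or.inl (le_abs_self (y 0))
  · have hk0 : (0 : ℝ) < k := by exact_mod_cast hk
    have hk1 : (1 : ℝ) ≤ k := by exact_mod_cast hk
    have hle : (k : ℝ) ^ (-r) ≤ 2 ^ |r| * ((k : ℝ) + 1) ^ (-r) := by
      rcases le_total 0 r with hr | hr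
      · rw [abs_of_nonneg hr, Real.rpow_neg hk0.le, Real.rpow_neg (natCast_add_one_pos k).le,
          ← div_eq_mul_inv, le_div_iff₀ (rpow_succ_pos k r), ← div_eq_inv_mul,
          ← Real.div_rpow (natCast_add_one_pos k).le hk0.le]
        refine Real.rpow_le_rpow (by positivity) ?_ hr
        rw [div_le_iff₀ hk0]; linarith
      · calc (k : ℝ) ^ (-r) ≤ ((k : ℝ) + 1) ^ (-r) :=
              Real.rpow_le_rpow hk0.le (by linarith) (by linarith)
          _ ≤ _ := le_mul_of_one_le_left (rpow_succ_pos k _).le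
              (Real.one_le_rpow one_le_two (abs_nonneg r))
    calc y k ≤ C * (k : ℝ) ^ (-r) := h k hk
      _ ≤ C * (2 ^ |r| * ((k : ℝ) + 1) ^ (-r)) := by gcongr
      _ = C * 2 ^ |r| * ((k : ℝ) + 1) ^ (-r) := by ring
      _ ≤ _ := mul_le_mul_of_nonneg_right (le_max_right _ _) (rpow_succ_pos k _).le

theorem norm_average_sq_le {H : Type*} [NormedAddCommGroup H] [NormedSpace ℝ H] {B : ℕ}
    (x : Fin B → H) : ‖(B : ℝ)⁻¹ • ∑ i, x i‖ ^ 2 ≤ (B : ℝ)⁻¹ * ∑ i, ‖x i‖ ^ 2 := by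
  rw [norm_smul, mul_pow, Real.norm_of_nonneg (by positivity)]
  rcases Nat.eq_zero_or_pos B with rfl | hB
  · simp
  have hB0 : (0 : ℝ) < B := by exact_mod_cast hB
  have h1 : ‖∑ i, x i‖ ^ 2 ≤ B * ∑ i, ‖x i‖ ^ 2 := by
    calc _ ≤ (∑ i, ‖x i‖) ^ 2 := by gcongr; exact norm_sum_le _ _
      _ ≤ _ := by simpa using sq_sum_le_card_mul_sum_sq (s := Finset.univ) (f := fun i => ‖x i‖)
  calc _ ≤ (B : ℝ)⁻¹ ^ 2 * (B * ∑ i, ‖x i‖ ^ 2) := by gcongr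
    _ = _ := by field_simp

theorem le_past {Ω ι : Type*} {m : ℕ+ × ι → MeasurableSpace Ω} {k : ℕ} (x : ℕ+ × ι)
    (hx : (x.1 : ℕ) ≤ k) : m x ≤ ⨆ y ∈ {y : ℕ+ × ι | (y.1 : ℕ) ≤ k}, m y :=
  le_iSup₂ (f := fun y (_ : y ∈ {y : ℕ+ × ι | (y.1 : ℕ) ≤ k}) => m y) x hx

theorem indep_past {Ω ι : Type*} {m0 : MeasurableSpace Ω} {P : Measure Ω} [IsProbabilityMeasure P]
    {m : ℕ+ × ι → MeasurableSpace Ω} (hle : ∀ x, m x ≤ m0) (hi : iIndep m P) (k : ℕ) (i : ι) :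
    Indep (⨆ y ∈ {y : ℕ+ × ι | (y.1 : ℕ) ≤ k}, m y) (m (⟨k + 1, k.succ_pos⟩, i)) P := by
  have hdisj : Disjoint {y : ℕ+ × ι | (y.1 : ℕ) ≤ k} {(⟨k + 1, k.succ_pos⟩, i)} := by
    simp
  refine indep_of_indep_of_le_right (indep_iSup_of_disjoint hle hi hdisj) ?_
  exact le_iSup₂ (f := fun y (_ : y ∈ ({(⟨k + 1, k.succ_pos⟩, i)} : Set (ℕ+ × ι))) => m y) _ rfl

/-! ### The setting with an everywhere controlled plug-in estimate -/

/-- Data and conditions of the online estimator, when the plug-in error is at most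
`M (k+1)^{-α}` everywhere. -/
structure Setting (Ω H : Type*) [MeasurableSpace Ω] [NormedAddCommGroup H]
    [InnerProductSpace ℝ H] (p B : ℕ) where
  P : Measure Ω
  ν : Measure (Obs p)
  θ₀ : EuclideanSpace ℝ (Fin p)
  F₀ : ℝ → ℝ
  ψ : ℕ → ℝ → ℝ
  W : ℕ → Fin B → Ω → Obs p
  θc : ℕ → Ω → EuclideanSpace ℝ (Fin p)
  J₀ : ℕ
  b₀ : Fin J₀ → ℝ
  e : ℕ → H
  (η₀ a j f α s s₁ κ K M c ρ : ℝ)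
  prob : IsProbabilityMeasure P
  probν : IsProbabilityMeasure ν
  one_le_B : 1 ≤ B
  one_le_J₀ : 1 ≤ J₀
  data : IIDBatches P ν W
  adapted : ∀ k, Measurable[dataSigma W k] (θc k)
  rate : ∀ k ω, ‖θc k ω - θ₀‖ ≤ M * ((k : ℝ) + 1) ^ (-α)
  reg : Regular ν θ₀ F₀ ψ f s s₁ κ K
  ortho : Orthonormal ℝ e
  η₀_pos : 0 < η₀
  a_pos : 0 < a
  j_pos : 0 < j
  f_nonneg : 0 ≤ f
  s_pos : 0 < s
  s₁_nonneg : 0 ≤ s₁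
  M_nonneg : 0 ≤ M
  c_pos : 0 < c
  three_j : 3 * j + 4 * c ≤ a
  four_j : a + 4 * j + 8 * c ≤ 1
  D_lower : j + 4 * c ≤ 2 * (α - j * (1 / 2 + f))
  sj_lower : 2 * j + 4 * c ≤ 2 * (s * j)
  κ_lower : 4 * c ≤ j * (κ - 4)
  ρ_le_sj : ρ ≤ s * j
  ρ_le_α : ρ ≤ α - j / 2
  ρ_le : ρ ≤ (1 + j) / 2 + c
  ρ_lower : a - j ≤ 2 * ρ
  D_add_ρ : (1 + j) / 2 + 2 * c ≤ α - j * (1 / 2 + f) + ρ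
  D_add_a : 1 + j + 8 * c ≤ 2 * (α - j * (1 / 2 + f)) + a
  D_add_sj : (1 + j) / 2 + c ≤ s * j + (α - j * (1 / 2 + f))
  s₁j_add : (1 + j) / 2 + c ≤ s₁ * j + (α - j / 2)

attribute [instance] Setting.prob Setting.probν

namespace Setting

variable {Ω H : Type*} [mΩ : MeasurableSpace Ω] [NormedAddCommGroup H] [InnerProductSpace ℝ H]
  {p B : ℕ} (S : Setting Ω H p B)

/-- Rate exponent of the perturbation of the features. -/
def D : ℝ := S.α - S.j * (1 / 2 + S.f)

/-- Target exponent for sums. -/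
def b : ℝ := (1 - S.j) / 2 - S.c

def J (k : ℕ) : ℕ := sieveDim S.J₀ S.j k

def G (k : ℕ) : H →L[ℝ] H := gramOp S.e S.ν S.θ₀ S.ψ (S.J k)

def Q (k : ℕ) : H →L[ℝ] H := gramInv S.e S.ν S.θ₀ S.ψ (S.J k)

def η (k : ℕ) : ℝ := learningRate S.η₀ S.a k

/-- Pseudo-true coefficients. -/
def bStar (k : ℕ) : H := coefStar S.e S.ν S.θ₀ S.F₀ S.ψ (S.J k)

/-- Truncation level. -/
def T (k : ℕ) : ℝ := (k : ℝ) ^ S.j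

/-- The online coefficient in `H`. -/
def coef : ℕ → Ω → H
  | 0 => fun _ => emb S.e (S.J 0) (pad _ S.b₀)
  | k + 1 => fun ω => coef k ω + (S.η (k + 1) / B) •
      ∑ i : Fin B, gradSample S.e S.ψ (S.J (k + 1)) (S.θc k ω) (coef k ω) (S.W (k + 1) i ω)

def δ (k : ℕ) (ω : Ω) : H := S.coef k ω - S.bStar (k + 1)

def g (k : ℕ) (ω : Ω) : H := biasDrift S.e S.ν S.θ₀ S.F₀ S.ψ (S.J (k + 1)) (S.θc k ω)

def h (k : ℕ) (ω : Ω) : H := gramDrift S.e S.ν S.θ₀ S.ψ (S.J (k + 1)) (S.θc k ω) (S.δ k ω)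

def trunc : ℕ → Ω → H
  | 0 => fun _ => 0
  | k + 1 => fun ω => (B : ℝ)⁻¹ •
      ∑ i : Fin B, truncScore S.e S.ν S.θ₀ S.F₀ S.ψ (S.J (k + 1)) (S.T (k + 1)) (S.W (k + 1) i ω)

def rem : ℕ → Ω → H
  | 0 => fun _ => 0
  | k + 1 => fun ω => (B : ℝ)⁻¹ • ∑ i : Fin B,
      (remSample S.e S.θ₀ S.F₀ S.ψ (S.J (k + 1)) (S.T (k + 1)) (S.θc k ω) (S.coef k ω)
          (S.W (k + 1) i ω)
        - ∫ w, remSample S.e S.θ₀ S.F₀ S.ψ (S.J (k + 1)) (S.T (k + 1)) (S.θc k ω)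
          (S.coef k ω) w ∂S.ν)

def tail : ℕ → Ω → H
  | 0 => fun _ => 0
  | k + 1 => fun ω => (B : ℝ)⁻¹ • ∑ i : Fin B,
      (tailSample S.e S.θ₀ S.F₀ S.ψ (S.J (k + 1)) (S.T (k + 1)) (S.W (k + 1) i ω)
        - ∫ w, tailSample S.e S.θ₀ S.F₀ S.ψ (S.J (k + 1)) (S.T (k + 1)) w ∂S.ν)

/-! Elementary facts. -/

theorem K_pos : 0 < S.K := S.reg.pos

theorem D_pos : 0 < S.D := by
  have := S.D_lower; have := S.j_pos; have := S.c_pos; unfold D; linarith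

include S in
theorem B_pos : (0 : ℝ) < B := by exact_mod_cast S.one_le_B

theorem a_lt_one : S.a < 1 := by
  have := S.four_j; have := S.j_pos; have := S.c_pos; linarith

theorem J₀_pos : (0 : ℝ) < S.J₀ := by exact_mod_cast S.one_le_J₀

theorem J_succ (k : ℕ) : S.J (k + 1) = ⌊(S.J₀ : ℝ) * ((k : ℝ) + 1) ^ S.j⌋₊ := by
  simp [J, sieveDim]

theorem J_zero : S.J 0 = S.J₀ := by simp [J, sieveDim]

theorem J₀_le_J (k : ℕ) : S.J₀ ≤ S.J k := by
  cases k with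
  | zero => rw [J_zero]
  | succ k =>
    rw [J_succ]
    refine Nat.le_floor (le_mul_of_one_le_right S.J₀_pos.le ?_)
    exact Real.one_le_rpow (one_le_natCast_add_one k) S.j_pos.le

theorem one_le_J (k : ℕ) : 1 ≤ S.J k := S.one_le_J₀.trans (S.J₀_le_J k)

theorem J_le_J_succ (k : ℕ) : S.J k ≤ S.J (k + 1) := by
  cases k with
  | zero => rw [J_zero]; exact S.J₀_le_J 1
  | succ k =>
    rw [J_succ, J_succ]
    refine Nat.floor_le_floor ?_
    have := S.j_pos
    push_cast
    gcongr
    linarith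

theorem J_mono : Monotone S.J := monotone_nat_of_le_succ S.J_le_J_succ

theorem J_succ_le (k : ℕ) : (S.J (k + 1) : ℝ) ≤ S.J₀ * ((k : ℝ) + 1) ^ S.j := by
  rw [J_succ]
  exact Nat.floor_le (by positivity)

theorem le_J_succ (k : ℕ) : (S.J₀ : ℝ) * ((k : ℝ) + 1) ^ S.j / 2 ≤ S.J (k + 1) := by
  have h1 : (1 : ℝ) ≤ S.J (k + 1) := by exact_mod_cast S.one_le_J (k + 1)
  have h2 := Nat.lt_floor_add_one ((S.J₀ : ℝ) * ((k : ℝ) + 1) ^ S.j)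
  rw [← J_succ] at h2
  linarith

theorem J_pos (k : ℕ) : (0 : ℝ) < S.J k := by exact_mod_cast S.one_le_J k

theorem η_succ (k : ℕ) : S.η (k + 1) = S.η₀ * ((k : ℝ) + 1) ^ (-S.a) := by
  simp [η, learningRate]

theorem η_pos (k : ℕ) : 0 < S.η (k + 1) := by
  rw [η_succ]; exact mul_pos S.η₀_pos (rpow_succ_pos k _)

theorem T_succ (k : ℕ) : S.T (k + 1) = ((k : ℝ) + 1) ^ S.j := by simp [T]

theorem T_pos (k : ℕ) : 0 < S.T (k + 1) := by rw [T_succ]; exact rpow_succ_pos k _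

theorem exists_J_rpow_neg_le {x : ℝ} (hx : 0 ≤ x) : ∃ C, 0 ≤ C ∧ ∀ k : ℕ,
    (S.J (k + 1) : ℝ) ^ (-x) ≤ C * ((k : ℝ) + 1) ^ (-(x * S.j)) := by
  have hJ := S.J₀_pos
  refine ⟨((S.J₀ : ℝ) / 2) ^ (-x), by positivity, fun k => ?_⟩
  have h1 := S.le_J_succ k
  have h2 : ((k : ℝ) + 1) ^ (-(x * S.j)) = (((k : ℝ) + 1) ^ S.j) ^ (-x) := by
    rw [← Real.rpow_mul (natCast_add_one_pos k).le]; ring_nf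
  rw [h2, ← Real.mul_rpow (by positivity) (rpow_succ_pos k _).le]
  exact Real.rpow_le_rpow_of_nonpos (mul_pos (by positivity) (rpow_succ_pos k _)) (by linarith)
    (by linarith)

/-- The perturbation of the features is of order `(k+1)^{-D}`. -/
theorem exists_plugIn_le : ∃ C, 0 ≤ C ∧ ∀ (k : ℕ) (θ : EuclideanSpace ℝ (Fin p)) (A : ℝ), 0 ≤ A →
    ‖θ - S.θ₀‖ ≤ A * ((k : ℝ) + 1) ^ (-S.α) →
    √(S.J (k + 1)) * (S.J (k + 1) : ℝ) ^ S.f * ‖θ - S.θ₀‖ ≤ C * A * ((k : ℝ) + 1) ^ (-S.D) := by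
  refine ⟨√S.J₀ * (S.J₀ : ℝ) ^ S.f, by positivity, fun k θ A hA hθ => ?_⟩
  have h1 := S.J_succ_le k
  have hf := S.f_nonneg
  have hp := natCast_add_one_pos k
  calc _ ≤ √(S.J₀ * ((k : ℝ) + 1) ^ S.j) * (S.J₀ * ((k : ℝ) + 1) ^ S.j) ^ S.f
        * (A * ((k : ℝ) + 1) ^ (-S.α)) := by gcongr
    _ = √S.J₀ * (S.J₀ : ℝ) ^ S.f * A * (((k : ℝ) + 1) ^ (S.j * (1 / 2))
          * ((k : ℝ) + 1) ^ (S.j * S.f) * ((k : ℝ) + 1) ^ (-S.α)) := by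
        rw [Real.sqrt_mul (by positivity), Real.mul_rpow (by positivity) (by positivity),
          Real.sqrt_eq_rpow (((k : ℝ) + 1) ^ S.j), ← Real.rpow_mul hp.le, ← Real.rpow_mul hp.le]
        ring
    _ = _ := by
        rw [rpow_succ_mul, rpow_succ_mul]
        congr 2
        unfold D; ring

/-! Filtration and independence. -/

/-- The filtration generated by the data. -/
def ℱ : Filtration ℕ mΩ where
  seq := dataSigma S.W
  mono' := by
    intro k l hkl
    refine iSup₂_le fun i hi => ?_
    exact le_iSup₂_of_le (f := fun l _ => ⨆ i : Fin B, MeasurableSpace.comap (S.W l i) inferInstance)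
      i (Finset.Icc_subset_Icc le_rfl hkl hi) le_rfl
  le' := fun k => iSup₂_le fun l hl => iSup_le fun i =>
    (S.data.measurable l i (Finset.mem_Icc.mp hl).1).comap_le

theorem measurable_W (k : ℕ) (i : Fin B) : Measurable (S.W (k + 1) i) :=
  S.data.measurable _ _ (Nat.le_add_left 1 k)

theorem measurable_W_ℱ (k : ℕ) (i : Fin B) : Measurable[S.ℱ (k + 1)] (S.W (k + 1) i) := by
  have : MeasurableSpace.comap (S.W (k + 1) i) inferInstance ≤ S.ℱ (k + 1) := by
    refine le_trans ?_ (le_iSup₂ (f := fun l (_ : l ∈ Finset.Icc 1 (k + 1)) => ⨆ i : Fin B,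
      MeasurableSpace.comap (S.W l i) inferInstance) (k + 1) (by simp))
    exact le_iSup (fun i => MeasurableSpace.comap (S.W (k + 1) i) inferInstance) i
  exact Measurable.of_comap_le this

theorem indep_W (k : ℕ) (i : Fin B) :
    Indep (S.ℱ k) (MeasurableSpace.comap (S.W (k + 1) i) inferInstance) S.P := by
  have hle : ∀ x : ℕ+ × Fin B,
      MeasurableSpace.comap (S.W x.1 x.2) inferInstance ≤ mΩ := fun x =>
    (S.data.measurable _ _ x.1.2).comap_le
  have hi : iIndep (fun x : ℕ+ × Fin B => MeasurableSpace.comap (S.W x.1 x.2) inferInstance) S.P :=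
    S.data.indep
  have key := indep_past hle hi k i
  refine indep_of_indep_of_le_left key (iSup₂_le fun l hl => iSup_le fun i' => ?_)
  exact le_past (m := fun x : ℕ+ × Fin B => MeasurableSpace.comap (S.W x.1 x.2) inferInstance)
    (k := k) (⟨l, (Finset.mem_Icc.mp hl).1⟩, i') (Finset.mem_Icc.mp hl).2

theorem law_W (k : ℕ) (i : Fin B) : S.P.map (S.W (k + 1) i) = S.ν :=
  S.data.law _ _ (Nat.le_add_left 1 k)

/-! Measurability. -/

theorem feat_comp_stronglyMeasurable {X : Type*} {m : MeasurableSpace X} (J : ℕ)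
    {θ : X → EuclideanSpace ℝ (Fin p)} (hθ : Measurable[m] θ) {w : X → Obs p}
    (hw : Measurable[m] w) : StronglyMeasurable[m] fun x => feat S.e S.ψ J (index (θ x) (w x)) :=
  (feat_continuous S.reg J).comp_stronglyMeasurable
    ((measurable_index_prod.comp (hθ.prodMk hw)).stronglyMeasurable)

theorem gradSample_stronglyMeasurable {X : Type*} {m : MeasurableSpace X} (J : ℕ)
    {θ : X → EuclideanSpace ℝ (Fin p)} (hθ : Measurable[m] θ) {w : X → Obs p}
    (hw : Measurable[m] w) {v : X → H} (hv : StronglyMeasurable[m] v) :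
    StronglyMeasurable[m] fun x => gradSample S.e S.ψ J (θ x) (v x) (w x) := by
  have hF := S.feat_comp_stronglyMeasurable J hθ hw
  have hY : StronglyMeasurable[m] fun x => (w x).2.2 :=
    (measurable_snd.comp (measurable_snd.comp hw)).stronglyMeasurable
  exact (hY.sub (hF.inner hv)).smul hF

theorem truncSmul_stronglyMeasurable {X : Type*} {m : MeasurableSpace X} (J : ℕ) (T : ℝ)
    {w : X → Obs p} (hw : Measurable[m] w) : StronglyMeasurable[m] fun x =>
      truncNoise S.θ₀ S.F₀ T (w x) • feat S.e S.ψ J (index S.θ₀ (w x)) :=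
  ((truncNoise_measurable S.reg T).comp hw).stronglyMeasurable.smul
    (S.feat_comp_stronglyMeasurable J measurable_const hw)

theorem coef_stronglyMeasurable (k : ℕ) : StronglyMeasurable[S.ℱ k] (S.coef k) := by
  induction k with
  | zero => exact stronglyMeasurable_const
  | succ k ih =>
    have hle : S.ℱ k ≤ S.ℱ (k + 1) := S.ℱ.mono (Nat.le_succ k)
    refine (ih.mono hle).add (StronglyMeasurable.const_smul
      (Finset.stronglyMeasurable_fun_sum _ fun i _ => ?_) _)
    exact S.gradSample_stronglyMeasurable _ ((S.adapted k).mono hle le_rfl) (S.measurable_W_ℱ k i)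
      (ih.mono hle)

theorem coef_mem (k : ℕ) (ω : Ω) : S.coef k ω ∈ sieveSub S.e (S.J k) := by
  induction k with
  | zero => exact emb_mem _ _
  | succ k ih =>
    refine Submodule.add_mem _ (sieveSub_mono (S.J_le_J_succ k) ih) (Submodule.smul_mem _ _
      (Submodule.sum_mem _ fun i _ => Submodule.smul_mem _ _ (feat_mem _ _)))

theorem coef_mem_succ (k : ℕ) (ω : Ω) : S.coef k ω ∈ sieveSub S.e (S.J (k + 1)) :=
  sieveSub_mono (S.J_le_J_succ k) (S.coef_mem k ω)

variable [CompleteSpace H]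

/-- Mean of the stochastic gradient given the past. -/
theorem integral_grad (k : ℕ) (ω : Ω) :
    ∫ w, gradSample S.e S.ψ (S.J (k + 1)) (S.θc k ω) (S.coef k ω) w ∂S.ν
      = S.g k ω - S.G (k + 1) (S.δ k ω) - S.h k ω :=
  integral_gradSample S.reg S.ortho _ (S.coef_mem_succ k ω)

theorem coef_succ (k : ℕ) (ω : Ω) : S.coef (k + 1) ω = S.coef k ω + S.η (k + 1) •
    (S.trunc (k + 1) ω + S.rem (k + 1) ω + (S.g k ω - S.G (k + 1) (S.δ k ω) - S.h k ω)) := by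
  have hB := S.B_pos
  have hrem := integral_remSample S.reg S.ortho (S.T (k + 1)) (S.θc k ω) (S.coef_mem_succ k ω)
  have : (B : ℝ)⁻¹ • ∑ i : Fin B,
      gradSample S.e S.ψ (S.J (k + 1)) (S.θc k ω) (S.coef k ω) (S.W (k + 1) i ω)
      = S.trunc (k + 1) ω + S.rem (k + 1) ω
        + (S.g k ω - S.G (k + 1) (S.δ k ω) - S.h k ω) := by
    simp only [trunc, rem, truncScore, remSample, Finset.sum_sub_distrib, Finset.sum_const,
      Finset.card_univ, Fintype.card_fin, smul_sub, ← Nat.cast_smul_eq_nsmul ℝ, smul_smul,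
      inv_mul_cancel₀ hB.ne', one_smul]
    unfold remSample at hrem
    rw [hrem]
    simp only [g, h, G, δ, bStar]
    abel
  rw [← this, smul_smul, ← div_eq_mul_inv]
  rfl

theorem mean_stronglyMeasurable (k : ℕ) : StronglyMeasurable[S.ℱ k]
    fun ω => S.g k ω - S.G (k + 1) (S.δ k ω) - S.h k ω := by
  simp only [← S.integral_grad]
  have h1 : StronglyMeasurable[(S.ℱ k).prod inferInstance] fun x : Ω × Obs p =>
      gradSample S.e S.ψ (S.J (k + 1)) (S.θc k x.1) (S.coef k x.1) x.2 :=
    S.gradSample_stronglyMeasurable _ ((S.adapted k).comp (measurable_fst))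
      (measurable_snd) ((S.coef_stronglyMeasurable k).comp_measurable measurable_fst)
  exact @StronglyMeasurable.integral_prod_right' _ _ _ (S.ℱ k) _ S.ν _ _ _ _ h1

end Setting

end

section

namespace Setting

variable {Ω H : Type*} [mΩ : MeasurableSpace Ω] [NormedAddCommGroup H] [InnerProductSpace ℝ H]
  [CompleteSpace H] {p B : ℕ} (S : Setting Ω H p B)

/-! ### Deterministic bounds on the drift terms -/

/-- The limit of the pseudo-true coefficients. -/
def bInf : H := (exists_coefLimit S.reg S.ortho S.s_pos).choose

/-- The error of the online coefficient. -/
def X (k : ℕ) (ω : Ω) : H := S.coef k ω - S.bInf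

theorem norm_bStar_sub_bInf_le (k : ℕ) :
    ‖S.bStar k - S.bInf‖ ≤ 2 * S.K ^ 2 * (S.J k : ℝ) ^ (-S.s) :=
  (exists_coefLimit S.reg S.ortho S.s_pos).choose_spec _ (S.one_le_J k)

theorem exists_bStar_sub_bInf_le : ∃ C, 0 ≤ C ∧ ∀ k : ℕ,
    ‖S.bStar (k + 1) - S.bInf‖ ≤ C * ((k : ℝ) + 1) ^ (-(S.s * S.j)) := by
  obtain ⟨C, hC, hC'⟩ := S.exists_J_rpow_neg_le S.s_pos.le
  have := S.K_pos
  refine ⟨2 * S.K ^ 2 * C, by positivity, fun k => (S.norm_bStar_sub_bInf_le (k + 1)).trans ?_⟩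
  rw [mul_assoc (2 * S.K ^ 2)]
  exact mul_le_mul_of_nonneg_left (hC' k) (by positivity)

theorem δ_eq (k : ℕ) (ω : Ω) : S.δ k ω = S.X k ω - (S.bStar (k + 1) - S.bInf) := by
  unfold δ X; abel

theorem exists_d_le : ∃ C, 0 ≤ C ∧ ∀ (k : ℕ) (ω : Ω),
    √(S.J (k + 1)) * (S.J (k + 1) : ℝ) ^ S.f * ‖S.θc k ω - S.θ₀‖
      ≤ C * ((k : ℝ) + 1) ^ (-S.D) := by
  obtain ⟨C, hC, h⟩ := S.exists_plugIn_le
  exact ⟨C * S.M, mul_nonneg hC S.M_nonneg, fun k ω => h k _ _ S.M_nonneg (S.rate k ω)⟩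

theorem exists_sqrt_J_mul_le : ∃ C, 0 ≤ C ∧ ∀ (k : ℕ) (ω : Ω),
    √(S.J (k + 1)) * ‖S.θc k ω - S.θ₀‖ ≤ C * ((k : ℝ) + 1) ^ (-(S.α - S.j / 2)) := by
  have hM := S.M_nonneg
  refine ⟨√S.J₀ * S.M, by positivity, fun k ω => ?_⟩
  have h1 := S.J_succ_le k
  have hp := natCast_add_one_pos k
  calc _ ≤ √(S.J₀ * ((k : ℝ) + 1) ^ S.j) * (S.M * ((k : ℝ) + 1) ^ (-S.α)) := by
        have := S.rate k ω; gcongr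
    _ = √S.J₀ * S.M * (((k : ℝ) + 1) ^ (S.j * (1 / 2)) * ((k : ℝ) + 1) ^ (-S.α)) := by
        rw [Real.sqrt_mul (by positivity), Real.sqrt_eq_rpow (((k : ℝ) + 1) ^ S.j),
          ← Real.rpow_mul hp.le]
        ring
    _ = _ := by rw [rpow_succ_mul]; congr 2; ring

theorem exists_gramDrift_le : ∃ C, 0 ≤ C ∧ ∀ (k : ℕ) (ω : Ω) (v : H),
    ‖gramDrift S.e S.ν S.θ₀ S.ψ (S.J (k + 1)) (S.θc k ω) v‖
      ≤ C * ((k : ℝ) + 1) ^ (-S.D) * ‖v‖ := by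
  obtain ⟨C, hC, h⟩ := S.exists_d_le
  have hK := S.K_pos
  refine ⟨3 * S.K ^ 4 * (C * (1 + C)), by positivity, fun k ω v => ?_⟩
  refine (norm_gramDrift_le S.reg S.ortho S.f_nonneg (S.one_le_J _) _ v).trans ?_
  have h1 := h k ω
  have h2 : C * ((k : ℝ) + 1) ^ (-S.D) ≤ C :=
    mul_le_of_le_one_right hC (rpow_succ_le_one k (by linarith [S.D_pos]))
  have h3 := rpow_succ_pos k (-S.D)
  set d := √(S.J (k + 1)) * (S.J (k + 1) : ℝ) ^ S.f * ‖S.θc k ω - S.θ₀‖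
  have hd0 : 0 ≤ d := by positivity
  calc _ ≤ 3 * S.K ^ 4 * (C * ((k : ℝ) + 1) ^ (-S.D) * (1 + C)) * ‖v‖ := by
        have := h1.trans h2; gcongr
    _ = _ := by ring

/-- The linearization error of the bias drift. -/
theorem exists_g_add_le : ∃ C, 0 ≤ C ∧ ∀ (k : ℕ) (ω : Ω),
    ‖S.g k ω + plugInEffect S.e S.ν S.θ₀ S.F₀ S.ψ (S.J (k + 1)) (S.θc k ω - S.θ₀)‖
      ≤ C * ((k : ℝ) + 1) ^ (-((1 + S.j) / 2 + S.c)) := by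
  obtain ⟨C₁, hC₁, h₁⟩ := S.exists_d_le
  obtain ⟨C₂, hC₂, h₂⟩ := S.exists_sqrt_J_mul_le
  obtain ⟨C₃, hC₃, h₃⟩ := S.exists_J_rpow_neg_le S.s_pos.le
  obtain ⟨C₄, hC₄, h₄⟩ := S.exists_J_rpow_neg_le S.s₁_nonneg
  have hK := S.K_pos
  have hM := S.M_nonneg
  have hx1 := S.D_add_sj
  have hx2 := S.s₁j_add
  have hx3 := S.D_add_ρ
  have hx4 := S.ρ_le_α
  have hj := S.j_pos
  have hc := S.c_pos
  have hf : 0 ≤ S.j * S.f := mul_nonneg hj.le S.f_nonneg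
  refine ⟨4 * S.K ^ 4 * (C₃ * C₁ + C₄ * C₂ + C₂ * S.M + S.M * C₁), by positivity, fun k ω => ?_⟩
  refine (norm_biasDrift_add_plugInEffect_le S.reg S.ortho S.f_nonneg (S.one_le_J _) _).trans ?_
  rw [mul_assoc (4 * S.K ^ 4)]
  refine mul_le_mul_of_nonneg_left ?_ (by positivity)
  have hr := S.rate k ω
  set t := ‖S.θc k ω - S.θ₀‖
  set r := (k : ℝ) + 1 with hrdef
  have key : ∀ {x y : ℝ}, (1 + S.j) / 2 + S.c ≤ x + y →
      r ^ (-x) * r ^ (-y) ≤ r ^ (-((1 + S.j) / 2 + S.c)) := by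
    intro x y hxy
    rw [hrdef, rpow_succ_mul]
    exact rpow_succ_le k (by linarith)
  have e1 := h₁ k ω
  have e2 := h₂ k ω
  have e3 := h₃ k
  have e4 := h₄ k
  have r0 : ∀ x : ℝ, 0 < r ^ x := fun x => rpow_succ_pos k x
  have hsq : √(S.J (k + 1) : ℝ) * t ^ 2 = (√(S.J (k + 1) : ℝ) * t) * t := by ring
  rw [hsq, add_mul, add_mul, add_mul]
  have n1 := r0 (-S.D)
  have n2 := r0 (-(S.α - S.j / 2))
  have n3 := r0 (-S.α)
  refine add_le_add (add_le_add (add_le_add ?_ ?_) ?_) ?_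
  · calc _ ≤ (C₃ * r ^ (-(S.s * S.j))) * (C₁ * r ^ (-S.D)) := by
          gcongr
      _ = C₃ * C₁ * (r ^ (-(S.s * S.j)) * r ^ (-S.D)) := by ring
      _ ≤ _ := by gcongr; exact key (by unfold D; linarith)
  · calc _ ≤ (C₄ * r ^ (-(S.s₁ * S.j))) * (C₂ * r ^ (-(S.α - S.j / 2))) := by
          gcongr
      _ = C₄ * C₂ * (r ^ (-(S.s₁ * S.j)) * r ^ (-(S.α - S.j / 2))) := by ring
      _ ≤ _ := by gcongr; exact key (by linarith)
  · calc _ ≤ (C₂ * r ^ (-(S.α - S.j / 2))) * (S.M * r ^ (-S.α)) := by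
          gcongr
      _ = C₂ * S.M * (r ^ (-(S.α - S.j / 2)) * r ^ (-S.α)) := by ring
      _ ≤ _ := by gcongr; exact key (by linarith)
  · calc _ ≤ (S.M * r ^ (-S.α)) * (C₁ * r ^ (-S.D)) := by
          gcongr
      _ = S.M * C₁ * (r ^ (-S.α) * r ^ (-S.D)) := by ring
      _ ≤ _ := by gcongr; exact key (by unfold D; linarith)

theorem exists_g_le : ∃ C, 0 ≤ C ∧ ∀ (k : ℕ) (ω : Ω), ‖S.g k ω‖ ≤ C * ((k : ℝ) + 1) ^ (-S.ρ) := by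
  obtain ⟨C₁, hC₁, h₁⟩ := S.exists_g_add_le
  obtain ⟨C₂, hC₂, h₂⟩ := S.exists_sqrt_J_mul_le
  have hK := S.K_pos
  refine ⟨C₁ + S.K ^ 3 * C₂, by positivity, fun k ω => ?_⟩
  have e1 := (h₁ k ω).trans (mul_le_mul_of_nonneg_left
    (rpow_succ_le k (by linarith [S.ρ_le] : -((1 + S.j) / 2 + S.c) ≤ -S.ρ)) hC₁)
  have e2 := (h₂ k ω).trans (mul_le_mul_of_nonneg_left
    (rpow_succ_le k (by linarith [S.ρ_le_α] : -(S.α - S.j / 2) ≤ -S.ρ)) hC₂)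
  have e3 := norm_plugInEffect_le S.reg S.ortho (S.J (k + 1)) (S.θc k ω - S.θ₀)
  set R := plugInEffect S.e S.ν S.θ₀ S.F₀ S.ψ (S.J (k + 1)) (S.θc k ω - S.θ₀)
  calc ‖S.g k ω‖ = ‖(S.g k ω + R) - R‖ := by rw [add_sub_cancel_right]
    _ ≤ ‖S.g k ω + R‖ + ‖R‖ := norm_sub_le _ _
    _ ≤ C₁ * ((k : ℝ) + 1) ^ (-S.ρ) + S.K ^ 3 * (C₂ * ((k : ℝ) + 1) ^ (-S.ρ)) :=
        add_le_add e1 (e3.trans (by gcongr))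
    _ = _ := by ring

/-- The deterministic part of the drift. -/
def w (k : ℕ) (ω : Ω) : H := S.G (k + 1) (S.bStar (k + 1) - S.bInf) + S.g k ω

theorem exists_w_le : ∃ C, 0 ≤ C ∧ ∀ (k : ℕ) (ω : Ω), ‖S.w k ω‖ ≤ C * ((k : ℝ) + 1) ^ (-S.ρ) := by
  obtain ⟨C₁, hC₁, h₁⟩ := S.exists_bStar_sub_bInf_le
  obtain ⟨C₂, hC₂, h₂⟩ := S.exists_g_le
  have hK := S.K_pos
  refine ⟨3 * S.K ^ 2 * C₁ + C₂, by positivity, fun k ω => (norm_add_le _ _).trans ?_⟩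
  rw [add_mul]
  refine add_le_add ((norm_gramOp_le S.reg S.ortho (S.one_le_J _) _).trans ?_) (h₂ k ω)
  rw [mul_assoc (3 * S.K ^ 2)]
  exact mul_le_mul_of_nonneg_left ((h₁ k).trans (mul_le_mul_of_nonneg_left
    (rpow_succ_le k (neg_le_neg S.ρ_le_sj)) hC₁)) (by positivity)

theorem exists_δ_le : ∃ C, 0 ≤ C ∧ ∀ (k : ℕ) (ω : Ω),
    ‖S.δ k ω‖ ≤ ‖S.X k ω‖ + C * ((k : ℝ) + 1) ^ (-(S.s * S.j)) := by
  obtain ⟨C₁, hC₁, h₁⟩ := S.exists_bStar_sub_bInf_le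
  refine ⟨C₁, hC₁, fun k ω => ?_⟩
  rw [δ_eq]
  exact (norm_sub_le _ _).trans (add_le_add le_rfl (h₁ k))

theorem exists_h_le : ∃ C, 0 ≤ C ∧ ∀ (k : ℕ) (ω : Ω),
    ‖S.h k ω‖ ≤ C * ((k : ℝ) + 1) ^ (-S.D) * (‖S.X k ω‖ + ((k : ℝ) + 1) ^ (-(S.s * S.j))) := by
  obtain ⟨C₁, hC₁, h₁⟩ := S.exists_gramDrift_le
  obtain ⟨C₂, hC₂, h₂⟩ := S.exists_δ_le
  refine ⟨C₁ * (1 + C₂), by positivity, fun k ω => (h₁ k ω _).trans ?_⟩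
  have r1 := rpow_succ_pos k (-S.D)
  have r2 := rpow_succ_pos k (-(S.s * S.j))
  calc _ ≤ C₁ * ((k : ℝ) + 1) ^ (-S.D) * (‖S.X k ω‖ + C₂ * ((k : ℝ) + 1) ^ (-(S.s * S.j))) := by
        have := h₂ k ω; gcongr
    _ ≤ C₁ * ((k : ℝ) + 1) ^ (-S.D) * ((1 + C₂) *
          (‖S.X k ω‖ + ((k : ℝ) + 1) ^ (-(S.s * S.j)))) := by
        gcongr
        nlinarith [norm_nonneg (S.X k ω), mul_nonneg hC₂ (norm_nonneg (S.X k ω))]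
    _ = _ := by ring

/-! ### Martingale differences -/

theorem condCentered_average (k : ℕ) {F : Ω × Obs p → H}
    (hF : StronglyMeasurable[(S.ℱ k).prod inferInstance] F) {R : Ω → ℝ} (hR : Integrable R S.P)
    (hFint : ∀ ω, MemLp (fun w => F (ω, w)) 2 S.ν) (hFR : ∀ ω, ∫ w, ‖F (ω, w)‖ ^ 2 ∂S.ν ≤ R ω) :
    CondCentered S.P (S.ℱ k) (fun ω => (B : ℝ)⁻¹ •
        ∑ i : Fin B, (F (ω, S.W (k + 1) i ω) - ∫ w, F (ω, w) ∂S.ν)) ∧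
      ∫ ω, ‖(B : ℝ)⁻¹ • ∑ i : Fin B, (F (ω, S.W (k + 1) i ω) - ∫ w, F (ω, w) ∂S.ν)‖ ^ 2 ∂S.P
        ≤ 4 * ∫ ω, R ω ∂S.P := by
  have h1 := fun i => condCentered_sample (S.ℱ.le k) (S.measurable_W k i) (S.indep_W k i)
    (S.law_W k i) hF hR hFint hFR
  have hB := S.B_pos
  have hc := (CondCentered.sum Finset.univ fun i _ => (h1 i).1).const_smul (B : ℝ)⁻¹
  refine ⟨hc, ?_⟩
  have hi : ∀ i ∈ Finset.univ, Integrable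
      (fun ω => ‖F (ω, S.W (k + 1) i ω) - ∫ w, F (ω, w) ∂S.ν‖ ^ 2) S.P :=
    fun i _ => integrable_norm_sq (h1 i).1.memLp
  calc _ ≤ ∫ ω, (B : ℝ)⁻¹ * ∑ i : Fin B, ‖F (ω, S.W (k + 1) i ω) - ∫ w, F (ω, w) ∂S.ν‖ ^ 2 ∂S.P :=
        integral_mono (integrable_norm_sq hc.memLp) ((integrable_finsetSum _ hi).const_mul _)
          fun ω => norm_average_sq_le _
    _ = (B : ℝ)⁻¹ * ∑ i : Fin B, ∫ ω, ‖F (ω, S.W (k + 1) i ω) - ∫ w, F (ω, w) ∂S.ν‖ ^ 2 ∂S.P := by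
        rw [integral_const_mul, integral_finsetSum _ hi]
    _ ≤ (B : ℝ)⁻¹ * ∑ _i : Fin B, 4 * ∫ ω, R ω ∂S.P := by
        gcongr with i; exact (h1 i).2
    _ = _ := by
        rw [Finset.sum_const, Finset.card_univ, Fintype.card_fin, nsmul_eq_mul]
        field_simp

theorem exists_trunc : ∃ C, 0 ≤ C ∧ ∀ k : ℕ, CondCentered S.P (S.ℱ k) (S.trunc (k + 1)) ∧
    ∫ ω, ‖S.trunc (k + 1) ω‖ ^ 2 ∂S.P ≤ C * ((k : ℝ) + 1) ^ S.j := by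
  set V := ∫ w, noise S.θ₀ S.F₀ w ^ 2 ∂S.ν with hV
  have hV0 : 0 ≤ V := integral_nonneg fun _ => sq_nonneg _
  have hK := S.K_pos
  refine ⟨4 * (S.K ^ 2 * S.J₀ * V), by positivity, fun k => ?_⟩
  have h1 := fun w => norm_feat_le S.reg S.ortho (S.J (k + 1)) (index S.θ₀ w)
  have hpt : ∀ w, ‖truncNoise S.θ₀ S.F₀ (S.T (k + 1)) w
      • feat S.e S.ψ (S.J (k + 1)) (index S.θ₀ w)‖ ^ 2
      ≤ S.K ^ 2 * S.J (k + 1) * noise S.θ₀ S.F₀ w ^ 2 := by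
    intro w
    have h2 := abs_truncNoise_le_noise (θ₀ := S.θ₀) (F₀ := S.F₀) (S.T (k + 1)) w
    rw [norm_smul, mul_pow, Real.norm_eq_abs, ← sq_abs (noise _ _ _)]
    calc _ ≤ |noise S.θ₀ S.F₀ w| ^ 2 * (S.K * √(S.J (k + 1))) ^ 2 := by
          have := h1 w; gcongr
      _ = _ := by rw [mul_pow, Real.sq_sqrt (by positivity)]; ring
  have hsm := S.truncSmul_stronglyMeasurable (S.J (k + 1)) (S.T (k + 1)) (w := fun w : Obs p => w)
    measurable_id
  obtain ⟨m1, m2⟩ := memLp_two_of_sq_le hsm.aestronglyMeasurable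
    ((noise_memLp_two S.reg).integrable_sq.const_mul _) hpt
  rw [integral_const_mul] at m2
  obtain ⟨c1, c2⟩ := S.condCentered_average k
    (S.truncSmul_stronglyMeasurable (m := (S.ℱ k).prod inferInstance) (S.J (k + 1)) (S.T (k + 1))
      (w := fun x : Ω × Obs p => x.2) measurable_snd)
    (integrable_const (S.K ^ 2 * S.J (k + 1) * V)) (fun _ => m1) (fun _ => m2)
  refine ⟨c1, c2.trans ?_⟩
  simp only [integral_const, probReal_univ, smul_eq_mul, one_mul]
  have := S.J_succ_le k
  calc _ ≤ 4 * (S.K ^ 2 * (S.J₀ * ((k : ℝ) + 1) ^ S.j) * V) := by gcongr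
    _ = _ := by ring

theorem J_mul_T_rpow_le (k : ℕ) : (S.J (k + 1) : ℝ) * S.T (k + 1) ^ (2 - S.κ)
    ≤ S.J₀ * ((k : ℝ) + 1) ^ (-(S.j + 4 * S.c)) := by
  rw [T_succ, ← Real.rpow_mul (natCast_add_one_pos k).le]
  calc _ ≤ (S.J₀ * ((k : ℝ) + 1) ^ S.j) * ((k : ℝ) + 1) ^ (S.j * (2 - S.κ)) := by
        have := S.J_succ_le k
        have := rpow_succ_pos k (S.j * (2 - S.κ))
        gcongr
    _ = S.J₀ * ((k : ℝ) + 1) ^ (S.j + S.j * (2 - S.κ)) := by rw [mul_assoc, rpow_succ_mul]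
    _ ≤ _ := by
        refine mul_le_mul_of_nonneg_left (rpow_succ_le k ?_) S.J₀_pos.le
        have := S.κ_lower
        have := S.c_pos
        nlinarith

theorem exists_tail : ∃ C, 0 ≤ C ∧ ∀ k : ℕ, CondCentered S.P (S.ℱ k) (S.tail (k + 1)) ∧
    ∫ ω, ‖S.tail (k + 1) ω‖ ^ 2 ∂S.P ≤ C * ((k : ℝ) + 1) ^ (-(S.j + 4 * S.c)) := by
  have hK := S.K_pos
  refine ⟨4 * (S.K ^ 3 * S.J₀), by positivity, fun k => ?_⟩
  obtain ⟨m1, m2⟩ := tailSample_sq_le S.reg S.ortho (S.J (k + 1)) (S.T_pos k)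
  have hsm : StronglyMeasurable[(S.ℱ k).prod inferInstance] fun x : Ω × Obs p =>
      tailSample S.e S.θ₀ S.F₀ S.ψ (S.J (k + 1)) (S.T (k + 1)) x.2 := by
    have h2 : Measurable[(S.ℱ k).prod inferInstance] fun x : Ω × Obs p => x.2 := measurable_snd
    exact (((noise_measurable S.reg).comp h2).stronglyMeasurable.smul
      (S.feat_comp_stronglyMeasurable _ measurable_const h2)).sub
      (S.truncSmul_stronglyMeasurable _ _ h2)
  obtain ⟨c1, c2⟩ := S.condCentered_average k hsm
    (integrable_const (S.K ^ 3 * (S.J (k + 1) * S.T (k + 1) ^ (2 - S.κ))))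
    (fun _ => m1) (fun _ => m2)
  refine ⟨c1, c2.trans ?_⟩
  simp only [integral_const, probReal_univ, smul_eq_mul, one_mul]
  have := S.J_mul_T_rpow_le k
  calc _ ≤ 4 * (S.K ^ 3 * (S.J₀ * ((k : ℝ) + 1) ^ (-(S.j + 4 * S.c)))) := by gcongr
    _ = _ := by ring

theorem exists_rem : ∃ C, 0 ≤ C ∧ ∀ k : ℕ, MemLp (S.X k) 2 S.P →
    CondCentered S.P (S.ℱ k) (S.rem (k + 1)) ∧
    ∫ ω, ‖S.rem (k + 1) ω‖ ^ 2 ∂S.P ≤ C * (((k : ℝ) + 1) ^ (-(S.j + 4 * S.c))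
      + ((k : ℝ) + 1) ^ S.j * ∫ ω, ‖S.X k ω‖ ^ 2 ∂S.P) := by
  obtain ⟨C₁, hC₁, h₁⟩ := S.exists_d_le
  obtain ⟨C₂, hC₂, h₂⟩ := S.exists_J_rpow_neg_le S.s_pos.le
  obtain ⟨C₃, hC₃, h₃⟩ := S.exists_δ_le
  have hK := S.K_pos
  have hJ := S.J₀_pos
  set A := C₁ ^ 2 + S.J₀ * C₂ ^ 2 + S.J₀ + 2 * S.J₀ * (1 + C₁ ^ 2) * C₃ ^ 2
    + 2 * S.J₀ * (1 + C₁ ^ 2) with hA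
  have hA0 : 0 ≤ A := by positivity
  refine ⟨4 * (40 * S.K ^ 6 * A), by positivity, fun k hX => ?_⟩
  have hsm : StronglyMeasurable[(S.ℱ k).prod inferInstance] fun x : Ω × Obs p =>
      remSample S.e S.θ₀ S.F₀ S.ψ (S.J (k + 1)) (S.T (k + 1)) (S.θc k x.1) (S.coef k x.1) x.2 :=
    (S.gradSample_stronglyMeasurable _ ((S.adapted k).comp measurable_fst) measurable_snd
      ((S.coef_stronglyMeasurable k).comp_measurable measurable_fst)).sub
      (S.truncSmul_stronglyMeasurable _ _ measurable_snd)
  have hm := fun ω => remSample_sq_le S.reg S.ortho S.f_nonneg (S.one_le_J (k + 1)) (S.T_pos k)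
    (S.θc k ω) (S.coef k ω) S.s₁_nonneg
  have hiX := integrable_norm_sq hX
  set R : Ω → ℝ := fun ω => 40 * S.K ^ 6 * (A * ((k : ℝ) + 1) ^ (-(S.j + 4 * S.c))
    + A * ((k : ℝ) + 1) ^ S.j * ‖S.X k ω‖ ^ 2) with hR
  have hRi : Integrable R S.P := ((integrable_const _).add (hiX.const_mul _)).const_mul _
  have hmR : ∀ ω, ∫ w, ‖remSample S.e S.θ₀ S.F₀ S.ψ (S.J (k + 1)) (S.T (k + 1)) (S.θc k ω)
      (S.coef k ω) w‖ ^ 2 ∂S.ν ≤ R ω := by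
    intro ω
    refine (hm ω).2.trans (mul_le_mul_of_nonneg_left ?_ (by positivity))
    have e1 := h₁ k ω
    have e2 := h₂ k
    have e3 := h₃ k ω
    have e4 := S.J_mul_T_rpow_le k
    have e5 := S.J_succ_le k
    have hx1 := S.D_lower
    have hx2 := S.sj_lower
    have hj := S.j_pos
    have hc := S.c_pos
    rw [show S.coef k ω - coefStar S.e S.ν S.θ₀ S.F₀ S.ψ (S.J (k + 1)) = S.δ k ω from rfl]
    set d := √(S.J (k + 1)) * (S.J (k + 1) : ℝ) ^ S.f * ‖S.θc k ω - S.θ₀‖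
    have hd0 : 0 ≤ d := by positivity
    set q := ((k : ℝ) + 1) ^ (-(S.j + 4 * S.c)) with hq
    set u := ((k : ℝ) + 1) ^ S.j with hu
    have hq0 : 0 < q := rpow_succ_pos k _
    have hu0 : 0 < u := rpow_succ_pos k _
    have rD := rpow_succ_pos k (-S.D)
    have rs := rpow_succ_pos k (-(S.s * S.j))
    have d1 : d ^ 2 ≤ C₁ ^ 2 * q := by
      calc d ^ 2 ≤ (C₁ * ((k : ℝ) + 1) ^ (-S.D)) ^ 2 := by gcongr
        _ = C₁ ^ 2 * ((k : ℝ) + 1) ^ (2 * -S.D) := by rw [mul_pow, rpow_succ_pow_two]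
        _ ≤ _ := by gcongr; exact rpow_succ_le k (by unfold D; linarith)
    have d2 : d ^ 2 ≤ C₁ ^ 2 := d1.trans (mul_le_of_le_one_right (sq_nonneg _)
      (rpow_succ_le_one k (by linarith)))
    have s1 : u * (((k : ℝ) + 1) ^ (-(S.s * S.j))) ^ 2 ≤ q := by
      rw [rpow_succ_pow_two, hu, rpow_succ_mul]
      exact rpow_succ_le k (by linarith)
    have s2 : (S.J (k + 1) : ℝ) * ((S.J (k + 1) : ℝ) ^ (-S.s)) ^ 2 ≤ S.J₀ * C₂ ^ 2 * q := by
      calc _ ≤ (S.J₀ * u) * (C₂ * ((k : ℝ) + 1) ^ (-(S.s * S.j))) ^ 2 := by gcongr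
        _ = S.J₀ * C₂ ^ 2 * (u * (((k : ℝ) + 1) ^ (-(S.s * S.j))) ^ 2) := by ring
        _ ≤ _ := by gcongr
    have s3 : (S.J (k + 1) : ℝ) * (1 + d ^ 2) * ‖S.δ k ω‖ ^ 2
        ≤ 2 * S.J₀ * (1 + C₁ ^ 2) * u * ‖S.X k ω‖ ^ 2
          + 2 * S.J₀ * (1 + C₁ ^ 2) * C₃ ^ 2 * q := by
      have hδ2 : ‖S.δ k ω‖ ^ 2 ≤ 2 * ‖S.X k ω‖ ^ 2
          + 2 * C₃ ^ 2 * (((k : ℝ) + 1) ^ (-(S.s * S.j))) ^ 2 := by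
        have := pow_le_pow_left₀ (norm_nonneg _) e3 2
        nlinarith [sq_nonneg (‖S.X k ω‖ - C₃ * ((k : ℝ) + 1) ^ (-(S.s * S.j)))]
      calc _ ≤ (S.J₀ * u) * (1 + C₁ ^ 2) * (2 * ‖S.X k ω‖ ^ 2
          + 2 * C₃ ^ 2 * (((k : ℝ) + 1) ^ (-(S.s * S.j))) ^ 2) := by gcongr
        _ = 2 * S.J₀ * (1 + C₁ ^ 2) * u * ‖S.X k ω‖ ^ 2 + 2 * S.J₀ * (1 + C₁ ^ 2) * C₃ ^ 2
            * (u * (((k : ℝ) + 1) ^ (-(S.s * S.j))) ^ 2) := by ring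
        _ ≤ _ := by gcongr
    have f1 : 2 * S.J₀ * (1 + C₁ ^ 2) ≤ A := by
      rw [hA]; have : 0 ≤ C₁ ^ 2 + S.J₀ * C₂ ^ 2 + S.J₀ + 2 * S.J₀ * (1 + C₁ ^ 2) * C₃ ^ 2 := by
        positivity
      linarith
    calc _ ≤ C₁ ^ 2 * q + S.J₀ * C₂ ^ 2 * q + S.J₀ * q
          + (2 * S.J₀ * (1 + C₁ ^ 2) * u * ‖S.X k ω‖ ^ 2
            + 2 * S.J₀ * (1 + C₁ ^ 2) * C₃ ^ 2 * q) :=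
          add_le_add (add_le_add (add_le_add d1 s2) e4) s3
      _ = (C₁ ^ 2 + S.J₀ * C₂ ^ 2 + S.J₀ + 2 * S.J₀ * (1 + C₁ ^ 2) * C₃ ^ 2) * q
          + 2 * S.J₀ * (1 + C₁ ^ 2) * u * ‖S.X k ω‖ ^ 2 := by ring
      _ ≤ _ := by
          gcongr
          rw [hA]
          have : 0 ≤ 2 * S.J₀ * (1 + C₁ ^ 2) := by positivity
          linarith
  obtain ⟨c1, c2⟩ := S.condCentered_average k hsm hRi (fun ω => (hm ω).1) hmR
  refine ⟨c1, c2.trans (le_of_eq ?_)⟩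
  rw [hR, integral_const_mul, integral_add (integrable_const _) (hiX.const_mul _)]
  simp only [integral_const_mul, integral_const, probReal_univ, smul_eq_mul, one_mul]
  ring

end Setting

end

section

/-- Power recursion, with bounds in powers of `k + 1`. -/
theorem exists_power_recursion {a c r C : ℝ} (hc : 0 < c) (ha0 : 0 < a) (ha : a < 1) {y : ℕ → ℝ}
    (hy : ∀ k, 0 ≤ y k)
    (h : ∀ᶠ k : ℕ in atTop, y (k + 1) ≤ (1 - c * ((k : ℝ) + 1) ^ (-a)) * y k
      + C * ((k : ℝ) + 1) ^ (-a) * ((k : ℝ) + 1) ^ (-r)) :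
    ∃ C', 0 ≤ C' ∧ ∀ k : ℕ, y k ≤ C' * ((k : ℝ) + 1) ^ (-r) := by
  obtain ⟨C', hC', h'⟩ := power_recursion hc ha0 ha hy h
  exact exists_le_rpow_succ hC' h'

theorem sq_convex_combination_le {t x u : ℝ} (ht0 : 0 ≤ t) (ht1 : t ≤ 1) :
    ((1 - t) * x + t * u) ^ 2 ≤ (1 - t) * x ^ 2 + t * u ^ 2 := by
  nlinarith [mul_nonneg (mul_nonneg ht0 (sub_nonneg.mpr ht1)) (sq_nonneg (x - u))]

namespace Setting

variable {Ω H : Type*} [mΩ : MeasurableSpace Ω] [NormedAddCommGroup H] [InnerProductSpace ℝ H]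
  [CompleteSpace H] {p B : ℕ} (S : Setting Ω H p B)

/-! ### Mean square bounds -/

/-- Mean drift of the error. -/
theorem X_succ (k : ℕ) (ω : Ω) : S.X (k + 1) ω =
    (S.X k ω - S.η (k + 1) • S.G (k + 1) (S.X k ω))
      + S.η (k + 1) • (S.trunc (k + 1) ω + S.rem (k + 1) ω + S.w k ω - S.h k ω) := by
  rw [X, coef_succ, w, δ_eq, map_sub, X]
  module

theorem X_stronglyMeasurable (k : ℕ) : StronglyMeasurable[S.ℱ k] (S.X k) :=
  (S.coef_stronglyMeasurable k).sub stronglyMeasurable_const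

theorem wh_stronglyMeasurable (k : ℕ) : StronglyMeasurable[S.ℱ k] fun ω => S.w k ω - S.h k ω := by
  have h1 := S.mean_stronglyMeasurable k
  have h2 : StronglyMeasurable[S.ℱ k] fun ω => S.G (k + 1) (S.X k ω) :=
    (S.G (k + 1)).continuous.comp_stronglyMeasurable (S.X_stronglyMeasurable k)
  have h3 : (fun ω => S.w k ω - S.h k ω) = fun ω =>
      (S.g k ω - S.G (k + 1) (S.δ k ω) - S.h k ω) + S.G (k + 1) (S.X k ω) := by
    funext ω
    simp only [w, δ_eq, map_sub]
    abel
  rw [h3]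
  exact h1.add h2

/-- The predictable part of the next error. -/
def Y (k : ℕ) (ω : Ω) : H :=
  (S.X k ω - S.η (k + 1) • S.G (k + 1) (S.X k ω)) + S.η (k + 1) • (S.w k ω - S.h k ω)

theorem X_succ_eq_Y (k : ℕ) (ω : Ω) :
    S.X (k + 1) ω = S.Y k ω + S.η (k + 1) • (S.trunc (k + 1) ω + S.rem (k + 1) ω) := by
  rw [X_succ, Y]; module

theorem Y_stronglyMeasurable (k : ℕ) : StronglyMeasurable[S.ℱ k] (S.Y k) := by
  have h2 : StronglyMeasurable[S.ℱ k] fun ω => S.G (k + 1) (S.X k ω) :=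
    (S.G (k + 1)).continuous.comp_stronglyMeasurable (S.X_stronglyMeasurable k)
  exact ((S.X_stronglyMeasurable k).sub (h2.const_smul _)).add
    ((S.wh_stronglyMeasurable k).const_smul _)

theorem G_memLp {f : Ω → H} (k : ℕ) (hf : MemLp f 2 S.P) :
    MemLp (fun ω => S.G k (f ω)) 2 S.P :=
  (S.G k).comp_memLp' hf

theorem wh_memLp {k : ℕ} (ih : MemLp (S.X k) 2 S.P) :
    MemLp (fun ω => S.w k ω - S.h k ω) 2 S.P := by
  obtain ⟨C₃, hC₃, h₃⟩ := S.exists_w_le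
  obtain ⟨C₄, hC₄, h₄⟩ := S.exists_h_le
  have hb0 : MemLp (fun ω => ‖S.X k ω‖ + ((k : ℝ) + 1) ^ (-(S.s * S.j))) 2 S.P :=
    ih.norm.add (memLp_const _)
  have hb : MemLp (fun ω => C₃ * ((k : ℝ) + 1) ^ (-S.ρ)
      + C₄ * ((k : ℝ) + 1) ^ (-S.D) * (‖S.X k ω‖ + ((k : ℝ) + 1) ^ (-(S.s * S.j)))) 2 S.P :=
    (memLp_const (C₃ * ((k : ℝ) + 1) ^ (-S.ρ))).add (hb0.const_mul _)
  refine hb.mono ((S.wh_stronglyMeasurable k).mono (S.ℱ.le k)).aestronglyMeasurable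
    (Eventually.of_forall fun ω => ?_)
  exact ((norm_sub_le _ _).trans (add_le_add (h₃ k ω) (h₄ k ω))).trans (le_abs_self _)

theorem Y_memLp {k : ℕ} (ih : MemLp (S.X k) 2 S.P) : MemLp (S.Y k) 2 S.P :=
  (ih.sub ((S.G_memLp (k + 1) ih).const_smul (S.η (k + 1)))).add
    ((S.wh_memLp ih).const_smul (S.η (k + 1)))

theorem X_memLp (k : ℕ) : MemLp (S.X k) 2 S.P := by
  induction k with
  | zero => exact memLp_const (emb S.e (S.J 0) (pad (S.J 0) S.b₀) - S.bInf)
  | succ k ih =>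
    obtain ⟨C₁, -, h₁⟩ := S.exists_trunc
    obtain ⟨C₂, -, h₂⟩ := S.exists_rem
    have h := (S.Y_memLp ih).add (((h₁ k).1.memLp.add (h₂ k ih).1.memLp).const_smul (S.η (k + 1)))
    exact h.ae_eq (Eventually.of_forall fun ω => (S.X_succ_eq_Y k ω).symm)

/-- Eventually the deterministic part of the recursion contracts. -/
theorem eventually_norm_sub_G_le : ∀ᶠ k : ℕ in atTop, ∀ x : H,
    ‖x - S.η (k + 1) • S.G (k + 1) x‖
      ≤ (1 - S.η₀ / (2 * S.K) * ((k : ℝ) + 1) ^ (-S.a)) * ‖x‖ := by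
  filter_upwards [eventually_mul_rpow_le (9 * S.K ^ 5 * S.η₀) (neg_lt_zero.mpr S.a_pos) one_pos]
    with k hk x
  have h1 : 9 * S.K ^ 5 * S.η (k + 1) ≤ 1 := by
    rw [η_succ, ← mul_assoc]; simpa using hk
  have h2 := contraction_gramOp S.reg S.ortho (S.one_le_J (k + 1)) (S.η_pos k).le h1 x
  rw [S.η_succ] at h2 ⊢
  calc _ ≤ _ := h2
    _ = _ := by ring

theorem exists_Y_le : ∃ C, 0 ≤ C ∧ ∀ᶠ k : ℕ in atTop, ∀ ω, ‖S.Y k ω‖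
    ≤ (1 - S.η₀ / (4 * S.K) * ((k : ℝ) + 1) ^ (-S.a)) * ‖S.X k ω‖
      + S.η₀ / (4 * S.K) * ((k : ℝ) + 1) ^ (-S.a) * (C * ((k : ℝ) + 1) ^ (-S.ρ)) := by
  obtain ⟨C₃, hC₃, h₃⟩ := S.exists_w_le
  obtain ⟨C₄, hC₄, h₄⟩ := S.exists_h_le
  have hK := S.K_pos
  have hη := S.η₀_pos
  refine ⟨4 * S.K * (C₃ + C₄), by positivity, ?_⟩
  filter_upwards [S.eventually_norm_sub_G_le,
    eventually_mul_rpow_le C₄ (neg_lt_zero.mpr S.D_pos)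
      (by positivity : 0 < 1 / (4 * S.K))] with k hk hk2 ω
  have hw := h₃ k ω
  have hh := h₄ k ω
  rw [Real.rpow_zero, mul_one] at hk2
  set r := ((k : ℝ) + 1) ^ (-S.a) with hr
  have hr0 : 0 < r := rpow_succ_pos k _
  set u := ((k : ℝ) + 1) ^ (-S.ρ) with hu
  have hu0 : 0 < u := rpow_succ_pos k _
  have hD0 : 0 < ((k : ℝ) + 1) ^ (-S.D) := rpow_succ_pos k _
  have hD1 : ((k : ℝ) + 1) ^ (-S.D) ≤ 1 := rpow_succ_le_one k (by linarith [S.D_pos])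
  have hsu : ((k : ℝ) + 1) ^ (-(S.s * S.j)) ≤ u := rpow_succ_le k (neg_le_neg S.ρ_le_sj)
  have hh2 : ‖S.h k ω‖ ≤ 1 / (4 * S.K) * ‖S.X k ω‖ + C₄ * u := by
    calc _ ≤ _ := hh
      _ = C₄ * ((k : ℝ) + 1) ^ (-S.D) * ‖S.X k ω‖
          + C₄ * (((k : ℝ) + 1) ^ (-S.D) * ((k : ℝ) + 1) ^ (-(S.s * S.j))) := by ring
      _ ≤ 1 / (4 * S.K) * ‖S.X k ω‖ + C₄ * (1 * u) := by gcongr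
      _ = _ := by ring
  have h5 : ‖S.Y k ω‖ ≤ (1 - S.η₀ / (2 * S.K) * r) * ‖S.X k ω‖
      + S.η₀ * r * (C₃ * u + (1 / (4 * S.K) * ‖S.X k ω‖ + C₄ * u)) := by
    refine (norm_add_le _ _).trans (add_le_add (hk _) ?_)
    rw [norm_smul, Real.norm_of_nonneg (S.η_pos k).le, η_succ]
    refine mul_le_mul_of_nonneg_left ((norm_sub_le _ _).trans (add_le_add hw hh2)) (by positivity)
  refine h5.trans (le_of_eq ?_)
  field_simp
  ring

/-- Mean square rate of the online coefficient. -/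
theorem exists_integral_X_sq_le : ∃ C, 0 ≤ C ∧ ∀ k : ℕ,
    ∫ ω, ‖S.X k ω‖ ^ 2 ∂S.P ≤ C * ((k : ℝ) + 1) ^ (-(S.a - S.j)) := by
  obtain ⟨C₁, hC₁, h₁⟩ := S.exists_trunc
  obtain ⟨C₂, hC₂, h₂⟩ := S.exists_rem
  obtain ⟨C₃, hC₃, h₃⟩ := S.exists_Y_le
  have hK := S.K_pos
  have hη := S.η₀_pos
  have hj := S.j_pos
  have hc := S.c_pos
  have ha := S.a_pos
  have h3 := S.three_j
  set γ := S.η₀ / (4 * S.K) with hγ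
  have hγ0 : 0 < γ := by positivity
  set A := 2 * (C₁ + C₂) with hA
  refine exists_power_recursion (c := γ / 2) (C := γ * C₃ ^ 2 + S.η₀ ^ 2 * A) (by positivity)
    ha S.a_lt_one (fun k => integral_nonneg fun _ => sq_nonneg _) ?_
  filter_upwards [h₃, eventually_mul_rpow_le γ (neg_lt_zero.mpr ha) one_pos,
    eventually_mul_rpow_le (S.η₀ ^ 2 * A) (show S.j - S.a < 0 by linarith)
      (by positivity : 0 < γ / 2)] with k hk hk2 hk3
  rw [Real.rpow_zero, mul_one] at hk2 hk3
  have hX := S.X_memLp k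
  obtain ⟨n1, n2⟩ := h₁ k
  obtain ⟨m1, m2⟩ := h₂ k hX
  have hY := S.Y_memLp hX
  have hN : CondCentered S.P (S.ℱ k) (fun ω => S.trunc (k + 1) ω + S.rem (k + 1) ω) := n1.add m1
  set y := ∫ ω, ‖S.X k ω‖ ^ 2 ∂S.P with hy
  have hy0 : 0 ≤ y := integral_nonneg fun _ => sq_nonneg _
  set r := ((k : ℝ) + 1) ^ (-S.a) with hr
  have hr0 : 0 < r := rpow_succ_pos k _
  set u := ((k : ℝ) + 1) ^ S.j with hu
  have hu0 : 0 < u := rpow_succ_pos k _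
  have hu1 : 1 ≤ u := Real.one_le_rpow (one_le_natCast_add_one k) hj.le
  have hnoise : ∫ ω, ‖S.trunc (k + 1) ω + S.rem (k + 1) ω‖ ^ 2 ∂S.P ≤ A * u * (1 + y) := by
    have i1 := integrable_norm_sq n1.memLp
    have i2 := integrable_norm_sq m1.memLp
    calc _ ≤ ∫ ω, (2 * ‖S.trunc (k + 1) ω‖ ^ 2 + 2 * ‖S.rem (k + 1) ω‖ ^ 2) ∂S.P := by
          refine integral_mono (integrable_norm_sq hN.memLp)
            ((i1.const_mul 2).add (i2.const_mul 2)) fun ω => ?_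
          have := pow_le_pow_left₀ (norm_nonneg _)
            (norm_add_le (S.trunc (k + 1) ω) (S.rem (k + 1) ω)) 2
          simp only
          nlinarith [sq_nonneg (‖S.trunc (k + 1) ω‖ - ‖S.rem (k + 1) ω‖)]
      _ = 2 * ∫ ω, ‖S.trunc (k + 1) ω‖ ^ 2 ∂S.P + 2 * ∫ ω, ‖S.rem (k + 1) ω‖ ^ 2 ∂S.P := by
          rw [integral_add (i1.const_mul 2) (i2.const_mul 2), integral_const_mul,
            integral_const_mul]
      _ ≤ 2 * (C₁ * u) + 2 * (C₂ * (1 + u * y)) := by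
          have : ((k : ℝ) + 1) ^ (-(S.j + 4 * S.c)) ≤ 1 := rpow_succ_le_one k (by linarith)
          have m3 := m2.trans (mul_le_mul_of_nonneg_left
            (add_le_add_left this (u * y)) hC₂)
          linarith
      _ ≤ _ := by
          rw [hA]
          have : 0 ≤ C₁ * (u * y) := by positivity
          have : C₂ * 1 ≤ C₂ * u := by gcongr
          nlinarith
  have hexp : ∫ ω, ‖S.X (k + 1) ω‖ ^ 2 ∂S.P = ∫ ω, ‖S.Y k ω‖ ^ 2 ∂S.P
      + S.η (k + 1) ^ 2 * ∫ ω, ‖S.trunc (k + 1) ω + S.rem (k + 1) ω‖ ^ 2 ∂S.P := by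
    have j1 := integrable_norm_sq hY
    have j2 := (integrable_inner_of_memLp hY hN.memLp).const_mul (2 * S.η (k + 1))
    have j3 := (integrable_norm_sq hN.memLp).const_mul (S.η (k + 1) ^ 2)
    have j12 : Integrable (fun ω => ‖S.Y k ω‖ ^ 2 + 2 * S.η (k + 1)
        * inner ℝ (S.Y k ω) (S.trunc (k + 1) ω + S.rem (k + 1) ω)) S.P := j1.add j2
    have hz := hN.integral_inner _ (S.Y_stronglyMeasurable k) hY
    calc _ = ∫ ω, (‖S.Y k ω‖ ^ 2 + 2 * S.η (k + 1)
          * inner ℝ (S.Y k ω) (S.trunc (k + 1) ω + S.rem (k + 1) ω)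
          + S.η (k + 1) ^ 2 * ‖S.trunc (k + 1) ω + S.rem (k + 1) ω‖ ^ 2) ∂S.P := by
          refine integral_congr_ae (Eventually.of_forall fun ω => ?_)
          simp only
          rw [X_succ_eq_Y, norm_add_sq_real, inner_smul_right, norm_smul, mul_pow,
            Real.norm_eq_abs, sq_abs]
          ring
      _ = _ := by
          rw [integral_add j12 j3, integral_add j1 j2, integral_const_mul, integral_const_mul, hz]
          ring
  have hYy : ∫ ω, ‖S.Y k ω‖ ^ 2 ∂S.P
      ≤ (1 - γ * r) * y + γ * r * (C₃ * ((k : ℝ) + 1) ^ (-S.ρ)) ^ 2 := by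
    have i1 := (integrable_norm_sq hX).const_mul (1 - γ * r)
    calc _ ≤ ∫ ω, ((1 - γ * r) * ‖S.X k ω‖ ^ 2
          + γ * r * (C₃ * ((k : ℝ) + 1) ^ (-S.ρ)) ^ 2) ∂S.P := by
          refine integral_mono (integrable_norm_sq hY) (i1.add (integrable_const _)) fun ω => ?_
          exact (pow_le_pow_left₀ (norm_nonneg _) (hk ω) 2).trans
            (sq_convex_combination_le (by positivity) hk2)
      _ = _ := by
          rw [integral_add i1 (integrable_const _), integral_const_mul]
          simp [hy]
  rw [hexp]
  have hρ : (((k : ℝ) + 1) ^ (-S.ρ)) ^ 2 ≤ ((k : ℝ) + 1) ^ (-(S.a - S.j)) := by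
    rw [rpow_succ_pow_two]; exact rpow_succ_le k (by linarith [S.ρ_lower])
  have hru : r * u = ((k : ℝ) + 1) ^ (-(S.a - S.j)) := by
    rw [hr, hu, rpow_succ_mul]; congr 1; ring
  have hru' : r * u = ((k : ℝ) + 1) ^ (S.j - S.a) := by rw [hru]; congr 1; ring
  rw [← hru'] at hk3
  rw [← hru] at hρ ⊢
  have hη2 : S.η (k + 1) = S.η₀ * r := S.η_succ k
  rw [hη2]
  have hA0 : 0 ≤ A := by positivity
  calc _ ≤ ((1 - γ * r) * y + γ * r * (C₃ * ((k : ℝ) + 1) ^ (-S.ρ)) ^ 2)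
        + (S.η₀ * r) ^ 2 * (A * u * (1 + y)) := by gcongr
    _ = (1 - γ * r) * y + γ * r * C₃ ^ 2 * (((k : ℝ) + 1) ^ (-S.ρ)) ^ 2
        + S.η₀ ^ 2 * A * r * (r * u) + (S.η₀ ^ 2 * A * (r * u)) * (r * y) := by ring
    _ ≤ (1 - γ * r) * y + γ * r * C₃ ^ 2 * (r * u)
        + S.η₀ ^ 2 * A * r * (r * u) + (γ / 2) * (r * y) := by gcongr
    _ = _ := by ring

theorem exists_rem_sq_le : ∃ C, 0 ≤ C ∧ ∀ k : ℕ, CondCentered S.P (S.ℱ k) (S.rem (k + 1)) ∧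
    ∫ ω, ‖S.rem (k + 1) ω‖ ^ 2 ∂S.P ≤ C * ((k : ℝ) + 1) ^ (-(S.j + 4 * S.c)) := by
  obtain ⟨C₁, hC₁, h₁⟩ := S.exists_rem
  obtain ⟨C₂, hC₂, h₂⟩ := S.exists_integral_X_sq_le
  refine ⟨C₁ * (1 + C₂), by positivity, fun k => ⟨(h₁ k (S.X_memLp k)).1,
    (h₁ k (S.X_memLp k)).2.trans ?_⟩⟩
  rw [mul_assoc, add_mul, one_mul]
  refine mul_le_mul_of_nonneg_left (add_le_add le_rfl ?_) hC₁
  have hu := rpow_succ_pos k S.j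
  calc _ ≤ ((k : ℝ) + 1) ^ S.j * (C₂ * ((k : ℝ) + 1) ^ (-(S.a - S.j))) := by
        have := h₂ k; gcongr
    _ = C₂ * ((k : ℝ) + 1) ^ (S.j + -(S.a - S.j)) := by rw [← rpow_succ_mul]; ring
    _ ≤ _ := mul_le_mul_of_nonneg_left (rpow_succ_le k (by linarith [S.three_j])) hC₂

theorem exists_integral_norm_X_le : ∃ C, 0 ≤ C ∧ ∀ k : ℕ,
    ∫ ω, ‖S.X k ω‖ ∂S.P ≤ C * ((k : ℝ) + 1) ^ (-((S.a - S.j) / 2)) := by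
  obtain ⟨C₂, hC₂, h₂⟩ := S.exists_integral_X_sq_le
  refine ⟨√C₂, by positivity, fun k => ?_⟩
  refine (le_abs_self _).trans (abs_integral_le_of_sq_le (S.X_memLp k).norm
    (mul_nonneg (Real.sqrt_nonneg _) (rpow_succ_pos k _).le) ?_)
  rw [mul_pow, Real.sq_sqrt hC₂, rpow_succ_pow_two]
  convert h₂ k using 3
  ring

end Setting

end

section

namespace Setting

variable {Ω H : Type*} [mΩ : MeasurableSpace Ω] [NormedAddCommGroup H] [InnerProductSpace ℝ H]
  [CompleteSpace H] {p B : ℕ} (S : Setting Ω H p B)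

/-! ### Decomposition of the error -/

/-- The deterministic transition of the error. -/
def L (k : ℕ) : H →L[ℝ] H := ContinuousLinearMap.id ℝ H - S.η k • S.G k

/-- Response to the truncated noise. -/
def nPart : ℕ → Ω → H
  | 0 => fun _ => 0
  | k + 1 => fun ω => S.L (k + 1) (nPart k ω) + S.η (k + 1) • S.trunc (k + 1) ω

/-- Response to the remaining martingale differences. -/
def rPart : ℕ → Ω → H
  | 0 => fun _ => 0
  | k + 1 => fun ω => S.L (k + 1) (rPart k ω) + S.η (k + 1) • S.rem (k + 1) ω

/-- Response to the initial value and to the deterministic drift. -/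
def wPart : ℕ → Ω → H
  | 0 => S.X 0
  | k + 1 => fun ω => S.L (k + 1) (wPart k ω) + S.η (k + 1) • S.w k ω

/-- Response to the perturbation of the Gram operator. -/
def hPart : ℕ → Ω → H
  | 0 => fun _ => 0
  | k + 1 => fun ω => S.L (k + 1) (hPart k ω) - S.η (k + 1) • S.h k ω

theorem L_apply (k : ℕ) (x : H) : S.L k x = x - S.η k • S.G k x := rfl

theorem X_eq_sum (k : ℕ) (ω : Ω) :
    S.X k ω = S.nPart k ω + S.rPart k ω + S.wPart k ω + S.hPart k ω := by
  induction k with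
  | zero => simp [nPart, rPart, wPart, hPart]
  | succ k ih =>
    rw [X_succ, ← L_apply, ih]
    simp only [nPart, rPart, wPart, hPart, map_add]
    module

theorem eventually_norm_L_le : ∀ᶠ k : ℕ in atTop, ∀ x : H,
    ‖S.L (k + 1) x‖ ≤ (1 - S.η₀ / (2 * S.K) * ((k : ℝ) + 1) ^ (-S.a)) * ‖x‖ :=
  S.eventually_norm_sub_G_le

theorem γ_pos : 0 < S.η₀ / (2 * S.K) := div_pos S.η₀_pos (by linarith [S.K_pos])

/-- Pathwise bound of a response. -/
theorem exists_response_le {x : ℕ → H} {u : ℕ → H} {C r : ℝ}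
    (hx : ∀ k, x (k + 1) = S.L (k + 1) (x k) + S.η (k + 1) • u k)
    (hu : ∀ k, ‖u k‖ ≤ C * ((k : ℝ) + 1) ^ (-r)) :
    ∃ C', 0 ≤ C' ∧ ∀ k : ℕ, ‖x k‖ ≤ C' * ((k : ℝ) + 1) ^ (-r) := by
  refine exists_power_recursion S.γ_pos S.a_pos S.a_lt_one (C := S.η₀ * C)
    (fun k => norm_nonneg (x k)) ?_
  filter_upwards [S.eventually_norm_L_le] with k hk
  rw [hx]
  refine (norm_add_le _ _).trans (add_le_add (hk _) ?_)
  rw [norm_smul, Real.norm_of_nonneg (S.η_pos k).le, η_succ]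
  have := hu k
  have := S.η₀_pos
  have := rpow_succ_pos k (-S.a)
  calc _ ≤ S.η₀ * ((k : ℝ) + 1) ^ (-S.a) * (C * ((k : ℝ) + 1) ^ (-r)) := by gcongr
    _ = _ := by ring

theorem exists_wPart_le (ω : Ω) : ∃ C, 0 ≤ C ∧ ∀ k : ℕ,
    ‖S.wPart k ω‖ ≤ C * ((k : ℝ) + 1) ^ (-S.ρ) := by
  obtain ⟨C, -, h⟩ := S.exists_w_le
  exact S.exists_response_le (x := fun k => S.wPart k ω) (fun _ => rfl) fun k => h k ω

theorem L_memLp {f : Ω → H} (k : ℕ) (hf : MemLp f 2 S.P) :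
    MemLp (fun ω => S.L k (f ω)) 2 S.P :=
  (S.L k).comp_memLp' hf

theorem L_stronglyMeasurable {Z : Type*} {m : MeasurableSpace Z} {f : Z → H} (k : ℕ)
    (hf : StronglyMeasurable[m] f) : StronglyMeasurable[m] fun ω => S.L k (f ω) :=
  (S.L k).continuous.comp_stronglyMeasurable hf

theorem gradSum_stronglyMeasurable (k : ℕ) : StronglyMeasurable[S.ℱ (k + 1)]
    (S.trunc (k + 1)) := by
  refine StronglyMeasurable.const_smul (Finset.stronglyMeasurable_fun_sum _ fun i _ => ?_) _
  exact (S.truncSmul_stronglyMeasurable _ _ (S.measurable_W_ℱ k i)).sub stronglyMeasurable_const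

theorem rem_stronglyMeasurable (k : ℕ) : StronglyMeasurable[S.ℱ (k + 1)] (S.rem (k + 1)) := by
  have hle : S.ℱ k ≤ S.ℱ (k + 1) := S.ℱ.mono (Nat.le_succ k)
  have h1 : StronglyMeasurable[S.ℱ (k + 1)] fun ω => (S.η (k + 1))⁻¹ •
      (S.coef (k + 1) ω - S.coef k ω) :=
    ((S.coef_stronglyMeasurable (k + 1)).sub ((S.coef_stronglyMeasurable k).mono hle)).const_smul _
  have h2 : S.rem (k + 1) = fun ω => (S.η (k + 1))⁻¹ • (S.coef (k + 1) ω - S.coef k ω)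
      - S.trunc (k + 1) ω - (S.g k ω - S.G (k + 1) (S.δ k ω) - S.h k ω) := by
    funext ω
    rw [coef_succ, add_sub_cancel_left, smul_smul, inv_mul_cancel₀ (S.η_pos k).ne', one_smul]
    abel
  rw [h2]
  exact (h1.sub (S.gradSum_stronglyMeasurable k)).sub ((S.mean_stronglyMeasurable k).mono hle)

theorem rPart_stronglyMeasurable (k : ℕ) : StronglyMeasurable[S.ℱ k] (S.rPart k) := by
  induction k with
  | zero => exact stronglyMeasurable_const
  | succ k ih =>
    exact (S.L_stronglyMeasurable (k + 1) (ih.mono (S.ℱ.mono (Nat.le_succ k)))).add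
      ((S.rem_stronglyMeasurable k).const_smul _)

theorem rem_centered (k : ℕ) : CondCentered S.P (S.ℱ k) (S.rem (k + 1)) := by
  obtain ⟨C, -, h⟩ := S.exists_rem_sq_le
  exact (h k).1

theorem rPart_memLp (k : ℕ) : MemLp (S.rPart k) 2 S.P := by
  induction k with
  | zero => exact memLp_const (0 : H)
  | succ k ih => exact (S.L_memLp (k + 1) ih).add ((S.rem_centered k).memLp.const_smul _)

/-- Mean square of a centred step. -/
theorem integral_norm_sq_step {k : ℕ} {y D : Ω → H}
    (hy : StronglyMeasurable[S.ℱ k] y) (hy2 : MemLp y 2 S.P)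
    (hD : CondCentered S.P (S.ℱ k) D) : ∫ ω, ‖y ω + D ω‖ ^ 2 ∂S.P
      = ∫ ω, ‖y ω‖ ^ 2 ∂S.P + ∫ ω, ‖D ω‖ ^ 2 ∂S.P := by
  have j1 := integrable_norm_sq hy2
  have j2 := (integrable_inner_of_memLp hy2 hD.memLp).const_mul 2
  have j3 := integrable_norm_sq hD.memLp
  have j12 : Integrable (fun ω => ‖y ω‖ ^ 2 + 2 * inner ℝ (y ω) (D ω)) S.P := j1.add j2
  simp only [norm_add_sq_real]
  rw [integral_add j12 j3, integral_add j1 j2, integral_const_mul, hD.integral_inner y hy hy2]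
  ring

theorem exists_integral_rPart_sq_le : ∃ C, 0 ≤ C ∧ ∀ k : ℕ,
    ∫ ω, ‖S.rPart k ω‖ ^ 2 ∂S.P ≤ C * ((k : ℝ) + 1) ^ (-S.a) := by
  obtain ⟨C, hC, h⟩ := S.exists_rem_sq_le
  have hη := S.η₀_pos
  refine exists_power_recursion S.γ_pos S.a_pos S.a_lt_one (C := S.η₀ ^ 2 * C)
    (fun k => integral_nonneg fun _ => sq_nonneg _) ?_
  filter_upwards [S.eventually_norm_L_le, eventually_mul_rpow_le (S.η₀ / (2 * S.K))
    (neg_lt_zero.mpr S.a_pos) one_pos] with k hk hk2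
  rw [Real.rpow_zero, mul_one] at hk2
  obtain ⟨c1, c2⟩ := h k
  have hr := rpow_succ_pos k (-S.a)
  set q := 1 - S.η₀ / (2 * S.K) * ((k : ℝ) + 1) ^ (-S.a) with hq
  have hq0 : 0 ≤ q := by linarith
  have hq1 : q ≤ 1 := by have := mul_pos S.γ_pos hr; linarith
  have h1 := S.integral_norm_sq_step (S.L_stronglyMeasurable (k + 1) (S.rPart_stronglyMeasurable k))
    (S.L_memLp (k + 1) (S.rPart_memLp k)) (c1.const_smul (S.η (k + 1)))
  have h2 : ∫ ω, ‖S.L (k + 1) (S.rPart k ω)‖ ^ 2 ∂S.P ≤ q * ∫ ω, ‖S.rPart k ω‖ ^ 2 ∂S.P := by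
    rw [← integral_const_mul]
    refine integral_mono (integrable_norm_sq (S.L_memLp (k + 1) (S.rPart_memLp k)))
      ((integrable_norm_sq (S.rPart_memLp k)).const_mul q) fun ω => ?_
    calc _ ≤ (q * ‖S.rPart k ω‖) ^ 2 := pow_le_pow_left₀ (norm_nonneg _) (hk _) 2
      _ = q * q * ‖S.rPart k ω‖ ^ 2 := by ring
      _ ≤ q * 1 * ‖S.rPart k ω‖ ^ 2 := by gcongr
      _ = _ := by ring
  have h3 : ∫ ω, ‖S.η (k + 1) • S.rem (k + 1) ω‖ ^ 2 ∂S.P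
      = S.η (k + 1) ^ 2 * ∫ ω, ‖S.rem (k + 1) ω‖ ^ 2 ∂S.P := by
    rw [← integral_const_mul]
    refine integral_congr_ae (Eventually.of_forall fun ω => ?_)
    simp only
    rw [norm_smul, mul_pow, Real.norm_eq_abs, sq_abs]
  have h4 : ((k : ℝ) + 1) ^ (-(S.j + 4 * S.c)) ≤ 1 :=
    rpow_succ_le_one k (by linarith [S.j_pos, S.c_pos])
  calc _ = _ := h1
    _ ≤ q * ∫ ω, ‖S.rPart k ω‖ ^ 2 ∂S.P
        + (S.η₀ * ((k : ℝ) + 1) ^ (-S.a)) ^ 2 * (C * 1) := by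
        rw [h3, η_succ]
        have := c2.trans (mul_le_mul_of_nonneg_left h4 hC)
        gcongr
    _ = _ := by ring

theorem exists_integral_norm_rPart_le : ∃ C, 0 ≤ C ∧ ∀ k : ℕ,
    ∫ ω, ‖S.rPart k ω‖ ∂S.P ≤ C * ((k : ℝ) + 1) ^ (-(S.a / 2)) := by
  obtain ⟨C₂, hC₂, h₂⟩ := S.exists_integral_rPart_sq_le
  refine ⟨√C₂, by positivity, fun k => ?_⟩
  refine (le_abs_self _).trans (abs_integral_le_of_sq_le (S.rPart_memLp k).norm
    (mul_nonneg (Real.sqrt_nonneg _) (rpow_succ_pos k _).le) ?_)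
  rw [mul_pow, Real.sq_sqrt hC₂, rpow_succ_pow_two]
  convert h₂ k using 3
  ring

/-- Scaled sums of centred steps are bounded. -/
theorem ae_exists_le_of_centered {x D : ℕ → Ω → H} {Λ : ℕ → H →L[ℝ] H} {q C : ℝ}
    (hΛ : ∀ᶠ k : ℕ in atTop, ∀ y, ((k : ℝ) + 1) ^ q * (k : ℝ) ^ (-q) * ‖Λ (k + 1) y‖ ≤ ‖y‖)
    (hxm : ∀ k, StronglyMeasurable[S.ℱ k] (x k)) (hx2 : ∀ k, MemLp (x k) 2 S.P)
    (hx : ∀ k ω, x (k + 1) ω = Λ (k + 1) (x k ω) + D (k + 1) ω)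
    (hD : ∀ k, CondCentered S.P (S.ℱ k) (D (k + 1)))
    (hD2 : ∀ k : ℕ, ∫ ω, ‖D (k + 1) ω‖ ^ 2 ∂S.P ≤ C * ((k : ℝ) + 1) ^ (-(1 + 2 * q + S.c))) :
    ∀ᵐ ω ∂S.P, ∃ C', 0 ≤ C' ∧ ∀ k : ℕ, ‖x k ω‖ ≤ C' * ((k : ℝ) + 1) ^ (-q) := by
  obtain ⟨n, hn⟩ := eventually_atTop.mp (hΛ.and (eventually_ge_atTop 1))
  set D' : ℕ → Ω → H := fun k => match k with
    | 0 => fun _ => 0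
    | k + 1 => fun ω => ((k : ℝ) + 1) ^ q • D (k + 1) ω with hD'
  have hsum : Summable fun k => ∫ ω, ‖D' k ω‖ ^ 2 ∂S.P := by
    rw [← summable_nat_add_iff 1]
    have hs : Summable fun k : ℕ => C * (((k + 1 : ℕ) : ℝ)) ^ (-(1 + S.c)) :=
      ((summable_nat_add_iff 1).mpr
        (summable_natCast_rpow_of_lt (by linarith [S.c_pos]))).mul_left C
    refine Summable.of_nonneg_of_le (fun k => integral_nonneg fun _ => sq_nonneg _) (fun k => ?_) hs
    have h3 : ∫ ω, ‖D' (k + 1) ω‖ ^ 2 ∂S.P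
        = ((k : ℝ) + 1) ^ (2 * q) * ∫ ω, ‖D (k + 1) ω‖ ^ 2 ∂S.P := by
      rw [← integral_const_mul]
      refine integral_congr_ae (Eventually.of_forall fun ω => ?_)
      simp only [hD']
      rw [norm_smul, mul_pow, Real.norm_eq_abs, sq_abs, rpow_succ_pow_two]
    rw [h3]
    have := rpow_succ_pos k (2 * q)
    calc _ ≤ ((k : ℝ) + 1) ^ (2 * q) * (C * ((k : ℝ) + 1) ^ (-(1 + 2 * q + S.c))) := by
          gcongr; exact hD2 k
      _ = C * ((k : ℝ) + 1) ^ (2 * q + -(1 + 2 * q + S.c)) := by rw [← rpow_succ_mul]; ring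
      _ = _ := by push_cast; congr 2; ring
  have key := ae_bounded_of_condCentered S.ℱ (S := fun k ω => (k : ℝ) ^ q • x k ω) (D := D')
    (L := fun k => (((k : ℝ) + 1) ^ q * (k : ℝ) ^ (-q)) • Λ (k + 1)) (n := n)
    (fun k hk y => by
      rw [smul_apply, norm_smul, Real.norm_of_nonneg (by positivity)]
      exact (hn k hk).1 y)
    (fun k => (hxm k).const_smul _) (fun k => (hx2 k).const_smul _)
    (fun k hk ω => by
      have hk0 : (0 : ℝ) < k := by exact_mod_cast (hn k hk).2
      simp only [hD', smul_apply, map_smul]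
      rw [hx, smul_add, smul_smul]
      push_cast
      rw [mul_left_comm, ← Real.rpow_add hk0, add_neg_cancel, Real.rpow_zero, mul_one])
    (fun k => (hD k).const_smul _) hsum (memLp_const (0 : H))
  filter_upwards [key] with ω ⟨C', hC'⟩
  have h0 : ∀ᶠ k : ℕ in atTop, ‖x k ω‖ ≤ C' * (k : ℝ) ^ (-q) := by
    filter_upwards [eventually_ge_atTop n, eventually_ge_atTop 1] with k hk hk1
    have hk0 : (0 : ℝ) < k := by exact_mod_cast hk1
    have := hC' k hk
    rw [norm_smul, Real.norm_of_nonneg (by positivity)] at this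
    rw [Real.rpow_neg hk0.le, ← div_eq_mul_inv, le_div_iff₀ (Real.rpow_pos_of_pos hk0 _), mul_comm]
    exact this
  obtain ⟨C'', hC'', h''⟩ := forall_le_of_eventually_le (fun k hk =>
    Real.rpow_pos_of_pos (by exact_mod_cast hk : (0 : ℝ) < k) (-q)) h0
  exact exists_le_rpow_succ hC'' h''

theorem b_pos : 0 < S.b := by
  have := S.four_j; have := S.a_pos; have := S.j_pos; have := S.c_pos; unfold b; linarith

theorem ae_exists_rPart_le : ∀ᵐ ω ∂S.P, ∃ C, 0 ≤ C ∧ ∀ k : ℕ,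
    ‖S.rPart k ω‖ ≤ C * ((k : ℝ) + 1) ^ (-(S.a - S.b)) := by
  obtain ⟨C, hC, h⟩ := S.exists_rem_sq_le
  refine S.ae_exists_le_of_centered (Λ := S.L) (D := fun k ω => S.η k • S.rem k ω)
    (C := S.η₀ ^ 2 * C) ?_ S.rPart_stronglyMeasurable S.rPart_memLp (fun _ _ => rfl)
    (fun k => (h k).1.const_smul _) fun k => ?_
  · filter_upwards [S.eventually_norm_L_le, ratio_le (S.a - S.b) S.γ_pos S.a_pos S.a_lt_one]
      with k hk hk2 y
    have h1 := hk y
    have hq : 0 ≤ ((k : ℝ) + 1) ^ (S.a - S.b) * (k : ℝ) ^ (-(S.a - S.b)) := by positivity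
    have hr := mul_pos S.γ_pos (rpow_succ_pos k (-S.a))
    calc _ ≤ ((k : ℝ) + 1) ^ (S.a - S.b) * (k : ℝ) ^ (-(S.a - S.b)) *
          ((1 - S.η₀ / (2 * S.K) * ((k : ℝ) + 1) ^ (-S.a)) * ‖y‖) := by gcongr
      _ = ((1 - S.η₀ / (2 * S.K) * ((k : ℝ) + 1) ^ (-S.a))
          * (((k : ℝ) + 1) ^ (S.a - S.b) * (k : ℝ) ^ (-(S.a - S.b)))) * ‖y‖ := by ring
      _ ≤ 1 * ‖y‖ := by
          refine mul_le_mul_of_nonneg_right (hk2.2.trans ?_) (norm_nonneg _)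
          linarith
      _ = _ := one_mul _
  · have h3 : ∫ ω, ‖S.η (k + 1) • S.rem (k + 1) ω‖ ^ 2 ∂S.P
        = S.η (k + 1) ^ 2 * ∫ ω, ‖S.rem (k + 1) ω‖ ^ 2 ∂S.P := by
      rw [← integral_const_mul]
      refine integral_congr_ae (Eventually.of_forall fun ω => ?_)
      simp only
      rw [norm_smul, mul_pow, Real.norm_eq_abs, sq_abs]
    rw [h3, η_succ, mul_pow, rpow_succ_pow_two]
    have := rpow_succ_pos k (2 * -S.a)
    calc _ ≤ S.η₀ ^ 2 * ((k : ℝ) + 1) ^ (2 * -S.a)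
          * (C * ((k : ℝ) + 1) ^ (-(S.j + 4 * S.c))) := by gcongr; exact (h k).2
      _ = S.η₀ ^ 2 * C * (((k : ℝ) + 1) ^ (2 * -S.a)
          * ((k : ℝ) + 1) ^ (-(S.j + 4 * S.c))) := by ring
      _ ≤ _ := by
          rw [rpow_succ_mul]
          refine mul_le_mul_of_nonneg_left (rpow_succ_le k ?_) (by positivity)
          have := S.c_pos
          unfold b; linarith

/-! The perturbation part. -/

theorem h_stronglyMeasurable (k : ℕ) : StronglyMeasurable[S.ℱ k] (S.h k) := by
  have hδ : StronglyMeasurable[S.ℱ k] (S.δ k) :=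
    (S.coef_stronglyMeasurable k).sub stronglyMeasurable_const
  have key : ∀ θ : Ω → EuclideanSpace ℝ (Fin p), Measurable[S.ℱ k] θ →
      StronglyMeasurable[S.ℱ k] fun ω => ∫ w, (inner ℝ (feat S.e S.ψ (S.J (k + 1))
        (index (θ ω) w)) (S.δ k ω) : ℝ) • feat S.e S.ψ (S.J (k + 1)) (index (θ ω) w) ∂S.ν := by
    intro θ hθ
    have hF := S.feat_comp_stronglyMeasurable (m := (S.ℱ k).prod inferInstance) (S.J (k + 1))
      (θ := fun x : Ω × Obs p => θ x.1) (w := fun x : Ω × Obs p => x.2)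
      (hθ.comp measurable_fst) measurable_snd
    have h1 : StronglyMeasurable[(S.ℱ k).prod inferInstance] fun x : Ω × Obs p =>
        (inner ℝ (feat S.e S.ψ (S.J (k + 1)) (index (θ x.1) x.2)) (S.δ k x.1) : ℝ)
          • feat S.e S.ψ (S.J (k + 1)) (index (θ x.1) x.2) :=
      (hF.inner (hδ.comp_measurable measurable_fst)).smul hF
    exact @StronglyMeasurable.integral_prod_right' _ _ _ (S.ℱ k) _ S.ν _ _ _ _ h1
  exact (key _ (S.adapted k)).sub (key _ measurable_const)

theorem h_memLp (k : ℕ) : MemLp (S.h k) 2 S.P := by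
  obtain ⟨C₄, hC₄, h₄⟩ := S.exists_h_le
  have hb0 : MemLp (fun ω => ‖S.X k ω‖ + ((k : ℝ) + 1) ^ (-(S.s * S.j))) 2 S.P :=
    (S.X_memLp k).norm.add (memLp_const _)
  exact (hb0.const_mul (C₄ * ((k : ℝ) + 1) ^ (-S.D))).mono
    ((S.h_stronglyMeasurable k).mono (S.ℱ.le k)).aestronglyMeasurable
    (Eventually.of_forall fun ω => (h₄ k ω).trans (le_abs_self _))

theorem exists_integral_norm_h_le : ∃ C, 0 ≤ C ∧ ∀ k : ℕ,
    ∫ ω, ‖S.h k ω‖ ∂S.P ≤ C * ((k : ℝ) + 1) ^ (-(S.a / 2)) := by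
  obtain ⟨C₁, hC₁, h₁⟩ := S.exists_h_le
  obtain ⟨C₂, hC₂, h₂⟩ := S.exists_integral_norm_X_le
  refine ⟨C₁ * (C₂ + 1), by positivity, fun k => ?_⟩
  have hX : Integrable (fun ω => ‖S.X k ω‖) S.P := ((S.X_memLp k).integrable one_le_two).norm
  have hr := rpow_succ_pos k (-S.D)
  have hρ := S.ρ_le_sj
  have hρ2 := S.ρ_lower
  have hD : S.j / 2 ≤ S.D := by have := S.D_lower; have := S.c_pos; unfold D; linarith
  calc _ ≤ ∫ ω, C₁ * ((k : ℝ) + 1) ^ (-S.D)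
        * (‖S.X k ω‖ + ((k : ℝ) + 1) ^ (-(S.s * S.j))) ∂S.P :=
        integral_mono ((S.h_memLp k).integrable one_le_two).norm
          ((hX.add (integrable_const _)).const_mul _) (h₁ k)
    _ = C₁ * ((k : ℝ) + 1) ^ (-S.D) * (∫ ω, ‖S.X k ω‖ ∂S.P + ((k : ℝ) + 1) ^ (-(S.s * S.j))) := by
        rw [integral_const_mul, integral_add hX (integrable_const _)]
        simp
    _ ≤ C₁ * ((k : ℝ) + 1) ^ (-S.D) * (C₂ * ((k : ℝ) + 1) ^ (-((S.a - S.j) / 2))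
          + 1 * ((k : ℝ) + 1) ^ (-((S.a - S.j) / 2))) := by
        rw [one_mul]
        have := h₂ k
        have h5 : ((k : ℝ) + 1) ^ (-(S.s * S.j)) ≤ ((k : ℝ) + 1) ^ (-((S.a - S.j) / 2)) :=
          rpow_succ_le k (by linarith)
        gcongr
    _ = C₁ * (C₂ + 1) * (((k : ℝ) + 1) ^ (-S.D) * ((k : ℝ) + 1) ^ (-((S.a - S.j) / 2))) := by ring
    _ ≤ _ := by
        rw [rpow_succ_mul]
        exact mul_le_mul_of_nonneg_left (rpow_succ_le k (by linarith)) (by positivity)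

theorem hPart_memLp (k : ℕ) : MemLp (S.hPart k) 2 S.P := by
  induction k with
  | zero => exact memLp_const (0 : H)
  | succ k ih => exact (S.L_memLp (k + 1) ih).sub ((S.h_memLp k).const_smul _)

theorem exists_integral_norm_hPart_le : ∃ C, 0 ≤ C ∧ ∀ k : ℕ,
    ∫ ω, ‖S.hPart k ω‖ ∂S.P ≤ C * ((k : ℝ) + 1) ^ (-(S.a / 2)) := by
  obtain ⟨C, hC, h⟩ := S.exists_integral_norm_h_le
  have hη := S.η₀_pos
  refine exists_power_recursion S.γ_pos S.a_pos S.a_lt_one (C := S.η₀ * C)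
    (fun k => integral_nonneg fun _ => norm_nonneg _) ?_
  filter_upwards [S.eventually_norm_L_le] with k hk
  have i1 : Integrable (fun ω => ‖S.hPart k ω‖) S.P :=
    ((S.hPart_memLp k).integrable one_le_two).norm
  have i2 : Integrable (fun ω => ‖S.h k ω‖) S.P := ((S.h_memLp k).integrable one_le_two).norm
  have hr := rpow_succ_pos k (-S.a)
  calc _ ≤ ∫ ω, ((1 - S.η₀ / (2 * S.K) * ((k : ℝ) + 1) ^ (-S.a)) * ‖S.hPart k ω‖
        + S.η (k + 1) * ‖S.h k ω‖) ∂S.P := by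
        refine integral_mono ((S.hPart_memLp (k + 1)).integrable one_le_two).norm
          ((i1.const_mul _).add (i2.const_mul _)) fun ω => ?_
        refine (norm_sub_le _ _).trans (add_le_add (hk _) ?_)
        rw [norm_smul, Real.norm_of_nonneg (S.η_pos k).le]
    _ = (1 - S.η₀ / (2 * S.K) * ((k : ℝ) + 1) ^ (-S.a)) * ∫ ω, ‖S.hPart k ω‖ ∂S.P
        + S.η (k + 1) * ∫ ω, ‖S.h k ω‖ ∂S.P := by
        rw [integral_add (i1.const_mul _) (i2.const_mul _), integral_const_mul, integral_const_mul]
    _ ≤ _ := by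
        rw [η_succ]
        refine add_le_add le_rfl ?_
        calc _ ≤ S.η₀ * ((k : ℝ) + 1) ^ (-S.a) * (C * ((k : ℝ) + 1) ^ (-(S.a / 2))) := by
              gcongr; exact h k
          _ = _ := by ring

end Setting

end

section

/-! ### Polynomially many exponential moments -/

/-- Polynomially many variables with bounded exponential moments are almost surely of logarithmic
order. -/
theorem ae_exists_le_log {Ω ι : Type*} [MeasurableSpace Ω] {P : Measure Ω} {V : ℕ → Finset ι}
    {Y : ℕ → ι → Ω → ℝ} (hY : ∀ k u, Measurable (Y k u)) {A C E : ℝ} {k₀ : ℕ} (hC : 0 ≤ C)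
    (hV : ∀ k : ℕ, ((V k).card : ℝ) ≤ C * ((k : ℝ) + 1) ^ A)
    (hE : ∀ k, k₀ ≤ k → ∀ u ∈ V k,
      ∫⁻ ω, ENNReal.ofReal (Real.exp (Y k u ω)) ∂P ≤ ENNReal.ofReal E) :
    ∀ᵐ ω ∂P, ∃ C', 0 ≤ C' ∧ ∀ k, k₀ ≤ k → ∀ u ∈ V k,
      Y k u ω ≤ C' + (A + 2) * Real.log ((k : ℝ) + 1) := by
  set Z : ℕ → Ω → ℝ≥0∞ := fun k ω => if k₀ ≤ k then
    ENNReal.ofReal (((k : ℝ) + 1) ^ (-(A + 2))) * ∑ u ∈ V k, ENNReal.ofReal (Real.exp (Y k u ω))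
    else 0 with hZ
  have hYm : ∀ k u, Measurable fun ω => ENNReal.ofReal (Real.exp (Y k u ω)) := fun k u =>
    ENNReal.measurable_ofReal.comp (Real.measurable_exp.comp (hY k u))
  have hZm : ∀ k, Measurable (Z k) := by
    intro k
    by_cases hk : k₀ ≤ k
    · simp only [hZ, if_pos hk]
      exact (Finset.measurable_fun_sum _ fun u _ => hYm k u).const_mul _
    · simp only [hZ, if_neg hk]; exact measurable_const
  have hZi : ∀ k, ∫⁻ ω, Z k ω ∂P ≤ ENNReal.ofReal (C * |E| * ((k : ℝ) + 1) ^ (-2 : ℝ)) := by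
    intro k
    by_cases hk : k₀ ≤ k
    · simp only [hZ, if_pos hk]
      rw [lintegral_const_mul _ (Finset.measurable_fun_sum _ fun u _ => hYm k u),
        lintegral_finsetSum _ fun u _ => hYm k u]
      have hsum : ∑ u ∈ V k, ∫⁻ ω, ENNReal.ofReal (Real.exp (Y k u ω)) ∂P
          ≤ ENNReal.ofReal (C * ((k : ℝ) + 1) ^ A * |E|) := by
        calc _ ≤ ∑ _u ∈ V k, ENNReal.ofReal |E| := Finset.sum_le_sum fun u hu =>
              (hE k hk u hu).trans (ENNReal.ofReal_le_ofReal (le_abs_self E))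
          _ = ENNReal.ofReal ((V k).card * |E|) := by
              rw [Finset.sum_const, nsmul_eq_mul, ENNReal.ofReal_mul (by positivity),
                ENNReal.ofReal_natCast]
          _ ≤ _ := ENNReal.ofReal_le_ofReal (mul_le_mul_of_nonneg_right (hV k) (abs_nonneg _))
      refine (mul_le_mul_right hsum _).trans ?_
      rw [← ENNReal.ofReal_mul (rpow_succ_pos k _).le]
      refine ENNReal.ofReal_le_ofReal (le_of_eq ?_)
      have := rpow_succ_mul k (-(A + 2)) A
      rw [show -(A + 2) + A = (-2 : ℝ) by ring] at this
      rw [← this]; ring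
    · simp [hZ, if_neg hk]
  have hfin : ∫⁻ ω, ∑' k, Z k ω ∂P ≠ ∞ := by
    rw [lintegral_tsum fun k => (hZm k).aemeasurable]
    have hs : Summable fun k : ℕ => C * |E| * ((k : ℝ) + 1) ^ (-2 : ℝ) := by
      have := (summable_nat_add_iff 1).mpr
        (summable_natCast_rpow_of_lt (by norm_num : (-2 : ℝ) < -1))
      push_cast at this
      exact this.mul_left _
    refine ne_top_of_le_ne_top ?_ (ENNReal.tsum_le_tsum hZi)
    rw [← ENNReal.ofReal_tsum_of_nonneg (fun k => by
      have := (rpow_succ_pos k (-2)).le; positivity) hs]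
    exact ENNReal.ofReal_ne_top
  filter_upwards [ae_lt_top (Measurable.tsum hZm) hfin] with ω hω
  set R := (∑' k, Z k ω).toReal with hR
  refine ⟨Real.log (R + 1), Real.log_nonneg (by have : 0 ≤ R := ENNReal.toReal_nonneg; linarith),
    fun k hk u hu => ?_⟩
  have hR0 : 0 ≤ R := ENNReal.toReal_nonneg
  have h1 : ENNReal.ofReal (((k : ℝ) + 1) ^ (-(A + 2)) * Real.exp (Y k u ω)) ≤ ∑' k, Z k ω := by
    refine le_trans ?_ (ENNReal.le_tsum k)
    simp only [hZ, if_pos hk]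
    rw [ENNReal.ofReal_mul (rpow_succ_pos k _).le]
    gcongr
    exact Finset.single_le_sum (f := fun u => ENNReal.ofReal (Real.exp (Y k u ω)))
      (fun _ _ => zero_le) hu
  have h2 : ((k : ℝ) + 1) ^ (-(A + 2)) * Real.exp (Y k u ω) ≤ R + 1 := by
    have := (ENNReal.ofReal_le_iff_le_toReal hω.ne).mp h1
    linarith
  have h3 : Real.exp (Y k u ω) ≤ (R + 1) * ((k : ℝ) + 1) ^ (A + 2) := by
    have h4 := mul_le_mul_of_nonneg_right h2 (rpow_succ_pos k (A + 2)).le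
    have h5 := rpow_succ_mul k (-(A + 2)) (A + 2)
    rw [neg_add_cancel, Real.rpow_zero] at h5
    calc _ = (((k : ℝ) + 1) ^ (-(A + 2)) * ((k : ℝ) + 1) ^ (A + 2)) * Real.exp (Y k u ω) := by
          rw [h5, one_mul]
      _ = ((k : ℝ) + 1) ^ (-(A + 2)) * Real.exp (Y k u ω) * ((k : ℝ) + 1) ^ (A + 2) := by ring
      _ ≤ _ := h4
  have h6 := Real.log_le_log (Real.exp_pos _) h3
  rwa [Real.log_exp, Real.log_mul (by positivity) (rpow_succ_pos k _).ne',
    Real.log_rpow (natCast_add_one_pos k)] at h6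

theorem exists_const_add_log_le (C A : ℝ) {c : ℝ} (hc : 0 < c) : ∃ C', 0 ≤ C' ∧ ∀ k : ℕ,
    C + A * Real.log ((k : ℝ) + 1) ≤ C' * ((k : ℝ) + 1) ^ c := by
  refine ⟨|C| + |A| / c, by positivity, fun k => ?_⟩
  have h1 := Real.log_le_rpow_div (natCast_add_one_pos k).le hc
  have h2 : 1 ≤ ((k : ℝ) + 1) ^ c := Real.one_le_rpow (one_le_natCast_add_one k) hc.le
  have h3 : 0 ≤ Real.log ((k : ℝ) + 1) := Real.log_nonneg (one_le_natCast_add_one k)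
  calc _ ≤ |C| * 1 + |A| * Real.log ((k : ℝ) + 1) := by
        rw [mul_one]
        exact add_le_add (le_abs_self _) (mul_le_mul_of_nonneg_right (le_abs_self _) h3)
    _ ≤ |C| * ((k : ℝ) + 1) ^ c + |A| * (((k : ℝ) + 1) ^ c / c) := by gcongr
    _ = _ := by ring

/-- A grid on a ball. -/
theorem exists_grid {p : ℕ} (θ₀ : EuclideanSpace ℝ (Fin p)) {M : ℝ} {m : ℕ}
    (hm : 1 ≤ m) : ∃ T : Finset (EuclideanSpace ℝ (Fin p)),
      (T.card : ℝ) ≤ (3 * (⌈M⌉₊ + 1) * m : ℝ) ^ p ∧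
      ∀ θ, ‖θ - θ₀‖ ≤ M → ∃ θ' ∈ T, ‖θ - θ'‖ ≤ p / m := by
  classical
  have hm0 : (0 : ℝ) < m := by exact_mod_cast hm
  have hm1 : (1 : ℝ) ≤ m := by exact_mod_cast hm
  set R : ℕ := ⌈M⌉₊ * m + 1 with hR
  set φ : (Fin p → ℤ) → EuclideanSpace ℝ (Fin p) :=
    fun z => θ₀ + WithLp.toLp 2 (fun i => (z i : ℝ) / m) with hφ
  refine ⟨(Fintype.piFinset fun _ : Fin p => Finset.Icc (-(R : ℤ)) R).image φ, ?_, fun θ hθ => ?_⟩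
  · have h1 : (((Fintype.piFinset fun _ : Fin p => Finset.Icc (-(R : ℤ)) R).image φ).card : ℝ)
        ≤ ((2 * R + 1 : ℕ) : ℝ) ^ p := by
      have h2 := Finset.card_image_le (s := Fintype.piFinset fun _ : Fin p =>
        Finset.Icc (-(R : ℤ)) R) (f := φ)
      rw [Fintype.card_piFinset] at h2
      simp only [Int.card_Icc, Finset.prod_const, Finset.card_univ, Fintype.card_fin] at h2
      rw [show ((R : ℤ) + 1 - -(R : ℤ)).toNat = 2 * R + 1 by omega] at h2
      exact_mod_cast h2
    refine h1.trans (pow_le_pow_left₀ (by positivity) ?_ p)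
    rw [hR]; push_cast
    nlinarith [mul_nonneg (Nat.cast_nonneg (α := ℝ) ⌈M⌉₊) hm0.le]
  · refine ⟨φ fun i => ⌊(m : ℝ) * (θ - θ₀) i⌋, Finset.mem_image_of_mem _ ?_, ?_⟩
    · rw [Fintype.mem_piFinset]
      intro i
      have h1 : |(θ - θ₀) i| ≤ M := by
        have := (PiLp.norm_apply_le (θ - θ₀) i).trans hθ
        rwa [Real.norm_eq_abs] at this
      have h2 := abs_le.mp h1
      have h3 : (m : ℝ) * M ≤ ⌈M⌉₊ * m := by
        rw [mul_comm]; exact mul_le_mul_of_nonneg_right (Nat.le_ceil M) hm0.le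
      rw [Finset.mem_Icc]
      constructor
      · rw [Int.le_floor, hR]; push_cast
        nlinarith
      · rw [← Int.cast_le (R := ℝ)]
        refine (Int.floor_le _).trans ?_
        rw [hR]; push_cast
        nlinarith
    · have hco : ∀ i, |(θ - φ fun i => ⌊(m : ℝ) * (θ - θ₀) i⌋) i| ≤ 1 / m := by
        intro i
        have h1 := Int.floor_le ((m : ℝ) * (θ - θ₀) i)
        have h2 := (Int.lt_floor_add_one ((m : ℝ) * (θ - θ₀) i)).le
        have h3 : (θ - φ fun i => ⌊(m : ℝ) * (θ - θ₀) i⌋) i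
            = ((m : ℝ) * (θ - θ₀) i - ⌊(m : ℝ) * (θ - θ₀) i⌋) / m := by
          simp only [hφ, PiLp.sub_apply, PiLp.add_apply]
          field_simp
          ring
        rw [h3, abs_div, abs_of_pos hm0]
        gcongr
        rw [abs_le]; constructor <;> linarith
      rw [EuclideanSpace.norm_eq]
      refine Real.sqrt_le_iff.mpr ⟨by positivity, ?_⟩
      calc _ ≤ ∑ _i : Fin p, (1 / m : ℝ) ^ 2 := by
            refine Finset.sum_le_sum fun i _ => ?_
            rw [Real.norm_eq_abs]
            exact pow_le_pow_left₀ (abs_nonneg _) (hco i) 2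
        _ = p * (1 / m : ℝ) ^ 2 := by simp
        _ ≤ (p : ℝ) ^ 2 * (1 / m : ℝ) ^ 2 := by
            gcongr
            rcases Nat.eq_zero_or_pos p with rfl | hp
            · simp
            · have : (1 : ℝ) ≤ p := by exact_mod_cast hp
              nlinarith
        _ = _ := by ring

namespace Setting

variable {Ω H : Type*} [mΩ : MeasurableSpace Ω] [NormedAddCommGroup H] [InnerProductSpace ℝ H]
  [CompleteSpace H] {p B : ℕ} (S : Setting Ω H p B)

/-! ### Exponential moments of the response to the truncated noise -/

theorem lintegral_exp_trunc_step (k : ℕ) {y : Ω → ℝ} (hy : Measurable[S.ℱ k] y) {u : H}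
    (hu : ‖u‖ * (2 * (S.T (k + 1) * (S.K * √(S.J (k + 1))))) ≤ 1) :
    ∫⁻ ω, ENNReal.ofReal (Real.exp (y ω + inner ℝ u (S.trunc (k + 1) ω))) ∂S.P
      ≤ ENNReal.ofReal (Real.exp ((S.K ^ 2 * ‖u‖) ^ 2))
        * ∫⁻ ω, ENNReal.ofReal (Real.exp (y ω)) ∂S.P := by
  have hT := S.T_pos k
  have hsm := truncScore_stronglyMeasurable S.reg S.ortho (S.J (k + 1)) (S.T (k + 1))
  have key := lintegral_exp_step S.one_le_B (S.ℱ.le k) (S.measurable_W k) (S.indep_W k)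
    (S.law_W k) hy
    (f := fun w => inner ℝ u (truncScore S.e S.ν S.θ₀ S.F₀ S.ψ (S.J (k + 1)) (S.T (k + 1)) w))
    ((stronglyMeasurable_const (b := u)).inner hsm (𝕜 := ℝ)).measurable
    (fun w => (abs_real_inner_le_norm _ _).trans ((mul_le_mul_of_nonneg_left
      (norm_truncScore_le S.reg S.ortho _ hT.le w) (norm_nonneg u)).trans hu))
    (integral_inner_truncScore S.reg S.ortho _ _ u)
    (integral_inner_truncScore_sq_le S.reg S.ortho (S.one_le_J _) hT.le u)
  refine le_trans (le_of_eq ?_) key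
  refine lintegral_congr fun ω => ?_
  rw [trunc, inner_smul_right, inner_sum]

theorem trunc_mem (k : ℕ) (ω : Ω) : S.trunc k ω ∈ sieveSub S.e (S.J k) := by
  cases k with
  | zero => exact Submodule.zero_mem _
  | succ k => exact Submodule.smul_mem _ _ (Submodule.sum_mem _ fun i _ => truncScore_mem S.ortho _ _ _)

theorem exists_norm_trunc_le (k : ℕ) : ∃ R, 0 ≤ R ∧ ∀ ω, ‖S.trunc k ω‖ ≤ R := by
  cases k with
  | zero => exact ⟨0, le_rfl, fun ω => by simp [trunc]⟩
  | succ k =>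
    have hK := S.K_pos
    have hT := S.T_pos k
    refine ⟨2 * (S.T (k + 1) * (S.K * √(S.J (k + 1)))), by positivity, fun ω => ?_⟩
    have hB := S.B_pos
    rw [trunc, norm_smul, Real.norm_of_nonneg (by positivity)]
    calc _ ≤ (B : ℝ)⁻¹ * ∑ _i : Fin B, 2 * (S.T (k + 1) * (S.K * √(S.J (k + 1)))) := by
          gcongr
          refine (norm_sum_le _ _).trans (Finset.sum_le_sum fun i _ => ?_)
          exact norm_truncScore_le S.reg S.ortho _ hT.le _
      _ = _ := by
          rw [Finset.sum_const, Finset.card_univ, Fintype.card_fin, nsmul_eq_mul]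
          field_simp

theorem nPart_mem (k : ℕ) (ω : Ω) : S.nPart k ω ∈ sieveSub S.e (S.J k) := by
  induction k with
  | zero => exact Submodule.zero_mem _
  | succ k ih =>
    have h1 := sieveSub_mono (S.J_le_J_succ k) ih
    exact Submodule.add_mem _ (Submodule.sub_mem _ h1 (Submodule.smul_mem _ _
      (extOp_mem S.ortho _ h1))) (Submodule.smul_mem _ _ (S.trunc_mem _ _))

theorem exists_norm_nPart_le (k : ℕ) : ∃ R, 0 ≤ R ∧ ∀ ω, ‖S.nPart k ω‖ ≤ R := by
  induction k with
  | zero => exact ⟨0, le_rfl, fun ω => by simp [nPart]⟩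
  | succ k ih =>
    obtain ⟨R, hR, h⟩ := ih
    obtain ⟨R', hR', h'⟩ := S.exists_norm_trunc_le (k + 1)
    refine ⟨‖S.L (k + 1)‖ * R + ‖S.η (k + 1)‖ * R', by positivity, fun ω => ?_⟩
    refine (norm_add_le _ _).trans (add_le_add ?_ ?_)
    · exact ((S.L (k + 1)).le_opNorm _).trans (mul_le_mul_of_nonneg_left (h ω) (norm_nonneg _))
    · rw [norm_smul]; exact mul_le_mul_of_nonneg_left (h' ω) (norm_nonneg _)

theorem nPart_stronglyMeasurable (k : ℕ) : StronglyMeasurable[S.ℱ k] (S.nPart k) := by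
  induction k with
  | zero => exact stronglyMeasurable_const
  | succ k ih =>
    exact (S.L_stronglyMeasurable (k + 1) (ih.mono (S.ℱ.mono (Nat.le_succ k)))).add
      ((S.gradSum_stronglyMeasurable k).const_smul _)

theorem inner_nPart_measurable (k : ℕ) (v : H) :
    Measurable[S.ℱ k] fun ω => (inner ℝ v (S.nPart k ω) : ℝ) :=
  (StronglyMeasurable.inner stronglyMeasurable_const (S.nPart_stronglyMeasurable k)
    (𝕜 := ℝ)).measurable

theorem inner_L_comm (k : ℕ) (x y : H) : (inner ℝ x (S.L k y) : ℝ) = inner ℝ (S.L k x) y := by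
  have hG : (inner ℝ (S.G k x) y : ℝ) = inner ℝ x (S.G k y) :=
    inner_extOp_comm (gram_transpose _) x y
  rw [L_apply, L_apply, inner_sub_right, inner_sub_left, inner_smul_right, real_inner_smul_left, hG]

theorem exists_lintegral_exp_nPart_le : ∃ (E : ℝ) (k₀ : ℕ), 1 ≤ k₀ ∧ ∀ k, k₀ ≤ k → ∀ v : H,
    S.η k * ‖v‖ ^ 2 ≤ 1 →
    ∫⁻ ω, ENNReal.ofReal (Real.exp (inner ℝ v (S.nPart k ω))) ∂S.P ≤ ENNReal.ofReal E := by
  have hK := S.K_pos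
  have hη := S.η₀_pos
  have hJ := S.J₀_pos
  obtain ⟨k₀, hk₀⟩ := eventually_atTop.mp ((S.eventually_norm_L_le.and
    ((ratio_le S.a S.γ_pos S.a_pos S.a_lt_one).and
      (eventually_mul_rpow_le (4 * S.K ^ 2 * S.J₀ * S.η₀)
        (show 3 * S.j - S.a < 0 by linarith [S.three_j, S.c_pos]) one_pos))).and
          (eventually_ge_atTop 1))
  have hk₀1 : 1 ≤ k₀ := (hk₀ k₀ le_rfl).2
  have hηk : ∀ k, 1 ≤ k → 0 < S.η k := fun k hk => by
    obtain ⟨l, rfl⟩ := Nat.exists_eq_add_of_le' hk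
    exact S.η_pos l
  obtain ⟨R, hR, hn⟩ := S.exists_norm_nPart_le k₀
  set R' := R / √(S.η k₀) with hR'
  have main : ∀ k, k₀ ≤ k → ∀ v : H, S.η k * ‖v‖ ^ 2 ≤ 1 →
      ∫⁻ ω, ENNReal.ofReal (Real.exp (inner ℝ v (S.nPart k ω))) ∂S.P
        ≤ ENNReal.ofReal (Real.exp (R' + 4 * S.K ^ 5 * (S.η k * ‖v‖ ^ 2))) := by
    intro k hk
    induction k, hk using Nat.le_induction with
    | base =>
      intro v hv
      have hη1 := hηk k₀ hk₀1
      have hvb : ‖v‖ ≤ 1 / √(S.η k₀) := by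
        rw [le_div_iff₀ (Real.sqrt_pos.mpr hη1)]
        refine le_of_sq_le_sq ?_ zero_le_one
        rw [mul_pow, Real.sq_sqrt hη1.le]; linarith
      calc _ ≤ ∫⁻ _ω, ENNReal.ofReal (Real.exp (R' + 4 * S.K ^ 5 * (S.η k₀ * ‖v‖ ^ 2))) ∂S.P := by
            refine lintegral_mono fun ω => ENNReal.ofReal_le_ofReal (Real.exp_le_exp.mpr ?_)
            have h1 := real_inner_le_norm v (S.nPart k₀ ω)
            have h2 : ‖v‖ * ‖S.nPart k₀ ω‖ ≤ (1 / √(S.η k₀)) * R := by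
              have := hn ω
              gcongr
            have h3 : 0 ≤ 4 * S.K ^ 5 * (S.η k₀ * ‖v‖ ^ 2) := by positivity
            have h4 : (1 / √(S.η k₀)) * R = R' := by rw [hR']; ring
            linarith
        _ = _ := by simp
    | succ k hk ih =>
      intro v hv
      obtain ⟨⟨hL, hrat, hsmall⟩, hk1⟩ := hk₀ k hk
      have hk0 : (0 : ℝ) < k := by exact_mod_cast hk1
      rw [Real.rpow_zero, mul_one] at hsmall
      have hη1 := S.η_pos k
      have hηk0 := hηk k hk1
      set q := 1 - S.η₀ / (2 * S.K) * ((k : ℝ) + 1) ^ (-S.a) with hq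
      have hq0 : 0 ≤ q := hrat.1
      have hr := rpow_succ_pos k (-S.a)
      have hq1 : q ≤ 1 := by have := mul_pos S.γ_pos hr; linarith
      set q' := 1 - S.η₀ / (2 * S.K) / 2 * ((k : ℝ) + 1) ^ (-S.a) with hq'
      have hqη : q * S.η k ≤ q' * S.η (k + 1) := by
        have h1 : S.η k = S.η₀ * (k : ℝ) ^ (-S.a) := rfl
        rw [h1, η_succ]
        have h2 := hrat.2
        have h3 : ((k : ℝ) + 1) ^ S.a * ((k : ℝ) + 1) ^ (-S.a) = 1 := by
          rw [rpow_succ_mul, add_neg_cancel, Real.rpow_zero]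
        have h4 := mul_le_mul_of_nonneg_right h2 (mul_nonneg hη.le hr.le)
        calc _ = q * (((k : ℝ) + 1) ^ S.a * (k : ℝ) ^ (-S.a))
              * (S.η₀ * ((k : ℝ) + 1) ^ (-S.a)) := by
              linear_combination (-(q * S.η₀ * (k : ℝ) ^ (-S.a))) * h3
          _ ≤ _ := h4
      have hLv : S.η k * ‖S.L (k + 1) v‖ ^ 2 ≤ q' * (S.η (k + 1) * ‖v‖ ^ 2) := by
        calc _ ≤ S.η k * (q * ‖v‖) ^ 2 := by have := hL v; gcongr
          _ = q * (q * S.η k) * ‖v‖ ^ 2 := by ring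
          _ ≤ 1 * (q * S.η k) * ‖v‖ ^ 2 := by gcongr
          _ ≤ 1 * (q' * S.η (k + 1)) * ‖v‖ ^ 2 := by gcongr
          _ = _ := by ring
      have hq'1 : q' ≤ 1 := by
        have := mul_pos S.γ_pos hr; rw [hq']; linarith
      have hv0 : 0 ≤ S.η (k + 1) * ‖v‖ ^ 2 := by positivity
      have hLv1 : S.η k * ‖S.L (k + 1) v‖ ^ 2 ≤ 1 :=
        hLv.trans ((mul_le_of_le_one_left hv0 hq'1).trans hv)
      have hu : ‖S.η (k + 1) • v‖ * (2 * (S.T (k + 1) * (S.K * √(S.J (k + 1))))) ≤ 1 := by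
        have hT := S.T_pos k
        refine le_of_sq_le_sq ?_ zero_le_one
        rw [norm_smul, Real.norm_of_nonneg hη1.le]
        have hsq : √(S.J (k + 1) : ℝ) ^ 2 ≤ S.J₀ * ((k : ℝ) + 1) ^ S.j := by
          rw [Real.sq_sqrt (by positivity)]; exact S.J_succ_le k
        calc _ = (S.η (k + 1) * ‖v‖ ^ 2) * (4 * S.K ^ 2 * S.η (k + 1) * S.T (k + 1) ^ 2
              * √(S.J (k + 1) : ℝ) ^ 2) := by ring
          _ ≤ 1 * (4 * S.K ^ 2 * S.η (k + 1) * S.T (k + 1) ^ 2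
              * (S.J₀ * ((k : ℝ) + 1) ^ S.j)) := by gcongr
          _ = 4 * S.K ^ 2 * S.J₀ * S.η₀ * (((k : ℝ) + 1) ^ (-S.a) * ((k : ℝ) + 1) ^ (2 * S.j)
              * ((k : ℝ) + 1) ^ S.j) := by
              rw [η_succ, T_succ, rpow_succ_pow_two]; ring
          _ = 4 * S.K ^ 2 * S.J₀ * S.η₀ * ((k : ℝ) + 1) ^ (3 * S.j - S.a) := by
              rw [rpow_succ_mul, rpow_succ_mul]; congr 2; ring
          _ ≤ 1 ^ 2 := by rw [one_pow]; exact hsmall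
      have hstep := S.lintegral_exp_trunc_step k (S.inner_nPart_measurable k (S.L (k + 1) v)) hu
      have heq : ∀ ω, (inner ℝ v (S.nPart (k + 1) ω) : ℝ)
          = inner ℝ (S.L (k + 1) v) (S.nPart k ω)
            + inner ℝ (S.η (k + 1) • v) (S.trunc (k + 1) ω) := by
        intro ω
        rw [nPart, inner_add_right, inner_L_comm, inner_smul_right, real_inner_smul_left]
      simp only [heq]
      refine hstep.trans ((mul_le_mul_right (ih _ hLv1) _).trans ?_)
      rw [← ENNReal.ofReal_mul (Real.exp_pos _).le, ← Real.exp_add]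
      refine ENNReal.ofReal_le_ofReal (Real.exp_le_exp.mpr ?_)
      rw [norm_smul, Real.norm_of_nonneg hη1.le]
      have hfin : 4 * S.K ^ 5 * (q' * (S.η (k + 1) * ‖v‖ ^ 2))
          = 4 * S.K ^ 5 * (S.η (k + 1) * ‖v‖ ^ 2) - (S.K ^ 2 * (S.η (k + 1) * ‖v‖)) ^ 2 := by
        rw [hq', η_succ]
        field_simp
        ring
      have := mul_le_mul_of_nonneg_left hLv (by positivity : 0 ≤ 4 * S.K ^ 5)
      linarith
  refine ⟨Real.exp (R' + 4 * S.K ^ 5), k₀, hk₀1, fun k hk v hv => (main k hk v hv).trans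
    (ENNReal.ofReal_le_ofReal (Real.exp_le_exp.mpr ?_))⟩
  have := mul_le_mul_of_nonneg_left hv (by positivity : 0 ≤ 4 * S.K ^ 5)
  linarith

/-- Logarithmic bound of the noise response in polynomially many directions. -/
theorem ae_exists_inner_nPart_le {V : ℕ → Finset H} {A C : ℝ} (hC : 0 ≤ C)
    (hV : ∀ k : ℕ, ((V k).card : ℝ) ≤ C * ((k : ℝ) + 1) ^ A) :
    ∀ᵐ ω ∂S.P, ∃ (C' : ℝ) (k₀ : ℕ), 0 ≤ C' ∧ ∀ k, k₀ ≤ k → ∀ v ∈ V k,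
      |(inner ℝ v (S.nPart k ω) : ℝ)|
        ≤ C' * ((k : ℝ) + 1) ^ (S.c - S.a / 2) * ‖v‖ := by
  obtain ⟨E, k₀, hk₀, hE⟩ := S.exists_lintegral_exp_nPart_le
  have hηk : ∀ k, 1 ≤ k → 0 < S.η k := fun k hk => by
    obtain ⟨l, rfl⟩ := Nat.exists_eq_add_of_le' hk
    exact S.η_pos l
  have key : ∀ σ : ℝ, σ ^ 2 = 1 → ∀ᵐ ω ∂S.P, ∃ C', 0 ≤ C' ∧ ∀ k, k₀ ≤ k → ∀ v ∈ V k,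
      inner ℝ ((σ * (‖v‖ * √(S.η k))⁻¹) • v) (S.nPart k ω)
        ≤ C' + (A + 2) * Real.log ((k : ℝ) + 1) := by
    intro σ hσ
    refine ae_exists_le_log (Y := fun k v ω =>
      inner ℝ ((σ * (‖v‖ * √(S.η k))⁻¹) • v) (S.nPart k ω))
      (fun k u => (S.inner_nPart_measurable k _).mono (S.ℱ.le k) le_rfl) hC hV
      fun k hk v _ => hE k hk _ ?_
    have hη := hηk k (hk₀.trans hk)
    rw [norm_smul, mul_pow, norm_mul, mul_pow, Real.norm_eq_abs, sq_abs, hσ, one_mul, norm_inv,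
      norm_mul, norm_norm, Real.norm_of_nonneg (Real.sqrt_nonneg _), inv_pow, mul_pow,
      Real.sq_sqrt hη.le]
    rcases eq_or_ne (‖v‖) 0 with h0 | h0
    · simp [h0]
    · exact le_of_eq (by field_simp)
  obtain ⟨Cη, hCη, hη'⟩ := exists_le_rpow_succ (y := fun k => √(S.η k)) (C := √S.η₀) (r := S.a / 2)
    (by positivity) (fun k hk => by
      have hk0 : (0 : ℝ) ≤ k := by positivity
      simp only [η, learningRate]
      rw [Real.sqrt_mul S.η₀_pos.le, Real.sqrt_eq_rpow ((k : ℝ) ^ (-S.a)), ← Real.rpow_mul hk0]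
      refine le_of_eq ?_
      congr 2; ring)
  filter_upwards [key 1 (by norm_num), key (-1) (by norm_num)] with ω ⟨C₁, hC₁, h₁⟩ ⟨C₂, hC₂, h₂⟩
  obtain ⟨C₃, hC₃, h₃⟩ := exists_const_add_log_le (C₁ + C₂) (A + 2) S.c_pos
  refine ⟨C₃ * Cη, k₀, by positivity, fun k hk v hv => ?_⟩
  have hη := hηk k (hk₀.trans hk)
  have hs := Real.sqrt_pos.mpr hη
  rcases eq_or_ne (‖v‖) 0 with h0 | h0
  · rw [norm_eq_zero.mp h0]; simp
  have hv0 : 0 < ‖v‖ := lt_of_le_of_ne (norm_nonneg _) (Ne.symm h0)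
  have e1 := h₁ k hk v hv
  have e2 := h₂ k hk v hv
  have e3 := h₃ k
  rw [real_inner_smul_left] at e1 e2
  have hbound : |(inner ℝ v (S.nPart k ω) : ℝ)| ≤ C₃ * ((k : ℝ) + 1) ^ S.c * (‖v‖ * √(S.η k)) := by
    rw [← div_le_iff₀ (by positivity), div_eq_inv_mul]
    rw [show (‖v‖ * √(S.η k))⁻¹ * |(inner ℝ v (S.nPart k ω) : ℝ)|
      = |(‖v‖ * √(S.η k))⁻¹ * inner ℝ v (S.nPart k ω)| by
        rw [abs_mul, abs_of_nonneg (by positivity : 0 ≤ (‖v‖ * √(S.η k))⁻¹)]]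
    rw [abs_le]
    constructor <;> linarith
  refine hbound.trans ?_
  have h5 := hη' k
  have hp := rpow_succ_pos k S.c
  calc _ ≤ C₃ * ((k : ℝ) + 1) ^ S.c * (‖v‖ * (Cη * ((k : ℝ) + 1) ^ (-(S.a / 2)))) := by gcongr
    _ = C₃ * Cη * (((k : ℝ) + 1) ^ S.c * ((k : ℝ) + 1) ^ (-(S.a / 2))) * ‖v‖ := by ring
    _ = _ := by rw [rpow_succ_mul]; ring_nf

end Setting

end

section

theorem exists_forall_le_rpow_succ {y : ℕ → ℝ} {C r : ℝ} {k₀ : ℕ}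
    (h : ∀ k : ℕ, k₀ ≤ k → y k ≤ C * ((k : ℝ) + 1) ^ r) :
    ∃ C', 0 ≤ C' ∧ ∀ k : ℕ, y k ≤ C' * ((k : ℝ) + 1) ^ r := by
  have hs : ∀ k ∈ Finset.range k₀, 0 ≤ |y k| * ((k : ℝ) + 1) ^ (-r) := fun k _ =>
    mul_nonneg (abs_nonneg _) (rpow_succ_pos k _).le
  refine ⟨|C| + ∑ k ∈ Finset.range k₀, |y k| * ((k : ℝ) + 1) ^ (-r),
    add_nonneg (abs_nonneg _) (Finset.sum_nonneg hs), fun k => ?_⟩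
  have hr := rpow_succ_pos k r
  rcases le_or_gt k₀ k with hk | hk
  · refine (h k hk).trans (mul_le_mul_of_nonneg_right ?_ hr.le)
    linarith [le_abs_self C, Finset.sum_nonneg hs]
  · have h1 := Finset.single_le_sum hs (Finset.mem_range.mpr hk)
    have h2 : ((k : ℝ) + 1) ^ (-r) * ((k : ℝ) + 1) ^ r = 1 := by
      rw [rpow_succ_mul]; simp
    calc y k ≤ |y k| * (((k : ℝ) + 1) ^ (-r) * ((k : ℝ) + 1) ^ r) := by
          rw [h2, mul_one]; exact le_abs_self _
      _ = |y k| * ((k : ℝ) + 1) ^ (-r) * ((k : ℝ) + 1) ^ r := by ring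
      _ ≤ _ := mul_le_mul_of_nonneg_right (by linarith [abs_nonneg C]) hr.le

theorem summable_rpow_succ {r : ℝ} (hr : r < -1) : Summable fun k : ℕ => ((k : ℝ) + 1) ^ r := by
  have := (summable_nat_add_iff 1).mpr (summable_natCast_rpow_of_lt hr)
  simpa using this

theorem ae_summable_of_integral_le {Ω : Type*} [MeasurableSpace Ω] {P : Measure Ω}
    {y : ℕ → Ω → ℝ} (h0 : ∀ k ω, 0 ≤ y k ω) (hint : ∀ k, Integrable (y k) P) {C r t : ℝ}
    (hE : ∀ k : ℕ, ∫ ω, y k ω ∂P ≤ C * ((k : ℝ) + 1) ^ (-r)) (ht : 1 < r + t) :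
    ∀ᵐ ω ∂P, Summable fun k : ℕ => y k ω * ((k : ℝ) + 1) ^ (-t) := by
  refine ae_summable_of_summable_integral (fun k ω => mul_nonneg (h0 k ω) (rpow_succ_pos k _).le)
    (fun k => (hint k).mul_const _) ?_
  refine Summable.of_nonneg_of_le
    (fun k => integral_nonneg fun ω => mul_nonneg (h0 k ω) (rpow_succ_pos k _).le) (fun k => ?_)
    ((summable_rpow_succ (show -(r + t) < -1 by linarith)).mul_left C)
  rw [integral_mul_const]
  calc _ ≤ C * ((k : ℝ) + 1) ^ (-r) * ((k : ℝ) + 1) ^ (-t) :=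
        mul_le_mul_of_nonneg_right (hE k) (rpow_succ_pos k _).le
    _ = _ := by rw [mul_assoc, rpow_succ_mul]; ring_nf

namespace Setting

variable {Ω H : Type*} [mΩ : MeasurableSpace Ω] [NormedAddCommGroup H] [InnerProductSpace ℝ H]
  [CompleteSpace H] {p B : ℕ} (S : Setting Ω H p B)

/-! ### Almost sure rates -/

theorem J_le_rpow (k : ℕ) : (S.J k : ℝ) ≤ S.J₀ * ((k : ℝ) + 1) ^ S.j :=
  (by exact_mod_cast S.J_le_J_succ k : (S.J k : ℝ) ≤ S.J (k + 1)).trans (S.J_succ_le k)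

theorem ae_exists_nPart_le : ∀ᵐ ω ∂S.P, ∃ C, 0 ≤ C ∧ ∀ k : ℕ,
    ‖S.nPart k ω‖ ≤ C * ((k : ℝ) + 1) ^ (S.j / 2 + S.c - S.a / 2) := by
  classical
  have hJ := S.J₀_pos
  filter_upwards [S.ae_exists_inner_nPart_le (V := fun k => (Finset.range (S.J k)).image S.e)
    hJ.le (A := S.j) fun k => (by
      exact_mod_cast Finset.card_image_le.trans (Finset.card_range _).le :
        ((((Finset.range (S.J k)).image S.e).card : ℕ) : ℝ) ≤ S.J k).trans (S.J_le_rpow k)]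
    with ω hω
  obtain ⟨C, k₀, hC, h⟩ := hω
  refine exists_forall_le_rpow_succ (C := √S.J₀ * C) (k₀ := k₀) fun k hk => ?_
  have r1 := rpow_succ_pos k (S.c - S.a / 2)
  have r2 := rpow_succ_pos k (S.j / 2)
  have hsq : ‖S.nPart k ω‖ ^ 2 ≤ (√S.J₀ * ((k : ℝ) + 1) ^ (S.j / 2)
      * (C * ((k : ℝ) + 1) ^ (S.c - S.a / 2))) ^ 2 := by
    rw [norm_sq_eq_sum_of_mem S.ortho (S.nPart_mem k ω)]
    calc _ ≤ ∑ _i : Fin (S.J k), (C * ((k : ℝ) + 1) ^ (S.c - S.a / 2)) ^ 2 := by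
          refine Finset.sum_le_sum fun i _ => sq_le_sq.mpr ?_
          have := h k hk (S.e i) (Finset.mem_image_of_mem _ (Finset.mem_range.mpr i.2))
          rw [S.ortho.1 i, mul_one] at this
          rwa [abs_of_nonneg (mul_nonneg hC r1.le)]
      _ = S.J k * (C * ((k : ℝ) + 1) ^ (S.c - S.a / 2)) ^ 2 := by simp
      _ ≤ S.J₀ * ((k : ℝ) + 1) ^ S.j * (C * ((k : ℝ) + 1) ^ (S.c - S.a / 2)) ^ 2 := by
          gcongr; exact S.J_le_rpow k
      _ = _ := by
          rw [mul_pow (√_ * _), mul_pow √_, Real.sq_sqrt hJ.le, rpow_succ_pow_two,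
            show 2 * (S.j / 2) = S.j by ring]
  calc _ ≤ √S.J₀ * ((k : ℝ) + 1) ^ (S.j / 2) * (C * ((k : ℝ) + 1) ^ (S.c - S.a / 2)) :=
        (sq_le_sq₀ (norm_nonneg _) (by positivity)).mp hsq
    _ = √S.J₀ * C * (((k : ℝ) + 1) ^ (S.j / 2) * ((k : ℝ) + 1) ^ (S.c - S.a / 2)) := by ring
    _ = _ := by rw [rpow_succ_mul]; ring_nf

/-- The perturbation of the Gram operator at the response to the noise. -/
theorem ae_exists_gramDrift_nPart_le : ∀ᵐ ω ∂S.P, ∃ C, 0 ≤ C ∧ ∀ k : ℕ,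
    ‖gramDrift S.e S.ν S.θ₀ S.ψ (S.J (k + 1)) (S.θc k ω) (S.nPart k ω)‖
      ≤ C * ((k : ℝ) + 1) ^ (-(S.D + S.a / 2 - S.c)) := by
  classical
  have hJ := S.J₀_pos
  have hK := S.K_pos
  have hM := S.M_nonneg
  have hf := S.f_nonneg
  obtain ⟨l, hl⟩ := exists_nat_ge (max S.α (S.j * (1 + S.f) + S.j / 2 + S.D))
  have hlα := (le_max_left _ _).trans hl
  have hlD := (le_max_right _ _).trans hl
  have hm : ∀ k : ℕ, 1 ≤ (k + 1) ^ l := fun k => Nat.one_le_pow _ _ k.succ_pos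
  choose N hN hcov using fun k : ℕ => exists_grid S.θ₀ (M := S.M) (hm k)
  obtain ⟨C₁, hC₁, hplug⟩ := S.exists_plugIn_le
  have hcard : ∀ k : ℕ, ((((N k) ×ˢ Finset.range (S.J (k + 1))).image fun x =>
      gramDrift S.e S.ν S.θ₀ S.ψ (S.J (k + 1)) x.1 (S.e x.2)).card : ℝ)
      ≤ (3 * (⌈S.M⌉₊ + 1) : ℝ) ^ p * S.J₀ * ((k : ℝ) + 1) ^ ((l * p : ℕ) + S.j) := by
    intro k
    have h1 : ((((N k) ×ˢ Finset.range (S.J (k + 1))).image fun x =>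
      gramDrift S.e S.ν S.θ₀ S.ψ (S.J (k + 1)) x.1 (S.e x.2)).card : ℝ)
        ≤ ((N k).card : ℝ) * S.J (k + 1) := by
      have := Finset.card_image_le (s := (N k) ×ˢ Finset.range (S.J (k + 1)))
        (f := fun x => gramDrift S.e S.ν S.θ₀ S.ψ (S.J (k + 1)) x.1 (S.e x.2))
      rw [Finset.card_product, Finset.card_range] at this
      exact_mod_cast this
    refine h1.trans ?_
    calc _ ≤ (3 * (⌈S.M⌉₊ + 1) * ((k + 1) ^ l : ℕ) : ℝ) ^ p * (S.J₀ * ((k : ℝ) + 1) ^ S.j) := by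
          gcongr
          · exact hN k
          · exact S.J_succ_le k
      _ = _ := by
          rw [← rpow_succ_mul, Real.rpow_natCast, mul_pow, pow_mul]
          push_cast
          ring
  filter_upwards [S.ae_exists_nPart_le, S.ae_exists_inner_nPart_le (by positivity) hcard]
    with ω hn hω
  obtain ⟨C₂, hC₂, hn⟩ := hn
  obtain ⟨C, k₀, hC, h⟩ := hω
  refine exists_forall_le_rpow_succ (k₀ := k₀)
    (C := C * (3 * S.K ^ 4 * (C₁ * (S.M + p) * (1 + C₁ * (S.M + p))))
      + 2 * S.K ^ 3 * (S.J₀ * (S.J₀ : ℝ) ^ S.f * p) * C₂) fun k hk => ?_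
  have hp := natCast_add_one_pos k
  set E := C₁ * (S.M + p) with hE
  have hE0 : 0 ≤ E := by positivity
  obtain ⟨θ', hθ', hd⟩ := hcov k (S.θc k ω) ((S.rate k ω).trans
    (mul_le_of_le_one_right hM (rpow_succ_le_one k (by
      have h1 := S.D_pos; have h2 := S.j_pos; unfold D at h1; nlinarith))))
  have hd' : ‖S.θc k ω - θ'‖ ≤ p * ((k : ℝ) + 1) ^ (-(l : ℝ)) := by
    refine hd.trans_eq ?_
    rw [Real.rpow_neg hp.le, Real.rpow_natCast, div_eq_mul_inv]
    push_cast; rfl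
  have hθ₀ : ‖θ' - S.θ₀‖ ≤ (S.M + p) * ((k : ℝ) + 1) ^ (-S.α) := by
    calc _ = ‖(S.θc k ω - S.θ₀) - (S.θc k ω - θ')‖ := by congr 1; abel
      _ ≤ ‖S.θc k ω - S.θ₀‖ + ‖S.θc k ω - θ'‖ := norm_sub_le _ _
      _ ≤ S.M * ((k : ℝ) + 1) ^ (-S.α) + p * ((k : ℝ) + 1) ^ (-S.α) := by
          gcongr
          · exact S.rate k ω
          · exact hd'.trans (mul_le_mul_of_nonneg_left (rpow_succ_le k (by linarith))
              (Nat.cast_nonneg p))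
      _ = _ := by ring
  set t := ((k : ℝ) + 1) ^ (-S.D) with ht
  have ht0 : 0 < t := rpow_succ_pos k _
  have ht1 : t ≤ 1 := rpow_succ_le_one k (by linarith [S.D_pos])
  have hd2 := hplug k θ' _ (by positivity) hθ₀
  rw [← hE, ← ht] at hd2
  set d := √(S.J (k + 1)) * (S.J (k + 1) : ℝ) ^ S.f * ‖θ' - S.θ₀‖ with hdd
  have hd0 : 0 ≤ d := by positivity
  set R := C * ((k : ℝ) + 1) ^ (S.c - S.a / 2) with hR
  have hR0 : 0 ≤ R := mul_nonneg hC (rpow_succ_pos k _).le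
  have hsq : ‖gramDrift S.e S.ν S.θ₀ S.ψ (S.J (k + 1)) θ' (S.nPart k ω)‖ ^ 2
      ≤ (R * (3 * S.K ^ 4 * (E * (1 + E)) * t)) ^ 2 := by
    rw [norm_sq_gramDrift S.reg S.ortho]
    calc _ ≤ ∑ i : Fin (S.J (k + 1)), R ^ 2 *
          ‖gramDrift S.e S.ν S.θ₀ S.ψ (S.J (k + 1)) θ' (S.e i)‖ ^ 2 := by
          refine Finset.sum_le_sum fun i _ => ?_
          rw [← mul_pow]
          refine sq_le_sq.mpr ?_
          rw [abs_of_nonneg (mul_nonneg hR0 (norm_nonneg _))]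
          exact h k hk _ (Finset.mem_image.mpr
            ⟨(θ', i), Finset.mk_mem_product hθ' (Finset.mem_range.mpr i.2), rfl⟩)
      _ = R ^ 2 * ∑ i : Fin (S.J (k + 1)),
          ‖gramDrift S.e S.ν S.θ₀ S.ψ (S.J (k + 1)) θ' (S.e i)‖ ^ 2 := by rw [Finset.mul_sum]
      _ ≤ R ^ 2 * (9 * S.K ^ 8 * (d ^ 2 * (1 + d ^ 2))) := by
          gcongr
          exact sum_norm_sq_gramDrift_le S.reg S.ortho hf (S.one_le_J _) θ'
      _ ≤ R ^ 2 * (9 * S.K ^ 8 * ((E * t) ^ 2 * (1 + E) ^ 2)) := by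
          have hdE : d ≤ E := hd2.trans (mul_le_of_le_one_right hE0 ht1)
          have : d ^ 2 ≤ E ^ 2 := pow_le_pow_left₀ hd0 hdE 2
          gcongr
          nlinarith
      _ = _ := by ring
  have h1 := (sq_le_sq₀ (norm_nonneg _) (by positivity)).mp hsq
  have h2 := norm_sub_gramDrift_le S.reg S.ortho hf (S.J (k + 1)) (S.θc k ω) θ' (S.nPart k ω)
  have h3 : (S.J (k + 1) : ℝ) * (S.J (k + 1) : ℝ) ^ S.f
      ≤ S.J₀ * (S.J₀ : ℝ) ^ S.f * ((k : ℝ) + 1) ^ (S.j * (1 + S.f)) := by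
    have := S.J_succ_le k
    calc _ ≤ (S.J₀ * ((k : ℝ) + 1) ^ S.j) * (S.J₀ * ((k : ℝ) + 1) ^ S.j) ^ S.f := by gcongr
      _ = S.J₀ * (S.J₀ : ℝ) ^ S.f * (((k : ℝ) + 1) ^ S.j * ((k : ℝ) + 1) ^ (S.j * S.f)) := by
          rw [Real.mul_rpow hJ.le (rpow_succ_pos k _).le, ← Real.rpow_mul hp.le]; ring
      _ = _ := by rw [rpow_succ_mul]; ring_nf
  have r1 := rpow_succ_pos k (S.j * (1 + S.f))
  have r2 := rpow_succ_pos k (-(l : ℝ))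
  have r3 := rpow_succ_pos k (S.j / 2 + S.c - S.a / 2)
  calc _ ≤ ‖gramDrift S.e S.ν S.θ₀ S.ψ (S.J (k + 1)) θ' (S.nPart k ω)‖
        + ‖gramDrift S.e S.ν S.θ₀ S.ψ (S.J (k + 1)) (S.θc k ω) (S.nPart k ω)
          - gramDrift S.e S.ν S.θ₀ S.ψ (S.J (k + 1)) θ' (S.nPart k ω)‖ := norm_le_norm_add_norm_sub' _ _
    _ ≤ R * (3 * S.K ^ 4 * (E * (1 + E)) * t)
        + 2 * S.K ^ 3 * ((S.J₀ * (S.J₀ : ℝ) ^ S.f * ((k : ℝ) + 1) ^ (S.j * (1 + S.f)))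
          * (p * ((k : ℝ) + 1) ^ (-(l : ℝ)))) *
            (C₂ * ((k : ℝ) + 1) ^ (S.j / 2 + S.c - S.a / 2)) := by
        refine add_le_add h1 (h2.trans ?_)
        gcongr
        exact hn k
    _ = C * (3 * S.K ^ 4 * (E * (1 + E))) * (((k : ℝ) + 1) ^ (S.c - S.a / 2) * t)
        + 2 * S.K ^ 3 * (S.J₀ * (S.J₀ : ℝ) ^ S.f * p) * C₂ * (((k : ℝ) + 1) ^ (S.j * (1 + S.f))
          * ((k : ℝ) + 1) ^ (-(l : ℝ)) * ((k : ℝ) + 1) ^ (S.j / 2 + S.c - S.a / 2)) := by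
        rw [hR]; ring
    _ ≤ C * (3 * S.K ^ 4 * (E * (1 + E))) * ((k : ℝ) + 1) ^ (-(S.D + S.a / 2 - S.c))
        + 2 * S.K ^ 3 * (S.J₀ * (S.J₀ : ℝ) ^ S.f * p) * C₂
          * ((k : ℝ) + 1) ^ (-(S.D + S.a / 2 - S.c)) := by
        rw [ht, rpow_succ_mul, rpow_succ_mul, rpow_succ_mul]
        gcongr
        · exact one_le_natCast_add_one k
        · linarith
        · exact one_le_natCast_add_one k
        · linarith
    _ = _ := by ring

theorem gramDrift_sub (J : ℕ) (θ : EuclideanSpace ℝ (Fin p)) (u v : H) :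
    gramDrift S.e S.ν S.θ₀ S.ψ J θ (u - v)
      = gramDrift S.e S.ν S.θ₀ S.ψ J θ u - gramDrift S.e S.ν S.θ₀ S.ψ J θ v := by
  refine ext_inner_left ℝ fun x => ?_
  rw [inner_sub_right, inner_gramDrift_comm S.reg S.ortho J θ (u - v),
    inner_gramDrift_comm S.reg S.ortho J θ u, inner_gramDrift_comm S.reg S.ortho J θ v,
    inner_sub_left]

/-- The perturbation of the Gram operator is summable against `k ^ (-b)`. -/
theorem ae_summable_h : ∀ᵐ ω ∂S.P,
    Summable fun k : ℕ => ‖S.h k ω‖ * ((k : ℝ) + 1) ^ (-S.b) := by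
  obtain ⟨C₁, hC₁, h₁⟩ := S.exists_gramDrift_le
  obtain ⟨C₂, hC₂, h₂⟩ := S.exists_bStar_sub_bInf_le
  obtain ⟨C₃, hC₃, h₃⟩ := S.exists_integral_norm_rPart_le
  obtain ⟨C₄, hC₄, h₄⟩ := S.exists_integral_norm_hPart_le
  have hDa := S.D_add_a
  have hDρ := S.D_add_ρ
  have hc := S.c_pos
  have hD : S.D = S.α - S.j * (1 / 2 + S.f) := rfl
  have hb : S.b = (1 - S.j) / 2 - S.c := rfl
  filter_upwards [S.ae_exists_gramDrift_nPart_le,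
    ae_summable_of_integral_le (fun k ω => norm_nonneg (S.rPart k ω))
      (fun k => ((S.rPart_memLp k).integrable one_le_two).norm) h₃
      (t := S.D + S.b) (by linarith),
    ae_summable_of_integral_le (fun k ω => norm_nonneg (S.hPart k ω))
      (fun k => ((S.hPart_memLp k).integrable one_le_two).norm) h₄
      (t := S.D + S.b) (by linarith)] with ω hn hr hh
  obtain ⟨C₅, hC₅, h₅⟩ := hn
  obtain ⟨C₆, hC₆, h₆⟩ := S.exists_wPart_le ω
  have s1 := (summable_rpow_succ
    (show -(S.D + S.a / 2 - S.c) + -S.b < -1 by linarith)).mul_left C₅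
  have s2 := (summable_rpow_succ
    (show -S.ρ + -(S.D + S.b) < -1 by linarith)).mul_left (C₆ + C₂)
  refine Summable.of_nonneg_of_le
    (fun k => mul_nonneg (norm_nonneg _) (rpow_succ_pos k _).le) (fun k => ?_)
    (s1.add (((hr.add hh).add s2).mul_left C₁))
  have r0 := rpow_succ_pos k (-S.b)
  have r1 := rpow_succ_pos k (-S.D)
  have hδ : S.h k ω = gramDrift S.e S.ν S.θ₀ S.ψ (S.J (k + 1)) (S.θc k ω) (S.nPart k ω)
      - gramDrift S.e S.ν S.θ₀ S.ψ (S.J (k + 1)) (S.θc k ω)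
        (S.bStar (k + 1) - S.bInf - S.rPart k ω - S.wPart k ω - S.hPart k ω) := by
    rw [← gramDrift_sub, h, S.δ_eq, S.X_eq_sum]
    congr 1; abel
  have hle : ‖S.bStar (k + 1) - S.bInf - S.rPart k ω - S.wPart k ω - S.hPart k ω‖
      ≤ ‖S.rPart k ω‖ + ‖S.hPart k ω‖ + (C₆ + C₂) * ((k : ℝ) + 1) ^ (-S.ρ) := by
    have e1 := norm_sub_le (S.bStar (k + 1) - S.bInf - S.rPart k ω - S.wPart k ω) (S.hPart k ω)
    have e2 := norm_sub_le (S.bStar (k + 1) - S.bInf - S.rPart k ω) (S.wPart k ω)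
    have e3 := norm_sub_le (S.bStar (k + 1) - S.bInf) (S.rPart k ω)
    have e4 : ((k : ℝ) + 1) ^ (-(S.s * S.j)) ≤ ((k : ℝ) + 1) ^ (-S.ρ) :=
      rpow_succ_le k (by linarith [S.ρ_le_sj])
    have e5 := (h₂ k).trans (mul_le_mul_of_nonneg_left e4 hC₂)
    linarith [h₆ k]
  calc _ ≤ (C₅ * ((k : ℝ) + 1) ^ (-(S.D + S.a / 2 - S.c)) + C₁ * ((k : ℝ) + 1) ^ (-S.D)
        * (‖S.rPart k ω‖ + ‖S.hPart k ω‖ + (C₆ + C₂) * ((k : ℝ) + 1) ^ (-S.ρ)))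
          * ((k : ℝ) + 1) ^ (-S.b) := by
        refine mul_le_mul_of_nonneg_right ?_ r0.le
        rw [hδ]
        refine (norm_sub_le _ _).trans (add_le_add (h₅ k) ((h₁ k ω _).trans ?_))
        gcongr
    _ = C₅ * (((k : ℝ) + 1) ^ (-(S.D + S.a / 2 - S.c)) * ((k : ℝ) + 1) ^ (-S.b))
        + C₁ * (‖S.rPart k ω‖ * (((k : ℝ) + 1) ^ (-S.D) * ((k : ℝ) + 1) ^ (-S.b))
          + ‖S.hPart k ω‖ * (((k : ℝ) + 1) ^ (-S.D) * ((k : ℝ) + 1) ^ (-S.b))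
          + (C₆ + C₂) * (((k : ℝ) + 1) ^ (-S.ρ)
            * (((k : ℝ) + 1) ^ (-S.D) * ((k : ℝ) + 1) ^ (-S.b)))) := by ring
    _ = _ := by rw [rpow_succ_mul, rpow_succ_mul, rpow_succ_mul, neg_add S.D]

theorem ae_exists_hPart_le : ∀ᵐ ω ∂S.P, ∃ C, 0 ≤ C ∧ ∀ k : ℕ,
    ‖S.hPart k ω‖ ≤ C * ((k : ℝ) + 1) ^ (-(S.a - S.b)) := by
  filter_upwards [S.ae_summable_h] with ω hs
  have hη := S.η₀_pos
  have hsum : Summable fun k : ℕ => S.η k * ‖S.h (k - 1) ω‖ * (k : ℝ) ^ (S.a - S.b) := by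
    refine (summable_nat_add_iff 1).mp ((hs.mul_left S.η₀).congr fun k => ?_)
    rw [η_succ, Nat.add_sub_cancel]
    push_cast
    rw [show -S.b = -S.a + (S.a - S.b) by ring, ← rpow_succ_mul]
    ring
  obtain ⟨C, hC, h⟩ := weighted_recursion S.γ_pos S.a_pos S.a_lt_one
    (x := fun k => S.η k * ‖S.h (k - 1) ω‖) (y := fun k => ‖S.hPart k ω‖)
    (fun k => mul_nonneg (mul_nonneg hη.le (Real.rpow_nonneg (Nat.cast_nonneg k) _))
      (norm_nonneg _)) (fun k => norm_nonneg _) hsum (by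
      filter_upwards [S.eventually_norm_L_le] with k hk
      calc ‖S.hPart (k + 1) ω‖ ≤ ‖S.L (k + 1) (S.hPart k ω)‖ + ‖S.η (k + 1) • S.h k ω‖ :=
            norm_sub_le _ _
        _ ≤ _ := by
            refine add_le_add (hk _) ?_
            rw [norm_smul, Real.norm_eq_abs, abs_of_pos (S.η_pos k), Nat.add_sub_cancel])
  exact exists_le_rpow_succ hC h

theorem ae_exists_X_le : ∀ᵐ ω ∂S.P, ∃ C, 0 ≤ C ∧ ∀ k : ℕ,
    ‖S.X k ω‖ ≤ C * ((k : ℝ) + 1) ^ (-(S.a - S.b)) := by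
  have hc := S.c_pos
  have hj := S.j_pos
  have h4 := S.four_j
  have hρ := S.ρ_lower
  have hb : S.b = (1 - S.j) / 2 - S.c := rfl
  filter_upwards [S.ae_exists_nPart_le, S.ae_exists_rPart_le, S.ae_exists_hPart_le]
    with ω hn hr hh
  obtain ⟨C₁, hC₁, h₁⟩ := hn
  obtain ⟨C₂, hC₂, h₂⟩ := hr
  obtain ⟨C₃, hC₃, h₃⟩ := hh
  obtain ⟨C₄, hC₄, h₄⟩ := S.exists_wPart_le ω
  refine ⟨C₁ + C₂ + C₄ + C₃, by positivity, fun k => ?_⟩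
  have e1 := (h₁ k).trans (mul_le_mul_of_nonneg_left
    (rpow_succ_le k (show _ ≤ -(S.a - S.b) by linarith)) hC₁)
  have e2 := (h₄ k).trans (mul_le_mul_of_nonneg_left
    (rpow_succ_le k (show _ ≤ -(S.a - S.b) by linarith)) hC₄)
  rw [X_eq_sum]
  have := norm_add₄_le (a := S.nPart k ω) (b := S.rPart k ω) (c := S.wPart k ω)
    (d := S.hPart k ω)
  linarith [h₂ k, h₃ k]

end Setting

end

section

theorem sum_range_succ_eq_sum_Icc {M : Type*} [AddCommMonoid M] (f : ℕ → M) (N : ℕ) :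
    ∑ k ∈ Finset.range N, f (k + 1) = ∑ k ∈ Finset.Icc 1 N, f k := by
  induction N with
  | zero => simp
  | succ N ih => rw [Finset.sum_range_succ, ih, Finset.sum_Icc_succ_top (by omega)]

theorem sum_range_le_add_sum_Icc {f : ℕ → ℝ} (hf : ∀ k, 0 ≤ f k) (N : ℕ) :
    ∑ k ∈ Finset.range N, f k ≤ f 0 + ∑ k ∈ Finset.Icc 1 N, f k := by
  rw [← sum_range_succ_eq_sum_Icc, add_comm, ← Finset.sum_range_succ']
  exact Finset.sum_le_sum_of_subset_of_nonneg (Finset.range_mono (Nat.le_succ N))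
    fun k _ _ => hf k

theorem sum_range_rpow_succ_le {r : ℝ} (hr0 : 0 ≤ r) (hr : r < 1) (N : ℕ) :
    ∑ k ∈ Finset.range N, ((k : ℝ) + 1) ^ (-r) ≤ (1 - r)⁻¹ * (N : ℝ) ^ (1 - r) := by
  have := sum_range_succ_eq_sum_Icc (fun k : ℕ => (k : ℝ) ^ (-r)) N
  push_cast at this
  rw [this]
  exact sum_Icc_rpow_neg_le hr0 hr N

theorem sum_range_le_of_summable {x : ℕ → ℝ} (hx : ∀ k, 0 ≤ x k) {b : ℝ} (hb : 0 ≤ b)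
    (hsum : Summable fun k : ℕ => x k * ((k : ℝ) + 1) ^ (-b)) (N : ℕ) :
    ∑ k ∈ Finset.range N, x k ≤ (∑' k : ℕ, x k * ((k : ℝ) + 1) ^ (-b)) * ((N : ℝ) + 1) ^ b := by
  calc ∑ k ∈ Finset.range N, x k
      ≤ ∑ k ∈ Finset.range N, x k * ((k : ℝ) + 1) ^ (-b) * ((N : ℝ) + 1) ^ b := by
        refine Finset.sum_le_sum fun k hk => ?_
        have hkN : (k : ℝ) ≤ N := by exact_mod_cast (Finset.mem_range.mp hk).le
        have h1 : ((k : ℝ) + 1) ^ b ≤ ((N : ℝ) + 1) ^ b := by gcongr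
        calc x k = x k * (((k : ℝ) + 1) ^ (-b) * ((k : ℝ) + 1) ^ b) := by
              rw [rpow_succ_mul]; simp
          _ ≤ x k * (((k : ℝ) + 1) ^ (-b) * ((N : ℝ) + 1) ^ b) := by
              have := hx k; gcongr
          _ = _ := by ring
    _ = (∑ k ∈ Finset.range N, x k * ((k : ℝ) + 1) ^ (-b)) * ((N : ℝ) + 1) ^ b := by
        rw [Finset.sum_mul]
    _ ≤ _ := by
        gcongr
        exact hsum.sum_le_tsum _ fun k _ => mul_nonneg (hx k) (rpow_succ_pos k _).le

theorem rpow_add_one_sub_rpow_le {a x : ℝ} (ha0 : 0 ≤ a) (ha1 : a ≤ 1) (hx : 0 < x) :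
    (x + 1) ^ a - x ^ a ≤ x ^ (a - 1) := by
  have h1 := rpow_one_add_le_one_add_mul_self (s := x⁻¹) (by linarith [inv_pos.mpr hx])
    ha0 ha1
  have h2 : (x + 1) ^ a = x ^ a * (1 + x⁻¹) ^ a := by
    rw [← Real.mul_rpow hx.le (by positivity), mul_add, mul_inv_cancel₀ hx.ne', mul_one]
  have h3 : x ^ (a - 1) = x ^ a * x⁻¹ := by rw [Real.rpow_sub_one hx.ne', div_eq_mul_inv]
  rw [h2, h3]
  have h4 : 0 < x ^ a := Real.rpow_pos_of_pos hx a
  have h5 : a * x⁻¹ ≤ x⁻¹ := mul_le_of_le_one_left (by positivity) ha1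
  nlinarith

theorem sum_apply_sub_eq {H : Type*} [NormedAddCommGroup H] [NormedSpace ℝ H] (A : ℕ → H →L[ℝ] H)
    (x : ℕ → H) (N : ℕ) : ∑ k ∈ Finset.range N, A (k + 1) (x (k + 1) - x k)
      = A N (x N) - A 0 (x 0) + ∑ k ∈ Finset.range N, (A k (x k) - A (k + 1) (x k)) := by
  induction N with
  | zero => simp
  | succ N ih => rw [Finset.sum_range_succ, ih, Finset.sum_range_succ, map_sub]; abel

namespace Setting

variable {Ω H : Type*} [mΩ : MeasurableSpace Ω] [NormedAddCommGroup H] [InnerProductSpace ℝ H]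
  [CompleteSpace H] {p B : ℕ} (S : Setting Ω H p B)

/-! ### The expansion -/

/-- The averaged score of a batch at the true index. -/
def score : ℕ → Ω → H
  | 0 => fun _ => 0
  | k + 1 => fun ω => (B : ℝ)⁻¹ • ∑ i : Fin B, noise S.θ₀ S.F₀ (S.W (k + 1) i ω)
      • feat S.e S.ψ (S.J (k + 1)) (index S.θ₀ (S.W (k + 1) i ω))

def plug (k : ℕ) (ω : Ω) : H :=
  plugInEffect S.e S.ν S.θ₀ S.F₀ S.ψ (S.J (k + 1)) (S.θc k ω - S.θ₀)

/-- `N` times the remainder of the expansion. -/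
def err (N : ℕ) (ω : Ω) : H := ∑ k ∈ Finset.range N,
  (S.coef (k + 1) ω - S.bStar (k + 1) - S.Q (k + 1) (S.score (k + 1) ω - S.plug k ω))

theorem norm_Q_le (k : ℕ) (x : H) : ‖S.Q k x‖ ≤ S.K * ‖x‖ :=
  norm_gramInv_le S.reg S.ortho (S.one_le_J k) x

theorem trunc_add_tail (k : ℕ) (ω : Ω) :
    S.trunc (k + 1) ω + S.tail (k + 1) ω = S.score (k + 1) ω := by
  rw [trunc, tail, score, ← smul_add, ← Finset.sum_add_distrib]
  refine congrArg _ (Finset.sum_congr rfl fun i _ => ?_)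
  rw [integral_tailSample S.reg S.ortho, truncScore, tailSample]
  abel

theorem tail_stronglyMeasurable (k : ℕ) : StronglyMeasurable[S.ℱ (k + 1)] (S.tail (k + 1)) := by
  refine StronglyMeasurable.const_smul (Finset.stronglyMeasurable_fun_sum _ fun i _ => ?_) _
  have hW := S.measurable_W_ℱ k i
  exact ((((noise_measurable S.reg).comp hW).stronglyMeasurable.smul
    (S.feat_comp_stronglyMeasurable _ measurable_const hW)).sub
    (S.truncSmul_stronglyMeasurable _ _ hW)).sub stronglyMeasurable_const

/-- Sums of centred increments of small variance, transformed by the inverse Gram operators. -/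
theorem ae_exists_sum_Q_le {D : ℕ → Ω → H} {C : ℝ}
    (hm : ∀ k, StronglyMeasurable[S.ℱ (k + 1)] (D (k + 1)))
    (hD : ∀ k, CondCentered S.P (S.ℱ k) (D (k + 1)))
    (hD2 : ∀ k : ℕ, ∫ ω, ‖D (k + 1) ω‖ ^ 2 ∂S.P ≤ C * ((k : ℝ) + 1) ^ (-(S.j + 4 * S.c))) :
    ∀ᵐ ω ∂S.P, ∃ C', 0 ≤ C' ∧ ∀ N : ℕ,
      ‖∑ k ∈ Finset.range N, S.Q (k + 1) (D (k + 1) ω)‖ ≤ C' * ((N : ℝ) + 1) ^ S.b := by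
  have hc := S.c_pos
  have hC : 0 ≤ C := by
    have := (integral_nonneg fun ω => sq_nonneg ‖D (0 + 1) ω‖).trans (hD2 0)
    simpa using this
  have key := S.ae_exists_le_of_centered (q := -S.b) (C := S.K ^ 2 * C)
    (x := fun N ω => ∑ k ∈ Finset.range N, S.Q (k + 1) (D (k + 1) ω))
    (D := fun k ω => S.Q k (D k ω)) (Λ := fun _ => ContinuousLinearMap.id ℝ H)
    (Eventually.of_forall fun k y => ?_) (fun N => ?_) (fun N => ?_)
    (fun N ω => Finset.sum_range_succ _ _) (fun k => (hD k).clm _) (fun k => ?_)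
  · simpa only [neg_neg] using key
  · rw [ContinuousLinearMap.id_apply]
    refine mul_le_of_le_one_left (norm_nonneg _) ?_
    rw [neg_neg, Real.rpow_neg (natCast_add_one_pos k).le, inv_mul_le_iff₀ (rpow_succ_pos k _),
      mul_one]
    exact Real.rpow_le_rpow (Nat.cast_nonneg k) (by linarith) S.b_pos.le
  · refine Finset.stronglyMeasurable_fun_sum _ fun k hk => ?_
    exact (S.Q (k + 1)).continuous.comp_stronglyMeasurable
      ((hm k).mono (S.ℱ.mono (Finset.mem_range.mp hk)))
  · exact memLp_finsetSum _ fun k _ => ((hD k).clm (S.Q (k + 1))).memLp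
  · have hint := integrable_norm_sq (hD k).memLp
    calc ∫ ω, ‖S.Q (k + 1) (D (k + 1) ω)‖ ^ 2 ∂S.P
        ≤ ∫ ω, S.K ^ 2 * ‖D (k + 1) ω‖ ^ 2 ∂S.P := by
          refine integral_mono (integrable_norm_sq ((hD k).clm (S.Q (k + 1))).memLp)
            (hint.const_mul _) fun ω => ?_
          simp only
          rw [← mul_pow]
          exact pow_le_pow_left₀ (norm_nonneg _) (S.norm_Q_le _ _) 2
      _ ≤ S.K ^ 2 * (C * ((k : ℝ) + 1) ^ (-(S.j + 4 * S.c))) := by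
          rw [integral_const_mul]
          gcongr
          exact hD2 k
      _ ≤ _ := by
          rw [← mul_assoc]
          refine mul_le_mul_of_nonneg_left (rpow_succ_le k ?_) (by positivity)
          unfold b; linarith

theorem ae_exists_sum_Q_tail_le : ∀ᵐ ω ∂S.P, ∃ C, 0 ≤ C ∧ ∀ N : ℕ,
    ‖∑ k ∈ Finset.range N, S.Q (k + 1) (S.tail (k + 1) ω)‖ ≤ C * ((N : ℝ) + 1) ^ S.b := by
  obtain ⟨C, -, h⟩ := S.exists_tail
  exact S.ae_exists_sum_Q_le S.tail_stronglyMeasurable (fun k => (h k).1) fun k => (h k).2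

theorem ae_exists_sum_Q_rem_le : ∀ᵐ ω ∂S.P, ∃ C, 0 ≤ C ∧ ∀ N : ℕ,
    ‖∑ k ∈ Finset.range N, S.Q (k + 1) (S.rem (k + 1) ω)‖ ≤ C * ((N : ℝ) + 1) ^ S.b := by
  obtain ⟨C, -, h⟩ := S.exists_rem_sq_le
  exact S.ae_exists_sum_Q_le S.rem_stronglyMeasurable (fun k => (h k).1) fun k => (h k).2

/-! Summation by parts. -/

/-- The coefficient of the increments. -/
def A (k : ℕ) : H →L[ℝ] H := (S.η k)⁻¹ • S.Q k

theorem inv_η_le (k : ℕ) : (S.η k)⁻¹ ≤ S.η₀⁻¹ * ((k : ℝ) + 1) ^ S.a := by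
  have hη := S.η₀_pos
  have ha := S.a_pos
  rcases k with _ | k
  · simp [η, learningRate, Real.zero_rpow (neg_ne_zero.mpr ha.ne'), hη.le]
  · rw [η_succ, mul_inv, Real.rpow_neg (natCast_add_one_pos k).le, inv_inv]
    have : ((k : ℝ) + 1) ^ S.a ≤ (((k + 1 : ℕ) : ℝ) + 1) ^ S.a := by
      push_cast; gcongr; linarith
    gcongr

theorem η_inv_nonneg (k : ℕ) : 0 ≤ (S.η k)⁻¹ :=
  inv_nonneg.mpr (mul_nonneg S.η₀_pos.le (Real.rpow_nonneg (Nat.cast_nonneg k) _))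

theorem norm_A_le (k : ℕ) (x : H) :
    ‖S.A k x‖ ≤ S.K * S.η₀⁻¹ * ((k : ℝ) + 1) ^ S.a * ‖x‖ := by
  have hK := S.K_pos
  have h0 := S.η_inv_nonneg k
  calc ‖S.A k x‖ = (S.η k)⁻¹ * ‖S.Q k x‖ := by
        rw [A, smul_apply, norm_smul, Real.norm_eq_abs, abs_of_nonneg h0]
    _ ≤ S.η₀⁻¹ * ((k : ℝ) + 1) ^ S.a * (S.K * ‖x‖) :=
        mul_le_mul (S.inv_η_le k) (S.norm_Q_le k x) (norm_nonneg _) (h0.trans (S.inv_η_le k))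
    _ = _ := by ring

/-- Size of the changes of the coefficients `A`. -/
def jump (k : ℕ) : ℝ :=
  (k : ℝ) ^ (S.a - 1) + if S.J k = S.J (k + 1) then 0 else (k : ℝ) ^ S.a

theorem jump_nonneg (k : ℕ) : 0 ≤ S.jump k := by
  unfold jump; split_ifs <;> positivity

theorem norm_A_sub_A_le {k : ℕ} (hk : 1 ≤ k) (x : H) :
    ‖S.A k x - S.A (k + 1) x‖ ≤ 8 * S.K * S.η₀⁻¹ * S.jump k * ‖x‖ := by
  have hK := S.K_pos
  have hη := S.η₀_pos
  have ha := S.a_pos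
  have ha1 := S.a_lt_one
  have hk1 : (1 : ℝ) ≤ k := by exact_mod_cast hk
  have hk0 : (0 : ℝ) < k := by linarith
  by_cases hJ : S.J k = S.J (k + 1)
  · have hQ : S.Q (k + 1) = S.Q k := by unfold Q; rw [hJ]
    have h1 : (S.η k)⁻¹ = S.η₀⁻¹ * (k : ℝ) ^ S.a := by
      rw [η, learningRate, mul_inv, Real.rpow_neg hk0.le, inv_inv]
    have h2 : (S.η (k + 1))⁻¹ = S.η₀⁻¹ * ((k : ℝ) + 1) ^ S.a := by
      rw [η_succ, mul_inv, Real.rpow_neg (by linarith), inv_inv]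
    have h3 := rpow_add_one_sub_rpow_le ha.le ha1.le hk0
    have h4 : (k : ℝ) ^ S.a ≤ ((k : ℝ) + 1) ^ S.a := by gcongr; linarith
    have hj : S.jump k = (k : ℝ) ^ (S.a - 1) := by simp [jump, hJ]
    calc ‖S.A k x - S.A (k + 1) x‖ = ‖((S.η k)⁻¹ - (S.η (k + 1))⁻¹) • S.Q k x‖ := by
          rw [A, A, smul_apply, smul_apply, hQ, sub_smul]
      _ = S.η₀⁻¹ * (((k : ℝ) + 1) ^ S.a - (k : ℝ) ^ S.a) * ‖S.Q k x‖ := by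
          rw [norm_smul, h1, h2, ← mul_sub, Real.norm_eq_abs, abs_mul, abs_sub_comm,
            abs_of_pos (inv_pos.mpr hη), abs_of_nonneg (sub_nonneg.mpr h4)]
      _ ≤ S.η₀⁻¹ * (k : ℝ) ^ (S.a - 1) * (S.K * ‖x‖) := by
          gcongr
          exact S.norm_Q_le k x
      _ ≤ 8 * (S.η₀⁻¹ * (k : ℝ) ^ (S.a - 1) * (S.K * ‖x‖)) :=
          le_mul_of_one_le_left (by positivity) (by norm_num)
      _ = _ := by rw [hj]; ring
  · have hj : (k : ℝ) ^ S.a ≤ S.jump k := by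
      simp only [jump, hJ, if_false]
      have : 0 ≤ (k : ℝ) ^ (S.a - 1) := by positivity
      linarith
    have hle : ∀ y : ℝ, 0 ≤ y → y ≤ 4 * k → y ^ S.a ≤ 4 * S.jump k := fun y hy hy4 => by
      calc y ^ S.a ≤ (4 * k : ℝ) ^ S.a := by gcongr
        _ = 4 ^ S.a * (k : ℝ) ^ S.a := Real.mul_rpow (by norm_num) hk0.le
        _ ≤ 4 * S.jump k := by
            gcongr
            calc (4 : ℝ) ^ S.a ≤ 4 ^ (1 : ℝ) := by gcongr; norm_num
              _ = 4 := Real.rpow_one 4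
    have h1 := hle ((k : ℝ) + 1) (by linarith) (by linarith)
    have h2 := hle ((k + 1 : ℕ) + 1 : ℝ) (by positivity) (by push_cast; linarith)
    calc _ ≤ ‖S.A k x‖ + ‖S.A (k + 1) x‖ := norm_sub_le _ _
      _ ≤ S.K * S.η₀⁻¹ * (4 * S.jump k) * ‖x‖ + S.K * S.η₀⁻¹ * (4 * S.jump k) * ‖x‖ := by
          refine add_le_add ((S.norm_A_le _ x).trans ?_) ((S.norm_A_le _ x).trans ?_) <;> gcongr
      _ = _ := by ring

theorem summable_jump_mul : Summable fun k : ℕ =>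
    S.jump k * (k : ℝ) ^ (-(S.b + (S.a - S.j) / 2)) := by
  have hc := S.c_pos
  have hj := S.j_pos
  have h4 := S.four_j
  have hJ := S.J₀_pos
  have s1 := summable_natCast_rpow_of_lt
    (show S.a - 1 + -(S.b + (S.a - S.j) / 2) < -1 by unfold b; linarith)
  have s2 := summable_jumps (J := S.J) (C := S.J₀) (j := S.j)
    (r := S.b + (S.a - S.j) / 2 - S.a) (fun k _ => S.J_le_J_succ k) hj
    (fun k hk => by
      obtain ⟨n, rfl⟩ := Nat.exists_eq_add_of_le' hk
      push_cast
      exact S.J_succ_le n) (fun k _ => S.one_le_J k) (by unfold b; linarith)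
  refine (summable_nat_add_iff 1).mp (((summable_nat_add_iff 1).mpr (s1.add s2)).congr fun k => ?_)
  have hk0 : (0 : ℝ) < (k + 1 : ℕ) := by positivity
  rw [jump, add_mul, ← Real.rpow_add hk0]
  split_ifs with h
  · simp
  · rw [← Real.rpow_add hk0]
    congr 2
    ring

theorem ae_exists_sum_A_le : ∀ᵐ ω ∂S.P, ∃ C, 0 ≤ C ∧ ∀ N : ℕ,
    ‖∑ k ∈ Finset.range N, S.A (k + 1) (S.X (k + 1) ω - S.X k ω)‖ ≤ C * ((N : ℝ) + 1) ^ S.b := by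
  obtain ⟨C₁, hC₁, h₁⟩ := S.exists_integral_norm_X_le
  have hK := S.K_pos
  have hη := S.η₀_pos
  have hb := S.b_pos
  have ha := S.a_pos
  have hj := S.j_pos
  have hsum : ∀ᵐ ω ∂S.P, Summable fun k : ℕ => S.jump k * ‖S.X k ω‖ * (k : ℝ) ^ (-S.b) := by
    refine ae_summable_of_summable_integral
      (fun k ω => mul_nonneg (mul_nonneg (S.jump_nonneg k) (norm_nonneg _))
        (Real.rpow_nonneg (Nat.cast_nonneg k) _))
      (fun k => (((S.X_memLp k).integrable one_le_two).norm.const_mul _).mul_const _) ?_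
    refine (summable_nat_add_iff 1).mp (Summable.of_nonneg_of_le (fun k => ?_) (fun k => ?_)
      (((summable_nat_add_iff 1).mpr S.summable_jump_mul).mul_left C₁))
    · exact integral_nonneg fun ω => mul_nonneg (mul_nonneg (S.jump_nonneg _) (norm_nonneg _))
        (Real.rpow_nonneg (Nat.cast_nonneg _) _)
    · rw [integral_mul_const, integral_const_mul]
      have hk0 : (0 : ℝ) < (k + 1 : ℕ) := by positivity
      have h2 : ∫ ω, ‖S.X (k + 1) ω‖ ∂S.P ≤ C₁ * ((k + 1 : ℕ) : ℝ) ^ (-((S.a - S.j) / 2)) := by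
        refine (h₁ (k + 1)).trans (mul_le_mul_of_nonneg_left ?_ hC₁)
        exact Real.rpow_le_rpow_of_nonpos hk0 (by linarith)
          (by have := S.three_j; have := S.c_pos; linarith)
      have h3 := S.jump_nonneg (k + 1)
      calc _ ≤ S.jump (k + 1) * (C₁ * ((k + 1 : ℕ) : ℝ) ^ (-((S.a - S.j) / 2)))
            * ((k + 1 : ℕ) : ℝ) ^ (-S.b) := by gcongr
        _ = C₁ * (S.jump (k + 1) * (((k + 1 : ℕ) : ℝ) ^ (-((S.a - S.j) / 2))
            * ((k + 1 : ℕ) : ℝ) ^ (-S.b))) := by ring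
        _ = _ := by rw [← Real.rpow_add hk0, neg_add S.b, add_comm (-S.b)]
  filter_upwards [hsum, S.ae_exists_X_le] with ω hs hX
  obtain ⟨C₂, hC₂, h₂⟩ := hX
  set V := ∑' k : ℕ, S.jump k * ‖S.X k ω‖ * (k : ℝ) ^ (-S.b) with hV
  have hV0 : 0 ≤ V := tsum_nonneg fun k => mul_nonneg
    (mul_nonneg (S.jump_nonneg k) (norm_nonneg _)) (Real.rpow_nonneg (Nat.cast_nonneg k) _)
  refine ⟨S.K * S.η₀⁻¹ * C₂ + ‖S.A 0 (S.X 0 ω)‖ + ‖S.A 0 (S.X 0 ω) - S.A 1 (S.X 0 ω)‖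
    + 8 * S.K * S.η₀⁻¹ * V, by positivity, fun N => ?_⟩
  have hN1 : 1 ≤ ((N : ℝ) + 1) ^ S.b := Real.one_le_rpow (one_le_natCast_add_one N) hb.le
  have hNN : (N : ℝ) ^ S.b ≤ ((N : ℝ) + 1) ^ S.b := by gcongr; linarith
  have e1 : ‖S.A N (S.X N ω)‖ ≤ S.K * S.η₀⁻¹ * C₂ * ((N : ℝ) + 1) ^ S.b := by
    calc _ ≤ S.K * S.η₀⁻¹ * ((N : ℝ) + 1) ^ S.a * (C₂ * ((N : ℝ) + 1) ^ (-(S.a - S.b))) := by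
          refine (S.norm_A_le N _).trans ?_
          gcongr
          exact h₂ N
      _ = S.K * S.η₀⁻¹ * C₂ * (((N : ℝ) + 1) ^ S.a * ((N : ℝ) + 1) ^ (-(S.a - S.b))) := by ring
      _ = _ := by rw [rpow_succ_mul]; ring_nf
  have e2 : ‖∑ k ∈ Finset.range N, (S.A k (S.X k ω) - S.A (k + 1) (S.X k ω))‖
      ≤ ‖S.A 0 (S.X 0 ω) - S.A 1 (S.X 0 ω)‖ + 8 * S.K * S.η₀⁻¹ * (V * (N : ℝ) ^ S.b) := by
    refine (norm_sum_le _ _).trans ((sum_range_le_add_sum_Icc (fun k => norm_nonneg _) N).trans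
      (add_le_add_right ?_ _))
    calc _ ≤ ∑ k ∈ Finset.Icc 1 N, 8 * S.K * S.η₀⁻¹ * (S.jump k * ‖S.X k ω‖) := by
          refine Finset.sum_le_sum fun k hk => ?_
          rw [← mul_assoc]
          exact S.norm_A_sub_A_le (Finset.mem_Icc.mp hk).1 _
      _ = 8 * S.K * S.η₀⁻¹ * ∑ k ∈ Finset.Icc 1 N, S.jump k * ‖S.X k ω‖ := by
          rw [Finset.mul_sum]
      _ ≤ _ := by
          gcongr
          exact sum_Icc_le_of_summable
            (fun k => mul_nonneg (S.jump_nonneg k) (norm_nonneg _)) hb.le hs N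
  rw [sum_apply_sub_eq S.A (fun k => S.X k ω)]
  have e3 := norm_add_le (S.A N (S.X N ω) - S.A 0 (S.X 0 ω))
    (∑ k ∈ Finset.range N, (S.A k (S.X k ω) - S.A (k + 1) (S.X k ω)))
  have e4 := norm_sub_le (S.A N (S.X N ω)) (S.A 0 (S.X 0 ω))
  have e5 := le_mul_of_one_le_right (norm_nonneg (S.A 0 (S.X 0 ω))) hN1
  have e6 := le_mul_of_one_le_right (norm_nonneg (S.A 0 (S.X 0 ω) - S.A 1 (S.X 0 ω))) hN1
  have e7 : 8 * S.K * S.η₀⁻¹ * (V * (N : ℝ) ^ S.b)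
      ≤ 8 * S.K * S.η₀⁻¹ * V * ((N : ℝ) + 1) ^ S.b := by
    rw [mul_assoc _ V]; gcongr
  linarith

/-- Decomposition of the remainder. -/
theorem err_eq (N : ℕ) (ω : Ω) : S.err N ω =
    ∑ k ∈ Finset.range N, S.Q (k + 1) (S.rem (k + 1) ω)
      - ∑ k ∈ Finset.range N, S.Q (k + 1) (S.tail (k + 1) ω)
      + ∑ k ∈ Finset.range N, S.Q (k + 1) (S.g k ω + S.plug k ω)
      - ∑ k ∈ Finset.range N, S.Q (k + 1) (S.h k ω)
      - ∑ k ∈ Finset.range N, S.A (k + 1) (S.X (k + 1) ω - S.X k ω)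
      + (S.X N ω - S.X 0 ω) := by
  rw [← Finset.sum_range_sub (fun k => S.X k ω), ← Finset.sum_sub_distrib,
    ← Finset.sum_add_distrib, ← Finset.sum_sub_distrib, ← Finset.sum_sub_distrib,
    ← Finset.sum_add_distrib, err]
  refine Finset.sum_congr rfl fun k _ => ?_
  have hX : S.X (k + 1) ω - S.X k ω = S.coef (k + 1) ω - S.coef k ω := by unfold X; abel
  have hδ : S.δ k ω = S.Q (k + 1) (S.G (k + 1) (S.δ k ω)) :=
    (gramInv_gramOp S.reg S.ortho (S.one_le_J _) _).symm
  have hG : S.G (k + 1) (S.δ k ω) = S.trunc (k + 1) ω + S.rem (k + 1) ω + S.g k ω - S.h k ω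
      - (S.η (k + 1))⁻¹ • (S.X (k + 1) ω - S.X k ω) := by
    rw [hX, coef_succ, add_sub_cancel_left, smul_smul, inv_mul_cancel₀ (S.η_pos k).ne', one_smul]
    abel
  have h1 : S.coef (k + 1) ω - S.bStar (k + 1) = S.δ k ω + (S.X (k + 1) ω - S.X k ω) := by
    rw [hX]; unfold δ; abel
  rw [h1, hδ, hG, ← trunc_add_tail]
  simp only [map_add, map_sub, map_smul, A, smul_apply, smul_sub]
  abel

/-- The remainder of the expansion of the averaged coefficients. -/
theorem ae_exists_err_le : ∀ᵐ ω ∂S.P, ∃ C, 0 ≤ C ∧ ∀ N : ℕ,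
    ‖S.err N ω‖ ≤ C * ((N : ℝ) + 1) ^ S.b := by
  obtain ⟨C₁, hC₁, h₁⟩ := S.exists_g_add_le
  have hK := S.K_pos
  have hb := S.b_pos
  have hc := S.c_pos
  have hj := S.j_pos
  have ha := S.a_pos
  have h4 := S.four_j
  filter_upwards [S.ae_exists_sum_Q_rem_le, S.ae_exists_sum_Q_tail_le, S.ae_summable_h,
    S.ae_exists_sum_A_le, S.ae_exists_X_le] with ω hr ht hh hA hX
  obtain ⟨C₂, hC₂, h₂⟩ := hr
  obtain ⟨C₃, hC₃, h₃⟩ := ht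
  obtain ⟨C₄, hC₄, h₄⟩ := hA
  obtain ⟨C₅, hC₅, h₅⟩ := hX
  set V := ∑' k : ℕ, ‖S.h k ω‖ * ((k : ℝ) + 1) ^ (-S.b)
  have hV0 : 0 ≤ V := tsum_nonneg fun k => mul_nonneg (norm_nonneg _) (rpow_succ_pos k _).le
  set r := (1 + S.j) / 2 + S.c with hr
  have hrb : 1 - r = S.b := by rw [hr]; unfold b; ring
  refine ⟨C₂ + C₃ + S.K * (C₁ * S.b⁻¹) + S.K * V + C₄ + C₅ + ‖S.X 0 ω‖, by positivity,
    fun N => ?_⟩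
  have hN1 : 1 ≤ ((N : ℝ) + 1) ^ S.b := Real.one_le_rpow (one_le_natCast_add_one N) hb.le
  have hNN : (N : ℝ) ^ S.b ≤ ((N : ℝ) + 1) ^ S.b := by gcongr; linarith
  have e1 : ‖∑ k ∈ Finset.range N, S.Q (k + 1) (S.g k ω + S.plug k ω)‖
      ≤ S.K * (C₁ * S.b⁻¹) * ((N : ℝ) + 1) ^ S.b := by
    calc _ ≤ ∑ k ∈ Finset.range N, S.K * (C₁ * ((k : ℝ) + 1) ^ (-r)) :=
          norm_sum_le_of_le _ fun k _ => (S.norm_Q_le _ _).trans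
            (mul_le_mul_of_nonneg_left (h₁ k ω) hK.le)
      _ = S.K * (C₁ * ∑ k ∈ Finset.range N, ((k : ℝ) + 1) ^ (-r)) := by
          rw [Finset.mul_sum, Finset.mul_sum]
      _ ≤ S.K * (C₁ * (S.b⁻¹ * ((N : ℝ) + 1) ^ S.b)) := by
          gcongr
          refine (sum_range_rpow_succ_le (by positivity) (by linarith) N).trans ?_
          rw [hrb]
          gcongr
      _ = _ := by ring
  have e2 : ‖∑ k ∈ Finset.range N, S.Q (k + 1) (S.h k ω)‖ ≤ S.K * V * ((N : ℝ) + 1) ^ S.b := by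
    calc _ ≤ ∑ k ∈ Finset.range N, S.K * ‖S.h k ω‖ :=
          norm_sum_le_of_le _ fun k _ => S.norm_Q_le _ _
      _ = S.K * ∑ k ∈ Finset.range N, ‖S.h k ω‖ := by rw [Finset.mul_sum]
      _ ≤ S.K * (V * ((N : ℝ) + 1) ^ S.b) := by
          gcongr
          exact sum_range_le_of_summable (fun k => norm_nonneg _) hb.le hh N
      _ = _ := by ring
  have e3 : ‖S.X N ω - S.X 0 ω‖ ≤ C₅ * ((N : ℝ) + 1) ^ S.b + ‖S.X 0 ω‖ * ((N : ℝ) + 1) ^ S.b := by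
    refine (norm_sub_le _ _).trans (add_le_add ((h₅ N).trans ?_)
      (le_mul_of_one_le_right (norm_nonneg _) hN1))
    exact mul_le_mul_of_nonneg_left (rpow_succ_le N (by linarith)) hC₅
  rw [err_eq]
  have i1 := norm_add_le (∑ k ∈ Finset.range N, S.Q (k + 1) (S.rem (k + 1) ω)
      - ∑ k ∈ Finset.range N, S.Q (k + 1) (S.tail (k + 1) ω)
      + ∑ k ∈ Finset.range N, S.Q (k + 1) (S.g k ω + S.plug k ω)
      - ∑ k ∈ Finset.range N, S.Q (k + 1) (S.h k ω)
      - ∑ k ∈ Finset.range N, S.A (k + 1) (S.X (k + 1) ω - S.X k ω)) (S.X N ω - S.X 0 ω)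
  have i2 := norm_sub_le (∑ k ∈ Finset.range N, S.Q (k + 1) (S.rem (k + 1) ω)
      - ∑ k ∈ Finset.range N, S.Q (k + 1) (S.tail (k + 1) ω)
      + ∑ k ∈ Finset.range N, S.Q (k + 1) (S.g k ω + S.plug k ω)
      - ∑ k ∈ Finset.range N, S.Q (k + 1) (S.h k ω))
    (∑ k ∈ Finset.range N, S.A (k + 1) (S.X (k + 1) ω - S.X k ω))
  have i3 := norm_sub_le (∑ k ∈ Finset.range N, S.Q (k + 1) (S.rem (k + 1) ω)
      - ∑ k ∈ Finset.range N, S.Q (k + 1) (S.tail (k + 1) ω)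
      + ∑ k ∈ Finset.range N, S.Q (k + 1) (S.g k ω + S.plug k ω))
      (∑ k ∈ Finset.range N, S.Q (k + 1) (S.h k ω))
  have i4 := norm_add_le (∑ k ∈ Finset.range N, S.Q (k + 1) (S.rem (k + 1) ω)
      - ∑ k ∈ Finset.range N, S.Q (k + 1) (S.tail (k + 1) ω))
      (∑ k ∈ Finset.range N, S.Q (k + 1) (S.g k ω + S.plug k ω))
  have i5 := norm_sub_le (∑ k ∈ Finset.range N, S.Q (k + 1) (S.rem (k + 1) ω))
      (∑ k ∈ Finset.range N, S.Q (k + 1) (S.tail (k + 1) ω))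
  linarith [h₂ N, h₃ N, h₄ N]

end Setting

end

section

/-! ### Uniform bounds on projections -/

section Projection

variable {p : ℕ} {ν : Measure (Obs p)} [IsProbabilityMeasure ν] {θ₀ : EuclideanSpace ℝ (Fin p)}
  {F₀ : ℝ → ℝ} {ψ : ℕ → ℝ → ℝ} {αψ s s₁ κ K : ℝ}
  {H : Type*} [NormedAddCommGroup H] [InnerProductSpace ℝ H] [CompleteSpace H] {e : ℕ → H}
  (h : Regular ν θ₀ F₀ ψ αψ s s₁ κ K) (he : Orthonormal ℝ e)

include h he

theorem coefStar_eq_gramInv {f : ℝ → ℝ} (hf : Measurable f) {C : ℝ} (hC : ∀ z, |f z| ≤ C) (J : ℕ) :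
    coefStar e ν θ₀ f ψ J
      = gramInv e ν θ₀ ψ J (∫ w, f (index θ₀ w) • feat e ψ J (index θ₀ w) ∂ν) := by
  rw [integral_smul_feat h hf hC, gramInv, extOp_emb he]
  rfl

theorem integrable_smul_feat {f : ℝ → ℝ} (hf : Measurable f) {C : ℝ} (hC : ∀ z, |f z| ≤ C)
    (J : ℕ) : Integrable (fun w => f (index θ₀ w) • feat e ψ J (index θ₀ w)) ν :=
  integrable_smul_of_memLp (MemLp.of_bound (hf.comp (measurable_index θ₀)).aestronglyMeasurable C
    (Eventually.of_forall fun _ => hC _)) (feat_memLp h he J θ₀)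

theorem proj_sub_sieve {J : ℕ} (hJ : 1 ≤ J) (b : Fin J → ℝ) (z : ℝ) :
    proj ν θ₀ ψ J (fun z => F₀ z - sieveVec ψ J z ⬝ᵥ b) z
      = proj ν θ₀ ψ J F₀ z - sieveVec ψ J z ⬝ᵥ b := by
  have hF := h.link_differentiable.continuous.measurable
  have hg : Measurable fun z => sieveVec ψ J z ⬝ᵥ b := by
    simp only [← inner_feat_emb he]
    exact ((feat_continuous h J).inner continuous_const).measurable
  have hgb : ∀ z, |sieveVec ψ J z ⬝ᵥ b| ≤ K * √J * ‖emb e J b‖ := fun z => by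
    rw [← inner_feat_emb he]
    exact (abs_real_inner_le_norm _ _).trans
      (mul_le_mul_of_nonneg_right (norm_feat_le h he J z) (norm_nonneg _))
  rw [proj_eq_inner he, proj_eq_inner he, ← inner_feat_emb he, ← inner_sub_right,
    coefStar_eq_gramInv h he (f := fun z => F₀ z - sieveVec ψ J z ⬝ᵥ b) (hF.sub hg)
      (fun z => (abs_sub _ _).trans (add_le_add (h.link_bound z) (hgb z))),
    coefStar_eq_gramInv h he hF h.link_bound]
  congr 1
  have h1 : ∀ w : Obs p, (F₀ (index θ₀ w) - sieveVec ψ J (index θ₀ w) ⬝ᵥ b)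
      • feat e ψ J (index θ₀ w) = F₀ (index θ₀ w) • feat e ψ J (index θ₀ w)
      - (inner ℝ (feat e ψ J (index θ₀ w)) (emb e J b) : ℝ) • feat e ψ J (index θ₀ w) := fun w => by
    rw [inner_feat_emb he, sub_smul]
  simp_rw [h1]
  rw [integral_sub (integrable_smul_feat h he hF h.link_bound J)
    (inner_feat_smul_integrable h he J θ₀ _), integral_inner_smul_feat h he (emb_mem J b), map_sub,
    gramInv_gramOp h he hJ]

/-- Uniform order of the projection error. -/
theorem exists_proj_sub_le (hstable : limsup (fun J : ℕ => ⨆ g ∈ sieveSpace ψ J,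
      ⨆ (_ : 0 < supNorm (fun z => F₀ z - g z) ∧ supNorm (fun z => F₀ z - g z) < ⊤),
        supNorm (proj ν θ₀ ψ J (fun z => F₀ z - g z)) / supNorm (fun z => F₀ z - g z)) atTop < ⊤) :
    ∃ C, 0 ≤ C ∧ ∀ J : ℕ, 1 ≤ J → ∀ z, |proj ν θ₀ ψ J F₀ z - F₀ z| ≤ C * (J : ℝ) ^ (-s) := by
  have hK := h.pos
  obtain ⟨c, hc1, hc2⟩ := exists_between hstable
  obtain ⟨J₁, hJ₁⟩ := eventually_atTop.mp (eventually_lt_of_limsup_lt hc1)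
  have hlarge : ∀ J : ℕ, 1 ≤ J → J₁ ≤ J → ∀ z,
      |proj ν θ₀ ψ J F₀ z - F₀ z| ≤ (c.toReal + 1) * K * (J : ℝ) ^ (-s) := by
    intro J hJ hJJ z
    obtain ⟨b, hb⟩ := h.approx J hJ
    set g : ℝ → ℝ := fun z => sieveVec ψ J z ⬝ᵥ b with hg
    have hA : 0 ≤ K * (J : ℝ) ^ (-s) := by positivity
    have hD : supNorm (fun z => F₀ z - g z) ≤ ENNReal.ofReal (K * (J : ℝ) ^ (-s)) :=
      (supNorm_le_iff hA).mpr hb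
    have hP : supNorm (proj ν θ₀ ψ J (fun z => F₀ z - g z))
        ≤ c * supNorm (fun z => F₀ z - g z) := by
      rcases eq_or_ne (supNorm fun z => F₀ z - g z) 0 with h0 | h0
      · have hz : (fun z => F₀ z - g z) = fun _ => 0 := by
          funext z
          have := enorm_le_supNorm (fun z => F₀ z - g z) z
          rw [h0] at this
          simpa using this
        rw [hz]
        have : proj ν θ₀ ψ J (fun _ => 0) = fun _ => 0 := by
          funext z
          simp only [proj, projCoef, mul_zero, integral_zero]
          rw [show (fun _ : Fin J => (0 : ℝ)) = 0 from rfl, Matrix.mulVec_zero, dotProduct_zero]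
        rw [this]
        simp [supNorm, supNormOn]
      · have hfin : supNorm (fun z => F₀ z - g z) < ⊤ := hD.trans_lt ENNReal.ofReal_lt_top
        rw [← ENNReal.div_le_iff h0 hfin.ne]
        refine le_trans ?_ (hJ₁ J hJJ).le
        exact le_iSup₂_of_le g ⟨b, rfl⟩ (le_iSup_of_le ⟨pos_iff_ne_zero.mpr h0, hfin⟩ le_rfl)
    have hP2 : supNorm (proj ν θ₀ ψ J (fun z => F₀ z - g z))
        ≤ ENNReal.ofReal (c.toReal * (K * (J : ℝ) ^ (-s))) := by
      rw [ENNReal.ofReal_mul ENNReal.toReal_nonneg, ENNReal.ofReal_toReal hc2.ne]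
      exact hP.trans (by gcongr)
    have h1 := abs_le_of_supNorm_le (by positivity) hP2 z
    have h2 := hb z
    rw [hg, proj_sub_sieve h he hJ] at h1
    rw [abs_le] at h1 h2 ⊢
    constructor <;> linarith
  obtain ⟨C, hC, hall⟩ := forall_le_of_eventually_le
    (x := fun J : ℕ => if J₁ ≤ J then (c.toReal + 1) * K * (J : ℝ) ^ (-s)
      else K * √J * ‖coefStar e ν θ₀ F₀ ψ J‖ + K)
    (y := fun J : ℕ => (J : ℝ) ^ (-s)) (C := (c.toReal + 1) * K)
    (fun J hJ => Real.rpow_pos_of_pos (by exact_mod_cast hJ) _)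
    (by filter_upwards [eventually_ge_atTop J₁] with J hJ; rw [if_pos hJ])
  refine ⟨C, hC, fun J hJ z => le_trans ?_ (hall J hJ)⟩
  split_ifs with hJJ
  · exact hlarge J hJ hJJ z
  · refine (abs_sub _ _).trans (add_le_add ?_ (h.link_bound z))
    rw [proj_eq_inner he]
    exact (abs_real_inner_le_norm _ _).trans
      (mul_le_mul_of_nonneg_right (norm_feat_le h he J z) (norm_nonneg _))

variable {μ₀ : ℝ → EuclideanSpace ℝ (Fin p)}

/-- The effect of the plug-in only involves the conditional mean of the regressors. -/
theorem plugInEffect_eq_integral (hμ : ν[fun w : Obs p => w.2.1 |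
      MeasurableSpace.comap (index θ₀) inferInstance] =ᵐ[ν] fun w => μ₀ (index θ₀ w))
    (J : ℕ) (Δ : EuclideanSpace ℝ (Fin p)) :
    plugInEffect e ν θ₀ F₀ ψ J Δ = ∫ w, (deriv F₀ (index θ₀ w) * inner ℝ (μ₀ (index θ₀ w)) Δ)
      • feat e ψ J (index θ₀ w) ∂ν := by
  have hle := (measurable_index θ₀).comap_le
  let L : H →L[ℝ] EuclideanSpace ℝ (Fin p) →L[ℝ] H :=
    ((ContinuousLinearMap.lsmul ℝ ℝ).comp (innerSL ℝ Δ)).flip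
  have hL : ∀ x X, L x X = (inner ℝ X Δ : ℝ) • x := fun x X => by
    simp [L, real_inner_comm]
  have hX : Integrable (fun w : Obs p => w.2.1) ν := h.regressor_memLp.integrable (by norm_num)
  have hφ : Continuous fun z => deriv F₀ z • feat e ψ J z :=
    h.link_deriv_continuous.smul (feat_continuous h J)
  have hφb : ∀ z, ‖deriv F₀ z • feat e ψ J z‖ ≤ K * (K * √J) := fun z => by
    rw [norm_smul]
    exact mul_le_mul (h.link_deriv_bound z) (norm_feat_le h he J z) (norm_nonneg _) h.pos.le
  have hφm : StronglyMeasurable[MeasurableSpace.comap (index θ₀) inferInstance] fun w : Obs p => deriv F₀ (index θ₀ w)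
      • feat e ψ J (index θ₀ w) :=
    hφ.comp_stronglyMeasurable (comap_measurable (index θ₀)).stronglyMeasurable
  have hint : Integrable (fun w : Obs p => L (deriv F₀ (index θ₀ w) • feat e ψ J (index θ₀ w))
      w.2.1) ν := by
    refine Integrable.mono' (hX.norm.const_mul (‖L‖ * (K * (K * √J))))
      (L.aestronglyMeasurable_comp₂ (hφm.mono hle).aestronglyMeasurable hX.aestronglyMeasurable)
      (Eventually.of_forall fun w => ?_)
    refine (L.le_opNorm₂ _ _).trans ?_
    gcongr
    exact hφb _
  have key := condExp_bilin_of_stronglyMeasurable_left (B := L) hφm hint hX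
  have h1 : ∫ w, L (deriv F₀ (index θ₀ w) • feat e ψ J (index θ₀ w)) w.2.1 ∂ν
      = ∫ w, L (deriv F₀ (index θ₀ w) • feat e ψ J (index θ₀ w)) (μ₀ (index θ₀ w)) ∂ν := by
    rw [← integral_condExp hle]
    refine integral_congr_ae ?_
    filter_upwards [key, hμ] with w hw hw2
    rw [hw, hw2]
  simp only [hL, smul_smul] at h1
  rw [plugInEffect]
  simpa only [mul_comm] using h1

theorem inner_feat_gramInv_plugInEffect (hm : Measurable μ₀)
    (hμ : ν[fun w : Obs p => w.2.1 | MeasurableSpace.comap (index θ₀) inferInstance]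
      =ᵐ[ν] fun w => μ₀ (index θ₀ w)) {C : ℝ} (hC : ∀ z, ‖deriv F₀ z • μ₀ z‖ ≤ C)
    (J : ℕ) (Δ : EuclideanSpace ℝ (Fin p)) (z : ℝ) :
    inner ℝ (feat e ψ J z) (gramInv e ν θ₀ ψ J (plugInEffect e ν θ₀ F₀ ψ J Δ))
      = ∑ a : Fin p, Δ a * proj ν θ₀ ψ J (fun t => deriv F₀ t * μ₀ t a) z := by
  have hfm : ∀ a : Fin p, Measurable fun t => deriv F₀ t * μ₀ t a := fun a =>
    h.link_deriv_continuous.measurable.mul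
      ((EuclideanSpace.proj (𝕜 := ℝ) a).continuous.measurable.comp hm)
  have hfb : ∀ (a : Fin p) t, |deriv F₀ t * μ₀ t a| ≤ C := fun a t => by
    have := (PiLp.norm_apply_le (deriv F₀ t • μ₀ t) a).trans (hC t)
    simpa [abs_mul] using this
  have h1 : ∀ w : Obs p, (deriv F₀ (index θ₀ w) * inner ℝ (μ₀ (index θ₀ w)) Δ)
      • feat e ψ J (index θ₀ w) = ∑ a : Fin p, Δ a •
        ((deriv F₀ (index θ₀ w) * μ₀ (index θ₀ w) a) • feat e ψ J (index θ₀ w)) := fun w => by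
    simp_rw [smul_smul, ← Finset.sum_smul, PiLp.inner_apply, Finset.mul_sum]
    congr 1
    refine Finset.sum_congr rfl fun a _ => ?_
    simp only [RCLike.inner_apply, conj_trivial]
    ring
  have hint : ∀ a ∈ Finset.univ, Integrable (fun w : Obs p => Δ a •
      ((deriv F₀ (index θ₀ w) * μ₀ (index θ₀ w) a) • feat e ψ J (index θ₀ w))) ν := fun a _ =>
    (integrable_smul_feat h he (hfm a) (hfb a) J).smul (Δ a)
  rw [plugInEffect_eq_integral h he hμ]
  simp_rw [h1]
  rw [integral_finsetSum _ hint, map_sum, inner_sum]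
  refine Finset.sum_congr rfl fun a _ => ?_
  rw [integral_smul, map_smul, inner_smul_right, ← coefStar_eq_gramInv h he (hfm a) (hfb a),
    ← proj_eq_inner he]

end Projection

namespace Setting

variable {Ω H : Type*} [mΩ : MeasurableSpace Ω] [NormedAddCommGroup H] [InnerProductSpace ℝ H]
  [CompleteSpace H] {p B : ℕ} (S : Setting Ω H p B)

theorem exists_inner_Q_plugInEffect_le {μ₀ : ℝ → EuclideanSpace ℝ (Fin p)}
    (hμ₀ : RegressorMean S.ν S.θ₀ S.F₀ S.ψ S.J₀ S.j μ₀) :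
    ∃ C, 0 ≤ C ∧ ∀ (k : ℕ) (Δ : EuclideanSpace ℝ (Fin p)) (z : ℝ),
      |(inner ℝ (feat S.e S.ψ (S.J k) z)
        (S.Q k (plugInEffect S.e S.ν S.θ₀ S.F₀ S.ψ (S.J k) Δ)) : ℝ)| ≤ C * ‖Δ‖ := by
  have hK := S.K_pos
  set C := (⨆ z : ℝ, ‖deriv S.F₀ z • μ₀ z‖ₑ).toReal with hCdef
  have hC : ∀ z, ‖deriv S.F₀ z • μ₀ z‖ ≤ C := fun z => by
    rw [← toReal_enorm]
    exact ENNReal.toReal_mono hμ₀.bounded.ne (le_iSup (fun z => ‖deriv S.F₀ z • μ₀ z‖ₑ) z)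
  have hC0 : 0 ≤ C := ENNReal.toReal_nonneg
  have hlim : limsup (fun k : ℕ => ⨆ a : Fin p,
      supNorm (fun z => proj S.ν S.θ₀ S.ψ (S.J k) (fun t => deriv S.F₀ t * μ₀ t a) z
        - deriv S.F₀ z * μ₀ z a)) atTop < 1 := by
    have := hμ₀.proj_converges
    unfold J
    rw [this]
    exact one_pos
  obtain ⟨k₀, hk₀⟩ := eventually_atTop.mp (eventually_lt_of_limsup_lt hlim)
  refine ⟨p * (1 + C) + S.K ^ 5 * S.J k₀, by positivity, fun k Δ z => ?_⟩
  rcases le_or_gt k₀ k with hk | hk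
  · have hb : ∀ a : Fin p, |proj S.ν S.θ₀ S.ψ (S.J k) (fun t => deriv S.F₀ t * μ₀ t a) z|
        ≤ 1 + C := fun a => by
      have h1 := abs_le_of_supNorm_le zero_le_one
        (((le_iSup (fun a : Fin p => supNorm (fun z => proj S.ν S.θ₀ S.ψ (S.J k)
          (fun t => deriv S.F₀ t * μ₀ t a) z - deriv S.F₀ z * μ₀ z a)) a).trans
            (hk₀ k hk).le).trans_eq ENNReal.ofReal_one.symm) z
      have h2 : |deriv S.F₀ z * μ₀ z a| ≤ C := by
        have := (PiLp.norm_apply_le (deriv S.F₀ z • μ₀ z) a).trans (hC z)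
        simpa [abs_mul] using this
      rw [abs_le] at h1 h2 ⊢
      constructor <;> linarith
    rw [Q, inner_feat_gramInv_plugInEffect S.reg S.ortho hμ₀.measurable hμ₀.version hC]
    calc _ ≤ ∑ a : Fin p, ‖Δ‖ * (1 + C) := by
          refine (Finset.abs_sum_le_sum_abs _ _).trans (Finset.sum_le_sum fun a _ => ?_)
          rw [abs_mul]
          exact mul_le_mul (PiLp.norm_apply_le Δ a) (hb a) (abs_nonneg _) (norm_nonneg _)
      _ = p * (1 + C) * ‖Δ‖ := by simp; ring
      _ ≤ _ := by
          rw [add_mul]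
          exact le_add_of_nonneg_right (by positivity)
  · have hJ : (S.J k : ℝ) ≤ S.J k₀ := by exact_mod_cast S.J_mono hk.le
    calc _ ≤ ‖feat S.e S.ψ (S.J k) z‖
          * ‖S.Q k (plugInEffect S.e S.ν S.θ₀ S.F₀ S.ψ (S.J k) Δ)‖ := abs_real_inner_le_norm _ _
      _ ≤ (S.K * √(S.J k)) * (S.K * (S.K ^ 3 * (√(S.J k) * ‖Δ‖))) := by
          gcongr
          · exact norm_feat_le S.reg S.ortho _ z
          · exact (norm_gramInv_le S.reg S.ortho (S.one_le_J k) _).trans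
              (mul_le_mul_of_nonneg_left (norm_plugInEffect_le S.reg S.ortho _ Δ) hK.le)
      _ = S.K ^ 5 * (√(S.J k) * √(S.J k)) * ‖Δ‖ := by ring
      _ ≤ S.K ^ 5 * S.J k₀ * ‖Δ‖ := by
          rw [Real.mul_self_sqrt (Nat.cast_nonneg _)]
          gcongr
      _ ≤ _ := by
          rw [add_mul]
          exact le_add_of_nonneg_left (by positivity)

end Setting

end

section

theorem exists_sum_rpow_le {r t : ℝ} (hr : 0 ≤ r) (ht0 : 0 ≤ t) (ht : t < 1) : ∃ C, 0 ≤ C ∧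
    ∀ N : ℕ, ∑ k ∈ Finset.range N, ((k : ℝ) + 1) ^ (-r)
      ≤ C * ((N : ℝ) ^ (1 - r) + (N : ℝ) ^ (1 - t)) := by
  rcases lt_or_ge r 1 with h | h
  · refine ⟨(1 - r)⁻¹, inv_nonneg.mpr (by linarith), fun N => ?_⟩
    refine (sum_range_rpow_succ_le hr h N).trans (mul_le_mul_of_nonneg_left ?_
      (inv_nonneg.mpr (by linarith)))
    exact le_add_of_nonneg_right (by positivity)
  · refine ⟨(1 - t)⁻¹, inv_nonneg.mpr (by linarith), fun N => ?_⟩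
    refine (Finset.sum_le_sum fun k _ => rpow_succ_le k (show -r ≤ -t by linarith)).trans
      ((sum_range_rpow_succ_le ht0 ht N).trans (mul_le_mul_of_nonneg_left ?_
      (inv_nonneg.mpr (by linarith))))
    exact le_add_of_nonneg_left (by positivity)

namespace Setting

variable {Ω H : Type*} [mΩ : MeasurableSpace Ω] [NormedAddCommGroup H] [InnerProductSpace ℝ H]
  [CompleteSpace H] {p B : ℕ} (S : Setting Ω H p B)

/-! ### Uniform rate of the estimated link function -/

/-- The sum of the truncated scores, transformed by the inverse Gram operators. -/
def noiseSum (N : ℕ) (ω : Ω) : H := ∑ k ∈ Finset.range N, S.Q (k + 1) (S.trunc (k + 1) ω)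

theorem noiseSum_stronglyMeasurable (N : ℕ) : StronglyMeasurable[S.ℱ N] (S.noiseSum N) :=
  Finset.stronglyMeasurable_fun_sum _ fun k hk => (S.Q (k + 1)).continuous.comp_stronglyMeasurable
    ((S.gradSum_stronglyMeasurable k).mono (S.ℱ.mono (Finset.mem_range.mp hk)))

theorem inner_noiseSum_measurable (N : ℕ) (v : H) :
    Measurable[S.ℱ N] fun ω => (inner ℝ v (S.noiseSum N ω) : ℝ) :=
  (StronglyMeasurable.inner stronglyMeasurable_const (S.noiseSum_stronglyMeasurable N)
    (𝕜 := ℝ)).measurable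

theorem inner_Q_comm (k : ℕ) (x y : H) : (inner ℝ x (S.Q k y) : ℝ) = inner ℝ (S.Q k x) y :=
  (inner_extOp_comm (by rw [Matrix.transpose_nonsing_inv, gram_transpose]) x y).symm

theorem norm_trunc_le (k : ℕ) (ω : Ω) :
    ‖S.trunc (k + 1) ω‖ ≤ 2 * (S.T (k + 1) * (S.K * √(S.J (k + 1)))) := by
  have hB := S.B_pos
  rw [trunc, norm_smul, norm_inv, Real.norm_natCast, inv_mul_le_iff₀ hB]
  refine (norm_sum_le_of_le _ fun i _ =>
    norm_truncScore_le S.reg S.ortho _ (S.T_pos k).le _).trans_eq ?_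
  simp

theorem T_le {k N : ℕ} (h : k ≤ N) : S.T k ≤ S.T N := by
  have := S.j_pos
  unfold T
  gcongr

theorem sqrt_J_le {k N : ℕ} (h : k ≤ N) : √(S.J k : ℝ) ≤ √(S.J N) :=
  Real.sqrt_le_sqrt (by exact_mod_cast S.J_mono h)

theorem T_le_rpow (N : ℕ) : S.T N ≤ ((N : ℝ) + 1) ^ S.j := by
  rw [← T_succ]
  exact S.T_le (Nat.le_succ N)

theorem norm_noiseSum_le (N : ℕ) (ω : Ω) :
    ‖S.noiseSum N ω‖ ≤ N * (S.K * (2 * (S.T N * (S.K * √(S.J N))))) := by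
  have hK := S.K_pos
  refine (norm_sum_le_of_le _ fun k hk => ?_).trans_eq (by
    rw [Finset.sum_const, Finset.card_range, nsmul_eq_mul])
  have hk' : k + 1 ≤ N := Finset.mem_range.mp hk
  refine (S.norm_Q_le _ _).trans (mul_le_mul_of_nonneg_left ((S.norm_trunc_le k ω).trans ?_) hK.le)
  have h1 := S.T_le hk'
  have h2 := S.sqrt_J_le hk'
  have h3 := (S.T_pos k).trans_le h1
  gcongr

theorem lintegral_exp_noiseSum_le {N : ℕ} {v : H}
    (hv : S.K * ‖v‖ * (2 * (S.T N * (S.K * √(S.J N)))) ≤ 1) {M : ℕ} (hM : M ≤ N) :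
    ∫⁻ ω, ENNReal.ofReal (Real.exp (inner ℝ v (S.noiseSum M ω))) ∂S.P
      ≤ ENNReal.ofReal (Real.exp (M * (S.K ^ 3 * ‖v‖) ^ 2)) := by
  have hK := S.K_pos
  induction M with
  | zero => simp [noiseSum]
  | succ M ih =>
    have hQ := S.norm_Q_le (M + 1) v
    have h1 := S.T_le hM
    have h2 := S.sqrt_J_le hM
    have h3 := S.T_pos M
    have h4 := h3.trans_le h1
    have step := S.lintegral_exp_trunc_step M (S.inner_noiseSum_measurable M v)
      (u := S.Q (M + 1) v) (le_trans (by gcongr) hv)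
    have heq : ∀ ω, (inner ℝ v (S.noiseSum (M + 1) ω) : ℝ) = inner ℝ v (S.noiseSum M ω)
        + inner ℝ (S.Q (M + 1) v) (S.trunc (M + 1) ω) := fun ω => by
      rw [← inner_Q_comm, ← inner_add_right, noiseSum, Finset.sum_range_succ, noiseSum]
    simp_rw [heq]
    refine step.trans ?_
    calc _ ≤ ENNReal.ofReal (Real.exp ((S.K ^ 2 * (S.K * ‖v‖)) ^ 2))
          * ENNReal.ofReal (Real.exp (M * (S.K ^ 3 * ‖v‖) ^ 2)) :=
          mul_le_mul' (ENNReal.ofReal_le_ofReal (Real.exp_le_exp.mpr (by gcongr))) (ih (by omega))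
      _ = _ := by
          rw [← ENNReal.ofReal_mul (Real.exp_pos _).le, ← Real.exp_add]
          congr 2
          push_cast
          ring

theorem norm_feat_sub_le_of_abs_le {J : ℕ} {z t r : ℝ} (hr : 0 ≤ r)
    (h : ∀ j : ℕ, 1 ≤ j → j ≤ J → |S.ψ j z - S.ψ j t| ≤ r) :
    ‖feat S.e S.ψ J z - feat S.e S.ψ J t‖ ≤ √J * r := by
  refine (sq_le_sq₀ (norm_nonneg _) (by positivity)).mp ?_
  rw [feat, feat, ← map_sub, norm_emb_sq S.ortho, mul_pow, Real.sq_sqrt (Nat.cast_nonneg J)]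
  calc _ ≤ ∑ _i : Fin J, r ^ 2 := Finset.sum_le_sum fun i _ => by
        refine sq_le_sq.mpr ?_
        rw [abs_of_nonneg hr]
        exact h (i + 1) (by omega) i.2
    _ = _ := by simp

theorem exists_card_cover_le {D : Set ℝ} (hD : PolyCovered S.ψ D) : ∃ (C A : ℝ)
    (V : ℕ → Finset ℝ), 0 ≤ C ∧ (∀ N, ((V N).card : ℝ) ≤ C * ((N : ℝ) + 1) ^ A) ∧
      ∀ N, ∀ z ∈ D, ∃ t ∈ V N, ∀ j : ℕ, 1 ≤ j → j ≤ S.J N →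
        |S.ψ j z - S.ψ j t| ≤ ((N : ℝ) + 1)⁻¹ := by
  obtain ⟨C, A, h⟩ := hD
  have hJ := S.J₀_pos
  choose V hV hcov using fun N : ℕ => h (S.J N) (S.one_le_J N) ((N : ℝ) + 1)⁻¹
    (inv_pos.mpr (natCast_add_one_pos N)) (inv_le_one_of_one_le₀ (one_le_natCast_add_one N))
  refine ⟨|C| * (S.J₀ : ℝ) ^ |A|, (S.j + 1) * |A|, V, by positivity, fun N => ?_, hcov⟩
  have hp := natCast_add_one_pos N
  have h1 : (1 : ℝ) ≤ S.J N := by exact_mod_cast S.one_le_J N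
  have h2 : (S.J N : ℝ) / ((N : ℝ) + 1)⁻¹ = S.J N * ((N : ℝ) + 1) := by rw [div_inv_eq_mul]
  have h3 := one_le_natCast_add_one N
  refine (hV N).trans ?_
  rw [h2]
  calc _ ≤ |C| * (S.J N * ((N : ℝ) + 1)) ^ |A| := by
        refine mul_le_mul (le_abs_self C) ?_ (by positivity) (abs_nonneg C)
        exact Real.rpow_le_rpow_of_exponent_le (one_le_mul_of_one_le_of_one_le h1 h3)
          (le_abs_self A)
    _ ≤ |C| * (S.J₀ * ((N : ℝ) + 1) ^ S.j * ((N : ℝ) + 1)) ^ |A| := by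
        have := S.J_le_rpow N
        gcongr
    _ = _ := by
        rw [mul_assoc (S.J₀ : ℝ), ← Real.rpow_add_one hp.ne', Real.mul_rpow hJ.le (by positivity),
          ← Real.rpow_mul hp.le, mul_assoc]

theorem one_le_log_add_one {N : ℕ} (hN : 2 ≤ N) : 1 ≤ Real.log ((N : ℝ) + 1) := by
  have h2 : (2 : ℝ) ≤ N := by exact_mod_cast hN
  rw [Real.le_log_iff_exp_le (natCast_add_one_pos N)]
  linarith [Real.exp_one_lt_d9]

/-- Uniform law of the logarithm for the noise. -/
theorem ae_exists_inner_noiseSum_le {D : Set ℝ} (hD : PolyCovered S.ψ D) :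
    ∀ᵐ ω ∂S.P, ∃ (C : ℝ) (k₀ : ℕ), 0 ≤ C ∧ ∀ N, k₀ ≤ N → ∀ z ∈ D,
      |(inner ℝ (feat S.e S.ψ (S.J N) z) (S.noiseSum N ω) : ℝ)|
        ≤ C * (((N : ℝ) + 1) ^ ((1 + S.j) / 2) * √(Real.log ((N : ℝ) + 1))) := by
  have hK := S.K_pos
  have hJ := S.J₀_pos
  have hj := S.j_pos
  have hc := S.c_pos
  have h4 := S.four_j
  have ha := S.a_pos
  obtain ⟨C₀, A, V, hC₀, hV, hcov⟩ := S.exists_card_cover_le hD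
  obtain ⟨C₁, hC₁, hlog⟩ := exists_const_add_log_le 0 1 hc
  obtain ⟨k₀, hk₀⟩ := eventually_atTop.mp ((eventually_mul_rpow_le
    (4 * S.K ^ 6 * C₁ * S.J₀) (show S.c + 3 * S.j < 1 by linarith) one_pos).and
      (eventually_ge_atTop 2))
  set l : ℕ → ℝ := fun N => Real.log ((N : ℝ) + 1) with hl
  set r : ℕ → ℝ := fun N => √(l N / (((N : ℝ) + 1) * S.J N)) with hr
  have hl1 : ∀ N, k₀ ≤ N → 1 ≤ l N := fun N hN => one_le_log_add_one (hk₀ N hN).2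
  have hrsq : ∀ N, k₀ ≤ N → r N ^ 2 = l N / (((N : ℝ) + 1) * S.J N) := fun N hN => by
    have h1 := hl1 N hN
    have h2 := S.J_pos N
    exact Real.sq_sqrt (by positivity)
  have key : ∀ σ : ℝ, |σ| = 1 → ∀ᵐ ω ∂S.P, ∃ C', 0 ≤ C' ∧ ∀ N, k₀ ≤ N → ∀ t ∈ V N,
      inner ℝ ((σ * r N) • feat S.e S.ψ (S.J N) t) (S.noiseSum N ω) - S.K ^ 8 * l N
        ≤ C' + (A + 2) * Real.log ((N : ℝ) + 1) := by
    intro σ hσ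
    refine ae_exists_le_log (E := 1) (Y := fun N t ω =>
      inner ℝ ((σ * r N) • feat S.e S.ψ (S.J N) t) (S.noiseSum N ω) - S.K ^ 8 * l N)
      (fun N t => ((S.inner_noiseSum_measurable N _).mono (S.ℱ.le N) le_rfl).sub_const _) hC₀ hV
      fun N hN t _ => ?_
    have hl0 := hl1 N hN
    have hJN := S.J_pos N
    have hr0 : 0 ≤ r N := Real.sqrt_nonneg _
    have hp := natCast_add_one_pos N
    set v := (σ * r N) • feat S.e S.ψ (S.J N) t with hv
    have hvn : ‖v‖ ≤ r N * (S.K * √(S.J N)) := by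
      rw [hv, norm_smul, norm_mul, Real.norm_eq_abs, hσ, one_mul, Real.norm_of_nonneg hr0]
      exact mul_le_mul_of_nonneg_left (norm_feat_le S.reg S.ortho _ t) hr0
    have hT0 : 0 ≤ S.T N := Real.rpow_nonneg (Nat.cast_nonneg N) _
    have hsmall : S.K * ‖v‖ * (2 * (S.T N * (S.K * √(S.J N)))) ≤ 1 := by
      have h1 : S.K * (r N * (S.K * √(S.J N))) * (2 * (S.T N * (S.K * √(S.J N)))) ≤ 1 := by
        refine (sq_le_sq₀ (by positivity) zero_le_one).mp ?_
        calc _ = 4 * S.K ^ 6 * r N ^ 2 * S.T N ^ 2 * (√(S.J N) ^ 2) ^ 2 := by ring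
          _ = 4 * S.K ^ 6 * (l N * S.J N * S.T N ^ 2) / ((N : ℝ) + 1) := by
              rw [hrsq N hN, Real.sq_sqrt hJN.le]
              field_simp
          _ ≤ 4 * S.K ^ 6 * (C₁ * ((N : ℝ) + 1) ^ S.c * (S.J₀ * ((N : ℝ) + 1) ^ S.j)
                * (((N : ℝ) + 1) ^ S.j) ^ 2) / ((N : ℝ) + 1) := by
              have e1 : l N ≤ C₁ * ((N : ℝ) + 1) ^ S.c := by simpa using hlog N
              have e2 := S.J_le_rpow N
              have e3 := S.T_le_rpow N
              have e4 := rpow_succ_pos N S.c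
              gcongr
          _ = 4 * S.K ^ 6 * C₁ * S.J₀ * (((N : ℝ) + 1) ^ S.c * ((N : ℝ) + 1) ^ S.j
                * ((N : ℝ) + 1) ^ (2 * S.j)) / ((N : ℝ) + 1) := by
              rw [rpow_succ_pow_two]; ring
          _ ≤ 1 ^ 2 := by
              rw [rpow_succ_mul, rpow_succ_mul, div_le_iff₀ hp]
              have := (hk₀ N hN).1
              rw [Real.rpow_one] at this
              rw [show S.c + S.j + 2 * S.j = S.c + 3 * S.j by ring]
              linarith
      refine le_trans ?_ h1
      gcongr
    have hexp := S.lintegral_exp_noiseSum_le hsmall le_rfl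
    have hbd : (N : ℝ) * (S.K ^ 3 * ‖v‖) ^ 2 ≤ S.K ^ 8 * l N := by
      calc _ ≤ ((N : ℝ) + 1) * (S.K ^ 3 * (r N * (S.K * √(S.J N)))) ^ 2 := by gcongr; linarith
        _ = ((N : ℝ) + 1) * S.K ^ 8 * r N ^ 2 * √(S.J N) ^ 2 := by ring
        _ = _ := by rw [hrsq N hN, Real.sq_sqrt hJN.le]; field_simp
    simp_rw [sub_eq_add_neg, Real.exp_add, ENNReal.ofReal_mul (Real.exp_pos _).le]
    rw [lintegral_mul_const' _ _ ENNReal.ofReal_ne_top]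
    calc _ ≤ ENNReal.ofReal (Real.exp (S.K ^ 8 * l N))
          * ENNReal.ofReal (Real.exp (-(S.K ^ 8 * l N))) := by
          gcongr
          exact hexp.trans (ENNReal.ofReal_le_ofReal (Real.exp_le_exp.mpr hbd))
      _ = _ := by
          rw [← ENNReal.ofReal_mul (Real.exp_pos _).le, ← Real.exp_add, add_neg_cancel,
            Real.exp_zero]
  filter_upwards [key 1 (by norm_num), key (-1) (by norm_num)] with ω ⟨C₂, hC₂, h₂⟩ ⟨C₃, hC₃, h₃⟩
  set E := C₂ + C₃ + |A + 2| + S.K ^ 8 with hE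
  have hE0 : 0 ≤ E := by positivity
  refine ⟨E * √S.J₀ + 2 * S.K ^ 2 * S.J₀, k₀, by positivity, fun N hN z hz => ?_⟩
  obtain ⟨t, ht, hzt⟩ := hcov N z hz
  have hl0 := hl1 N hN
  have hJN := S.J_pos N
  have hp := natCast_add_one_pos N
  have hr0 : 0 < r N := Real.sqrt_pos.mpr (by positivity)
  have hsl : 1 ≤ √(l N) := Real.one_le_sqrt.mpr hl0
  have hJN2 := S.J_le_rpow N
  have e1 : |(inner ℝ (feat S.e S.ψ (S.J N) t) (S.noiseSum N ω) : ℝ)|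
      ≤ E * (√(l N) * √(((N : ℝ) + 1) * S.J N)) := by
    have i1 : _ ≤ C₂ + (A + 2) * l N := h₂ N hN t ht
    have i2 : _ ≤ C₃ + (A + 2) * l N := h₃ N hN t ht
    rw [real_inner_smul_left] at i1 i2
    have i3 : (A + 2) * l N ≤ |A + 2| * l N := by gcongr; exact le_abs_self _
    have i4 : C₂ + C₃ ≤ (C₂ + C₃) * l N := le_mul_of_one_le_right (by positivity) hl0
    have i5 : r N * (√(l N) * √(((N : ℝ) + 1) * S.J N)) = l N := by
      rw [hr]
      simp only
      rw [Real.sqrt_div (by linarith)]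
      have : 0 < √(((N : ℝ) + 1) * S.J N) := Real.sqrt_pos.mpr (by positivity)
      field_simp
      exact Real.sq_sqrt (by linarith)
    have i6 : r N * |(inner ℝ (feat S.e S.ψ (S.J N) t) (S.noiseSum N ω) : ℝ)|
        = |r N * inner ℝ (feat S.e S.ψ (S.J N) t) (S.noiseSum N ω)| := by
      rw [abs_mul, abs_of_pos hr0]
    refine le_of_mul_le_mul_left ?_ hr0
    rw [mul_left_comm, i5, i6, hE, add_mul, add_mul, abs_le]
    constructor <;> linarith
  have e2 : √(((N : ℝ) + 1) * S.J N) ≤ √S.J₀ * ((N : ℝ) + 1) ^ ((1 + S.j) / 2) := by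
    rw [Real.sqrt_le_left (by positivity), mul_pow, Real.sq_sqrt hJ.le, rpow_succ_pow_two]
    calc _ ≤ ((N : ℝ) + 1) * (S.J₀ * ((N : ℝ) + 1) ^ S.j) := by gcongr
      _ = S.J₀ * (((N : ℝ) + 1) ^ (1 : ℝ) * ((N : ℝ) + 1) ^ S.j) := by rw [Real.rpow_one]; ring
      _ = _ := by rw [rpow_succ_mul]; ring_nf
  have e3 : |(inner ℝ (feat S.e S.ψ (S.J N) z - feat S.e S.ψ (S.J N) t) (S.noiseSum N ω) : ℝ)|
      ≤ 2 * S.K ^ 2 * S.J₀ * ((N : ℝ) + 1) ^ ((1 + S.j) / 2) := by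
    have hT0 : 0 ≤ S.T N := Real.rpow_nonneg (Nat.cast_nonneg N) _
    calc _ ≤ (√(S.J N) * ((N : ℝ) + 1)⁻¹) * (N * (S.K * (2 * (S.T N * (S.K * √(S.J N)))))) := by
          refine (abs_real_inner_le_norm _ _).trans (mul_le_mul
            (S.norm_feat_sub_le_of_abs_le (by positivity) hzt) (S.norm_noiseSum_le N ω)
            (norm_nonneg _) (by positivity))
      _ = 2 * S.K ^ 2 * (√(S.J N) * √(S.J N)) * S.T N * (((N : ℝ) + 1)⁻¹ * N) := by ring
      _ ≤ 2 * S.K ^ 2 * (S.J₀ * ((N : ℝ) + 1) ^ S.j) * ((N : ℝ) + 1) ^ S.j * 1 := by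
          rw [Real.mul_self_sqrt hJN.le]
          have := S.T_le_rpow N
          gcongr
          rw [inv_mul_le_iff₀ hp]
          linarith
      _ = 2 * S.K ^ 2 * S.J₀ * (((N : ℝ) + 1) ^ S.j * ((N : ℝ) + 1) ^ S.j) := by ring
      _ ≤ _ := by
          rw [rpow_succ_mul]
          exact mul_le_mul_of_nonneg_left (rpow_succ_le N (by linarith)) (by positivity)
  have hR := rpow_succ_pos N ((1 + S.j) / 2)
  calc |(inner ℝ (feat S.e S.ψ (S.J N) z) (S.noiseSum N ω) : ℝ)|
      = |(inner ℝ (feat S.e S.ψ (S.J N) t) (S.noiseSum N ω) : ℝ)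
        + inner ℝ (feat S.e S.ψ (S.J N) z - feat S.e S.ψ (S.J N) t) (S.noiseSum N ω)| := by
        rw [← inner_add_left]; congr 2; abel
    _ ≤ E * (√(l N) * (√S.J₀ * ((N : ℝ) + 1) ^ ((1 + S.j) / 2)))
        + 2 * S.K ^ 2 * S.J₀ * ((N : ℝ) + 1) ^ ((1 + S.j) / 2) * √(l N) := by
        refine (abs_add_le _ _).trans (add_le_add (e1.trans (by gcongr))
          (e3.trans (le_mul_of_one_le_right (by positivity) hsl)))
    _ = _ := by ring

end Setting

end

section

theorem rpow_add_one_le {N : ℕ} (hN : 1 ≤ N) {x : ℝ} (hx0 : 0 ≤ x) (hx1 : x ≤ 1) :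
    ((N : ℝ) + 1) ^ x ≤ 2 * (N : ℝ) ^ x := by
  have h1 : (1 : ℝ) ≤ N := by exact_mod_cast hN
  calc ((N : ℝ) + 1) ^ x ≤ (2 * (N : ℝ)) ^ x := by gcongr; linarith
    _ = 2 ^ x * (N : ℝ) ^ x := Real.mul_rpow (by norm_num) (by linarith)
    _ ≤ 2 * (N : ℝ) ^ x := by
        gcongr
        calc (2 : ℝ) ^ x ≤ 2 ^ (1 : ℝ) := by gcongr; norm_num
          _ = 2 := Real.rpow_one 2

theorem sqrt_log_add_one_le {N : ℕ} (hN : 2 ≤ N) :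
    √(Real.log ((N : ℝ) + 1)) ≤ 2 * Real.log N ^ (1 / 2 : ℝ) := by
  have h2 : (2 : ℝ) ≤ N := by exact_mod_cast hN
  have h0 : 0 ≤ Real.log N := Real.log_nonneg (by linarith)
  rw [← Real.sqrt_eq_rpow, Real.sqrt_le_left (by positivity), mul_pow, Real.sq_sqrt h0]
  have : Real.log ((N : ℝ) + 1) ≤ 2 * Real.log N := by
    rw [← Real.log_rpow (by linarith), show (2 : ℝ) = (2 : ℕ) by norm_num, Real.rpow_natCast]
    exact Real.log_le_log (by linarith) (by nlinarith)
  linarith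

namespace Setting

variable {Ω H : Type*} [mΩ : MeasurableSpace Ω] [NormedAddCommGroup H] [InnerProductSpace ℝ H]
  [CompleteSpace H] {p B : ℕ} (S : Setting Ω H p B)

theorem plug_mem (k : ℕ) (ω : Ω) : S.plug k ω ∈ sieveSub S.e (S.J (k + 1)) :=
  integral_mem_sieveSub S.ortho _ fun _ => Submodule.smul_mem _ _ (feat_mem _ _)

theorem sum_coef_eq (N : ℕ) (ω : Ω) : ∑ k ∈ Finset.range N, S.coef (k + 1) ω
    = S.err N ω + S.noiseSum N ω + ∑ k ∈ Finset.range N, S.Q (k + 1) (S.tail (k + 1) ω)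
      - ∑ k ∈ Finset.range N, S.Q (k + 1) (S.plug k ω)
      + ∑ k ∈ Finset.range N, S.bStar (k + 1) := by
  rw [err, noiseSum, ← Finset.sum_add_distrib, ← Finset.sum_add_distrib,
    ← Finset.sum_sub_distrib, ← Finset.sum_add_distrib]
  refine Finset.sum_congr rfl fun k _ => ?_
  rw [← trunc_add_tail, map_sub, map_add]
  abel

/-- Uniform rate of the averaged link function. -/
theorem ae_exists_link_le {D : Set ℝ} (hD : PolyCovered S.ψ D)
    {μ₀ : ℝ → EuclideanSpace ℝ (Fin p)}
    (hμ₀ : RegressorMean S.ν S.θ₀ S.F₀ S.ψ S.J₀ S.j μ₀)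
    (hstable : SieveApproximation S.ν S.θ₀ S.F₀ S.ψ S.s S.s₁) :
    ∀ᵐ ω ∂S.P, ∃ C, 0 ≤ C ∧ ∀ᶠ N : ℕ in atTop, ∀ z ∈ D,
      |(inner ℝ (feat S.e S.ψ (S.J N) z)
          ((N : ℝ)⁻¹ • ∑ k ∈ Finset.range N, S.coef (k + 1) ω) : ℝ) - S.F₀ z|
        ≤ C * ((N : ℝ) ^ (-((1 - S.j) / 2)) * Real.log N ^ (1 / 2 : ℝ) + (N : ℝ) ^ (-(S.j * S.s))
          + (N : ℝ)⁻¹ * ∑ k ∈ Finset.range N, ‖S.θc k ω - S.θ₀‖) := by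
  have hK := S.K_pos
  have hJ := S.J₀_pos
  have hj := S.j_pos
  have hc := S.c_pos
  have h4 := S.four_j
  have ha := S.a_pos
  have hs := S.s_pos
  obtain ⟨C₁, hC₁, hbias⟩ := exists_proj_sub_le S.reg S.ortho hstable.stable
  obtain ⟨C₂, hC₂, hplug⟩ := S.exists_inner_Q_plugInEffect_le hμ₀
  obtain ⟨C₃, hC₃, hJs⟩ := S.exists_J_rpow_neg_le hs.le
  obtain ⟨C₄, hC₄, hsum⟩ := exists_sum_rpow_le (r := S.s * S.j) (t := (1 - S.j) / 2)
    (by positivity) (by linarith) (by linarith)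
  filter_upwards [S.ae_exists_err_le, S.ae_exists_sum_Q_tail_le,
    S.ae_exists_inner_noiseSum_le hD] with ω ⟨C₅, hC₅, h₅⟩ ⟨C₆, hC₆, h₆⟩ ⟨C₇, k₀, hC₇, h₇⟩
  refine ⟨4 * (S.K * √S.J₀ * (C₅ + C₆) + C₇ + C₁ * C₃ * C₄) + C₂, by positivity, ?_⟩
  filter_upwards [eventually_ge_atTop k₀, eventually_ge_atTop 2] with N hN hN2 z hz
  have hN0 : (0 : ℝ) < N := by exact_mod_cast (by omega : 0 < N)
  set Φ := feat S.e S.ψ (S.J N) z with hΦ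
  set Θ := ∑ k ∈ Finset.range N, ‖S.θc k ω - S.θ₀‖ with hΘ
  set R := ((N : ℝ) + 1) ^ ((1 + S.j) / 2) * √(Real.log ((N : ℝ) + 1)) with hR
  have hl := one_le_log_add_one hN2
  have hsl : 1 ≤ √(Real.log ((N : ℝ) + 1)) := Real.one_le_sqrt.mpr hl
  have hp := rpow_succ_pos N ((1 + S.j) / 2)
  have hpR : ((N : ℝ) + 1) ^ ((1 + S.j) / 2) ≤ R := le_mul_of_one_le_right hp.le hsl
  have e1 : ∀ x : H, ∀ C, 0 ≤ C → ‖x‖ ≤ C * ((N : ℝ) + 1) ^ S.b →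
      |(inner ℝ Φ x : ℝ)| ≤ S.K * √S.J₀ * C * R := fun x C hC hx => by
    calc |(inner ℝ Φ x : ℝ)| ≤ (S.K * √(S.J N)) * (C * ((N : ℝ) + 1) ^ S.b) :=
          (abs_real_inner_le_norm _ _).trans (mul_le_mul (norm_feat_le S.reg S.ortho _ z) hx
            (norm_nonneg _) (by positivity))
      _ ≤ (S.K * √(S.J₀ * ((N : ℝ) + 1) ^ S.j)) * (C * ((N : ℝ) + 1) ^ S.b) := by
          have := S.J_le_rpow N
          gcongr
      _ = S.K * √S.J₀ * C * (((N : ℝ) + 1) ^ (S.j * (1 / 2)) * ((N : ℝ) + 1) ^ S.b) := by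
          rw [Real.sqrt_mul hJ.le, Real.sqrt_eq_rpow (((N : ℝ) + 1) ^ S.j),
            ← Real.rpow_mul (natCast_add_one_pos N).le]
          ring
      _ ≤ S.K * √S.J₀ * C * ((N : ℝ) + 1) ^ ((1 + S.j) / 2) := by
          rw [rpow_succ_mul]
          exact mul_le_mul_of_nonneg_left (rpow_succ_le N (by unfold b; linarith)) (by positivity)
      _ ≤ _ := by gcongr
  have e2 : |(inner ℝ Φ (∑ k ∈ Finset.range N, S.Q (k + 1) (S.plug k ω)) : ℝ)| ≤ C₂ * Θ := by
    rw [inner_sum, hΘ, Finset.mul_sum]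
    refine (Finset.abs_sum_le_sum_abs _ _).trans (Finset.sum_le_sum fun k hk => ?_)
    have hm : S.Q (k + 1) (S.plug k ω) ∈ sieveSub S.e (S.J (k + 1)) :=
      extOp_mem S.ortho _ (S.plug_mem k ω)
    rw [hΦ, inner_feat_of_le S.ortho (S.J_mono (Finset.mem_range.mp hk)) hm]
    exact hplug (k + 1) _ z
  have e3 : |(inner ℝ Φ (∑ k ∈ Finset.range N, S.bStar (k + 1)) : ℝ) - N * S.F₀ z|
      ≤ C₁ * C₃ * C₄ * ((N : ℝ) ^ (1 - S.s * S.j) + R) := by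
    have h1 : (inner ℝ Φ (∑ k ∈ Finset.range N, S.bStar (k + 1)) : ℝ) - N * S.F₀ z
        = ∑ k ∈ Finset.range N, (proj S.ν S.θ₀ S.ψ (S.J (k + 1)) S.F₀ z - S.F₀ z) := by
      rw [inner_sum, Finset.sum_sub_distrib, Finset.sum_const, Finset.card_range, nsmul_eq_mul]
      congr 1
      refine Finset.sum_congr rfl fun k hk => ?_
      have hm : S.bStar (k + 1) ∈ sieveSub S.e (S.J (k + 1)) := emb_mem _ _
      rw [hΦ, inner_feat_of_le S.ortho (S.J_mono (Finset.mem_range.mp hk)) hm,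
        proj_eq_inner S.ortho]
      rfl
    rw [h1]
    calc _ ≤ ∑ k ∈ Finset.range N, C₁ * (C₃ * ((k : ℝ) + 1) ^ (-(S.s * S.j))) := by
          refine (Finset.abs_sum_le_sum_abs _ _).trans (Finset.sum_le_sum fun k _ => ?_)
          exact (hbias _ (S.one_le_J _) z).trans (mul_le_mul_of_nonneg_left (hJs k) hC₁)
      _ = C₁ * (C₃ * ∑ k ∈ Finset.range N, ((k : ℝ) + 1) ^ (-(S.s * S.j))) := by
          rw [Finset.mul_sum, Finset.mul_sum]
      _ ≤ C₁ * (C₃ * (C₄ * ((N : ℝ) ^ (1 - S.s * S.j) + R))) := by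
          have h2 : (N : ℝ) ^ (1 - (1 - S.j) / 2) ≤ R := by
            refine le_trans ?_ hpR
            rw [show 1 - (1 - S.j) / 2 = (1 + S.j) / 2 by ring]
            gcongr
            linarith
          have := hsum N
          gcongr
          refine this.trans ?_
          gcongr
      _ = _ := by ring
  have hmain : |(inner ℝ Φ (∑ k ∈ Finset.range N, S.coef (k + 1) ω) : ℝ) - N * S.F₀ z|
      ≤ (S.K * √S.J₀ * (C₅ + C₆) + C₇ + C₁ * C₃ * C₄) * (R + (N : ℝ) ^ (1 - S.s * S.j))
        + C₂ * Θ := by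
    have i1 := e1 _ C₅ hC₅ (h₅ N)
    have i2 := e1 _ C₆ hC₆ (h₆ N)
    have i3 := h₇ N hN z hz
    rw [sum_coef_eq, inner_add_right, inner_sub_right, inner_add_right, inner_add_right]
    have i4 : 0 ≤ (S.K * √S.J₀ * (C₅ + C₆) + C₇) * (N : ℝ) ^ (1 - S.s * S.j) := by positivity
    rw [abs_le] at i1 i2 i3 e2 e3 ⊢
    constructor <;> linarith
  have hR4 : R ≤ 4 * ((N : ℝ) ^ ((1 + S.j) / 2) * Real.log N ^ (1 / 2 : ℝ)) := by
    have h1 := rpow_add_one_le (by omega : 1 ≤ N) (show 0 ≤ (1 + S.j) / 2 by linarith)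
      (by linarith)
    have h2 := sqrt_log_add_one_le hN2
    calc R ≤ (2 * (N : ℝ) ^ ((1 + S.j) / 2)) * (2 * Real.log N ^ (1 / 2 : ℝ)) := by
          rw [hR]; gcongr
      _ = _ := by ring
  have hfinal : |(inner ℝ Φ ((N : ℝ)⁻¹ • ∑ k ∈ Finset.range N, S.coef (k + 1) ω) : ℝ) - S.F₀ z|
      = (N : ℝ)⁻¹ * |(inner ℝ Φ (∑ k ∈ Finset.range N, S.coef (k + 1) ω) : ℝ) - N * S.F₀ z| := by
    rw [← abs_of_pos (inv_pos.mpr hN0), ← abs_mul, abs_of_pos (inv_pos.mpr hN0), inner_smul_right,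
      mul_sub, inv_mul_cancel_left₀ hN0.ne']
  have hx1 : (N : ℝ)⁻¹ * (N : ℝ) ^ ((1 + S.j) / 2) = (N : ℝ) ^ (-((1 - S.j) / 2)) := by
    rw [← Real.rpow_neg_one, ← Real.rpow_add hN0]; ring_nf
  have hx2 : (N : ℝ)⁻¹ * (N : ℝ) ^ (1 - S.s * S.j) = (N : ℝ) ^ (-(S.j * S.s)) := by
    rw [← Real.rpow_neg_one, ← Real.rpow_add hN0]; ring_nf
  have hlogN : 0 ≤ Real.log N ^ (1 / 2 : ℝ) := Real.rpow_nonneg (Real.log_natCast_nonneg N) _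
  have hΘ0 : 0 ≤ Θ := Finset.sum_nonneg fun k _ => norm_nonneg _
  set G := S.K * √S.J₀ * (C₅ + C₆) + C₇ + C₁ * C₃ * C₄ with hG
  have hG0 : 0 ≤ G := by positivity
  rw [hfinal]
  set U := (N : ℝ) ^ (-((1 - S.j) / 2)) * Real.log N ^ (1 / 2 : ℝ) with hU
  have hU0 : 0 ≤ U := by positivity
  set V := (N : ℝ) ^ (-(S.j * S.s)) with hV
  have hV0 : 0 ≤ V := by positivity
  calc _ ≤ (N : ℝ)⁻¹ * (G * (4 * ((N : ℝ) ^ ((1 + S.j) / 2) * Real.log N ^ (1 / 2 : ℝ))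
        + (N : ℝ) ^ (1 - S.s * S.j)) + C₂ * Θ) := by
        gcongr
        exact hmain.trans (by gcongr)
    _ = 4 * G * (((N : ℝ)⁻¹ * (N : ℝ) ^ ((1 + S.j) / 2)) * Real.log N ^ (1 / 2 : ℝ))
        + G * ((N : ℝ)⁻¹ * (N : ℝ) ^ (1 - S.s * S.j)) + C₂ * ((N : ℝ)⁻¹ * Θ) := by ring
    _ = 4 * G * U + G * V + C₂ * ((N : ℝ)⁻¹ * Θ) := by rw [hx1, hx2]
    _ ≤ (4 * G + C₂) * U + (4 * G + C₂) * V + (4 * G + C₂) * ((N : ℝ)⁻¹ * Θ) := by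
        have : 0 ≤ (N : ℝ)⁻¹ * Θ := by positivity
        gcongr <;> linarith
    _ = _ := by ring

end Setting

end

section

/-! ### The coefficients as vectors -/

namespace Setting

variable {Ω H : Type*} [mΩ : MeasurableSpace Ω] [NormedAddCommGroup H] [InnerProductSpace ℝ H]
  [CompleteSpace H] {p B : ℕ} (S : Setting Ω H p B)

omit [CompleteSpace H] in
theorem emb_coefHat (ω : Ω) (k : ℕ) : emb S.e (sieveDim S.J₀ S.j k) (coefHat S.ψ S.J₀ S.j S.η₀ S.a
    S.b₀ (fun k i => S.W k i ω) (fun k => S.θc k ω) k) = S.coef k ω := by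
  induction k with
  | zero => rfl
  | succ k ih =>
    rw [coefHat, coef]
    simp only [map_add, map_smul, map_sum]
    have hpad : emb S.e (sieveDim S.J₀ S.j (k + 1)) (pad (sieveDim S.J₀ S.j (k + 1))
        (coefHat S.ψ S.J₀ S.j S.η₀ S.a S.b₀ (fun k i => S.W k i ω) (fun k => S.θc k ω) k))
        = S.coef k ω := (emb_pad (S.J_le_J_succ k) _).trans ih
    rw [hpad]
    refine congrArg₂ _ rfl (congrArg₂ _ rfl (Finset.sum_congr rfl fun i _ => ?_))
    rw [gradSample, ← hpad]
    exact congrArg (fun t : ℝ => ((S.W (k + 1) i ω).2.2 - t) • feat S.e S.ψ (S.J (k + 1)) _)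
      (inner_emb_emb S.ortho _ _).symm

omit [CompleteSpace H] in
theorem emb_coefBar (ω : Ω) (N : ℕ) : emb S.e (sieveDim S.J₀ S.j N) (coefBar S.ψ S.J₀ S.j S.η₀ S.a
    S.b₀ (fun k i => S.W k i ω) (fun k => S.θc k ω) N)
      = (N : ℝ)⁻¹ • ∑ k ∈ Finset.range N, S.coef (k + 1) ω := by
  rw [coefBar, map_smul, map_sum, ← sum_range_succ_eq_sum_Icc]
  refine congrArg _ (Finset.sum_congr rfl fun k hk => ?_)
  exact (emb_pad (S.J_mono (Finset.mem_range.mp hk)) _).trans (S.emb_coefHat ω (k + 1))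

omit [CompleteSpace H] in
theorem linkBar_eq (ω : Ω) (N : ℕ) (z : ℝ) : linkBar S.ψ S.J₀ S.j S.η₀ S.a
    S.b₀ (fun k i => S.W k i ω) (fun k => S.θc k ω) N z
      = inner ℝ (feat S.e S.ψ (S.J N) z) ((N : ℝ)⁻¹ • ∑ k ∈ Finset.range N, S.coef (k + 1) ω) := by
  rw [← emb_coefBar]
  exact (inner_feat_emb S.ortho _ _).symm

omit [CompleteSpace H] in
theorem emb_scaledSieveVec {k N : ℕ} (hk : k ≤ N) (z : ℝ) :
    emb S.e (sieveDim S.J₀ S.j N) (scaledSieveVec S.ν S.θ₀ S.ψ S.J₀ S.j N k z)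
      = S.Q k (feat S.e S.ψ (S.J k) z) := by
  rw [scaledSieveVec, Q, gramInv, feat, extOp_emb S.ortho]
  exact emb_pad (n := sieveDim S.J₀ S.j N) (S.J_mono hk) _

omit [CompleteSpace H] in
theorem emb_varianceTerm (ω : Ω) (N : ℕ) : emb S.e (sieveDim S.J₀ S.j N) (varianceTerm S.ν S.θ₀ S.F₀ S.ψ S.J₀ S.j
    (fun k i => S.W k i ω) N)
      = (N : ℝ)⁻¹ • ∑ k ∈ Finset.range N, S.Q (k + 1) (S.score (k + 1) ω) := by
  rw [varianceTerm, map_smul, map_sum, ← sum_range_succ_eq_sum_Icc]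
  refine congrArg _ (Finset.sum_congr rfl fun k hk => ?_)
  have hk' : k + 1 ≤ N := Finset.mem_range.mp hk
  rw [map_smul, map_sum, score, map_smul, map_sum]
  refine congrArg _ (Finset.sum_congr rfl fun i _ => ?_)
  rw [map_smul, map_smul, ← S.emb_scaledSieveVec hk']

theorem emb_regressor {k N : ℕ} (hk : k ≤ N) (Δ : EuclideanSpace ℝ (Fin p)) :
    emb S.e (sieveDim S.J₀ S.j N) ((Matrix.of fun (i : Fin (sieveDim S.J₀ S.j N)) (a : Fin p) => ∫ w, deriv S.F₀ (index S.θ₀ w)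
        * scaledSieveVec S.ν S.θ₀ S.ψ S.J₀ S.j N k (index S.θ₀ w) i * w.2.1 a ∂S.ν)
          *ᵥ fun a => Δ a)
      = S.Q k (plugInEffect S.e S.ν S.θ₀ S.F₀ S.ψ (S.J k) Δ) := by
  have hmem : S.Q k (plugInEffect S.e S.ν S.θ₀ S.F₀ S.ψ (S.J k) Δ) ∈ sieveSub S.e (sieveDim S.J₀ S.j N) :=
    sieveSub_mono (S.J_mono hk) (extOp_mem S.ortho _ (integral_mem_sieveSub S.ortho _ fun _ =>
      Submodule.smul_mem _ _ (feat_mem _ _)))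
  rw [← emb_coord_of_mem S.ortho hmem]
  congr 1
  ext i
  have hX : MemLp (fun w : Obs p => w.2.1) 2 S.ν := S.reg.regressor_memLp.mono_exponent (by norm_num)
  have hXa : ∀ a : Fin p, Integrable (fun w : Obs p => w.2.1 a) S.ν := fun a =>
    (EuclideanSpace.proj (𝕜 := ℝ) a).integrable_comp (hX.integrable one_le_two)
  have hdm : Measurable fun w : Obs p => deriv S.F₀ (index S.θ₀ w) :=
    S.reg.link_deriv_continuous.measurable.comp (measurable_index S.θ₀)
  have hsc : ∀ w : Obs p, scaledSieveVec S.ν S.θ₀ S.ψ S.J₀ S.j N k (index S.θ₀ w) i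
      = inner ℝ (S.e i) (S.Q k (feat S.e S.ψ (S.J k) (index S.θ₀ w))) := fun w => by
    rw [← S.emb_scaledSieveVec hk, inner_e_emb S.ortho, dif_pos i.2]
  have hsm : Measurable fun w : Obs p =>
      (inner ℝ (S.e i) (S.Q k (feat S.e S.ψ (S.J k) (index S.θ₀ w))) : ℝ) :=
    (stronglyMeasurable_const.inner ((S.Q k).continuous.comp_stronglyMeasurable
      (feat_stronglyMeasurable S.reg (S.J k) S.θ₀)) (𝕜 := ℝ)).measurable
  have hb : ∀ w : Obs p, ‖deriv S.F₀ (index S.θ₀ w)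
      * inner ℝ (S.e i) (S.Q k (feat S.e S.ψ (S.J k) (index S.θ₀ w)))‖
      ≤ S.K * (S.K * (S.K * √(S.J k))) := fun w => by
    rw [norm_mul]
    refine mul_le_mul (S.reg.link_deriv_bound _) ?_ (norm_nonneg _) S.K_pos.le
    refine (norm_inner_le_norm _ _).trans ?_
    rw [S.ortho.1 i, one_mul]
    exact (S.norm_Q_le k _).trans (mul_le_mul_of_nonneg_left
      (norm_feat_le S.reg S.ortho _ _) S.K_pos.le)
  have hint : ∀ a : Fin p, Integrable (fun w : Obs p => deriv S.F₀ (index S.θ₀ w)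
      * inner ℝ (S.e i) (S.Q k (feat S.e S.ψ (S.J k) (index S.θ₀ w))) * w.2.1 a) S.ν := fun a =>
    (hXa a).bdd_mul (hdm.mul hsm).aestronglyMeasurable (Eventually.of_forall hb)
  have hpl : Integrable (fun w : Obs p => (deriv S.F₀ (index S.θ₀ w) * inner ℝ w.2.1 Δ)
      • feat S.e S.ψ (S.J k) (index S.θ₀ w)) S.ν := by
    refine integrable_smul_of_memLp ?_ (feat_memLp S.reg S.ortho (S.J k) S.θ₀)
    refine (hX.inner_const (𝕜 := ℝ) Δ).of_le_mul (c := S.K)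
      (hdm.aestronglyMeasurable.mul (hX.inner_const (𝕜 := ℝ) Δ).aestronglyMeasurable)
      (Eventually.of_forall fun w => ?_)
    rw [norm_mul]
    exact mul_le_mul_of_nonneg_right (S.reg.link_deriv_bound _) (norm_nonneg _)
  have hc : coord S.e (sieveDim S.J₀ S.j N) (S.Q k (plugInEffect S.e S.ν S.θ₀ S.F₀ S.ψ (S.J k) Δ)) i
      = inner ℝ (S.e i) (S.Q k (plugInEffect S.e S.ν S.θ₀ S.F₀ S.ψ (S.J k) Δ)) := rfl
  have h1 : ∀ w : Obs p, (inner ℝ (S.Q k (S.e i)) ((deriv S.F₀ (index S.θ₀ w) * inner ℝ w.2.1 Δ)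
      • feat S.e S.ψ (S.J k) (index S.θ₀ w)) : ℝ) = ∑ a : Fin p, deriv S.F₀ (index S.θ₀ w)
      * inner ℝ (S.e i) (S.Q k (feat S.e S.ψ (S.J k) (index S.θ₀ w))) * w.2.1 a * Δ a := fun w => by
    rw [inner_smul_right, ← inner_Q_comm, PiLp.inner_apply, mul_right_comm, Finset.mul_sum]
    refine Finset.sum_congr rfl fun a _ => ?_
    simp only [RCLike.inner_apply, conj_trivial]
    ring
  rw [hc, inner_Q_comm, plugInEffect, ← integral_inner hpl]
  simp_rw [h1]
  rw [integral_finsetSum _ fun a _ => (hint a).mul_const (Δ a)]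
  simp only [Matrix.mulVec, dotProduct, Matrix.of_apply, hsc, integral_mul_const]

theorem emb_regressorTerm (ω : Ω) (N : ℕ) : emb S.e (sieveDim S.J₀ S.j N) (regressorTerm S.ν S.θ₀ S.F₀ S.ψ S.J₀
    S.j (fun k => S.θc k ω) N)
      = (N : ℝ)⁻¹ • ∑ k ∈ Finset.range N, S.Q (k + 1) (S.plug k ω) := by
  rw [regressorTerm, map_smul, map_sum, ← sum_range_succ_eq_sum_Icc]
  refine congrArg _ (Finset.sum_congr rfl fun k hk => ?_)
  rw [Nat.add_sub_cancel]
  exact S.emb_regressor (Finset.mem_range.mp hk) _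

omit [CompleteSpace H] in
theorem emb_pseudoTrueTerm (N : ℕ) : emb S.e (sieveDim S.J₀ S.j N) (pseudoTrueTerm S.ν S.θ₀ S.F₀ S.ψ S.J₀ S.j N)
      = (N : ℝ)⁻¹ • ∑ k ∈ Finset.range N, (S.bStar (k + 1) - S.bStar N) := by
  rw [pseudoTrueTerm, map_smul, map_sum, ← sum_range_succ_eq_sum_Icc]
  refine congrArg _ (Finset.sum_congr rfl fun k hk => ?_)
  rw [map_sub]
  exact congrArg₂ _ (emb_pad (S.J_mono (Finset.mem_range.mp hk)) _) rfl

/-- The remainder of the expansion. -/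
theorem norm_expansion_eq (ω : Ω) {N : ℕ} (hN : 1 ≤ N) : ‖WithLp.toLp 2
      (coefBarError S.ν S.θ₀ S.F₀ S.ψ S.J₀ S.j S.η₀ S.a S.b₀ (fun k i => S.W k i ω)
          (fun k => S.θc k ω) N
        - (varianceTerm S.ν S.θ₀ S.F₀ S.ψ S.J₀ S.j (fun k i => S.W k i ω) N
            - regressorTerm S.ν S.θ₀ S.F₀ S.ψ S.J₀ S.j (fun k => S.θc k ω) N
            + pseudoTrueTerm S.ν S.θ₀ S.F₀ S.ψ S.J₀ S.j N))‖
      = (N : ℝ)⁻¹ * ‖S.err N ω‖ := by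
  have hN0 : (N : ℝ) ≠ 0 := by exact_mod_cast (by omega : N ≠ 0)
  have hb : S.bStar N = (N : ℝ)⁻¹ • ∑ _k ∈ Finset.range N, S.bStar N := by
    rw [Finset.sum_const, Finset.card_range, ← Nat.cast_smul_eq_nsmul ℝ, smul_smul,
      inv_mul_cancel₀ hN0, one_smul]
  have hp : emb S.e (sieveDim S.J₀ S.j N) (projCoef S.ν S.θ₀ S.ψ (sieveDim S.J₀ S.j N) S.F₀) = S.bStar N := rfl
  rw [← norm_emb S.ortho, coefBarError, map_sub, map_sub, map_add, map_sub]
  rw [S.emb_coefBar, S.emb_varianceTerm, S.emb_regressorTerm, S.emb_pseudoTrueTerm, hp, hb]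
  rw [← smul_sub, ← smul_sub, ← smul_add, ← smul_sub, norm_smul, norm_inv, Real.norm_natCast]
  congr 2
  rw [← Finset.sum_sub_distrib, ← Finset.sum_sub_distrib, ← Finset.sum_add_distrib,
    ← Finset.sum_sub_distrib, err]
  refine Finset.sum_congr rfl fun k _ => ?_
  rw [← hb, map_sub]
  abel

theorem ae_expansion : ∀ᵐ ω ∂S.P, (fun N : ℕ => ‖WithLp.toLp 2
      (coefBarError S.ν S.θ₀ S.F₀ S.ψ S.J₀ S.j S.η₀ S.a S.b₀ (fun k i => S.W k i ω)
          (fun k => S.θc k ω) N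
        - (varianceTerm S.ν S.θ₀ S.F₀ S.ψ S.J₀ S.j (fun k i => S.W k i ω) N
            - regressorTerm S.ν S.θ₀ S.F₀ S.ψ S.J₀ S.j (fun k => S.θc k ω) N
            + pseudoTrueTerm S.ν S.θ₀ S.F₀ S.ψ S.J₀ S.j N))‖)
      =o[atTop] fun N : ℕ => (N : ℝ) ^ (-((1 + S.j) / 2)) := by
  have hj := S.j_pos
  filter_upwards [S.ae_exists_err_le] with ω ⟨C, hC, h⟩
  refine isLittleO_iff.mpr fun ε hε => ?_
  filter_upwards [eventually_mul_rpow_le (2 * C) (show S.b - 1 < -((1 + S.j) / 2) by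
    have := S.c_pos; unfold b; linarith) hε, eventually_ge_atTop 1] with N hN hN1
  have h1 : (1 : ℝ) ≤ N := by exact_mod_cast hN1
  have hp := natCast_add_one_pos N
  rw [S.norm_expansion_eq ω hN1, norm_mul, norm_norm, Real.norm_of_nonneg (by positivity),
    Real.norm_of_nonneg (by positivity)]
  calc _ ≤ (2 * ((N : ℝ) + 1)⁻¹) * (C * ((N : ℝ) + 1) ^ S.b) := by
        gcongr
        · rw [← div_eq_mul_inv, le_div_iff₀ hp, inv_mul_le_iff₀ (by linarith)]
          linarith
        · exact h N
    _ = 2 * C * ((N : ℝ) + 1) ^ (S.b - 1) := by rw [Real.rpow_sub_one hp.ne']; ring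
    _ ≤ ε * ((N : ℝ) + 1) ^ (-((1 + S.j) / 2)) := hN
    _ ≤ _ := by
        gcongr ε * ?_
        exact Real.rpow_le_rpow_of_nonpos (by linarith) (by linarith) (by linarith)

end Setting

end

section

/-! ### Exponents and plug-in rates -/

theorem Exponents.exists_slack {a j f r s s₁ κ : ℝ} (h : Exponents a j f r s s₁) (hκ : 4 < κ) :
    ∃ α c ρ : ℝ, α < r ∧ 0 < c ∧ 3 * j + 4 * c ≤ a ∧ a + 4 * j + 8 * c ≤ 1 ∧
      j + 4 * c ≤ 2 * (α - j * (1 / 2 + f)) ∧ 2 * j + 4 * c ≤ 2 * (s * j) ∧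
      4 * c ≤ j * (κ - 4) ∧ ρ ≤ s * j ∧ ρ ≤ α - j / 2 ∧ ρ ≤ (1 + j) / 2 + c ∧ a - j ≤ 2 * ρ ∧
      (1 + j) / 2 + 2 * c ≤ α - j * (1 / 2 + f) + ρ ∧
      1 + j + 8 * c ≤ 2 * (α - j * (1 / 2 + f)) + a ∧
      (1 + j) / 2 + c ≤ s * j + (α - j * (1 / 2 + f)) ∧
      (1 + j) / 2 + c ≤ s₁ * j + (α - j / 2) := by
  have hj := h.αJ_pos
  have hf := mul_pos hj h.αψ_pos
  have hsj := mul_pos hj (sub_pos.2 h.one_lt_s)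
  have hκj := mul_pos hj (sub_pos.2 hκ)
  obtain ⟨-, hl⟩ := max_lt_iff.1 h.αη_lower
  obtain ⟨hu1, hu2⟩ := lt_min_iff.1 h.αη_upper
  obtain ⟨hθ1, hθ⟩ := max_lt_iff.1 h.αθ_lower
  obtain ⟨hθ2, hθ3⟩ := max_lt_iff.1 hθ
  have h4 := h.four_αJ_lt
  have ha := h.αη_lt
  have hr := h.αθ_gt
  have key : ∀ x : ℝ, 0 < x → ∀ᶠ t in 𝓝[>] (0 : ℝ), 20 * t ≤ x := fun x hx => by
    filter_upwards [Ioo_mem_nhdsGT (by positivity : 0 < x / 20)] with t ht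
    linarith [ht.2]
  obtain ⟨t, ht0, t1, t2, t3, t4, t5, t6, t7, t8, t9, t10⟩ := (eventually_mem_nhdsWithin.and <|
    (key (a - 4 * j) (by linarith)).and <| (key (1 - 4 * j - a) (by linarith)).and <|
    (key (r - j * (1 + f)) (by linarith)).and <| (key _ hsj).and <| (key _ hκj).and <|
    (key (r - ((1 - s₁) * j + 1 / 2)) (by linarith)).and <|
    (key (r - ((1 - s + f) * j + 1 / 2)) (by linarith)).and <|
    (key (r - ((3 / 4 + f / 2) * j + 1 / 4)) (by linarith)).and <|
    (key (a - (1 + 2 * j * (1 + f) - 2 * r)) (by linarith)).and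
    (key (2 * r - 2 * j * f - a) (by linarith))).exists
  rw [Set.mem_Ioi] at ht0
  refine ⟨r - t, t, min (s * j) (min (r - t - j / 2) ((1 + j) / 2 + t)), ?_, ht0, ?_, ?_, ?_, ?_, ?_,
    min_le_left _ _, (min_le_right _ _).trans (min_le_left _ _),
    (min_le_right _ _).trans (min_le_right _ _), ?_, ?_, ?_, ?_, ?_⟩
  · linarith
  · linarith
  · linarith
  · linarith
  · linarith
  · linarith
  · rw [← div_le_iff₀' two_pos, le_min_iff, le_min_iff]
    exact ⟨by linarith, by linarith, by linarith⟩
  · rw [← sub_le_iff_le_add', le_min_iff, le_min_iff]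
    exact ⟨by linarith, by linarith, by linarith⟩
  · linarith
  · linarith
  · linarith

theorem isBigO_rpow_mul_log {r r' : ℝ} (h : r' < r) (q : ℝ) :
    (fun k : ℕ => (k : ℝ) ^ (-r) * Real.log k ^ q) =O[atTop] fun k : ℕ => (k : ℝ) ^ (-r') := by
  have h1 := ((isLittleO_log_rpow_rpow_atTop q (sub_pos.2 h)).comp_tendsto
    tendsto_natCast_atTop_atTop).isBigO
  refine ((isBigO_refl (fun k : ℕ => (k : ℝ) ^ (-r)) atTop).mul h1).congr' (by rfl) ?_
  filter_upwards [eventually_gt_atTop 0] with k hk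
  have hk0 : (0 : ℝ) < k := by exact_mod_cast hk
  simp only [Function.comp_apply]
  rw [← Real.rpow_add hk0]
  congr 1
  ring

theorem exists_nat_le_rpow_succ {d : ℕ → ℝ} {r α q : ℝ} (hα : α < r)
    (hd : d =O[atTop] fun k : ℕ => (k : ℝ) ^ (-r) * Real.log k ^ q) :
    ∃ M : ℕ, ∀ k : ℕ, d k ≤ M * ((k : ℝ) + 1) ^ (-α) := by
  obtain ⟨C, hC⟩ := (hd.trans (isBigO_rpow_mul_log hα q)).bound
  have h1 : ∀ᶠ k : ℕ in atTop, d k ≤ C * (k : ℝ) ^ (-α) := by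
    filter_upwards [hC] with k hk
    rw [Real.norm_of_nonneg (by positivity : (0 : ℝ) ≤ (k : ℝ) ^ (-α))] at hk
    exact (Real.le_norm_self _).trans hk
  obtain ⟨C1, hC1, h2⟩ := forall_le_of_eventually_le
    (fun k hk => Real.rpow_pos_of_pos (by exact_mod_cast hk) _) h1
  obtain ⟨C2, -, h3⟩ := exists_le_rpow_succ hC1 h2
  obtain ⟨M, hM⟩ := exists_nat_ge C2
  exact ⟨M, fun k => (h3 k).trans (mul_le_mul_of_nonneg_right hM (rpow_succ_pos k _).le)⟩

theorem exists_sum_le_of_lt_one {d : ℕ → ℝ} {r q : ℝ} (hd0 : ∀ k, 0 ≤ d k) (hr0 : 0 ≤ r)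
    (hr : r < 1) (hq : 0 ≤ q)
    (hd : d =O[atTop] fun k : ℕ => (k : ℝ) ^ (-r) * Real.log k ^ q) :
    ∃ C, 0 ≤ C ∧ ∀ N : ℕ, ∑ k ∈ Finset.range N, d k
      ≤ C * (1 + (N : ℝ) ^ (1 - r) * Real.log N ^ q) := by
  obtain ⟨C, hC, hb⟩ := hd.exists_nonneg
  obtain ⟨n, hn⟩ := eventually_atTop.1 hb.bound
  obtain ⟨C1, hC1, h1⟩ := exists_le_rpow_succ (y := fun k : ℕ => (k : ℝ) ^ (-r)) (r := r) one_pos.le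
    fun k _ => (one_mul _).ge
  have hA : 0 ≤ ∑ k ∈ Finset.range n, d k := Finset.sum_nonneg fun k _ => hd0 k
  have hr1 : 0 ≤ (1 - r)⁻¹ := inv_nonneg.2 (by linarith)
  refine ⟨max (∑ k ∈ Finset.range n, d k) (C * C1 * (1 - r)⁻¹), hA.trans (le_max_left _ _),
    fun N => ?_⟩
  have hL : 0 ≤ Real.log N ^ q := Real.rpow_nonneg (Real.log_natCast_nonneg N) q
  have hstep : ∀ k ∈ Finset.range N, d k ≤ (if k < n then d k else 0)
      + C * C1 * Real.log N ^ q * ((k : ℝ) + 1) ^ (-r) := fun k hk => by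
    have hp := rpow_succ_pos k (-r)
    split_ifs with hkn
    · exact le_add_of_nonneg_right (by positivity)
    · rw [zero_add]
      have hlog : Real.log k ^ q ≤ Real.log N ^ q := by
        rcases Nat.eq_zero_or_pos k with rfl | hk0
        · rw [Nat.cast_zero, Real.log_zero]
          rcases hq.eq_or_lt with rfl | hq'
          · simp
          · rwa [Real.zero_rpow hq'.ne']
        · refine Real.rpow_le_rpow (Real.log_natCast_nonneg k) ?_ hq
          exact Real.log_le_log (by exact_mod_cast hk0)
            (by exact_mod_cast (Finset.mem_range.1 hk).le)
      have := hn k (not_lt.1 hkn)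
      rw [Real.norm_of_nonneg (hd0 k), Real.norm_of_nonneg (mul_nonneg (by positivity)
        (Real.rpow_nonneg (Real.log_natCast_nonneg k) q))] at this
      calc d k ≤ C * ((k : ℝ) ^ (-r) * Real.log k ^ q) := this
        _ ≤ C * ((C1 * ((k : ℝ) + 1) ^ (-r)) * Real.log N ^ q) := by
          refine mul_le_mul_of_nonneg_left ?_ hC
          exact mul_le_mul (h1 k) hlog (Real.rpow_nonneg (Real.log_natCast_nonneg k) q)
            (by positivity)
        _ = _ := by ring
  have hfirst : ∑ k ∈ Finset.range N, (if k < n then d k else 0) ≤ ∑ k ∈ Finset.range n, d k := by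
    rw [← Finset.sum_filter]
    refine Finset.sum_le_sum_of_subset_of_nonneg (fun k hk => ?_) fun k _ _ => hd0 k
    exact Finset.mem_range.2 (Finset.mem_filter.1 hk).2
  calc ∑ k ∈ Finset.range N, d k
      ≤ (∑ k ∈ Finset.range n, d k)
        + C * C1 * Real.log N ^ q * ((1 - r)⁻¹ * (N : ℝ) ^ (1 - r)) := by
        refine (Finset.sum_le_sum hstep).trans ?_
        rw [Finset.sum_add_distrib, ← Finset.mul_sum]
        gcongr
        exact sum_range_rpow_succ_le hr0 hr N
    _ = (∑ k ∈ Finset.range n, d k) * 1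
        + C * C1 * (1 - r)⁻¹ * ((N : ℝ) ^ (1 - r) * Real.log N ^ q) := by ring
    _ ≤ _ := by
        rw [mul_add]
        gcongr
        · exact le_max_left _ _
        · exact le_max_right _ _

theorem exists_average_le {d : ℕ → ℝ} {r q j : ℝ} (hd0 : ∀ k, 0 ≤ d k) (hr0 : 0 ≤ r)
    (hq : 0 ≤ q) (hj0 : 0 < j) (hj : j < 1)
    (hd : d =O[atTop] fun k : ℕ => (k : ℝ) ^ (-r) * Real.log k ^ q) :
    ∃ C, 0 ≤ C ∧ ∀ᶠ N : ℕ in atTop, (N : ℝ)⁻¹ * ∑ k ∈ Finset.range N, d k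
      ≤ C * ((N : ℝ) ^ (-((1 - j) / 2)) * Real.log N ^ (1 / 2 : ℝ)
        + (N : ℝ) ^ (-r) * Real.log N ^ q) := by
  have hone : ∀ N : ℕ, 3 ≤ N → (1 : ℝ) ≤ Real.log N := fun N hN => by
    rw [Real.le_log_iff_exp_le (by exact_mod_cast (by omega : 0 < N))]
    have : (3 : ℝ) ≤ N := by exact_mod_cast hN
    linarith [Real.exp_one_lt_d9]
  rcases lt_or_ge r 1 with hr | hr
  · obtain ⟨C, hC, h⟩ := exists_sum_le_of_lt_one hd0 hr0 hr hq hd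
    refine ⟨C, hC, ?_⟩
    filter_upwards [eventually_ge_atTop 3] with N hN
    have hN0 : (0 : ℝ) < N := by exact_mod_cast (by omega : 0 < N)
    have hN1 : (1 : ℝ) ≤ N := by exact_mod_cast (by omega : 1 ≤ N)
    have hinv : (N : ℝ)⁻¹ ≤ (N : ℝ) ^ (-((1 - j) / 2)) * Real.log N ^ (1 / 2 : ℝ) := by
      rw [← Real.rpow_neg_one]
      refine (Real.rpow_le_rpow_of_exponent_le hN1 (by linarith)).trans
        (le_mul_of_one_le_right (by positivity) (Real.one_le_rpow (hone N hN) (by norm_num)))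
    calc _ ≤ (N : ℝ)⁻¹ * (C * (1 + (N : ℝ) ^ (1 - r) * Real.log N ^ q)) := by
          gcongr; exact h N
      _ = C * ((N : ℝ)⁻¹ + (N : ℝ) ^ (-r) * Real.log N ^ q) := by
          rw [sub_eq_add_neg, Real.rpow_add hN0, Real.rpow_one]
          field_simp
      _ ≤ _ := by gcongr
  · have ht : (1 - j) / 2 < 1 := by linarith
    have hd' : d =O[atTop] fun k : ℕ => (k : ℝ) ^ (-((1 - j) / 2)) * Real.log k ^ (0 : ℝ) := by
      simpa using hd.trans (isBigO_rpow_mul_log (by linarith : (1 - j) / 2 < r) q)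
    obtain ⟨C, hC, h⟩ := exists_sum_le_of_lt_one hd0 (by linarith) ht le_rfl hd'
    refine ⟨C * 2, by positivity, ?_⟩
    filter_upwards [eventually_ge_atTop 3] with N hN
    have hN0 : (0 : ℝ) < N := by exact_mod_cast (by omega : 0 < N)
    have hN1 : (1 : ℝ) ≤ N := by exact_mod_cast (by omega : 1 ≤ N)
    have hinv : (N : ℝ)⁻¹ ≤ (N : ℝ) ^ (-((1 - j) / 2)) := by
      rw [← Real.rpow_neg_one]
      exact Real.rpow_le_rpow_of_exponent_le hN1 (by linarith)
    have hlog : (N : ℝ) ^ (-((1 - j) / 2))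
        ≤ (N : ℝ) ^ (-((1 - j) / 2)) * Real.log N ^ (1 / 2 : ℝ) :=
      le_mul_of_one_le_right (by positivity) (Real.one_le_rpow (hone N hN) (by norm_num))
    have hq0 : 0 ≤ (N : ℝ) ^ (-r) * Real.log N ^ q := mul_nonneg (by positivity)
      (Real.rpow_nonneg (Real.log_natCast_nonneg N) q)
    calc _ ≤ (N : ℝ)⁻¹ * (C * (1 + (N : ℝ) ^ (1 - (1 - j) / 2) * Real.log N ^ (0 : ℝ))) := by
          gcongr; exact h N
      _ = C * ((N : ℝ)⁻¹ + (N : ℝ) ^ (-((1 - j) / 2))) := by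
          rw [sub_eq_add_neg, Real.rpow_add hN0, Real.rpow_one, Real.rpow_zero]
          field_simp
      _ ≤ C * (2 * ((N : ℝ) ^ (-((1 - j) / 2)) * Real.log N ^ (1 / 2 : ℝ)
          + (N : ℝ) ^ (-r) * Real.log N ^ q)) := by
          gcongr
          linarith
      _ = _ := by ring

/-- Value `x` if its distance to `θ` is at most `r`, and `θ` otherwise. -/
def clip {E : Type*} [NormedAddCommGroup E] (θ : E) (r : ℝ) (x : E) : E :=
  open Classical in if ‖x - θ‖ ≤ r then x else θ

theorem norm_clip_sub_le {E : Type*} [NormedAddCommGroup E] (θ : E) {r : ℝ} (hr : 0 ≤ r) (x : E) :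
    ‖clip θ r x - θ‖ ≤ r := by
  unfold clip
  split_ifs with h
  · exact h
  · simpa using hr

theorem clip_of_le {E : Type*} [NormedAddCommGroup E] {θ : E} {r : ℝ} {x : E} (h : ‖x - θ‖ ≤ r) :
    clip θ r x = x := if_pos h

theorem measurable_clip {E : Type*} [NormedAddCommGroup E] [MeasurableSpace E] [BorelSpace E]
    [SecondCountableTopology E] (θ : E) (r : ℝ) : Measurable (clip θ r) :=
  Measurable.ite (measurableSet_le (by fun_prop) measurable_const) measurable_id
    measurable_const

theorem orthonormal_lp_two : ∃ e : ℕ → lp (fun _ : ℕ => ℝ) 2, Orthonormal ℝ e :=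
  ⟨_, (HilbertBasis.ofRepr (LinearIsometryEquiv.refl ℝ (lp (fun _ : ℕ => ℝ) 2))).orthonormal⟩

end

end OnlineSieve

end

theorem theorem6 {Ω : Type*} [MeasurableSpace Ω] (P : Measure Ω) [IsProbabilityMeasure P]
    {p B : ℕ} (hB : 1 ≤ B)
    (ν : Measure (Obs p)) [IsProbabilityMeasure ν]
    (θ₀ : EuclideanSpace ℝ (Fin p)) (F₀ : ℝ → ℝ) (ψ : ℕ → ℝ → ℝ)
    (W : ℕ → Fin B → Ω → Obs p) (θc : ℕ → Ω → EuclideanSpace ℝ (Fin p))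
    (μ₀ : ℝ → EuclideanSpace ℝ (Fin p))
    (J₀ : ℕ) (hJ₀ : 1 ≤ J₀) (b₀ : Fin J₀ → ℝ)
    (η₀ αη αJ αψ αθ s s₁ κ q : ℝ) (hη₀ : 0 < η₀) (hκ : 2 + 2 / αη < κ) (hq : 0 ≤ q)
    (hexp : Exponents αη αJ αψ αθ s s₁)
    (hmodel : IndexModel ν θ₀ F₀ κ) (hF₀ : SmoothLink F₀)
    (hdata : IIDBatches P ν W) (hplug : PlugIn P θ₀ W θc αθ q)
    (hbasis : SieveBasis ν θ₀ ψ αψ) (happrox : SieveApproximation ν θ₀ F₀ ψ s s₁)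
    (hμ₀ : RegressorMean ν θ₀ F₀ ψ J₀ αJ μ₀) :
    (∀ᵐ ω ∂P,
      (fun N : ℕ => ‖WithLp.toLp 2
        (coefBarError ν θ₀ F₀ ψ J₀ αJ η₀ αη b₀ (fun k i => W k i ω) (fun k => θc k ω) N
          - (varianceTerm ν θ₀ F₀ ψ J₀ αJ (fun k i => W k i ω) N
              - regressorTerm ν θ₀ F₀ ψ J₀ αJ (fun k => θc k ω) N
              + pseudoTrueTerm ν θ₀ F₀ ψ J₀ αJ N))‖)
        =o[atTop] fun N : ℕ => (N : ℝ) ^ (-((1 + αJ) / 2))) ∧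
    ∀ D : Set ℝ, PolyCovered ψ D →
      ∀ᵐ ω ∂P, ∃ C : ℝ, ∀ᶠ N : ℕ in atTop,
        supNormOn D (fun z =>
          linkBar ψ J₀ αJ η₀ αη b₀ (fun k i => W k i ω) (fun k => θc k ω) N z - F₀ z)
        ≤ ENNReal.ofReal (C *
            ((N : ℝ) ^ (-((1 - αJ) / 2)) * Real.log N ^ (1 / 2 : ℝ)
              + (N : ℝ) ^ (-(αJ * s))
              + (N : ℝ) ^ (-αθ) * Real.log N ^ q)) := by
  have hκ4 : 4 < κ := by
    have := (one_lt_div hexp.αη_pos).2 hexp.αη_lt_one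
    have h2 : 2 / αη = 2 * (1 / αη) := by ring
    linarith
  obtain ⟨K, hK⟩ := exists_regular hκ4.le hmodel hF₀ hbasis happrox
  obtain ⟨α, c, ρ, hα, hc, i1, i2, i3, i4, i5, i6, i7, i8, i9, i10, i11, i12, i13⟩ :=
    hexp.exists_slack hκ4
  obtain ⟨e, he⟩ := orthonormal_lp_two
  have hsetting : ∀ M : ℕ, ∃ S : Setting Ω (lp (fun _ : ℕ => ℝ) 2) p B,
      S.P = P ∧ S.ν = ν ∧ S.θ₀ = θ₀ ∧ S.F₀ = F₀ ∧ S.ψ = ψ ∧ S.W = W ∧ S.η₀ = η₀ ∧ S.a = αη ∧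
      S.j = αJ ∧ S.s = s ∧ S.s₁ = s₁ ∧ (∃ h : S.J₀ = J₀, h ▸ S.b₀ = b₀) ∧
      S.θc = fun (k : ℕ) ω => clip θ₀ (M * ((k : ℝ) + 1) ^ (-α)) (θc k ω) := fun M =>
    ⟨{ P := P, ν := ν, θ₀ := θ₀, F₀ := F₀, ψ := ψ, W := W
       θc := fun (k : ℕ) ω => clip θ₀ (M * ((k : ℝ) + 1) ^ (-α)) (θc k ω)
       J₀ := J₀, b₀ := b₀, e := e, η₀ := η₀, a := αη, j := αJ, f := αψ, α := α, s := s, s₁ := s₁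
       κ := κ, K := K, M := M, c := c, ρ := ρ
       prob := inferInstance, probν := inferInstance, one_le_B := hB, one_le_J₀ := hJ₀
       data := hdata, adapted := fun k => (measurable_clip _ _).comp (hplug.adapted k)
       rate := fun k ω => norm_clip_sub_le _ (by positivity) _
       reg := hK, ortho := he, η₀_pos := hη₀, a_pos := hexp.αη_pos, j_pos := hexp.αJ_pos
       f_nonneg := hexp.αψ_pos.le, s_pos := one_pos.trans hexp.one_lt_s
       s₁_nonneg := hexp.s₁_pos.le, M_nonneg := Nat.cast_nonneg M, c_pos := hc
       three_j := i1, four_j := i2, D_lower := i3, sj_lower := i4, κ_lower := i5, ρ_le_sj := i6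
       ρ_le_α := i7, ρ_le := i8, ρ_lower := i9, D_add_ρ := i10, D_add_a := i11
       D_add_sj := i12, s₁j_add := i13 },
      rfl, rfl, rfl, rfl, rfl, rfl, rfl, rfl, rfl, rfl, rfl, ⟨rfl, rfl⟩, rfl⟩
  have hpath : ∀ ω, ((fun k : ℕ => ‖θc k ω - θ₀‖) =O[atTop]
      fun k : ℕ => (k : ℝ) ^ (-αθ) * Real.log k ^ q) → ∃ M : ℕ,
      (fun k : ℕ => clip θ₀ ((M : ℝ) * ((k : ℝ) + 1) ^ (-α)) (θc k ω)) = fun k => θc k ω :=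
    fun ω hω => by
      obtain ⟨M, hM⟩ := exists_nat_le_rpow_succ hα hω
      exact ⟨M, funext fun k => clip_of_le (hM k)⟩
  refine ⟨?_, fun D hD => ?_⟩
  · have hall : ∀ᵐ ω ∂P, ∀ M : ℕ, (fun N : ℕ => ‖WithLp.toLp 2
        (coefBarError ν θ₀ F₀ ψ J₀ αJ η₀ αη b₀ (fun k i => W k i ω)
            (fun k : ℕ => clip θ₀ ((M : ℝ) * ((k : ℝ) + 1) ^ (-α)) (θc k ω)) N
          - (varianceTerm ν θ₀ F₀ ψ J₀ αJ (fun k i => W k i ω) N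
              - regressorTerm ν θ₀ F₀ ψ J₀ αJ
                (fun k : ℕ => clip θ₀ ((M : ℝ) * ((k : ℝ) + 1) ^ (-α)) (θc k ω)) N
              + pseudoTrueTerm ν θ₀ F₀ ψ J₀ αJ N))‖)
        =o[atTop] fun N : ℕ => (N : ℝ) ^ (-((1 + αJ) / 2)) := by
      refine ae_all_iff.2 fun M => ?_
      obtain ⟨S, rfl, rfl, rfl, rfl, rfl, rfl, rfl, rfl, rfl, rfl, rfl, ⟨rfl, rfl⟩, hθ⟩ :=
        hsetting M
      have := S.ae_expansion
      rw [hθ] at this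
      exact this
    filter_upwards [hall, hplug.rate] with ω h1 h2
    obtain ⟨M, hM⟩ := hpath ω h2
    have := h1 M
    rwa [hM] at this
  · have hall : ∀ᵐ ω ∂P, ∀ M : ℕ, ∃ C, 0 ≤ C ∧ ∀ᶠ N : ℕ in atTop, ∀ z ∈ D,
        |linkBar ψ J₀ αJ η₀ αη b₀ (fun k i => W k i ω)
            (fun k : ℕ => clip θ₀ ((M : ℝ) * ((k : ℝ) + 1) ^ (-α)) (θc k ω)) N z - F₀ z|
          ≤ C * ((N : ℝ) ^ (-((1 - αJ) / 2)) * Real.log N ^ (1 / 2 : ℝ) + (N : ℝ) ^ (-(αJ * s))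
            + (N : ℝ)⁻¹ * ∑ k ∈ Finset.range N,
              ‖clip θ₀ ((M : ℝ) * ((k : ℝ) + 1) ^ (-α)) (θc k ω) - θ₀‖) := by
      refine ae_all_iff.2 fun M => ?_
      obtain ⟨S, rfl, rfl, rfl, rfl, rfl, rfl, rfl, rfl, rfl, rfl, rfl, ⟨rfl, rfl⟩, hθ⟩ :=
        hsetting M
      have := S.ae_exists_link_le hD hμ₀ happrox
      simp only [← S.linkBar_eq] at this
      rw [hθ] at this
      exact this
    filter_upwards [hall, hplug.rate] with ω h1 h2
    obtain ⟨M, hM⟩ := hpath ω h2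
    obtain ⟨C, hC, h⟩ := h1 M
    rw [hM] at h
    simp only [congrFun hM] at h
    obtain ⟨A, hA, havg⟩ := exists_average_le (fun k => norm_nonneg (θc k ω - θ₀)) hexp.αθ_pos.le hq
      hexp.αJ_pos (by linarith [hexp.αη_lt, hexp.αη_pos, hexp.αJ_pos]) h2
    refine ⟨C * (1 + A), ?_⟩
    filter_upwards [h, havg] with N hN hN'
    refine iSup₂_le fun z hz => ?_
    rw [Real.enorm_eq_ofReal_abs]
    refine ENNReal.ofReal_le_ofReal ((hN z hz).trans ?_)
    have h3 : 0 ≤ (N : ℝ) ^ (-(αJ * s)) := by positivity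
    have h4 : 0 ≤ (N : ℝ) ^ (-αθ) * Real.log N ^ q := mul_nonneg (by positivity)
      (Real.rpow_nonneg (Real.log_natCast_nonneg N) q)
    rw [mul_assoc]
    refine mul_le_mul_of_nonneg_left ?_ hC
    nlinarith [mul_nonneg hA h3]
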